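/- **$k$-SUM.** An instance of $k$-SUM on $n$ numbers consists of $k$ arrays $S_1,\dots,S_k$ of $n$ integers each and an integer target $t$; one has to decide whether there are $s_1\in S_1,\dots,s_k\in S_k$ with $s_1+\dots+s_k=t$. **Model.** Algorithms run on a randomized word RAM with word length $w\ge 1$, $n\le 2^w$, and all input numbers and $t$ of absolute value at most $2^w$. The input is read-only and is not charged for space. Each memory cell holds an integer of $O(w)$ bits; the elementary operations (addition, subtraction, multiplication, integer division with remainder, comparison, indirect reading and writing, reading an input number, drawing a uniformly random element of $\{0,\dots,m-1\}$ for a computed $m$) take unit time. A *Las Vegas algorithm* is a program, the same for all $n$ and $w$, that never gives a wrong answer. Its time is the expected number of steps and its space is the number of cells that it uses in the worst case over its random choices, both bounded, as functions of $n$ alone, for all inputs and all $w$. $\tilde O(g(n))$ means $O(g(n)(\log n)^{j})$ for some constant $j$. **The exponent $f$.** Let $f(1)=f(2)=1$, $f(3)=f(4)=2$, and for $k>4$ let $f(k)$ be the minimum of $f(k-1)+1$ and of all the numbers $$k_1k_2-k_1-k_2+1+\max(f(k_1),k_2),\qquad k_1k_2=k,\ 1\le k_1<k .$$ **Theorem.**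 Let $k\ge 1$ be an integer and let $0\le\delta\le 1$ be a real number. Then $k$-SUM on $n$ numbers can be solved by a Las Vegas algorithm in $$\tilde O\left(n^{k-\delta(k-1)}+n^{k-\delta(k-1)+(\delta f(k)-1)}\right)$$ time and $O(n^{\delta})$ space. Here the algorithm knows the constant $\delta$ in the sense that the number $\lfloor n^{\delta}\rfloor$ is supplied to it in one register; if $\delta$ is rational, there is such an algorithm to which nothing is supplied besides the input. -/

import Mathlib

open scoped ENNReal

/-! A randomized word RAM with read-only input, Las Vegas algorithms for `k`-SUM on it,
and the exponent function of the linear-space family. -/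

namespace KSumRam

/-- A `k`-SUM instance: `k` arrays of `n` integers each, and a target. -/
structure KInstance (k n : ℕ) where
  arr : Fin k → Fin n → ℤ
  target : ℤ

/-- The `k`-SUM question: can one choose one entry from each array so that the chosen entries
sum to the target? -/
def KInstance.HasSolution {k n : ℕ} (x : KInstance k n) : Prop :=
  ∃ i : Fin k → Fin n, ∑ j, x.arr j (i j) = x.target

/-- All input numbers fit into words of `w` bits. -/
def KInstance.FitsIn {k n : ℕ} (x : KInstance k n) (w : ℕ) : Prop :=
  (∀ i j, |x.arr i j| ≤ 2 ^ w) ∧ |x.target| ≤ 2 ^ w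

/-- The value of entry `b` of array `a` (both counted from `0`); `0` outside the input. -/
def KInstance.read {k n : ℕ} (x : KInstance k n) (a b : ℤ) : ℤ :=
  if h : (0 ≤ a ∧ a.toNat < k) ∧ (0 ≤ b ∧ b.toNat < n) then
    x.arr ⟨a.toNat, h.1.2⟩ ⟨b.toNat, h.2.2⟩
  else 0

/-- The arithmetic operations; `div` and `mod` are integer quotient and remainder. -/
inductive ArithOp where
  | add | sub | mul | div | mod

def ArithOp.eval : ArithOp → ℤ → ℤ → ℤ
  | .add, a, b => a + b
  | .sub, a, b => a - b
  | .mul, a, b => a * b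
  | .div, a, b => a / b
  | .mod, a, b => a % b

/-- Elementary instructions. The natural-number arguments are names of registers:
* `const d z`: `r_d := z`;
* `arith o d a b`: `r_d := r_a o r_b`;
* `load d a`: `r_d := M[r_a]`;
* `store a b`: `M[r_a] := r_b`;
* `input d a b`: `r_d :=` entry `r_b` of input array `r_a`;
* `rand d a`: `r_d :=` a fresh uniformly random element of `{0, …, r_a - 1}`. -/
inductive Instr where
  | const (d : ℕ) (z : ℤ)
  | arith (o : ArithOp) (d a b : ℕ)
  | load (d a : ℕ)
  | store (a b : ℕ)
  | input (d a b : ℕ)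
  | rand (d a : ℕ)

/-- Programs: finite texts built from elementary instructions with sequencing, branching
and looping on the comparison `r_a ≤ r_b`. -/
inductive Prog where
  | skip
  | instr (i : Instr)
  | seq (p q : Prog)
  | ifLE (a b : ℕ) (p q : Prog)
  | whileLE (a b : ℕ) (p : Prog)

/-- The data of the machine: registers named by the program, and addressable working memory. -/
structure Store where
  reg : ℕ → ℤ
  mem : ℕ → ℤ

/-- `todo` is the control state: the pieces of the program text that remain to be executed. It
plays the part of the program counter; since there is no recursion, only finitely many values of
it (for a given program) can ever occur. The machine has halted when `todo` is empty. -/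
structure Config where
  todo : List Prog
  store : Store

def Store.setReg (s : Store) (d : ℕ) (v : ℤ) : Store :=
  { s with reg := Function.update s.reg d v }

/-- A negative address is read as address `0`. -/
def Store.setMem (s : Store) (a v : ℤ) : Store :=
  { s with mem := Function.update s.mem a.toNat v }

/-- The uniform distribution on `{0, …, m - 1}` (the point mass at `0` if `m ≤ 0`). -/
noncomputable def uniformBelow (m : ℤ) : PMF ℤ :=
  if h : (Finset.range m.toNat).Nonempty then
    (PMF.uniformOfFinset (Finset.range m.toNat) h).map (fun v : ℕ => (v : ℤ))
  else PMF.pure 0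

noncomputable def Instr.exec {k n : ℕ} (x : KInstance k n) (s : Store) : Instr → PMF Store
  | .const d z => PMF.pure (s.setReg d z)
  | .arith o d a b => PMF.pure (s.setReg d (o.eval (s.reg a) (s.reg b)))
  | .load d a => PMF.pure (s.setReg d (s.mem (s.reg a).toNat))
  | .store a b => PMF.pure (s.setMem (s.reg a) (s.reg b))
  | .input d a b => PMF.pure (s.setReg d (x.read (s.reg a) (s.reg b)))
  | .rand d a => (uniformBelow (s.reg a)).map (fun v => s.setReg d v)

/-- One step of the machine on the read-only input `x`. -/
noncomputable def step {k n : ℕ} (x : KInstance k n) : Config → PMF Config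
  | ⟨[], s⟩ => PMF.pure ⟨[], s⟩
  | ⟨.skip :: r, s⟩ => PMF.pure ⟨r, s⟩
  | ⟨.instr i :: r, s⟩ => (i.exec x s).map (fun s' => ⟨r, s'⟩)
  | ⟨.seq p q :: r, s⟩ => PMF.pure ⟨p :: q :: r, s⟩
  | ⟨.ifLE a b p q :: r, s⟩ =>
      PMF.pure (if s.reg a ≤ s.reg b then ⟨p :: r, s⟩ else ⟨q :: r, s⟩)
  | ⟨.whileLE a b p :: r, s⟩ =>
      PMF.pure (if s.reg a ≤ s.reg b then ⟨p :: .whileLE a b p :: r, s⟩ else ⟨r, s⟩)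

/-- At the start register `0` holds `n`, register `1` the target, register `2` the extra word
`hint`; everything else is `0`. -/
def initConfig {k n : ℕ} (P : Prog) (x : KInstance k n) (hint : ℕ) : Config where
  todo := [P]
  store :=
    { reg := fun i => if i = 0 then (n : ℤ) else if i = 1 then x.target
        else if i = 2 then (hint : ℤ) else 0
      mem := fun _ => 0 }

/-- The distribution of the configuration after `τ` steps. -/
noncomputable def runDist {k n : ℕ} (P : Prog) (x : KInstance k n) (hint : ℕ) : ℕ → PMF Config
  | 0 => PMF.pure (initConfig P x hint)
  | τ + 1 => (runDist P x hint τ).bind (step x)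

/-- A configuration that occurs with positive probability at some time. -/
def Reachable {k n : ℕ} (P : Prog) (x : KInstance k n) (hint : ℕ) (c : Config) : Prop :=
  ∃ τ, c ∈ (runDist P x hint τ).support

/-- The expected number of steps before halting, `∑_τ Pr[not halted after τ steps]`; it is `∞`
if the machine fails to halt with positive probability. -/
noncomputable def expectedTime {k n : ℕ} (P : Prog) (x : KInstance k n) (hint : ℕ) : ℝ≥0∞ :=
  ∑' τ, (runDist P x hint τ).toOuterMeasure {c | c.todo ≠ []}

/-- Only registers and memory cells with index below `s` are in use. (All cells start at `0`, so a
cell that holds `0` has left no trace; bounding the addresses, not the number, of the nonzero cells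
means that no information can be kept in the position of a cell outside this range.) -/
def Store.UsesAtMost (σ : Store) (s : ℕ) : Prop :=
  ∀ i, s ≤ i → σ.reg i = 0 ∧ σ.mem i = 0

/-- Every register and every memory cell holds an integer of at most `c * w` bits, that is, `c`
machine words. -/
def Store.WordSized (σ : Store) (c w : ℕ) : Prop :=
  ∀ i, |σ.reg i| < 2 ^ (c * w) ∧ |σ.mem i| < 2 ^ (c * w)

/-- `P` is a Las Vegas algorithm for `k`-SUM on `n` numbers with expected time at most `T n` and
working space at most `S n`, when the extra word `hint n` is supplied. For every `n`, every word
length `w` and every input that fits into `w`-bit words: whatever the random choices are, the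
space bound holds at all times, all cells hold `O(1)` words, and on halting register `0` holds the
correct answer (`1` for yes, `0` for no); the expected running time is at most `T n`. -/
def IsLasVegasKSum (k : ℕ) (hint : ℕ → ℕ) (P : Prog) (T : ℕ → ℝ) (S : ℕ → ℕ) : Prop :=
  ∃ c : ℕ, ∀ n w : ℕ, 1 ≤ w → n ≤ 2 ^ w → ∀ x : KInstance k n, x.FitsIn w →
    (∀ C : Config, Reachable P x (hint n) C →
      C.store.UsesAtMost (S n) ∧ C.store.WordSized c w ∧
      (C.todo = [] →
        (x.HasSolution → C.store.reg 0 = 1) ∧ (¬ x.HasSolution → C.store.reg 0 = 0))) ∧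
    expectedTime P x (hint n) ≤ ENNReal.ofReal (T n)

/-- `T = Õ(g)` for `g` polynomially bounded: `T = O(g · (log n) ^ j)` for some constant `j`. -/
def IsSoftO (T g : ℕ → ℝ) : Prop :=
  ∃ j : ℕ, T =O[Filter.atTop] (fun n : ℕ => g n * Real.log n ^ j)

/-- `k`-SUM on `n` numbers can be solved by a Las Vegas algorithm in `Õ(g n)` time and `O(s n)`
space, when the word `hint n` is supplied to the algorithm. -/
def KSumSolvable (k : ℕ) (hint : ℕ → ℕ) (g s : ℕ → ℝ) : Prop :=
  ∃ (P : Prog) (T : ℕ → ℝ) (S : ℕ → ℕ),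
    IsSoftO T g ∧ (fun n => (S n : ℝ)) =O[Filter.atTop] s ∧ IsLasVegasKSum k hint P T S

/-- The exponent `f`: `f 1 = f 2 = 1`, `f 3 = f 4 = 2`, and for `k > 4` the value `f k` is the
minimum of `f (k - 1) + 1` and of all `k₁ k₂ - k₁ - k₂ + 1 + max (f k₁) k₂` with `k₁ k₂ = k`,
`k₁ < k`. Here `k₁ k₂ - k₁ - k₂ + 1` is written as `(k₁ - 1) (k₂ - 1)`. -/
def linExp : ℕ → ℕ
  | 0 => 0
  | 1 => 1
  | 2 => 1
  | 3 => 2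
  | 4 => 2
  | m + 5 =>
      (m + 5).properDivisors.attach.fold min (linExp (m + 4) + 1)
        (fun d : {d // d ∈ (m + 5).properDivisors} =>
        have : d.1 < m + 5 := (Nat.mem_properDivisors.1 d.2).2
        (d.1 - 1) * ((m + 5) / d.1 - 1) + max (linExp d.1) ((m + 5) / d.1))

end KSumRam

set_option linter.unusedSimpArgs false


/-! Let `z = ⌊n ^ δ⌋` be the block length and `m = ⌈n / z⌉` the number of blocks of each array. The
core is a randomized reduction from `k` arrays of `m z` numbers to `k` sorted lists of `z` numbers.
Choose `a` uniformly below `Q = m L`, where `L` exceeds every difference of input numbers, and hash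
`x` to `a x mod Q`. The hash is exactly linear modulo `Q`, so for a solution the hash values add up
to that of the target. The residues are covered by `m` cyclic windows that start at the multiples of
`L`. Once windows have been chosen for arrays `k - 1, …, 1`, the hash of the entry of array `0` is
known up to a rounding error below `k L`; windows of width `k L` absorb that error, so the window of
array `0` is forced and only `m ^ (k - 1)` tuples of windows remain. Each window is read from the
input in sorted chunks of `z` numbers: a chunk consists of the `z` smallest elements above a
threshold, found in one pass with a buffer of `2 z` cells and a tournament tree. A solver for `k`
lists of length `z` is run on every tuple of chunks. No solution is missed and none is invented,
whatever `a` is; only the time is random.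

For the time, the numbers of chunks are summed over tuples of windows. For arrays `2, …, k - 1` the
sum over all windows is `O(m)` for every `a`. The product belonging to arrays `1` and `0` is bounded
by a sum of squares, and the squares have expected total `O(m)`, because two distinct numbers share
a window for only a fraction `O(1 / m)` of the multipliers (`card_mul_emod_lt`,
`sum_sum_chunks_sq_le`). So `O(m ^ (k - 1))` tuples of chunks are expected, each costing `Õ(m z)`
for extraction and the time of the solver (`sum_nestCost_le`, `reduce_run`). A solver of time `Õ(z ^
f k)` gives `n ^ ((1 - δ) (k - 1)) * (n + n ^ (δ f k))`, which is the claim.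

The linear-space solvers follow the recursion of `f`. Up to four lists are treated by meet in the
middle with two sorted streams of pairwise sums (`meet_run`). A further list can be searched
exhaustively (`Solves.succ`). For `K = p q` lists, the sums of groups of `q` lists form `p` virtual
arrays of `z ^ q` numbers, and the same reduction with `m = z ^ (q - 1)` leads to `p` lists of
length `z` (`Solves.mul`).

To reach the machine, programs are written in a small language with named variables and arrays.
`Run` is a Hoare triple with expected cost, interpreted by the transformer `ert`. Since `ert`
charges infinity for any store that breaks the bounds on space or word size, and infinity can also
be charged for a wrong final store, a finite value certifies time, space, word size and correctness
together (`Run.sound`). -/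

namespace KSumRam

/-! ### Expectations and the expected-runtime transformer -/

/-- Expectation of a nonnegative extended-real function. -/
noncomputable def expect {α : Type*} (p : PMF α) (f : α → ℝ≥0∞) : ℝ≥0∞ := ∑' a, p a * f a

theorem expect_mono {α : Type*} (p : PMF α) {f g : α → ℝ≥0∞} (h : ∀ a, f a ≤ g a) :
    expect p f ≤ expect p g :=
  ENNReal.tsum_le_tsum fun a => mul_le_mul_right (h a) _

theorem expect_add {α : Type*} (p : PMF α) (f g : α → ℝ≥0∞) :
    expect p (fun a => f a + g a) = expect p f + expect p g := by
  simp [expect, mul_add, ENNReal.tsum_add]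

@[simp] theorem expect_pure {α : Type*} (a : α) (f : α → ℝ≥0∞) :
    expect (PMF.pure a) f = f a := by
  unfold expect
  rw [tsum_eq_single a]
  · simp
  · intro b hb
    simp [PMF.pure_apply, hb]

theorem expect_bind {α β : Type*} (p : PMF α) (q : α → PMF β) (f : β → ℝ≥0∞) :
    expect (p.bind q) f = expect p (fun a => expect (q a) f) := by
  simp only [expect, PMF.bind_apply, ← ENNReal.tsum_mul_right, ← ENNReal.tsum_mul_left, mul_assoc]
  exact ENNReal.tsum_comm

theorem expect_map {α β : Type*} (p : PMF α) (g : α → β) (f : β → ℝ≥0∞) :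
    expect (p.map g) f = expect p (fun a => f (g a)) := by
  rw [PMF.map, expect_bind]
  simp

theorem expect_indicator {α : Type*} (p : PMF α) (s : Set α) :
    expect p (s.indicator 1) = p.toOuterMeasure s := by
  rw [PMF.toOuterMeasure_apply]
  refine tsum_congr fun a => ?_
  by_cases h : a ∈ s <;> simp [h]

theorem expect_uniformBelow {m : ℕ} (hm : 0 < m) (f : ℤ → ℝ≥0∞) :
    expect (uniformBelow m) f = (∑ v ∈ Finset.range m, f v) / m := by
  have hne : (Finset.range (m : ℤ).toNat).Nonempty := by simpa using hm.ne'
  rw [uniformBelow, dif_pos hne, expect_map]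
  unfold expect
  rw [tsum_eq_sum (s := Finset.range m), ENNReal.div_eq_inv_mul, Finset.mul_sum]
  · refine Finset.sum_congr rfl fun v hv => ?_
    rw [PMF.uniformOfFinset_apply]
    simp at hv
    simp [hv]
  · intro v hv
    rw [PMF.uniformOfFinset_apply]
    simp at hv
    simp [hv]

/-- The expected-runtime transformer: `ert G x p f σ` is the expected number of steps of `p` from
`σ`, plus the expectation of `f` at the end; it is `∞` if a store outside `G` can be met. -/
noncomputable def ert {k n : ℕ} (G : Store → Prop) (x : KInstance k n) :
    Prog → (Store → ℝ≥0∞) →o (Store → ℝ≥0∞)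
  | .skip =>
    { toFun := fun f σ => (⨆ _ : ¬ G σ, ⊤) + 1 + f σ
      monotone' := fun f g h σ => add_le_add le_rfl (h σ) }
  | .instr i =>
    { toFun := fun f σ => (⨆ _ : ¬ G σ, ⊤) + 1 + expect (i.exec x σ) f
      monotone' := fun f g h σ => add_le_add le_rfl (expect_mono _ h) }
  | .seq p q =>
    { toFun := fun f σ => (⨆ _ : ¬ G σ, ⊤) + 1 + ert G x p (ert G x q f) σ
      monotone' := fun f g h σ =>
        add_le_add le_rfl ((ert G x p).monotone ((ert G x q).monotone h) σ) }
  | .ifLE a b p q =>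
    { toFun := fun f σ => (⨆ _ : ¬ G σ, ⊤) + 1 +
        if σ.reg a ≤ σ.reg b then ert G x p f σ else ert G x q f σ
      monotone' := fun f g h σ => by
        refine add_le_add le_rfl ?_
        split_ifs
        · exact (ert G x p).monotone h σ
        · exact (ert G x q).monotone h σ }
  | .whileLE a b p =>
    { toFun := fun f => OrderHom.lfp
        { toFun := fun g σ => (⨆ _ : ¬ G σ, ⊤) + 1 +
            if σ.reg a ≤ σ.reg b then ert G x p g σ else f σ
          monotone' := fun g g' h σ => by
            refine add_le_add le_rfl ?_
            split_ifs
            · exact (ert G x p).monotone h σ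
            · exact le_rfl }
      monotone' := fun f f' h => by
        refine OrderHom.lfp.monotone ?_
        intro g σ
        refine add_le_add le_rfl ?_
        split_ifs
        · exact le_rfl
        · exact h σ }

section
variable {k n : ℕ} (G : Store → Prop) (x : KInstance k n)

theorem ert_skip (f : Store → ℝ≥0∞) (σ : Store) :
    ert G x .skip f σ = (⨆ _ : ¬ G σ, ⊤) + 1 + f σ := by
  rw [ert]; rfl

theorem ert_instr (i : Instr) (f : Store → ℝ≥0∞) (σ : Store) :
    ert G x (.instr i) f σ = (⨆ _ : ¬ G σ, ⊤) + 1 + expect (i.exec x σ) f := by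
  rw [ert]; rfl

theorem ert_seq (p q : Prog) (f : Store → ℝ≥0∞) (σ : Store) :
    ert G x (.seq p q) f σ = (⨆ _ : ¬ G σ, ⊤) + 1 + ert G x p (ert G x q f) σ := by
  conv_lhs => rw [ert]
  rfl

theorem ert_ifLE (a b : ℕ) (p q : Prog) (f : Store → ℝ≥0∞) (σ : Store) :
    ert G x (.ifLE a b p q) f σ = (⨆ _ : ¬ G σ, ⊤) + 1 +
      if σ.reg a ≤ σ.reg b then ert G x p f σ else ert G x q f σ := by
  conv_lhs => rw [ert]
  rfl

/-- Later proofs use only this unrolling and never the minimality of the fixed point: every loop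
comes with an explicit bound on its number of iterations. -/
theorem ert_whileLE (a b : ℕ) (p : Prog) (f : Store → ℝ≥0∞) (σ : Store) :
    ert G x (.whileLE a b p) f σ = (⨆ _ : ¬ G σ, ⊤) + 1 +
      if σ.reg a ≤ σ.reg b then ert G x p (ert G x (.whileLE a b p) f) σ else f σ := by
  have h : ∃ Φ : (Store → ℝ≥0∞) →o (Store → ℝ≥0∞),
      ert G x (.whileLE a b p) f = OrderHom.lfp Φ ∧ ∀ g, Φ g = fun σ => (⨆ _ : ¬ G σ, ⊤) + 1 +
        if σ.reg a ≤ σ.reg b then ert G x p g σ else f σ := by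
    conv in (ert G x _ f) => rw [ert]
    exact ⟨_, rfl, fun g => rfl⟩
  obtain ⟨Φ, h1, h2⟩ := h
  have h3 : Φ (OrderHom.lfp Φ) = OrderHom.lfp Φ := OrderHom.map_lfp Φ
  rw [← h1] at h3
  conv_lhs => rw [← h3, h2]

/-- The potential of a control stack. -/
noncomputable def stackPot (f : Store → ℝ≥0∞) : List Prog → Store → ℝ≥0∞
  | [] => f
  | p :: r => ert G x p (stackPot f r)

/-- A running configuration pays one unit for the next step and carries the rest as the expected
potential after it; each case is the defining equation of `ert`. -/
theorem stackPot_step (f : Store → ℝ≥0∞) (c : Config) (hc : c.todo ≠ []) :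
    stackPot G x f c.todo c.store = (⨆ _ : ¬ G c.store, ⊤) + 1 +
      expect (step x c) (fun c' => stackPot G x f c'.todo c'.store) := by
  obtain ⟨todo, σ⟩ := c
  cases todo with
  | nil => exact absurd rfl hc
  | cons p r =>
    cases p with
    | skip => simp [step, stackPot, ert_skip]
    | instr i => simp [step, stackPot, ert_instr, expect_map]
    | seq p q => simp [step, stackPot, ert_seq]
    | ifLE a b p q =>
      simp only [step, expect_pure, stackPot]
      by_cases h : σ.reg a ≤ σ.reg b <;> simp [h, ert_ifLE, stackPot]
    | whileLE a b p =>
      simp only [step, expect_pure, stackPot]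
      rw [ert_whileLE]
      by_cases h : σ.reg a ≤ σ.reg b <;> simp [h, stackPot]

/-- Summing the step equation over time: the expected potential drops by at least the probability of
not having halted, so the steps already spent and the potential still present never exceed the
initial potential. -/
theorem stackPot_run (f : Store → ℝ≥0∞) (P : Prog) (hint τ : ℕ) :
    ∑ i ∈ Finset.range τ, (runDist P x hint i).toOuterMeasure {c | c.todo ≠ []} +
      expect (runDist P x hint τ) (fun c => stackPot G x f c.todo c.store) ≤
    ert G x P f (initConfig P x hint).store := by
  induction τ with
  | zero => simp [runDist, initConfig, stackPot]
  | succ τ ih =>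
    refine le_trans ?_ ih
    rw [Finset.sum_range_succ, add_assoc]
    refine add_le_add le_rfl ?_
    rw [runDist, expect_bind, ← expect_indicator, ← expect_add]
    refine expect_mono _ fun c => ?_
    by_cases hc : c.todo = []
    · obtain ⟨todo, σ⟩ := c
      simp only at hc
      subst hc
      simp [step]
    · rw [stackPot_step G x f c hc]
      have : c ∈ {c : Config | c.todo ≠ []} := hc
      simp only [Set.indicator_of_mem this, Pi.one_apply]
      exact add_le_add le_add_self le_rfl

theorem expectedTime_le (f : Store → ℝ≥0∞) (P : Prog) (hint : ℕ) :
    expectedTime P x hint ≤ ert G x P f (initConfig P x hint).store := by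
  unfold expectedTime
  rw [ENNReal.tsum_eq_iSup_nat]
  exact iSup_le fun τ => le_trans le_self_add (stackPot_run G x f P hint τ)

theorem stackPot_ne_top_of_reachable (f : Store → ℝ≥0∞) (P : Prog) (hint : ℕ)
    (hfin : ert G x P f (initConfig P x hint).store ≠ ⊤) (c : Config)
    (hc : Reachable P x hint c) : stackPot G x f c.todo c.store ≠ ⊤ := by
  obtain ⟨τ, hτ⟩ := hc
  intro htop
  refine hfin (top_le_iff.1 ?_)
  refine le_trans ?_ (stackPot_run G x f P hint τ)
  refine le_trans ?_ le_add_self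
  have h1 : runDist P x hint τ c * stackPot G x f c.todo c.store = ⊤ := by
    rw [htop]
    -- A reachable configuration has positive probability at some time, so an infinite potential
    -- there would make the whole expectation infinite.
    exact ENNReal.mul_top ((PMF.mem_support_iff _ _).1 hτ)
  calc ⊤ = runDist P x hint τ c * stackPot G x f c.todo c.store := h1.symm
    _ ≤ _ := ENNReal.le_tsum (f := fun c : Config =>
        runDist P x hint τ c * stackPot G x f c.todo c.store) c

/-- Safety is extracted from finiteness: the penalty in `ert` makes the potential infinite outside
`G`, and on halting the potential is `f` itself. -/
theorem good_of_reachable (f : Store → ℝ≥0∞) (hf : ∀ σ, f σ ≠ ⊤ → G σ) (P : Prog) (hint : ℕ)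
    (hfin : ert G x P f (initConfig P x hint).store ≠ ⊤) (c : Config)
    (hc : Reachable P x hint c) : G c.store ∧ (c.todo = [] → f c.store ≠ ⊤) := by
  have h := stackPot_ne_top_of_reachable G x f P hint hfin c hc
  by_cases hn : c.todo = []
  · rw [hn] at h
    exact ⟨hf _ h, fun _ => h⟩
  · refine ⟨?_, fun h' => absurd h' hn⟩
    rw [stackPot_step G x f c hn] at h
    by_contra hG
    simp [hG] at h

end

end KSumRam

namespace KSumRam

/-! ### A small imperative language compiled to the machine -/

/-- Names of variables and arrays; the first component is called the level. -/
abbrev Var := ℕ × ℕ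

/-- The register number of a variable, or the column of an array. -/
def enc (x : Var) : ℕ := Nat.pair x.1 x.2

theorem enc_inj {x y : Var} : enc x = enc y ↔ x = y := by
  rw [enc, enc, Nat.pair_eq_pair, Prod.ext_iff]

/-- Abstract states: named variables and named arrays. -/
@[ext] structure St where
  v : Var → ℤ
  a : Var → ℕ → ℤ

def St.setV (s : St) (x : Var) (z : ℤ) : St := { s with v := Function.update s.v x z }

def St.setA (s : St) (A : Var) (i : ℕ) (z : ℤ) : St :=
  { s with a := Function.update s.a A (Function.update (s.a A) i z) }

@[simp] theorem St.setV_v (s : St) (x y : Var) (z : ℤ) :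
    (s.setV x z).v y = if y = x then z else s.v y := by
  simp [St.setV, Function.update_apply]

@[simp] theorem St.setV_a (s : St) (x : Var) (z : ℤ) : (s.setV x z).a = s.a := rfl

@[simp] theorem St.setA_v (s : St) (A : Var) (i : ℕ) (z : ℤ) : (s.setA A i z).v = s.v := rfl

@[simp] theorem St.setA_a (s : St) (A B : Var) (i j : ℕ) (z : ℤ) :
    (s.setA A i z).a B j = if B = A ∧ j = i then z else s.a B j := by
  by_cases h : B = A
  · subst h
    simp [St.setA, Function.update_apply]
  · simp [St.setA, Function.update_apply, h]

inductive Expr where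
  | const (z : ℤ)
  | var (x : Var)
  | bin (o : ArithOp) (a b : Expr)
  | arr (A : Var) (i : Expr)
  | inp (a b : Expr)

section
variable {k n : ℕ}

/-- The value of an expression; a negative index reads the first entry of array `(0, 0)`. -/
def Expr.eval (x : KInstance k n) (s : St) : Expr → ℤ
  | .const z => z
  | .var y => s.v y
  | .bin o a b => o.eval (a.eval x s) (b.eval x s)
  | .arr A i => if 0 ≤ i.eval x s then s.a A (i.eval x s).toNat else s.a (0, 0) 0
  | .inp a b => x.read (a.eval x s) (b.eval x s)

def Expr.size : Expr → ℕ
  | .const _ => 1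
  | .var _ => 1
  | .bin _ a b => a.size + b.size + 1
  | .arr _ i => i.size + 2
  | .inp a b => a.size + b.size + 1

def Expr.cost : Expr → ℕ
  | .const _ => 1
  | .var _ => 3
  | .bin _ a b => a.cost + b.cost + 3
  | .arr _ i => i.cost + 10
  | .inp a b => a.cost + b.cost + 3

def Expr.Wf (N : ℕ) : Expr → Prop
  | .const z => |z| ≤ N
  | .var x => enc x < N
  | .bin _ a b => a.Wf N ∧ b.Wf N
  | .arr A i => enc A < N ∧ i.Wf N
  | .inp a b => a.Wf N ∧ b.Wf N

/-- Code that leaves the value of the expression in register `N + t`. -/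
def Expr.code (N : ℕ) : Expr → ℕ → Prog
  | .const z, t => .instr (.const (N + t) z)
  | .var x, t => .seq (.instr (.const (N + t) 0)) (.instr (.arith .add (N + t) (N + t) (enc x)))
  | .bin o a b, t => .seq (a.code N t) (.seq (b.code N (t + 1))
      (.instr (.arith o (N + t) (N + t) (N + t + 1))))
  | .arr A i, t => .seq (i.code N t) (.seq (.instr (.const (N + t + 1) N))
      (.seq (.instr (.arith .mul (N + t) (N + t) (N + t + 1)))
      (.seq (.instr (.const (N + t + 1) (enc A)))
      (.seq (.instr (.arith .add (N + t) (N + t) (N + t + 1)))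
        (.instr (.load (N + t) (N + t)))))))
  | .inp a b, t => .seq (a.code N t) (.seq (b.code N (t + 1))
      (.instr (.input (N + t) (N + t) (N + t + 1))))

/-- The static data of a run: input, number `N` of columns, number of rows of the memory, and
a bound on the values of variables and array entries. -/
structure Env (k n : ℕ) where
  x : KInstance k n
  N : ℕ
  cap : ℕ
  B : ℤ
  hN : 0 < N
  hB : (N : ℤ) ≤ B
  hB2 : 2 ≤ B
  hx : ∀ a b, |x.read a b| ≤ B

/-- Registers below `N` hold the named variables, registers from `N` to `3 N - 1` the intermediate
values of expressions. Only the latter may exceed `B`, up to `B ^ N`. The arrays are interleaved as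
the `N` columns of a memory with `cap` rows, so one bound on addresses limits the space. -/
structure Good (E : Env k n) (σ : Store) : Prop where
  var_le : ∀ i < E.N, |σ.reg i| ≤ E.B
  reg_le : ∀ i, |σ.reg i| ≤ E.B ^ E.N
  reg_zero : ∀ i, 3 * E.N ≤ i → σ.reg i = 0
  mem_le : ∀ i, |σ.mem i| ≤ E.B
  mem_zero : ∀ i, E.N * E.cap ≤ i → σ.mem i = 0

/-- The abstract state of a store. -/
def absSt (N : ℕ) (σ : Store) : St where
  v x := if enc x < N then σ.reg (enc x) else 0
  a A i := if enc A < N then σ.mem (i * N + enc A) else 0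

/-- `p` runs deterministically from `σ` to `σ'` in at most `t` steps. -/
def Det (E : Env k n) (p : Prog) (σ : Store) (t : ℕ) (σ' : Store) : Prop :=
  ∀ f : Store → ℝ≥0∞, ert (Good E) E.x p f σ ≤ t + f σ'

variable {E : Env k n}

theorem Det.seq {p q : Prog} {σ σ' σ'' : Store} {t u : ℕ} (hσ : Good E σ) (h1 : Det E p σ t σ')
    (h2 : Det E q σ' u σ'') : Det E (.seq p q) σ (t + u + 1) σ'' := by
  intro f
  rw [ert_seq]
  simp only [hσ, not_true_eq_false, iSup_false, bot_eq_zero, zero_add]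
  calc 1 + ert (Good E) E.x p (ert (Good E) E.x q f) σ
      ≤ 1 + (t + (u + f σ'')) := by gcongr; exact (h1 _).trans (by gcongr; exact h2 f)
    _ = _ := by push_cast; ring

theorem Det.instr {i : Instr} {σ σ' : Store} (hσ : Good E σ) (h : i.exec E.x σ = PMF.pure σ') :
    Det E (.instr i) σ 1 σ' := by
  intro f
  rw [ert_instr, h]
  simp [hσ]

theorem Det.mono {p : Prog} {σ σ' : Store} {t u : ℕ} (h : Det E p σ t σ') (htu : t ≤ u) :
    Det E p σ u σ' := fun f => (h f).trans (by gcongr)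

theorem Expr.size_pos (e : Expr) : 1 ≤ e.size := by
  cases e <;> simp [Expr.size]

theorem Good.abs_v {σ : Store} (hσ : Good E σ) (y : Var) : |(absSt E.N σ).v y| ≤ E.B := by
  have := E.hB2
  simp only [absSt]
  split_ifs with h
  · exact hσ.var_le _ h
  · simp; omega

theorem Good.abs_a {σ : Store} (hσ : Good E σ) (A : Var) (i : ℕ) : |(absSt E.N σ).a A i| ≤ E.B := by
  have := E.hB2
  simp only [absSt]
  split_ifs with h
  · exact hσ.mem_le _
  · simp; omega

/-- Every operation costs at most one more factor `B` than its operands together, because `B ^ i + B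
^ j ≤ B ^ (i + j + 1)` for `B ≥ 2`. A program whose expressions have size at most `N` therefore
stays within a fixed number of words. -/
theorem Expr.eval_le {σ : Store} (hσ : Good E σ) (e : Expr) (he : e.Wf E.N) :
    |e.eval E.x (absSt E.N σ)| ≤ E.B ^ e.size := by
  have hB2 := E.hB2
  have h1 : (1 : ℤ) ≤ E.B := by omega
  have hpos : ∀ m : ℕ, (1 : ℤ) ≤ E.B ^ m := fun m => one_le_pow₀ h1
  have hle : ∀ {i j : ℕ}, i ≤ j → E.B ^ i ≤ E.B ^ j := fun h => pow_le_pow_right₀ h1 h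
  have hself : ∀ m : ℕ, 1 ≤ m → E.B ≤ E.B ^ m := fun m hm => by
    simpa using hle hm
  induction e with
  | const z => simpa [Expr.eval, Expr.size] using le_trans he E.hB
  | var y => simpa [Expr.eval, Expr.size] using hσ.abs_v y
  | bin o a b iha ihb =>
    have ha := iha he.1
    have hb := ihb he.2
    have h2 : E.B ^ a.size + E.B ^ b.size ≤ E.B ^ (a.size + b.size + 1) := by
      have h3 := hle (show a.size ≤ a.size + b.size by omega)
      have h4 := hle (show b.size ≤ a.size + b.size by omega)
      have h5 : E.B ^ (a.size + b.size + 1) = E.B ^ (a.size + b.size) * E.B := pow_succ _ _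
      nlinarith [hpos (a.size + b.size)]
    have h3 : (1 : ℤ) ≤ E.B ^ a.size := hpos _
    have h4 : (1 : ℤ) ≤ E.B ^ b.size := hpos _
    simp only [Expr.eval, Expr.size]
    cases o with
    | add => exact (abs_add_le _ _).trans (by linarith)
    | sub => exact (abs_sub _ _).trans (by linarith)
    | mul =>
      simp only [ArithOp.eval, abs_mul]
      calc _ ≤ E.B ^ a.size * E.B ^ b.size := by gcongr
        _ = E.B ^ (a.size + b.size) := (pow_add _ _ _).symm
        _ ≤ _ := hle (by omega)
    | div =>
      simp only [ArithOp.eval]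
      exact (Int.abs_ediv_le_abs _ _).trans (by linarith)
    | mod =>
      simp only [ArithOp.eval]
      by_cases h : b.eval E.x (absSt E.N σ) = 0
      · rw [h, Int.emod_zero]; linarith
      · rw [abs_of_nonneg (Int.emod_nonneg _ h)]
        have := Int.emod_lt_abs (a.eval E.x (absSt E.N σ)) h
        linarith
  | arr A i _ =>
    simp only [Expr.eval, Expr.size]
    split_ifs
    · exact (hσ.abs_a _ _).trans (hself _ (by omega))
    · exact (hσ.abs_a _ _).trans (hself _ (by omega))
  | inp a b _ _ => exact (E.hx _ _).trans (hself _ (by simp [Expr.size]))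

theorem Good.setTemp {σ : Store} (hσ : Good E σ) {r : ℕ} {z : ℤ} (h1 : E.N ≤ r) (h2 : r < 3 * E.N)
    (hz : |z| ≤ E.B ^ E.N) : Good E (σ.setReg r z) where
  var_le i hi := by
    simp only [Store.setReg, Function.update_apply]
    rw [if_neg (by omega)]
    exact hσ.var_le i hi
  reg_le i := by
    simp only [Store.setReg, Function.update_apply]
    split_ifs
    · exact hz
    · exact hσ.reg_le i
  reg_zero i hi := by
    simp only [Store.setReg, Function.update_apply]
    rw [if_neg (by omega)]
    exact hσ.reg_zero i hi
  mem_le := hσ.mem_le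
  mem_zero := hσ.mem_zero

theorem absSt_eq_of_agree {N : ℕ} {σ σ' : Store} (h1 : ∀ i < N, σ'.reg i = σ.reg i)
    (h2 : σ'.mem = σ.mem) : absSt N σ' = absSt N σ := by
  ext y
  · simp only [absSt]
    split_ifs with h
    · exact h1 _ h
    · rfl
  · simp [absSt, h2]

/-- Temporaries are used as a stack: evaluation at height `t` leaves every register below `N + t`
alone, so a first operand survives the evaluation of the second one at height `t + 1`. -/
theorem Expr.code_det (e : Expr) (he : e.Wf E.N) : ∀ (t : ℕ) (σ : Store), Good E σ →
    t + e.size ≤ 2 * E.N → e.size ≤ E.N → ∃ σ', Det E (e.code E.N t) σ e.cost σ' ∧ Good E σ' ∧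
      σ'.mem = σ.mem ∧ σ'.reg (E.N + t) = e.eval E.x (absSt E.N σ) ∧
      ∀ i < E.N + t, σ'.reg i = σ.reg i := by
  have hB2 := E.hB2
  have hB := E.hB
  have hN := E.hN
  have h1 : (1 : ℤ) ≤ E.B := by omega
  have hle : ∀ {i j : ℕ}, i ≤ j → E.B ^ i ≤ E.B ^ j := fun h => pow_le_pow_right₀ h1 h
  have hself : ∀ m : ℕ, 1 ≤ m → E.B ≤ E.B ^ m := fun m hm => by
    simpa using hle hm
  induction e with
  | const z =>
    intro t σ hσ ht _
    refine ⟨σ.setReg (E.N + t) z, Det.instr hσ rfl, hσ.setTemp (by omega) ?_ ?_, rfl, ?_, ?_⟩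
    · simp only [Expr.size] at ht; omega
    · exact le_trans he (hB.trans (hself _ hN))
    · simp [Store.setReg, Expr.eval]
    · intro i hi
      simp [Store.setReg, Function.update_apply, hi.ne]
  | var y =>
    intro t σ hσ ht _
    simp only [Expr.size] at ht
    simp only [Expr.Wf] at he
    have hg1 : Good E (σ.setReg (E.N + t) 0) :=
      hσ.setTemp (by omega) (by omega) (by simp; positivity)
    have hne : enc y ≠ E.N + t := by omega
    refine ⟨(σ.setReg (E.N + t) 0).setReg (E.N + t) (σ.reg (enc y)), ?_, ?_, rfl, ?_, ?_⟩
    · refine (Det.seq hσ (Det.instr hσ rfl) (Det.instr (σ' := _) hg1 ?_))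
      simp [Instr.exec, ArithOp.eval, Store.setReg, Function.update_apply, hne]
    · exact hg1.setTemp (by omega) (by omega) (hσ.reg_le _)
    · simp [Store.setReg, Expr.eval, absSt, he]
    · intro i hi
      simp [Store.setReg, Function.update_apply, hi.ne]
  | bin o a b iha ihb =>
    intro t σ hσ ht hs
    have hbd := Expr.eval_le hσ (.bin o a b) he
    simp only [Expr.size] at ht hs hbd
    have := a.size_pos
    obtain ⟨σ1, d1, g1, m1, v1, r1⟩ := iha he.1 t σ hσ (by omega) (by omega)
    obtain ⟨σ2, d2, g2, m2, v2, r2⟩ := ihb he.2 (t + 1) σ1 g1 (by omega) (by omega)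
    rw [absSt_eq_of_agree (fun i hi => r1 i (by omega)) m1] at v2
    refine ⟨σ2.setReg (E.N + t) ((Expr.bin o a b).eval E.x (absSt E.N σ)), ?_, ?_, ?_, ?_, ?_⟩
    · refine (d1.seq hσ (d2.seq g1 (Det.instr (σ' := _) g2 ?_))).mono ?_
      · simp only [Instr.exec]
        rw [r2 (E.N + t) (by omega), v1, add_assoc, v2]
        rfl
      · simp only [Expr.cost]; omega
    · exact g2.setTemp (by omega) (by omega) (hbd.trans (hle hs))
    · simp [Store.setReg, m2, m1]
    · simp [Store.setReg]
    · intro i hi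
      simp [Store.setReg, Function.update_apply, hi.ne]
      rw [r2 i (by omega), r1 i hi]
  | arr A e ih =>
    intro t σ hσ ht hs
    have hbd := Expr.eval_le hσ e he.2
    simp only [Expr.size] at ht hs
    have hz := e.size_pos
    obtain ⟨σ1, d1, g1, m1, v1, r1⟩ := ih he.2 t σ hσ (by omega) (by omega)
    set z := e.eval E.x (absSt E.N σ) with hzdef
    have hA := he.1
    have hb1 : |z * E.N| ≤ E.B ^ (e.size + 1) := by
      rw [abs_mul, pow_succ, abs_of_nonneg (by positivity : (0 : ℤ) ≤ E.N)]
      gcongr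
    -- The address needs two factors `B` beyond the index, one for the multiplication by the number
    -- of columns and one for adding the column; this is why an array access adds `2` to the size of
    -- an expression.
    have hb2 : |z * E.N + enc A| ≤ E.B ^ E.N := by
      have h4 : ((enc A : ℕ) : ℤ) ≤ E.B ^ (e.size + 1) :=
        le_trans (by omega) (hself (e.size + 1) (by omega))
      have h5 : E.B ^ (e.size + 2) = E.B ^ (e.size + 1) * E.B := pow_succ _ _
      have h6 := hle hs
      have h7 := abs_add_le (z * E.N) (enc A : ℤ)
      rw [abs_of_nonneg (by positivity : (0 : ℤ) ≤ (enc A : ℤ))] at h7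
      nlinarith
    have hNle : |(E.N : ℤ)| ≤ E.B ^ E.N := by
      rw [abs_of_nonneg (by positivity)]; exact hB.trans (hself _ hN)
    have hAle : |(enc A : ℤ)| ≤ E.B ^ E.N := by
      rw [abs_of_nonneg (by positivity)]; exact (by omega : (enc A : ℤ) ≤ E.B).trans (hself _ hN)
    have g2 : Good E (σ1.setReg (E.N + t + 1) E.N) :=
      g1.setTemp (by omega) (by omega) hNle
    have g3 := g2.setTemp (r := E.N + t) (z := z * E.N) (by omega) (by omega)
      (hb1.trans (hle (by omega)))
    have g4 := g3.setTemp (r := E.N + t + 1) (z := enc A) (by omega) (by omega) hAle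
    have g5 := g4.setTemp (r := E.N + t) (z := z * E.N + enc A) (by omega) (by omega) hb2
    have hval : (Expr.arr A e).eval E.x (absSt E.N σ) = σ.mem (z * E.N + enc A).toNat := by
      simp only [Expr.eval, ← hzdef]
      split_ifs with h0
      · simp only [absSt, hA, if_true]
        congr 1
        have h8 : z * E.N + enc A = ((z.toNat * E.N + enc A : ℕ) : ℤ) := by
          push_cast [Int.toNat_of_nonneg h0]; rfl
        rw [h8, Int.toNat_natCast]
      -- For a negative index the computed address is at most `0`, because the column number is
      -- below `N`. The machine then reads cell `0`, which is the first entry of array `(0, 0)`.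
      · have : enc (0, 0) = 0 := by simp [enc, Nat.pair]
        simp only [absSt, this, hN, if_true]
        congr 1
        have : z * E.N + enc A ≤ 0 := by
          have : (enc A : ℤ) < E.N := by exact_mod_cast hA
          nlinarith
        rw [Int.toNat_of_nonpos this]
        simp
    have hvle : |σ.mem (z * E.N + enc A).toNat| ≤ E.B ^ E.N := (hσ.mem_le _).trans (hself _ hN)
    refine ⟨_, (d1.seq hσ ((Det.instr g1 rfl).seq g1 ((Det.instr (σ' := _) g2 ?_).seq g2
      ((Det.instr g3 rfl).seq g3 ((Det.instr (σ' := _) g4 ?_).seq g4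
      (Det.instr (σ' := _) g5 ?_)))))).mono ?_, g5.setTemp (r := E.N + t) (by omega) (by omega) hvle,
      ?_, ?_, ?_⟩
    · simp [Instr.exec, ArithOp.eval, Store.setReg, Function.update_apply, v1]
    · simp [Instr.exec, ArithOp.eval, Store.setReg, Function.update_apply]
    · simp [Instr.exec, Store.setReg, Function.update_apply, m1]
    · simp only [Expr.cost]; omega
    · simp [Store.setReg, m1]
    · simp only [Store.setReg, Function.update_self]
      exact hval.symm
    · intro i hi
      have : i ≠ E.N + t + 1 := by omega
      simp [Store.setReg, Function.update_apply, hi.ne, r1 i hi, this]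
  | inp a b iha ihb =>
    intro t σ hσ ht hs
    simp only [Expr.size] at ht hs
    have := a.size_pos
    obtain ⟨σ1, d1, g1, m1, v1, r1⟩ := iha he.1 t σ hσ (by omega) (by omega)
    obtain ⟨σ2, d2, g2, m2, v2, r2⟩ := ihb he.2 (t + 1) σ1 g1 (by omega) (by omega)
    rw [absSt_eq_of_agree (fun i hi => r1 i (by omega)) m1] at v2
    refine ⟨σ2.setReg (E.N + t) ((Expr.inp a b).eval E.x (absSt E.N σ)), ?_, ?_, ?_, ?_, ?_⟩
    · refine (d1.seq hσ (d2.seq g1 (Det.instr (σ' := _) g2 ?_))).mono ?_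
      · simp only [Instr.exec]
        rw [r2 (E.N + t) (by omega), v1, add_assoc, v2]
        rfl
      · simp only [Expr.cost]; omega
    · exact g2.setTemp (by omega) (by omega) ((E.hx _ _).trans (hself _ hN))
    · simp [Store.setReg, m2, m1]
    · simp [Store.setReg]
    · intro i hi
      simp [Store.setReg, Function.update_apply, hi.ne]
      rw [r2 i (by omega), r1 i hi]

end

end KSumRam

/-! ### Commands, their compilation, and proof rules for expected running time. -/

namespace KSumRam

inductive Cmd where
  | skip
  | assign (x : Var) (e : Expr)
  | store (A : Var) (i e : Expr)
  | rand (x : Var) (e : Expr)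
  | seq (c d : Cmd)
  | ite (a b : Expr) (c d : Cmd)
  | loop (a b : Expr) (c : Cmd)

def Cmd.Wf (N : ℕ) : Cmd → Prop
  | .skip => True
  | .assign x e => enc x < N ∧ e.Wf N ∧ e.size ≤ N
  | .store A i e => enc A < N ∧ i.Wf N ∧ e.Wf N ∧ i.size + 2 ≤ N ∧ e.size ≤ N
  | .rand x e => enc x < N ∧ e.Wf N ∧ e.size ≤ N
  | .seq c d => c.Wf N ∧ d.Wf N
  | .ite a b c d => a.Wf N ∧ b.Wf N ∧ a.size ≤ N ∧ b.size ≤ N ∧ c.Wf N ∧ d.Wf N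
  | .loop a b c => a.Wf N ∧ b.Wf N ∧ a.size ≤ N ∧ b.size ≤ N ∧ c.Wf N

theorem Expr.exists_wf (e : Expr) : ∃ N₀, ∀ N, N₀ ≤ N → e.Wf N := by
  induction e with
  | const z => exact ⟨z.natAbs, fun N h => by rw [Expr.Wf, ← Int.natCast_natAbs]; exact_mod_cast h⟩
  | var x => exact ⟨enc x + 1, fun N h => h⟩
  | bin o a b iha ihb =>
    obtain ⟨N1, h1⟩ := iha
    obtain ⟨N2, h2⟩ := ihb
    exact ⟨max N1 N2, fun N h => ⟨h1 N (le_of_max_le_left h), h2 N (le_of_max_le_right h)⟩⟩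
  | arr A i ih =>
    obtain ⟨N1, h1⟩ := ih
    exact ⟨max (enc A + 1) N1, fun N h => ⟨le_of_max_le_left h, h1 N (le_of_max_le_right h)⟩⟩
  | inp a b iha ihb =>
    obtain ⟨N1, h1⟩ := iha
    obtain ⟨N2, h2⟩ := ihb
    exact ⟨max N1 N2, fun N h => ⟨h1 N (le_of_max_le_left h), h2 N (le_of_max_le_right h)⟩⟩

theorem Cmd.exists_wf (c : Cmd) : ∃ N₀, ∀ N, N₀ ≤ N → c.Wf N := by
  induction c with
  | skip => exact ⟨0, fun _ _ => trivial⟩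
  | assign x e =>
    obtain ⟨N1, h1⟩ := e.exists_wf
    exact ⟨max (enc x + 1) (max N1 e.size), fun N h => ⟨by omega, h1 N (by omega), by omega⟩⟩
  | store A i e =>
    obtain ⟨N1, h1⟩ := e.exists_wf
    obtain ⟨N2, h2⟩ := i.exists_wf
    exact ⟨enc A + 1 + N1 + N2 + e.size + i.size + 2, fun N h =>
      ⟨by omega, h2 N (by omega), h1 N (by omega), by omega, by omega⟩⟩
  | rand x e =>
    obtain ⟨N1, h1⟩ := e.exists_wf
    exact ⟨max (enc x + 1) (max N1 e.size), fun N h => ⟨by omega, h1 N (by omega), by omega⟩⟩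
  | seq c d ihc ihd =>
    obtain ⟨N1, h1⟩ := ihc
    obtain ⟨N2, h2⟩ := ihd
    exact ⟨max N1 N2, fun N h => ⟨h1 N (by omega), h2 N (by omega)⟩⟩
  | ite a b c d ihc ihd =>
    obtain ⟨N1, h1⟩ := ihc
    obtain ⟨N2, h2⟩ := ihd
    obtain ⟨N3, h3⟩ := a.exists_wf
    obtain ⟨N4, h4⟩ := b.exists_wf
    exact ⟨N1 + N2 + N3 + N4 + a.size + b.size, fun N h => ⟨h3 N (by omega), h4 N (by omega),
      by omega, by omega, h1 N (by omega), h2 N (by omega)⟩⟩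
  | loop a b c ihc =>
    obtain ⟨N1, h1⟩ := ihc
    obtain ⟨N3, h3⟩ := a.exists_wf
    obtain ⟨N4, h4⟩ := b.exists_wf
    exact ⟨N1 + N3 + N4 + a.size + b.size, fun N h => ⟨h3 N (by omega), h4 N (by omega),
      by omega, by omega, h1 N (by omega)⟩⟩

/-- Code that evaluates two expressions into registers `N` and `N + 1`. -/
def evalPair (N : ℕ) (a b : Expr) : Prog := .seq (a.code N 0) (b.code N 1)

def Cmd.code (N : ℕ) : Cmd → Prog
  | .skip => .skip
  | .assign x e => .seq (e.code N 0) (.seq (.instr (.const (N + 1) 0))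
      (.instr (.arith .add (enc x) (N + 0) (N + 1))))
  | .store A i e => .seq (evalPair N e i) (.seq (.instr (.const (N + 2) N))
      (.seq (.instr (.arith .mul (N + 1) (N + 1) (N + 2)))
      (.seq (.instr (.const (N + 2) (enc A)))
      (.seq (.instr (.arith .add (N + 1) (N + 1) (N + 2)))
        (.instr (.store (N + 1) (N + 0)))))))
  | .rand x e => .seq (e.code N 0) (.instr (.rand (enc x) (N + 0)))
  | .seq c d => .seq (c.code N) (d.code N)
  | .ite a b c d => .seq (evalPair N a b) (.ifLE (N + 0) (N + 1) (c.code N) (d.code N))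
  | .loop a b c => .seq (evalPair N a b)
      (.whileLE (N + 0) (N + 1) (.seq (c.code N) (evalPair N a b)))

section
variable {k n : ℕ} {E : Env k n}

/-- From the abstract state `s` the command `c` ends after an expected number of at most `t` steps
in an abstract state satisfying `Q`, without ever leaving the good stores. -/
def Run (E : Env k n) (s : St) (c : Cmd) (t : ℕ) (Q : St → Prop) : Prop :=
  c.Wf E.N → ∀ σ, Good E σ → absSt E.N σ = s → ∀ (f : Store → ℝ≥0∞) (T : ℝ≥0∞),
    (∀ σ', Good E σ' → Q (absSt E.N σ') → f σ' ≤ T) → ert (Good E) E.x (c.code E.N) f σ ≤ t + T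

theorem evalPair_det {a b : Expr} (ha : a.Wf E.N) (hb : b.Wf E.N) (has : a.size ≤ E.N)
    (hbs : b.size ≤ E.N) {σ : Store} (hσ : Good E σ) :
    ∃ σ', Det E (evalPair E.N a b) σ (a.cost + b.cost + 1) σ' ∧ Good E σ' ∧ σ'.mem = σ.mem ∧
      absSt E.N σ' = absSt E.N σ ∧ σ'.reg (E.N + 0) = a.eval E.x (absSt E.N σ) ∧
      σ'.reg (E.N + 1) = b.eval E.x (absSt E.N σ) := by
  have hN := E.hN
  obtain ⟨σ1, d1, g1, m1, v1, r1⟩ := a.code_det ha 0 σ hσ (by omega) has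
  obtain ⟨σ2, d2, g2, m2, v2, r2⟩ := b.code_det hb 1 σ1 g1 (by omega) hbs
  have e1 := absSt_eq_of_agree (N := E.N) (fun i hi => r1 i (by omega)) m1
  have e2 := absSt_eq_of_agree (N := E.N) (fun i hi => r2 i (by omega)) m2
  refine ⟨σ2, d1.seq hσ d2, g2, m2.trans m1, e2.trans e1, ?_, ?_⟩
  · rw [r2 _ (by omega), v1]
  · rw [v2, e1]

theorem Run.mono {s : St} {c : Cmd} {t t' : ℕ} {Q Q' : St → Prop} (h : Run E s c t Q)
    (ht : t ≤ t') (hQ : ∀ s', Q s' → Q' s') : Run E s c t' Q' := by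
  intro hwf σ hσ hs f T hf
  refine (h hwf σ hσ hs f T fun σ' h1 h2 => hf σ' h1 (hQ _ h2)).trans ?_
  gcongr

theorem Run.skip {s : St} {Q : St → Prop} (h : Q s) : Run E s .skip 1 Q := by
  intro hwf σ hσ hs f T hf
  rw [Cmd.code, ert_skip]
  simp only [hσ, not_true_eq_false, iSup_false, bot_eq_zero, zero_add, Nat.cast_one]
  gcongr
  exact hf σ hσ (hs ▸ h)

theorem Run.seq {s : St} {c d : Cmd} {t u : ℕ} {R Q : St → Prop} (h1 : Run E s c t R)
    (h2 : ∀ s', R s' → Run E s' d u Q) : Run E s (.seq c d) (t + u + 1) Q := by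
  intro hwf σ hσ hs f T hf
  rw [Cmd.code, ert_seq]
  simp only [hσ, not_true_eq_false, iSup_false, bot_eq_zero, zero_add]
  have := h1 hwf.1 σ hσ hs (ert (Good E) E.x (d.code E.N) f) (u + T)
    fun σ' g' r' => h2 _ r' hwf.2 σ' g' rfl f T hf
  calc _ ≤ 1 + (t + (u + T)) := by gcongr
    _ = _ := by push_cast; ring

theorem Good.setVar {σ : Store} (hσ : Good E σ) {x : Var} {z : ℤ} (hx : enc x < E.N)
    (hz : |z| ≤ E.B) : Good E (σ.setReg (enc x) z) where
  var_le i hi := by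
    simp only [Store.setReg, Function.update_apply]
    split_ifs
    · exact hz
    · exact hσ.var_le i hi
  reg_le i := by
    have h1 : (1 : ℤ) ≤ E.B := by have := E.hB2; omega
    have := E.hN
    simp only [Store.setReg, Function.update_apply]
    split_ifs
    · exact hz.trans (by simpa using pow_le_pow_right₀ h1 E.hN)
    · exact hσ.reg_le i
  reg_zero i hi := by
    simp only [Store.setReg, Function.update_apply]
    rw [if_neg (by omega)]
    exact hσ.reg_zero i hi
  mem_le := hσ.mem_le
  mem_zero := hσ.mem_zero

theorem absSt_setVar {N : ℕ} (σ : Store) {x : Var} {z : ℤ} (hx : enc x < N) :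
    absSt N (σ.setReg (enc x) z) = (absSt N σ).setV x z := by
  ext y
  · rw [St.setV_v]
    simp only [absSt, Store.setReg, Function.update_apply, enc_inj]
    by_cases h : y = x
    · simp [h, hx]
    · simp [h]
  · rfl

theorem Run.assign {s : St} {x : Var} {e : Expr} {Q : St → Prop} (hb : |e.eval E.x s| ≤ E.B)
    (h : Q (s.setV x (e.eval E.x s))) : Run E s (.assign x e) (e.cost + 4) Q := by
  intro hwf σ hσ hs f T hf
  have hN := E.hN
  have hes := hwf.2.2
  obtain ⟨σ1, d1, g1, m1, v1, r1⟩ := e.code_det hwf.2.1 0 σ hσ (by omega) hes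
  have e1 := absSt_eq_of_agree (N := E.N) (fun i hi => r1 i (by omega)) m1
  have hB2 := E.hB2
  have g2 : Good E (σ1.setReg (E.N + 1) 0) :=
    g1.setTemp (by omega) (by omega) (by simp; positivity)
  rw [hs] at v1 e1
  have e2 : absSt E.N (σ1.setReg (E.N + 1) 0) = s := by
    rw [← e1]
    refine absSt_eq_of_agree ?_ rfl
    intro i hi
    have : i ≠ E.N + 1 := by omega
    simp [Store.setReg, Function.update_apply, this]
  have hd : Det E (Cmd.code E.N (.assign x e)) σ (e.cost + 4)
      ((σ1.setReg (E.N + 1) 0).setReg (enc x) (e.eval E.x s)) := by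
    refine (d1.seq hσ ((Det.instr g1 rfl).seq g1 (Det.instr (σ' := _) g2 ?_))).mono (by omega)
    have : E.N ≠ E.N + 1 := by omega
    rw [add_zero] at v1
    simp only [Instr.exec, ArithOp.eval, Store.setReg, Function.update_apply, this, if_false, v1,
      if_true, add_zero]
  refine (hd f).trans ?_
  gcongr
  refine hf _ (g2.setVar hwf.1 hb) ?_
  rw [absSt_setVar _ hwf.1, e2]
  exact h

theorem absSt_setMem {N : ℕ} (σ : Store) {A : Var} {i : ℕ} {z : ℤ} (hA : enc A < N) :
    absSt N (σ.setMem ((i : ℤ) * N + enc A) z) = (absSt N σ).setA A i z := by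
  have h0 : ((i : ℤ) * N + enc A).toNat = i * N + enc A := by
    rw [show (i : ℤ) * N + enc A = ((i * N + enc A : ℕ) : ℤ) by push_cast; ring]
    exact Int.toNat_natCast _
  ext B j
  · rfl
  · rw [St.setA_a]
    simp only [absSt, Store.setMem, h0, Function.update_apply]
    by_cases hB : enc B < N
    -- Division with remainder by the number of columns recovers row and column, so different array
    -- entries occupy different cells.
    · have : (j * N + enc B = i * N + enc A) ↔ (B = A ∧ j = i) := by
        constructor
        · intro h
          have h1 : (j * N + enc B) % N = (i * N + enc A) % N := by rw [h]
          rw [Nat.mul_add_mod_self_right, Nat.mul_add_mod_self_right, Nat.mod_eq_of_lt hB,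
            Nat.mod_eq_of_lt hA] at h1
          refine ⟨enc_inj.1 h1, ?_⟩
          rw [h1] at h
          exact Nat.eq_of_mul_eq_mul_right (by omega) (Nat.add_right_cancel h)
        · rintro ⟨rfl, rfl⟩; rfl
      simp [hB, this]
    · have : B ≠ A := by rintro rfl; exact hB hA
      simp [hB, this]

theorem Good.setMem {σ : Store} (hσ : Good E σ) {A : Var} {i : ℕ} {z : ℤ} (hA : enc A < E.N)
    (hi : i < E.cap) (hz : |z| ≤ E.B) : Good E (σ.setMem ((i : ℤ) * E.N + enc A) z) where
  var_le := hσ.var_le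
  reg_le := hσ.reg_le
  reg_zero := hσ.reg_zero
  mem_le j := by
    simp only [Store.setMem, Function.update_apply]
    split_ifs
    · exact hz
    · exact hσ.mem_le j
  mem_zero j hj := by
    have h0 : ((i : ℤ) * E.N + enc A).toNat = i * E.N + enc A := by
      rw [show (i : ℤ) * E.N + enc A = ((i * E.N + enc A : ℕ) : ℤ) by push_cast; ring]
      exact Int.toNat_natCast _
    simp only [Store.setMem, Function.update_apply, h0]
    rw [if_neg]
    · exact hσ.mem_zero j hj
    · have : (i + 1) * E.N ≤ E.cap * E.N := Nat.mul_le_mul_right _ hi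
      have : E.cap * E.N = E.N * E.cap := mul_comm _ _
      have : (i + 1) * E.N = i * E.N + E.N := by ring
      omega

theorem Run.store {s : St} {A : Var} {i e : Expr} {Q : St → Prop} (hb : |e.eval E.x s| ≤ E.B)
    (h0 : 0 ≤ i.eval E.x s) (hcap : i.eval E.x s < E.cap)
    (h : Q (s.setA A (i.eval E.x s).toNat (e.eval E.x s))) :
    Run E s (.store A i e) (i.cost + e.cost + 11) Q := by
  intro hwf σ hσ hs f T hf
  obtain ⟨hA, hi, he, his, hes⟩ := hwf
  have hN := E.hN
  have hB := E.hB
  have hB2 := E.hB2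
  have h1 : (1 : ℤ) ≤ E.B := by omega
  have hle : ∀ {i j : ℕ}, i ≤ j → E.B ^ i ≤ E.B ^ j := fun h => pow_le_pow_right₀ h1 h
  have hself : ∀ m : ℕ, 1 ≤ m → E.B ≤ E.B ^ m := fun m hm => by
    simpa using hle hm
  obtain ⟨σ1, d1, g1, m1, e1, v1, w1⟩ := evalPair_det he hi hes (by omega) hσ
  have hbd := Expr.eval_le hσ i hi
  rw [hs] at v1 w1 e1 hbd
  set z := i.eval E.x s with hz
  have hb1 : |z * E.N| ≤ E.B ^ (i.size + 1) := by
    rw [abs_mul, pow_succ, abs_of_nonneg (by positivity : (0 : ℤ) ≤ E.N)]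
    gcongr
  have hb2 : |z * E.N + enc A| ≤ E.B ^ E.N := by
    have h4 : ((enc A : ℕ) : ℤ) ≤ E.B ^ (i.size + 1) :=
      le_trans (by omega) (hself (i.size + 1) (by omega))
    have h5 : E.B ^ (i.size + 2) = E.B ^ (i.size + 1) * E.B := pow_succ _ _
    have h6 := hle his
    have h7 := abs_add_le (z * E.N) (enc A : ℤ)
    rw [abs_of_nonneg (by positivity : (0 : ℤ) ≤ (enc A : ℤ))] at h7
    nlinarith
  have hNle : |(E.N : ℤ)| ≤ E.B ^ E.N := by
    rw [abs_of_nonneg (by positivity)]; exact hB.trans (hself _ hN)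
  have hAle : |(enc A : ℤ)| ≤ E.B ^ E.N := by
    rw [abs_of_nonneg (by positivity)]; exact (by omega : (enc A : ℤ) ≤ E.B).trans (hself _ hN)
  have hsz := i.size_pos
  have g2 := g1.setTemp (r := E.N + 2) (z := E.N) (by omega) (by omega) hNle
  have g3 := g2.setTemp (r := E.N + 1) (z := z * E.N) (by omega) (by omega)
    (hb1.trans (hle (by omega)))
  have g4 := g3.setTemp (r := E.N + 2) (z := enc A) (by omega) (by omega) hAle
  have g5 := g4.setTemp (r := E.N + 1) (z := z * E.N + enc A) (by omega) (by omega) hb2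
  set σ5 := (((σ1.setReg (E.N + 2) E.N).setReg (E.N + 1) (z * E.N)).setReg (E.N + 2)
    (enc A)).setReg (E.N + 1) (z * E.N + enc A) with hσ5
  have hd : Det E (Cmd.code E.N (.store A i e)) σ (i.cost + e.cost + 11)
      (σ5.setMem (z * E.N + enc A) (e.eval E.x s)) := by
    refine (d1.seq hσ ((Det.instr g1 rfl).seq g1 ((Det.instr (σ' := _) g2 ?_).seq g2
      ((Det.instr g3 rfl).seq g3 ((Det.instr (σ' := _) g4 ?_).seq g4
      (Det.instr (σ' := _) g5 ?_)))))).mono (by omega)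
    · simp [Instr.exec, ArithOp.eval, Store.setReg, Function.update_apply, w1]
    · simp [Instr.exec, ArithOp.eval, Store.setReg, Function.update_apply, hσ5]
    · simp only [add_zero] at v1
      simp [Instr.exec, ArithOp.eval, Store.setReg, Function.update_apply, hσ5, v1]
  have e5 : absSt E.N σ5 = s := by
    rw [← e1]
    refine absSt_eq_of_agree ?_ rfl
    intro j hj
    have h1 : j ≠ E.N + 1 := by omega
    have h2 : j ≠ E.N + 2 := by omega
    simp [hσ5, Store.setReg, Function.update_apply, h1, h2]
  have hzn : z = (z.toNat : ℤ) := (Int.toNat_of_nonneg h0).symm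
  refine (hd f).trans ?_
  gcongr
  rw [hzn]
  refine hf _ (g5.setMem hA (by omega) hb) ?_
  rw [absSt_setMem _ hA, e5]
  exact h

theorem Run.ite {s : St} {a b : Expr} {c d : Cmd} {t : ℕ} {Q : St → Prop}
    (h1 : a.eval E.x s ≤ b.eval E.x s → Run E s c t Q)
    (h2 : ¬ a.eval E.x s ≤ b.eval E.x s → Run E s d t Q) :
    Run E s (.ite a b c d) (a.cost + b.cost + t + 3) Q := by
  intro hwf σ hσ hs f T hf
  obtain ⟨ha, hb, has, hbs, hc, hd⟩ := hwf
  obtain ⟨σ1, d1, g1, m1, e1, v1, w1⟩ := evalPair_det ha hb has hbs hσ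
  rw [hs] at v1 w1 e1
  rw [Cmd.code, ert_seq]
  simp only [hσ, not_true_eq_false, iSup_false, bot_eq_zero, zero_add]
  refine (add_le_add le_rfl (d1 _)).trans ?_
  rw [ert_ifLE]
  simp only [g1, not_true_eq_false, iSup_false, bot_eq_zero, zero_add, v1, w1]
  have : (if a.eval E.x s ≤ b.eval E.x s then ert (Good E) E.x (c.code E.N) f σ1
      else ert (Good E) E.x (d.code E.N) f σ1) ≤ t + T := by
    split_ifs with h
    · exact h1 h hc σ1 g1 e1 f T hf
    · exact h2 h hd σ1 g1 e1 f T hf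
  calc _ ≤ 1 + (((a.cost + b.cost + 1 : ℕ) : ℝ≥0∞) + (1 + (t + T))) := by gcongr
    _ = _ := by push_cast; ring

/-- The invariant is indexed by the number of completed iterations, and it has to force `r < m`
whenever the guard holds; this yields termination, and it allows a separate cost `t r` for each
iteration. -/
theorem Run.loop {s : St} {a b : Expr} {c : Cmd} {t : ℕ → ℕ} {m : ℕ} {Q : St → Prop}
    (I : ℕ → St → Prop) (h0 : I 0 s)
    (h : ∀ r s, I r s → a.eval E.x s ≤ b.eval E.x s → r < m ∧ Run E s c (t r) (I (r + 1)))
    (hQ : ∀ r s, I r s → ¬ a.eval E.x s ≤ b.eval E.x s → Q s) :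
    Run E s (.loop a b c) (∑ r ∈ Finset.range m, (t r + (a.cost + b.cost + 3)) +
      (a.cost + b.cost + 3)) Q := by
  intro hwf σ hσ hs f T hf
  obtain ⟨ha, hb, has, hbs, hc⟩ := hwf
  -- Induction on a bound `d` for the number of iterations that are still possible. The operands of
  -- the guard are already in registers `N` and `N + 1`, since the compiled body ends by evaluating
  -- them again.
  have key : ∀ d r : ℕ, m ≤ r + d → ∀ σ, Good E σ → I r (absSt E.N σ) →
      σ.reg (E.N + 0) = a.eval E.x (absSt E.N σ) → σ.reg (E.N + 1) = b.eval E.x (absSt E.N σ) →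
      ert (Good E) E.x (.whileLE (E.N + 0) (E.N + 1) (.seq (c.code E.N) (evalPair E.N a b))) f σ ≤
      ((∑ i ∈ Finset.Ico r m, (t i + (a.cost + b.cost + 3)) + 1 : ℕ) : ℝ≥0∞) + T := by
    intro d
    induction d with
    | zero =>
      intro r hr σ hσ hI v w
      rw [ert_whileLE]
      simp only [hσ, not_true_eq_false, iSup_false, bot_eq_zero, zero_add]
      rw [v, w]
      split_ifs with hg
      · have := (h r _ hI hg).1
        omega
      · have : f σ ≤ T := hf σ hσ (hQ r _ hI hg)
        push_cast
        rw [add_assoc]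
        exact (add_le_add le_rfl this).trans le_add_self
    | succ d ih =>
      intro r hr σ hσ hI v w
      rw [ert_whileLE]
      simp only [hσ, not_true_eq_false, iSup_false, bot_eq_zero, zero_add]
      rw [v, w]
      split_ifs with hg
      · obtain ⟨hrm, hrun⟩ := h r _ hI hg
        rw [ert_seq]
        simp only [hσ, not_true_eq_false, iSup_false, bot_eq_zero, zero_add]
        have h3 := hrun hc σ hσ rfl (ert (Good E) E.x (evalPair E.N a b)
          (ert (Good E) E.x (.whileLE (E.N + 0) (E.N + 1)
            (.seq (c.code E.N) (evalPair E.N a b))) f))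
          (((a.cost + b.cost + 1 : ℕ) : ℝ≥0∞) +
            (((∑ i ∈ Finset.Ico (r + 1) m, (t i + (a.cost + b.cost + 3)) + 1 : ℕ) : ℝ≥0∞) + T)) ?_
        · refine (add_le_add le_rfl (add_le_add le_rfl h3)).trans (le_of_eq ?_)
          rw [Finset.sum_eq_sum_Ico_succ_bot hrm]
          push_cast
          ring
        · intro σ' g' hI'
          obtain ⟨σ1, d1, g1, m1, e1, v1, w1⟩ := evalPair_det ha hb has hbs g'
          refine (d1 _).trans ?_
          gcongr
          exact ih (r + 1) (by omega) σ1 g1 (e1 ▸ hI') (e1 ▸ v1) (e1 ▸ w1)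
      · have : f σ ≤ T := hf σ hσ (hQ r _ hI hg)
        push_cast
        rw [add_assoc]
        exact (add_le_add le_rfl this).trans le_add_self
  obtain ⟨σ1, d1, g1, m1, e1, v1, w1⟩ := evalPair_det ha hb has hbs hσ
  rw [Cmd.code, ert_seq]
  simp only [hσ, not_true_eq_false, iSup_false, bot_eq_zero, zero_add]
  refine (add_le_add le_rfl (d1 _)).trans ?_
  have h3 := key m 0 (by omega) σ1 g1 (by rw [e1, hs]; exact h0) (e1 ▸ v1) (e1 ▸ w1)
  refine (add_le_add le_rfl (add_le_add le_rfl h3)).trans (le_of_eq ?_)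
  rw [Finset.range_eq_Ico]
  push_cast
  ring

/-- The only rule in which an expectation appears. The postcondition has to hold for every outcome,
as befits a Las Vegas algorithm, while the costs enter through their average. -/
theorem Run.rand_seq {s : St} {x : Var} {e : Expr} {c : Cmd} {m T : ℕ} {t : ℕ → ℕ}
    {Q : St → Prop} (hm : e.eval E.x s = m) (hm0 : 0 < m) (hmB : (m : ℤ) ≤ E.B)
    (h : ∀ v < m, Run E (s.setV x v) c (t v) Q) (ht : ∑ v ∈ Finset.range m, t v ≤ m * T) :
    Run E s (.seq (.rand x e) c) (T + e.cost + 3) Q := by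
  intro hwf σ hσ hs f T' hf
  obtain ⟨⟨hx, he, hes⟩, hc⟩ := hwf
  have hN := E.hN
  obtain ⟨σ1, d1, g1, m1, v1, r1⟩ := e.code_det he 0 σ hσ (by omega) hes
  have e1 := absSt_eq_of_agree (N := E.N) (fun i hi => r1 i (by omega)) m1
  rw [hs] at v1 e1
  rw [Cmd.code, ert_seq]
  simp only [hσ, not_true_eq_false, iSup_false, bot_eq_zero, zero_add]
  rw [Cmd.code, ert_seq]
  simp only [hσ, not_true_eq_false, iSup_false, bot_eq_zero, zero_add]
  have h3 : ert (Good E) E.x (.instr (.rand (enc x) (E.N + 0)))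
      (ert (Good E) E.x (c.code E.N) f) σ1 ≤ 1 + (T + T') := by
    rw [ert_instr]
    simp only [g1, not_true_eq_false, iSup_false, bot_eq_zero, zero_add, Instr.exec]
    gcongr
    rw [expect_map, v1, hm, expect_uniformBelow hm0]
    refine ENNReal.div_le_of_le_mul ?_
    calc _ ≤ ∑ v ∈ Finset.range m, ((t v : ℝ≥0∞) + T') := by
          refine Finset.sum_le_sum fun v hv => ?_
          rw [Finset.mem_range] at hv
          refine h v hv hc _ (g1.setVar hx ?_) ?_ f T' hf
          · rw [abs_of_nonneg (by positivity)]; omega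
          · rw [absSt_setVar _ hx, e1]
      _ = ((∑ v ∈ Finset.range m, t v : ℕ) : ℝ≥0∞) + m * T' := by
          rw [Finset.sum_add_distrib]; simp
      _ ≤ ((m * T : ℕ) : ℝ≥0∞) + m * T' := by gcongr
      _ = _ := by push_cast; ring
  refine (add_le_add le_rfl (add_le_add le_rfl (d1 _))).trans ?_
  calc _ ≤ 1 + (1 + ((e.cost : ℝ≥0∞) + (1 + (T + T')))) := by gcongr
    _ = _ := by push_cast; ring

end

end KSumRam

/-! ### From proof rules to statements about all reachable configurations. -/

namespace KSumRam

section
variable {k n : ℕ} {E : Env k n}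

theorem Run.sound {s : St} {c : Cmd} {t : ℕ} {Q : St → Prop} {hint : ℕ} (hrun : Run E s c t Q)
    (hwf : c.Wf E.N) (hs : s = absSt E.N (initConfig .skip E.x hint).store) (hN : 3 ≤ E.N)
    (hn : (n : ℤ) ≤ E.B) (ht : |E.x.target| ≤ E.B) (hh : (hint : ℤ) ≤ E.B) :
    (∀ C : Config, Reachable (c.code E.N) E.x hint C →
      Good E C.store ∧ (C.todo = [] → Q (absSt E.N C.store))) ∧
    expectedTime (c.code E.N) E.x hint ≤ t := by
  classical
  have hB2 := E.hB2
  have h1 : (1 : ℤ) ≤ E.B := by omega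
  have hself : E.B ≤ E.B ^ E.N := by simpa using pow_le_pow_right₀ h1 E.hN
  have hv : ∀ i, |(initConfig (c.code E.N) E.x hint).store.reg i| ≤ E.B := by
    intro i
    simp only [initConfig]
    split_ifs
    · simpa using hn
    · exact ht
    · simpa using hh
    · simp; omega
  have hinit : Good E (initConfig (c.code E.N) E.x hint).store :=
    { var_le := fun i _ => hv i
      reg_le := fun i => (hv i).trans hself
      reg_zero := fun i hi => by
        simp only [initConfig]
        rw [if_neg (by omega), if_neg (by omega), if_neg (by omega)]
      mem_le := fun i => by simp [initConfig]; omega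
      mem_zero := fun i _ => rfl }
  -- The final cost is infinite on every unwanted store, so a finite `ert` excludes all of them.
  set f : Store → ℝ≥0∞ := fun σ => if Good E σ ∧ Q (absSt E.N σ) then 0 else ⊤ with hf
  have hert : ert (Good E) E.x (c.code E.N) f (initConfig (c.code E.N) E.x hint).store ≤ t := by
    have := hrun hwf _ hinit hs.symm f 0 (fun σ' g q => by simp [hf, g, q])
    simpa using this
  have hfin : ert (Good E) E.x (c.code E.N) f (initConfig (c.code E.N) E.x hint).store ≠ ⊤ :=
    ne_top_of_le_ne_top (ENNReal.natCast_ne_top t) hert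
  refine ⟨fun C hC => ?_, (expectedTime_le _ _ f _ _).trans hert⟩
  have := good_of_reachable (Good E) E.x f (fun σ h => by
    by_contra hg; simp [hf, hg] at h) _ _ hfin C hC
  refine ⟨this.1, fun h => ?_⟩
  by_contra hq
  exact this.2 h (by simp [hf, hq])

theorem Good.usesAtMost {σ : Store} (hσ : Good E σ) :
    σ.UsesAtMost (3 * E.N + E.N * E.cap) := fun i hi =>
  ⟨hσ.reg_zero i (by omega), hσ.mem_zero i (by omega)⟩

theorem Good.wordSized {σ : Store} (hσ : Good E σ) {c w : ℕ} (h : E.B ^ E.N < 2 ^ (c * w)) :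
    σ.WordSized c w := fun i => by
  have hB2 := E.hB2
  have h1 : (1 : ℤ) ≤ E.B := by omega
  have hself : E.B ≤ E.B ^ E.N := by simpa using pow_le_pow_right₀ h1 E.hN
  exact ⟨(hσ.reg_le i).trans_lt h, ((hσ.mem_le i).trans hself).trans_lt h⟩

/-! ### Straight-line code -/

/-- The effect of a command without loops and random choices. -/
def Cmd.exec (x : KInstance k n) : Cmd → St → St
  | .assign y e, s => s.setV y (e.eval x s)
  | .store A i e, s => s.setA A (i.eval x s).toNat (e.eval x s)
  | .seq c d, s => d.exec x (c.exec x s)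
  | .ite a b c d, s => if a.eval x s ≤ b.eval x s then c.exec x s else d.exec x s
  | _, s => s

/-- The bounds that have to hold along a command without loops and random choices. -/
def Cmd.Ok (E : Env k n) : Cmd → St → Prop
  | .skip, _ => True
  | .assign _ e, s => |e.eval E.x s| ≤ E.B
  | .store _ i e, s => |e.eval E.x s| ≤ E.B ∧ 0 ≤ i.eval E.x s ∧ i.eval E.x s < E.cap
  | .seq c d, s => c.Ok E s ∧ d.Ok E (c.exec E.x s)
  | .ite a b c d, s => if a.eval E.x s ≤ b.eval E.x s then c.Ok E s else d.Ok E s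
  | _, _ => False

def Cmd.cost : Cmd → ℕ
  | .skip => 1
  | .assign _ e => e.cost + 4
  | .store _ i e => i.cost + e.cost + 11
  | .seq c d => c.cost + d.cost + 1
  | .ite a b c d => a.cost + b.cost + (c.cost + d.cost) + 3
  | _ => 0

theorem Run.straight {s : St} {c : Cmd} {Q : St → Prop} (h : c.Ok E s) (hQ : Q (c.exec E.x s)) :
    Run E s c c.cost Q := by
  induction c generalizing s Q with
  | skip => exact Run.skip hQ
  | assign y e => exact Run.assign h hQ
  | store A i e => exact Run.store h.1 h.2.1 h.2.2 hQ
  | rand y e => exact h.elim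
  | seq c d ihc ihd =>
    exact Run.seq (ihc h.1 (Q := fun s' => s' = c.exec E.x s) rfl)
      fun s' hs' => by subst hs'; exact ihd h.2 hQ
  | ite a b c d ihc ihd =>
    simp only [Cmd.Ok] at h
    simp only [Cmd.exec] at hQ
    refine Run.ite (fun hab => ?_) (fun hab => ?_)
    · rw [if_pos hab] at h hQ
      exact (ihc h hQ).mono (by omega) fun _ h => h
    · rw [if_neg hab] at h hQ
      exact (ihd h hQ).mono (by omega) fun _ h => h
  | loop a b c _ => exact h.elim

/-- Sequential composition of a list of commands. -/
def Cmd.block : List Cmd → Cmd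
  | [] => .skip
  | [c] => c
  | c :: d :: l => .seq c (block (d :: l))

/-! ### Counting loops -/

instance : Add Expr := ⟨.bin .add⟩
instance : Sub Expr := ⟨.bin .sub⟩
instance : Mul Expr := ⟨.bin .mul⟩
instance : Div Expr := ⟨.bin .div⟩
instance : Mod Expr := ⟨.bin .mod⟩

@[simp] theorem Expr.eval_const (x : KInstance k n) (s : St) (z : ℤ) :
    (Expr.const z).eval x s = z := rfl
@[simp] theorem Expr.eval_var (x : KInstance k n) (s : St) (y : Var) :
    (Expr.var y).eval x s = s.v y := rfl
@[simp] theorem Expr.eval_add (x : KInstance k n) (s : St) (a b : Expr) :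
    (a + b).eval x s = a.eval x s + b.eval x s := rfl
@[simp] theorem Expr.eval_sub (x : KInstance k n) (s : St) (a b : Expr) :
    (a - b).eval x s = a.eval x s - b.eval x s := rfl
@[simp] theorem Expr.eval_mul (x : KInstance k n) (s : St) (a b : Expr) :
    (a * b).eval x s = a.eval x s * b.eval x s := rfl
@[simp] theorem Expr.eval_div (x : KInstance k n) (s : St) (a b : Expr) :
    (a / b).eval x s = a.eval x s / b.eval x s := rfl
@[simp] theorem Expr.eval_mod (x : KInstance k n) (s : St) (a b : Expr) :
    (a % b).eval x s = a.eval x s % b.eval x s := rfl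
@[simp] theorem Expr.eval_inp (x : KInstance k n) (s : St) (a b : Expr) :
    (Expr.inp a b).eval x s = x.read (a.eval x s) (b.eval x s) := rfl

theorem Expr.eval_arr (x : KInstance k n) (s : St) (A : Var) (i : Expr) :
    (Expr.arr A i).eval x s =
      if 0 ≤ i.eval x s then s.a A (i.eval x s).toNat else s.a (0, 0) 0 := rfl

theorem Expr.eval_arr_nat {x : KInstance k n} {s : St} {A : Var} {i : Expr} {j : ℕ}
    (h : i.eval x s = j) : (Expr.arr A i).eval x s = s.a A j := by
  simp [Expr.eval_arr, h]

@[simp] theorem Expr.cost_const (z : ℤ) : (Expr.const z).cost = 1 := rfl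
@[simp] theorem Expr.cost_var (y : Var) : (Expr.var y).cost = 3 := rfl
@[simp] theorem Expr.cost_add (a b : Expr) : (a + b).cost = a.cost + b.cost + 3 := rfl
@[simp] theorem Expr.cost_sub (a b : Expr) : (a - b).cost = a.cost + b.cost + 3 := rfl
@[simp] theorem Expr.cost_mul (a b : Expr) : (a * b).cost = a.cost + b.cost + 3 := rfl
@[simp] theorem Expr.cost_div (a b : Expr) : (a / b).cost = a.cost + b.cost + 3 := rfl
@[simp] theorem Expr.cost_mod (a b : Expr) : (a % b).cost = a.cost + b.cost + 3 := rfl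
@[simp] theorem Expr.cost_inp (a b : Expr) : (Expr.inp a b).cost = a.cost + b.cost + 3 := rfl
@[simp] theorem Expr.cost_arr (A : Var) (i : Expr) : (Expr.arr A i).cost = i.cost + 10 := rfl

/-- `for i = 0, …, e - 1 do c`. -/
def Cmd.for (i : Var) (e : Expr) (c : Cmd) : Cmd :=
  .seq (.assign i (.const 0)) (.loop (.var i + .const 1) e
    (.seq c (.assign i (.var i + .const 1))))

/-- The bound `e` is evaluated anew in each turn, so the invariant has to fix its value; it must
also survive the increment of the counter, which the body itself may not change. -/
theorem Run.for_sum {s : St} {i : Var} {e : Expr} {c : Cmd} {m : ℕ} {t : ℕ → ℕ} {Q : St → Prop}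
    (I : ℕ → St → Prop) (hm : (m : ℤ) ≤ E.B) (h0 : I 0 (s.setV i 0))
    (hI : ∀ r s, r ≤ m → I r s → s.v i = r ∧ e.eval E.x s = m)
    (h : ∀ r s, r < m → I r s →
      Run E s c (t r) (fun s' => s'.v i = r ∧ I (r + 1) (s'.setV i (r + 1))))
    (hQ : ∀ s, I m s → Q s) :
    Run E s (.for i e c) (∑ r ∈ Finset.range m, (t r + (e.cost + 22)) + (e.cost + 16)) Q := by
  have hB2 := E.hB2
  have hw := fun s (hs : I 0 s) => Run.loop (E := E) (s := s) (a := .var i + .const 1) (b := e)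
    (c := .seq c (.assign i (.var i + .const 1))) (t := fun r => t r + 11 + 1) (m := m) (Q := Q)
    (fun r s => r ≤ m ∧ I r s) ⟨Nat.zero_le _, hs⟩
    (fun r s hr hg => by
      obtain ⟨h1, h2⟩ := hI r s hr.1 hr.2
      simp only [Expr.eval_add, Expr.eval_var, Expr.eval_const, h1, h2] at hg
      have hrm : r < m := by omega
      refine ⟨hrm, Run.seq (h r s hrm hr.2) fun s' hs' => ?_⟩
      refine Run.assign ?_ ?_
      · simp only [Expr.eval_add, Expr.eval_var, Expr.eval_const, hs'.1]
        rw [abs_of_nonneg (by positivity)]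
        omega
      · simp only [Expr.eval_add, Expr.eval_var, Expr.eval_const, hs'.1]
        exact ⟨hrm, hs'.2⟩)
    (fun r s hr hg => by
      obtain ⟨h1, h2⟩ := hI r s hr.1 hr.2
      simp only [Expr.eval_add, Expr.eval_var, Expr.eval_const, h1, h2] at hg
      have : r = m := by omega
      subst this
      exact hQ s hr.2)
  refine (Run.seq (u := ∑ r ∈ Finset.range m, (t r + 11 + 1 + (7 + e.cost + 3)) +
    (7 + e.cost + 3)) (Run.assign (Q := fun s' => s' = s.setV i 0) ?_ rfl) fun s' hs' => ?_).mono
    (le_of_eq ?_) fun _ h => h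
  · simp; omega
  · rw [hs']; exact hw _ h0
  · have : ∀ r, t r + 11 + 1 + (7 + e.cost + 3) = t r + (e.cost + 22) := fun r => by omega
    simp only [this, Expr.cost_const]
    omega

theorem Run.for {s : St} {i : Var} {e : Expr} {c : Cmd} {m t : ℕ} {Q : St → Prop}
    (I : ℕ → St → Prop) (hm : (m : ℤ) ≤ E.B) (h0 : I 0 (s.setV i 0))
    (hI : ∀ r s, r ≤ m → I r s → s.v i = r ∧ e.eval E.x s = m)
    (h : ∀ r s, r < m → I r s →
      Run E s c t (fun s' => s'.v i = r ∧ I (r + 1) (s'.setV i (r + 1))))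
    (hQ : ∀ s, I m s → Q s) :
    Run E s (.for i e c) (m * (t + (e.cost + 22)) + (e.cost + 16)) Q := by
  have := Run.for_sum I hm h0 hI h hQ
  simpa using this

end

/-! ### Frames -/

/-- The variables that code below level `d` must leave alone: those of level at least `d`, and
the global ones except the result flag `(0, 2)`. -/
def Prot (d : ℕ) (x : Var) : Prop := (x.1 = 0 ∧ x.2 ≠ 2) ∨ (x.1 ≠ 0 ∧ d ≤ x.1)

/-- The frame condition of nested procedures. Code for levels below `d` may use everything on levels
`1, …, d - 1` as scratch space, so its callers keep their data on level `d` and above. Of the global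
level only the result flag may change. -/
structure Frm (d : ℕ) (s s' : St) : Prop where
  v : ∀ x, Prot d x → s'.v x = s.v x
  a : ∀ A : Var, A.1 = 0 ∨ d ≤ A.1 → s'.a A = s.a A

theorem Frm.refl (d : ℕ) (s : St) : Frm d s s := ⟨fun _ _ => rfl, fun _ _ => rfl⟩

theorem Frm.trans {d : ℕ} {s s' s'' : St} (h1 : Frm d s s') (h2 : Frm d s' s'') : Frm d s s'' :=
  ⟨fun x hx => (h2.v x hx).trans (h1.v x hx), fun A hA => (h2.a A hA).trans (h1.a A hA)⟩

theorem Frm.mono {d d' : ℕ} {s s' : St} (h : Frm d s s') (hd : d ≤ d') : Frm d' s s' :=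
  ⟨fun x hx => h.v x (hx.imp id fun h => ⟨h.1, hd.trans h.2⟩),
    fun A hA => h.a A (hA.imp id fun h => hd.trans h)⟩

theorem Frm.setV {d : ℕ} {s s' : St} (h : Frm d s s') {x : Var} (hx : ¬ Prot d x) (z : ℤ) :
    Frm d s (s'.setV x z) :=
  ⟨fun y hy => by
    have : y ≠ x := by rintro rfl; exact hx hy
    simp [this, h.v y hy], fun A hA => h.a A hA⟩

theorem Frm.setA {d : ℕ} {s s' : St} (h : Frm d s s') {A : Var} (hA : A.1 ≠ 0 ∧ A.1 < d) (i : ℕ)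
    (z : ℤ) : Frm d s (s'.setA A i z) :=
  ⟨fun y hy => h.v y hy, fun B hB => by
    have : B ≠ A := by rintro rfl; omega
    rw [← h.a B hB]
    funext j
    simp [this]⟩

end KSumRam

namespace KSumRam

/-! ### Sorted streams: tournament trees -/

/-- The tree property of a tournament tree with leaves `M, …, 2 M - 1`. -/
def Heap (M : ℕ) (T : ℕ → ℤ) : Prop := ∀ i, 1 ≤ i → i < M → T i = min (T (2 * i)) (T (2 * i + 1))

/-- The parent of node `j ≥ 2` is `j / 2`, an inner node whenever `j < 2 M`. Nothing here needs `M`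
to be a power of two. -/
theorem Heap.root_le {M : ℕ} {T : ℕ → ℤ} (h : Heap M T) {j : ℕ} (h1 : 1 ≤ j) (h2 : j < 2 * M) :
    T 1 ≤ T j := by
  induction j using Nat.strong_induction_on with
  | _ j ih =>
    rcases Nat.lt_or_ge j 2 with hj | hj
    · rw [show j = 1 by omega]
    · refine (ih (j / 2) (by omega) (by omega) (by omega)).trans ?_
      rw [h (j / 2) (by omega) (by omega)]
      rcases Nat.mod_two_eq_zero_or_one j with h0 | h0
      · exact min_le_of_left_le (by rw [show 2 * (j / 2) = j by omega])
      · exact min_le_of_right_le (by rw [show 2 * (j / 2) + 1 = j by omega])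

/-- The tree and the pointers of stream `q`, and the registers of its code. -/
def treeA (q : ℕ) : Var := (1, 2 * q)
def ptrA (q : ℕ) : Var := (1, 2 * q + 1)

/-- The register holding the value that stands for infinity. -/
def gInf : Var := (0, 6)

theorem treeA_ne_ptrA (q q' : ℕ) : treeA q ≠ ptrA q' := by
  simp only [treeA, ptrA, ne_eq, Prod.mk.injEq, not_and]; omega

theorem ptrA_ne_treeA (q q' : ℕ) : ptrA q ≠ treeA q' := (treeA_ne_ptrA q' q).symm

/-- An inner node holds the minimum of its children, so the left child is at most its parent exactly
when it attains that minimum. The walk thus follows the root value down to a leaf. -/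
def siftDown (q : ℕ) (M : Var) : Cmd :=
  .seq (.assign (1, 1) (.const 1)) (.loop (.var (1, 1) + .const 1) (.var M)
    (.ite (.arr (treeA q) (.const 2 * .var (1, 1))) (.arr (treeA q) (.var (1, 1)))
      (.assign (1, 1) (.const 2 * .var (1, 1)))
      (.assign (1, 1) (.const 2 * .var (1, 1) + .const 1))))

/-- An exhausted leaf is parked at pointer `J` with the infinite key and stays there under further
pops. -/
def popLeaf (q : ℕ) (M J A B : Var) : Cmd := .block [
  .assign (1, 2) (.var (1, 1) - .var M),
  .assign (1, 3) (.arr (ptrA q) (.var (1, 2)) + .const 1),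
  .ite (.var (1, 3) + .const 1) (.var J)
    (.seq (.store (ptrA q) (.var (1, 2)) (.var (1, 3)))
      (.store (treeA q) (.var (1, 1)) (.arr A (.var (1, 2)) + .arr B (.var (1, 3)))))
    (.seq (.store (ptrA q) (.var (1, 2)) (.var J))
      (.store (treeA q) (.var (1, 1)) (.var gInf)))]

/-- Recompute a node of the tree from its children. -/
def fixNode (q : ℕ) : Cmd :=
  .ite (.arr (treeA q) (.const 2 * .var (1, 1))) (.arr (treeA q) (.const 2 * .var (1, 1) + .const 1))
    (.store (treeA q) (.var (1, 1)) (.arr (treeA q) (.const 2 * .var (1, 1))))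
    (.store (treeA q) (.var (1, 1)) (.arr (treeA q) (.const 2 * .var (1, 1) + .const 1)))

def siftUp (q : ℕ) : Cmd :=
  .loop (.const 2) (.var (1, 1)) (.seq (.assign (1, 1) (.var (1, 1) / .const 2)) (fixNode q))

def popStream (q : ℕ) (M J A B : Var) : Cmd :=
  .seq (siftDown q M) (.seq (popLeaf q M J A B) (siftUp q))

def initStream (q : ℕ) (M A B : Var) : Cmd :=
  .seq (.for (1, 4) (.var M) (.seq (.store (ptrA q) (.var (1, 4)) (.const 0))
    (.store (treeA q) (.var M + .var (1, 4)) (.arr A (.var (1, 4)) + .arr B (.const 0)))))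
  (.for (1, 4) (.var M) (.seq (.assign (1, 1) (.var M - .const 1 - .var (1, 4))) (fixNode q)))

/-- The current key of a leaf. -/
def leafKey (J : ℕ) (fA fB : ℕ → ℤ) (inf : ℤ) (pt : ℕ → ℕ) (l : ℕ) : ℤ :=
  if pt l < J then fA l + fB (pt l) else inf

/-- Stream `q` has `M` leaves; leaf `l` runs through `fA l + fB j`, `j < J`, and stands at
`j = pt l`. -/
structure SInv (q M J : ℕ) (fA fB : ℕ → ℤ) (inf : ℤ) (pt : ℕ → ℕ) (s : St) : Prop where
  ptr : ∀ l < M, s.a (ptrA q) l = pt l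
  le : ∀ l < M, pt l ≤ J
  leaf : ∀ l < M, s.a (treeA q) (M + l) = leafKey J fA fB inf pt l
  heap : Heap M (s.a (treeA q))

/-- `s'` differs from `s` only in the stream `q` and the scratch registers of streams. -/
structure StreamFrm (q : ℕ) (s s' : St) : Prop where
  v : ∀ x : Var, x.1 ≠ 1 → s'.v x = s.v x
  a : ∀ A : Var, A ≠ treeA q → A ≠ ptrA q → s'.a A = s.a A

theorem StreamFrm.refl (q : ℕ) (s : St) : StreamFrm q s s := ⟨fun _ _ => rfl, fun _ _ _ => rfl⟩

theorem StreamFrm.trans {q : ℕ} {s s' s'' : St} (h1 : StreamFrm q s s') (h2 : StreamFrm q s' s'') :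
    StreamFrm q s s'' :=
  ⟨fun x hx => (h2.v x hx).trans (h1.v x hx), fun A h h' => (h2.a A h h').trans (h1.a A h h')⟩

theorem StreamFrm.setV {q : ℕ} {s s' : St} (h : StreamFrm q s s') {x : Var} (hx : x.1 = 1) (z : ℤ) :
    StreamFrm q s (s'.setV x z) :=
  ⟨fun y hy => by
    have : y ≠ x := by rintro rfl; exact hy hx
    simp [this, h.v y hy], h.a⟩

theorem StreamFrm.setA {q : ℕ} {s s' : St} (h : StreamFrm q s s') {A : Var}
    (hA : A = treeA q ∨ A = ptrA q) (i : ℕ) (z : ℤ) : StreamFrm q s (s'.setA A i z) :=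
  ⟨h.v, fun B h1 h2 => by
    have : B ≠ A := by rintro rfl; tauto
    rw [← h.a B h1 h2]
    funext j
    simp [this]⟩

theorem StreamFrm.frm {q d : ℕ} {s s' : St} (h : StreamFrm q s s') (hd : 2 ≤ d) : Frm d s s' := by
  refine ⟨fun x hx => h.v x ?_, fun A hA => h.a A ?_ ?_⟩
  · rintro h1
    rcases hx with hx | hx <;> omega
  · rintro rfl; simp [treeA] at hA; omega
  · rintro rfl; simp [ptrA] at hA; omega

theorem SInv.root_le {q M J : ℕ} {fA fB : ℕ → ℤ} {inf : ℤ} {pt : ℕ → ℕ} {s : St}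
    (h : SInv q M J fA fB inf pt s) {l : ℕ} (hl : l < M) :
    s.a (treeA q) 1 ≤ leafKey J fA fB inf pt l := by
  rw [← h.leaf l hl]
  exact h.heap.root_le (by omega) (by omega)

theorem SInv.congr {q q' M J : ℕ} {fA fB : ℕ → ℤ} {inf : ℤ} {pt : ℕ → ℕ} {s s' : St}
    (h : SInv q M J fA fB inf pt s) (h1 : s'.a (treeA q') = s.a (treeA q))
    (h2 : s'.a (ptrA q') = s.a (ptrA q)) : SInv q' M J fA fB inf pt s' :=
  ⟨fun l hl => by rw [h2]; exact h.ptr l hl, h.le, fun l hl => by rw [h1]; exact h.leaf l hl,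
    by rw [h1]; exact h.heap⟩

section
variable {k n : ℕ} {E : Env k n}

/-- The bounds on variables and array entries belong to `Good`, so they come for free in every
abstract state from which a run starts. -/
theorem Run.of_bounded {s : St} {c : Cmd} {t : ℕ} {Q : St → Prop}
    (h : (∀ x, |s.v x| ≤ E.B) → (∀ A i, |s.a A i| ≤ E.B) → Run E s c t Q) : Run E s c t Q := by
  intro hwf σ hσ hs
  exact h (fun x => hs ▸ hσ.abs_v x) (fun A i => hs ▸ hσ.abs_a A i) hwf σ hσ hs

/-- After `r` turns the current node is at least `2 ^ r`, and it is below `M ≤ 2 ^ lg` as long as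
the loop continues; hence at most `lg` turns. -/
theorem siftDown_run {s : St} {q M lg : ℕ} {Mv : Var} (hMv : s.v Mv = M) (hMv1 : Mv.1 ≠ 1)
    (hM : 1 ≤ M) (hlg : M ≤ 2 ^ lg) (hB : (2 * M : ℤ) ≤ E.B) (hheap : Heap M (s.a (treeA q))) :
    Run E s (siftDown q Mv) (100 * (lg + 1)) (fun s' => ∃ i : ℕ, M ≤ i ∧ i < 2 * M ∧
      s'.v (1, 1) = i ∧ s.a (treeA q) i = s.a (treeA q) 1 ∧ s'.a = s.a ∧
      StreamFrm q s s') := by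
  have hB2 := E.hB2
  have hw := fun s1 (hs1 : s1 = s.setV (1, 1) 1) => Run.loop (E := E) (s := s1)
    (a := .var (1, 1) + .const 1) (b := .var Mv)
    (c := .ite (.arr (treeA q) (.const 2 * .var (1, 1))) (.arr (treeA q) (.var (1, 1)))
      (.assign (1, 1) (.const 2 * .var (1, 1)))
      (.assign (1, 1) (.const 2 * .var (1, 1) + .const 1))) (t := fun _ => 62) (m := lg)
    (Q := fun s' => ∃ i : ℕ, M ≤ i ∧ i < 2 * M ∧
      s'.v (1, 1) = i ∧ s.a (treeA q) i = s.a (treeA q) 1 ∧ s'.a = s.a ∧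
      StreamFrm q s s')
    (fun r s' => ∃ i : ℕ, 2 ^ r ≤ i ∧ i < 2 * M ∧ s'.v (1, 1) = i ∧
      s.a (treeA q) i = s.a (treeA q) 1 ∧ s'.a = s.a ∧ StreamFrm q s s')
    ⟨1, by simp, by omega, by simp [hs1], rfl, by simp [hs1],
      hs1 ▸ (StreamFrm.refl q s).setV rfl _⟩ ?_ ?_
  · refine (Run.seq (Run.assign ?_ rfl) fun s' hs' => hw s' hs'.symm).mono ?_ fun _ h => h
    · simp; omega
    · simp; omega
  · rintro r s' ⟨i, h1, h2, h3, h4, h5, h6⟩ hg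
    have hMs : s'.v Mv = M := (h6.v _ hMv1).trans hMv
    simp only [Expr.eval_add, Expr.eval_var, Expr.eval_const, h3, hMs] at hg
    have hiM : i < M := by omega
    have hi1 : 1 ≤ i := le_trans Nat.one_le_two_pow h1
    refine ⟨(Nat.pow_lt_pow_iff_right (by norm_num : 1 < 2)).1 ((h1.trans_lt hiM).trans_le hlg), ?_⟩
    have e1 : (Expr.arr (treeA q) (.const 2 * .var (1, 1))).eval E.x s' = s.a (treeA q) (2 * i) := by
      rw [Expr.eval_arr_nat (j := 2 * i) (by simp [h3]), h5]
    have e2 : (Expr.arr (treeA q) (.var (1, 1))).eval E.x s' = s.a (treeA q) i := by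
      rw [Expr.eval_arr_nat (j := i) (by simp [h3]), h5]
    have hh := hheap i hi1 hiM
    refine (Run.straight ?_ ?_).mono (?_ : _ ≤ 62) fun _ h => h
    · simp only [Cmd.Ok, Expr.eval_mul, Expr.eval_add, Expr.eval_var, Expr.eval_const, h3]
      split_ifs <;> rw [abs_of_nonneg (by positivity)] <;> omega
    · simp only [Cmd.exec, e1, e2]
      split_ifs with hc
      · refine ⟨2 * i, by rw [pow_succ]; omega, by omega, by simp [h3], ?_, by simp [h5],
          h6.setV rfl _⟩
        rw [← h4]
        have := min_le_left (s.a (treeA q) (2 * i)) (s.a (treeA q) (2 * i + 1))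
        omega
      · refine ⟨2 * i + 1, by rw [pow_succ]; omega, by omega, by simp [h3], ?_, by simp [h5],
          h6.setV rfl _⟩
        rw [← h4]
        rcases min_choice (s.a (treeA q) (2 * i)) (s.a (treeA q) (2 * i + 1)) with hm | hm <;> omega
    · simp [Cmd.cost]
  · rintro r s' ⟨i, h1, h2, h3, h4, h5, h6⟩ hg
    have hMs : s'.v Mv = M := (h6.v _ hMv1).trans hMv
    simp only [Expr.eval_add, Expr.eval_var, Expr.eval_const, h3, hMs] at hg
    exact ⟨i, by omega, h2, h3, h4, h5, h6⟩

theorem fixNode_run {s : St} {q i : ℕ} (hi : s.v (1, 1) = i) (hcap : i < E.cap) :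
    Run E s (fixNode q) 130 (fun s' => s' = s.setA (treeA q) i
      (min (s.a (treeA q) (2 * i)) (s.a (treeA q) (2 * i + 1)))) := by
  refine Run.of_bounded fun hv ha => ?_
  have e1 : (Expr.arr (treeA q) (.const 2 * .var (1, 1))).eval E.x s = s.a (treeA q) (2 * i) := by
    rw [Expr.eval_arr_nat (j := 2 * i) (by simp [hi])]
  have e2 : (Expr.arr (treeA q) (.const 2 * .var (1, 1) + .const 1)).eval E.x s =
      s.a (treeA q) (2 * i + 1) := by
    rw [Expr.eval_arr_nat (j := 2 * i + 1) (by simp [hi])]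
  refine (Run.straight ?_ ?_).mono (?_ : _ ≤ 130) fun _ h => h
  · simp only [fixNode, Cmd.Ok, e1, e2, Expr.eval_var, hi]
    have := ha (treeA q)
    split_ifs <;> exact ⟨this _, by positivity, by exact_mod_cast hcap⟩
  · simp only [fixNode, Cmd.exec, e1, e2, Expr.eval_var, hi, Int.toNat_natCast]
    split_ifs with h
    · rw [min_eq_left h]
    · rw [min_eq_right (by omega)]
  · simp [fixNode, Cmd.cost]

theorem fixNode_at_run {s : St} {q i : ℕ} {e : Expr} (hi : e.eval E.x s = i) (hcap : i < E.cap)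
    (hB : (i : ℤ) ≤ E.B) : Run E s (.seq (.assign (1, 1) e) (fixNode q)) (e.cost + 135)
      (fun s' => s' = (s.setV (1, 1) i).setA (treeA q) i
        (min (s.a (treeA q) (2 * i)) (s.a (treeA q) (2 * i + 1)))) := by
  refine (Run.seq (Run.assign ?_ rfl) fun s1 hs1 => ?_).mono (t := e.cost + 4 + 130 + 1) (by omega)
    fun _ h => h
  · rw [hi, abs_of_nonneg (by positivity)]; exact hB
  · subst hs1
    refine (fixNode_run (i := i) (by simp [hi]) hcap).mono le_rfl ?_
    rintro _ rfl
    simp [hi]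

/-- After a leaf has changed, only its parent can violate the tree property. Recomputing a node
repairs it and moves the only possible violation to its own parent. The invariant `i * 2 ^ r < 2 M`
bounds the number of turns. -/
theorem siftUp_run {s : St} {q M lg i : ℕ} (hi : s.v (1, 1) = i) (hi1 : 1 ≤ i) (hi2 : i < 2 * M)
    (hlg : M ≤ 2 ^ lg) (hcap : 2 * M ≤ E.cap)
    (hheap : ∀ j, 1 ≤ j → j < M → j ≠ i / 2 →
      s.a (treeA q) j = min (s.a (treeA q) (2 * j)) (s.a (treeA q) (2 * j + 1))) :
    Run E s (siftUp q) (170 * (lg + 1)) (fun s' => Heap M (s'.a (treeA q)) ∧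
      (∀ j, M ≤ j → s'.a (treeA q) j = s.a (treeA q) j) ∧ s'.a (ptrA q) = s.a (ptrA q) ∧
      StreamFrm q s s') := by
  have hw := Run.loop (E := E) (s := s) (a := .const 2) (b := .var (1, 1))
    (c := .seq (.assign (1, 1) (.var (1, 1) / .const 2)) (fixNode q)) (t := fun _ => 145) (m := lg)
    (Q := fun s' => Heap M (s'.a (treeA q)) ∧
      (∀ j, M ≤ j → s'.a (treeA q) j = s.a (treeA q) j) ∧ s'.a (ptrA q) = s.a (ptrA q) ∧
      StreamFrm q s s')
    (fun r s' => ∃ i : ℕ, 1 ≤ i ∧ i * 2 ^ r < 2 * M ∧ s'.v (1, 1) = i ∧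
      (∀ j, 1 ≤ j → j < M → j ≠ i / 2 →
        s'.a (treeA q) j = min (s'.a (treeA q) (2 * j)) (s'.a (treeA q) (2 * j + 1))) ∧
      (∀ j, M ≤ j → s'.a (treeA q) j = s.a (treeA q) j) ∧ s'.a (ptrA q) = s.a (ptrA q) ∧
      StreamFrm q s s')
    ⟨i, hi1, by simpa using hi2, hi, hheap, fun _ _ => rfl, rfl, StreamFrm.refl q s⟩ ?_ ?_
  · exact hw.mono (by simp; omega) fun _ h => h
  · rintro r s' ⟨i, h1, h2, h3, h4, h5, h6, h7⟩ hg
    simp only [Expr.eval_var, Expr.eval_const, h3] at hg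
    have hi2' : 2 ≤ i := by exact_mod_cast hg
    have hiM : i < 2 * M := lt_of_le_of_lt (Nat.le_mul_of_pos_right _ (by positivity)) h2
    constructor
    · refine (Nat.pow_lt_pow_iff_right (by norm_num : 1 < 2)).1 ?_
      have : 2 * 2 ^ r ≤ i * 2 ^ r := Nat.mul_le_mul_right _ hi2'
      omega
    · refine Run.of_bounded fun hv ha => ?_
      have hdiv : (i : ℤ) / 2 = ((i / 2 : ℕ) : ℤ) := by norm_cast
      have hv1 := hv (1, 1)
      rw [h3, abs_of_nonneg (by positivity)] at hv1
      refine (fixNode_at_run (i := i / 2) (by simp [h3]) (by omega) (by omega)).mono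
        (?_ : _ ≤ 145) ?_
      · simp
      · intro s2 hs2
        have : ∀ x, ¬ (2 * x = i / 2 ∧ 2 * x + 1 = i / 2) := fun x => by omega
        subst hs2
        refine ⟨i / 2, by omega, ?_, by simp [h3], ?_, ?_, ?_, (h7.setV rfl _).setA (Or.inl rfl) _ _⟩
        · rw [pow_succ]
          have : i / 2 * 2 ≤ i := Nat.div_mul_le_self i 2
          calc i / 2 * (2 ^ r * 2) = i / 2 * 2 * 2 ^ r := by ring
            _ ≤ i * 2 ^ r := Nat.mul_le_mul_right _ this
            _ < _ := h2
        · intro j hj1 hj2 hj3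
          by_cases hj : j = i / 2
          · subst hj
            have c1 : 2 * (i / 2) ≠ i / 2 := by omega
            have c2 : 2 * (i / 2) + 1 ≠ i / 2 := by omega
            simp [c1, c2]
          · have c1 : 2 * j ≠ i / 2 := by omega
            have c2 : 2 * j + 1 ≠ i / 2 := by omega
            simp [hj, c1, c2, h4 j hj1 hj2 hj]
        · intro j hj
          have : j ≠ i / 2 := by omega
          simp [this, h5 j hj]
        · funext j
          simp [ptrA_ne_treeA, h6]
  · rintro r s' ⟨i, h1, h2, h3, h4, h5, h6, h7⟩ hg
    simp only [Expr.eval_var, Expr.eval_const, h3] at hg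
    have : i / 2 = 0 := by omega
    exact ⟨fun j hj1 hj2 => h4 j hj1 hj2 (by omega), h5, h6, h7⟩

/-- Ties are possible, so the popped leaf is known only to attain the root value. One pop advances
one pointer, at the cost of one way down and one way up the tree. -/
theorem popStream_run {s : St} {q M J lg : ℕ} {Mv Jv A B : Var} {fA fB : ℕ → ℤ} {inf : ℤ}
    {pt : ℕ → ℕ} (hs : SInv q M J fA fB inf pt s) (hMv : s.v Mv = M) (hMv1 : Mv.1 ≠ 1)
    (hJv : s.v Jv = J) (hJv1 : Jv.1 ≠ 1) (hinf : s.v gInf = inf)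
    (hA : A.1 ≠ 1) (hB : B.1 ≠ 1) (hfA : ∀ l < M, s.a A l = fA l) (hfB : ∀ j < J, s.a B j = fB j)
    (hM : 1 ≤ M) (hlg : M ≤ 2 ^ lg) (hBM : (2 * M : ℤ) ≤ E.B) (hcap : 2 * M ≤ E.cap)
    (hJB : (J + 1 : ℤ) ≤ E.B) (hkey : ∀ l < M, ∀ j < J, |fA l + fB j| ≤ E.B) :
    Run E s (popStream q Mv Jv A B) (600 * (lg + 1)) (fun s' => ∃ l < M,
      s.a (treeA q) 1 = leafKey J fA fB inf pt l ∧
      SInv q M J fA fB inf (Function.update pt l (min (pt l + 1) J)) s' ∧ StreamFrm q s s') := by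
  have hw := Run.seq (siftDown_run (E := E) hMv hMv1 hM hlg hBM hs.heap)
    (d := .seq (popLeaf q Mv Jv A B) (siftUp q)) (u := 500 * (lg + 1) - 1)
    (Q := fun s' => ∃ l < M, s.a (treeA q) 1 = leafKey J fA fB inf pt l ∧
      SInv q M J fA fB inf (Function.update pt l (min (pt l + 1) J)) s' ∧ StreamFrm q s s') ?_
  · exact hw.mono (by omega) fun _ h => h
  rintro s1 ⟨i, hi1, hi2, hi3, hi4, hi5, hi6⟩
  refine Run.of_bounded fun hv ha => ?_
  obtain ⟨l, rfl⟩ : ∃ l, i = M + l := ⟨i - M, by omega⟩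
  have hl : l < M := by omega
  have hM1 : s1.v Mv = M := (hi6.v _ hMv1).trans hMv
  have hJ1 : s1.v Jv = J := (hi6.v _ hJv1).trans hJv
  have hinf1 : s1.v gInf = inf := (hi6.v _ (by simp [gInf])).trans hinf
  have hJx : ∀ m, Jv ≠ (1, m) := by rintro m rfl; exact hJv1 rfl
  have hIx : ∀ m, gInf ≠ (1, m) := by rintro m h; simp [gInf] at h
  have hAp : A ≠ ptrA q := by rintro rfl; exact hA rfl
  have hBp : B ≠ ptrA q := by rintro rfl; exact hB rfl
  set key := if pt l + 1 < J then fA l + fB (pt l + 1) else inf with hkeydef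
  have hleaf : Run E s1 (popLeaf q Mv Jv A B) 212 (fun s2 =>
      s2 = (((s1.setV (1, 2) l).setV (1, 3) (pt l + 1)).setA (ptrA q) l
        (min (pt l + 1) J : ℕ)).setA (treeA q) (M + l) key) := by
    have hptl := hs.le l hl
    have hp : s1.a (ptrA q) l = pt l := by rw [hi5]; exact hs.ptr l hl
    have hfA1 : s1.a A l = fA l := by rw [hi5]; exact hfA l hl
    refine (Run.straight ?_ ?_).mono (?_ : _ ≤ 212) fun _ h => h
    · simp only [popLeaf, Cmd.block, Cmd.Ok, Cmd.exec, Expr.eval_sub, Expr.eval_var,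
        Expr.eval_add, Expr.eval_const, Expr.eval_arr, hi3, hM1]
      simp [hp, hJx, hIx, hJ1, hinf1, hi3, hfA1, hAp, hBp]
      have hpos : (0 : ℤ) ≤ (pt l : ℤ) + 1 := by positivity
      refine ⟨by omega, by rw [abs_of_nonneg (by positivity)]; omega, ?_⟩
      split_ifs with hc
      · refine ⟨⟨by rw [abs_of_nonneg hpos]; omega, by omega⟩, ?_, by omega, by omega⟩
        have : s1.a B (pt l + 1) = fB (pt l + 1) := by rw [hi5]; exact hfB _ (by omega)
        rw [this]
        exact hkey l hl _ (by omega)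
      · refine ⟨⟨by omega, by omega⟩, ?_, by omega, by omega⟩
        rw [← hinf1]; exact hv gInf
    · simp only [popLeaf, Cmd.block, Cmd.Ok, Cmd.exec, Expr.eval_sub, Expr.eval_var,
        Expr.eval_add, Expr.eval_const, Expr.eval_arr, hi3, hM1]
      simp [hp, hJx, hIx, hJ1, hinf1, hi3, hfA1, hAp, hBp]
      have hpos : (0 : ℤ) ≤ (pt l : ℤ) + 1 := by positivity
      have hN : ((M : ℤ) + l).toNat = M + l := by omega
      by_cases hc : (pt l : ℤ) + 1 < J
      · have hc' : pt l + 1 < J := by omega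
        rw [if_pos hc, hN, show min ((pt l : ℤ) + 1) J = pt l + 1 by omega, hkeydef, if_pos hc',
          if_pos hpos]
        have : s1.a B (pt l + 1) = fB (pt l + 1) := by rw [hi5]; exact hfB _ hc'
        rw [this]
      · have hc' : ¬ pt l + 1 < J := by omega
        rw [if_neg hc, hN, show min ((pt l : ℤ) + 1) J = J by omega, hkeydef, if_neg hc']
    · simp [popLeaf, Cmd.block, Cmd.cost]
  refine (Run.seq (u := 170 * (lg + 1)) hleaf fun s2 hs2 => ?_).mono (by omega) fun _ h => h
  have hup := siftUp_run (E := E) (s := s2) (q := q) (M := M) (lg := lg) (i := M + l)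
    (by simp [hs2, hi3]) (by omega) (by omega) hlg hcap ?_
  · refine hup.mono le_rfl ?_
    rintro s3 ⟨u1, u2, u3, u4⟩
    refine ⟨l, hl, ?_, ⟨?_, ?_, ?_, u1⟩, ?_⟩
    · rw [← hi4, hs.leaf l hl]
    · intro j hj
      rw [u3, hs2]
      by_cases hjl : j = l
      · subst hjl
        simp [ptrA_ne_treeA]
      · simp [ptrA_ne_treeA, hjl, hi5, hs.ptr j hj]
    · intro j hj
      by_cases hjl : j = l
      · subst hjl
        simp
      · simp [hjl, hs.le j hj]
    · intro j hj
      rw [u2 _ (by omega), hs2]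
      by_cases hjl : j = l
      · subst hjl
        simp only [St.setA_a, and_self, if_true, leafKey, Function.update_self, hkeydef]
        by_cases h : pt j + 1 < J
        · rw [if_pos h, min_eq_left (by omega), if_pos h]
        · rw [if_neg h, if_neg (by omega)]
      · simp [treeA_ne_ptrA, hjl, hi5, leafKey, Function.update_apply]
        exact hs.leaf j hj
    · refine StreamFrm.trans ?_ u4
      rw [hs2]
      exact ((((hi6.setV rfl _).setV rfl _).setA (Or.inr rfl) _ _).setA (Or.inl rfl) _ _)
  · intro j hj1 hj2 hj3
    have c1 : j ≠ M + l := by omega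
    have c2 : 2 * j ≠ M + l := by omega
    have c3 : 2 * j + 1 ≠ M + l := by omega
    simp [hs2, c1, c2, c3, treeA_ne_ptrA, hi5]
    exact hs.heap j hj1 hj2

theorem initStream_run {s : St} {q M J : ℕ} {Mv A B : Var} {fA fB : ℕ → ℤ} (inf : ℤ)
    (hMv : s.v Mv = M) (hMv1 : Mv.1 ≠ 1) (hA : A.1 ≠ 1) (hB : B.1 ≠ 1)
    (hfA : ∀ l < M, s.a A l = fA l) (hfB : ∀ j < J, s.a B j = fB j)
    (hM : 1 ≤ M) (hJ : 1 ≤ J) (hBM : (2 * M : ℤ) ≤ E.B) (hcap : 2 * M ≤ E.cap)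
    (hkey : ∀ l < M, ∀ j < J, |fA l + fB j| ≤ E.B) :
    Run E s (initStream q Mv A B) (400 * M) (fun s' =>
      SInv q M J fA fB inf (fun _ => 0) s' ∧ StreamFrm q s s') := by
  have hAp : A ≠ ptrA q := by rintro rfl; exact hA rfl
  have hBp : B ≠ ptrA q := by rintro rfl; exact hB rfl
  have hAt : A ≠ treeA q := by rintro rfl; exact hA rfl
  have hBt : B ≠ treeA q := by rintro rfl; exact hB rfl
  have hMx : ∀ m, Mv ≠ (1, m) := by rintro m rfl; exact hMv1 rfl
  have h1 := Run.for (E := E) (s := s) (i := (1, 4)) (e := .var Mv) (m := M) (t := 64)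
    (c := .seq (.store (ptrA q) (.var (1, 4)) (.const 0))
      (.store (treeA q) (.var Mv + .var (1, 4)) (.arr A (.var (1, 4)) + .arr B (.const 0))))
    (Q := fun s' => (∀ l < M, s'.a (ptrA q) l = 0) ∧
      (∀ l < M, s'.a (treeA q) (M + l) = fA l + fB 0) ∧ StreamFrm q s s')
    (fun r s' => s'.v (1, 4) = r ∧ (∀ l < r, s'.a (ptrA q) l = 0) ∧
      (∀ l < r, s'.a (treeA q) (M + l) = fA l + fB 0) ∧ StreamFrm q s s') (by omega)
    ⟨by simp, by simp, by simp, (StreamFrm.refl q s).setV rfl _⟩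
    (fun r s' _ h => ⟨h.1, by simp [h.2.2.2.v _ hMv1, hMv]⟩) ?_ (fun s' h => h.2)
  · refine (Run.seq h1 (Q := fun s' => SInv q M J fA fB inf (fun _ => 0) s' ∧ StreamFrm q s s')
      (u := M * (155 + (3 + 22)) + (3 + 16)) fun s1 hs1 => ?_).mono ?_ fun _ h => h
    swap
    · simp only [Expr.cost_var]; omega
    obtain ⟨p1, p2, p3⟩ := hs1
    refine Run.for (fun r s' => s'.v (1, 4) = r ∧ (∀ l < M, s'.a (ptrA q) l = 0) ∧
      (∀ l < M, s'.a (treeA q) (M + l) = fA l + fB 0) ∧ StreamFrm q s s' ∧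
      ∀ i, 1 ≤ i → M - r ≤ i → i < M → s'.a (treeA q) i =
        min (s'.a (treeA q) (2 * i)) (s'.a (treeA q) (2 * i + 1))) (by omega)
      ⟨by simp, p1, p2, p3.setV rfl _, fun i _ h h' => by omega⟩
      (fun r s' _ h => ⟨h.1, by simp [h.2.2.2.1.v _ hMv1, hMv]⟩) ?_ ?_
    · rintro r s2 hr ⟨q1, q2, q3, q4, q5⟩
      have hM2 : s2.v Mv = M := (q4.v _ hMv1).trans hMv
      -- Nodes are repaired in the order `M - 1, …, 0`, children before parents. The last turn
      -- writes cell `0`, which the tree property does not mention.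
      have hval : (M : ℤ) - 1 - r = ((M - 1 - r : ℕ) : ℤ) := by omega
      refine (fixNode_at_run (i := M - 1 - r) (by simp [hM2, q1, hval]) (by omega)
        (by omega)).mono (?_ : _ ≤ 155) ?_
      · simp
      · intro s4 hs4
        subst hs4
        refine ⟨by simp [q1], by simp, ?_, ?_,
          ((q4.setV rfl _).setA (Or.inl rfl) _ _).setV rfl _, ?_⟩
        · intro l hl
          simp [ptrA_ne_treeA, q2 l hl]
        · intro l hl
          have : M + l ≠ M - 1 - r := by omega
          simp [this, q3 l hl]
        · intro i hi1 hi2 hi3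
          by_cases hi : i = M - 1 - r
          · have c1 : 2 * i ≠ i := by omega
            have c2 : 2 * i + 1 ≠ i := by omega
            rw [← hi]
            simp [c1, c2]
          · have c1 : 2 * i ≠ M - 1 - r := by omega
            have c2 : 2 * i + 1 ≠ M - 1 - r := by omega
            simp [hi, c1, c2, q5 i hi1 (by omega) hi3]
    · rintro s2 ⟨q1, q2, q3, q4, q5⟩
      refine ⟨⟨fun l hl => by simp [q2 l hl], fun _ _ => by omega, fun l hl => ?_, ?_⟩, q4⟩
      · rw [q3 l hl, leafKey, if_pos (by omega)]
      · exact fun i hi1 hi2 => q5 i hi1 (by omega) hi2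
  · rintro r s' hr ⟨q1, q2, q3, q4⟩
    have hM2 : s'.v Mv = M := (q4.v _ hMv1).trans hMv
    have hA1 : s'.a A r = fA r := by rw [q4.a A hAt hAp]; exact hfA r hr
    have hB1 : s'.a B 0 = fB 0 := by rw [q4.a B hBt hBp]; exact hfB 0 (by omega)
    have hN : ((M : ℤ) + r).toNat = M + r := by omega
    have hB0 := E.hB2
    refine (Run.straight ?_ ?_).mono (?_ : _ ≤ 64) fun _ h => h
    · simp only [Cmd.Ok, Cmd.exec, Expr.eval_var, Expr.eval_add, Expr.eval_const, Expr.eval_arr,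
        q1, hM2]
      simp [q1, hM2, hAp, hBp, hA1, hB1]
      exact ⟨⟨by omega, by omega⟩, hkey r hr 0 (by omega), by omega, by omega⟩
    · simp only [Cmd.exec, Expr.eval_var, Expr.eval_add, Expr.eval_const, Expr.eval_arr, q1, hM2]
      simp [q1, hM2, hAp, hBp, hA1, hB1, hN]
      refine ⟨?_, ?_, ((q4.setA (Or.inr rfl) _ _).setA (Or.inl rfl) _ _).setV rfl _⟩
      · intro l hl
        by_cases h : l = r
        · simp [ptrA_ne_treeA, h]
        · simp [ptrA_ne_treeA, h, q2 l (by omega)]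
      · intro l hl
        by_cases h : l = r
        · simp [h]
        · simp [treeA_ne_ptrA, h, q3 l (by omega)]
    · simp [Cmd.cost]

end

end KSumRam

namespace KSumRam

/-! ### The smallest elements of a set -/

/-- `o 0 < … < o (c - 1)` are the `min z |X|` smallest elements of `X`. -/
structure Chunk (z : ℕ) (X : Finset ℤ) (o : ℕ → ℤ) (c : ℕ) : Prop where
  le : c ≤ z
  mono : ∀ i j, i < j → j < c → o i < o j
  mem : ∀ i < c, o i ∈ X
  compl : ∀ x ∈ X, (∃ i < c, o i = x) ∨ (c = z ∧ ∀ i < c, o i < x)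

theorem Chunk.card_image {z : ℕ} {X : Finset ℤ} {o : ℕ → ℤ} {c : ℕ} (h : Chunk z X o c) :
    ((Finset.range c).image o).card = c := by
  rw [Finset.card_image_of_injOn, Finset.card_range]
  intro i hi j hj hij
  simp only [Finset.coe_range, Set.mem_Iio] at hi hj
  rcases lt_trichotomy i j with h1 | h1 | h1
  · have := h.mono i j h1 hj; omega
  · exact h1
  · have := h.mono j i h1 hi; omega

theorem Chunk.congr {z : ℕ} {X : Finset ℤ} {o o' : ℕ → ℤ} {c : ℕ} (h : Chunk z X o c)
    (ho : ∀ i < c, o' i = o i) : Chunk z X o' c where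
  le := h.le
  mono i j hij hj := by rw [ho i (by omega), ho j hj]; exact h.mono i j hij hj
  mem i hi := by rw [ho i hi]; exact h.mem i hi
  compl x hx := by
    rcases h.compl x hx with ⟨i, hi, hix⟩ | ⟨h1, h2⟩
    · exact Or.inl ⟨i, hi, by rw [ho i hi]; exact hix⟩
    · exact Or.inr ⟨h1, fun i hi => by rw [ho i hi]; exact h2 i hi⟩

/-- This allows a source to be processed block by block: the elements of `X` outside its chunk can
be forgotten, since each of them has `z` smaller ones in the chunk. -/
theorem Chunk.extend {z : ℕ} {X Z : Finset ℤ} {o o' : ℕ → ℤ} {c c' : ℕ} (h : Chunk z X o c)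
    (h' : Chunk z ((Finset.range c).image o ∪ Z) o' c') : Chunk z (X ∪ Z) o' c' := by
  refine ⟨h'.le, h'.mono, fun i hi => ?_, fun x hx => ?_⟩
  · rcases Finset.mem_union.1 (h'.mem i hi) with h1 | h1
    · obtain ⟨j, hj, hji⟩ := Finset.mem_image.1 h1
      rw [← hji]
      exact Finset.mem_union_left _ (h.mem j (Finset.mem_range.1 hj))
    · exact Finset.mem_union_right _ h1
  · rcases Finset.mem_union.1 hx with hx | hx
    swap
    · exact h'.compl x (Finset.mem_union_right _ hx)
    rcases h.compl x hx with ⟨i, hi, hix⟩ | ⟨hc, hlt⟩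
    · exact h'.compl x (Finset.mem_union_left _
        (Finset.mem_image.2 ⟨i, Finset.mem_range.2 hi, hix⟩))
    · have hU : ∀ i < c, (∃ j < c', o' j = o i) ∨ (c' = z ∧ ∀ j < c', o' j < o i) := fun i hi =>
        h'.compl (o i) (Finset.mem_union_left _ (Finset.mem_image_of_mem _ (Finset.mem_range.2 hi)))
      -- With fewer than `z` elements the new chunk would exhaust its set, so it would contain all
      -- `z` elements of the old chunk.
      have hcz : c' = z := by
        by_contra hne
        have hsub : (Finset.range c).image o ⊆ (Finset.range c').image o' := by
          intro y hy
          obtain ⟨i, hi, rfl⟩ := Finset.mem_image.1 hy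
          rcases hU i (Finset.mem_range.1 hi) with ⟨j, hj, hji⟩ | h2
          · exact Finset.mem_image.2 ⟨j, Finset.mem_range.2 hj, hji⟩
          · exact absurd h2.1 hne
        have := Finset.card_le_card hsub
        rw [h.card_image, h'.card_image] at this
        have := h'.le
        omega
      by_contra hcon
      push Not at hcon
      obtain ⟨h1, h2⟩ := hcon
      obtain ⟨j, hj, hjx⟩ := h2 hcz
      have hjx' : x < o' j := lt_of_le_of_ne hjx fun h => h1 j hj h.symm
      -- If some new element `o' j` exceeded `x`, all `z` old elements, being below `x`, would lie
      -- among the `z - 1` other new ones.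
      have hsub : (Finset.range c).image o ⊆ ((Finset.range c').image o').erase (o' j) := by
        intro y hy
        obtain ⟨i, hi, rfl⟩ := Finset.mem_image.1 hy
        have hi' := Finset.mem_range.1 hi
        have hlx := hlt i hi'
        rcases hU i hi' with ⟨l, hl, hli⟩ | h2
        · refine Finset.mem_erase.2 ⟨by omega, Finset.mem_image.2 ⟨l, Finset.mem_range.2 hl, hli⟩⟩
        · have := h2.2 j hj
          omega
      have := Finset.card_le_card hsub
      rw [h.card_image, Finset.card_erase_of_mem
        (Finset.mem_image_of_mem _ (Finset.mem_range.2 hj)), h'.card_image] at this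
      omega

theorem Chunk.empty (z : ℕ) (o : ℕ → ℤ) : Chunk z ∅ o 0 :=
  ⟨Nat.zero_le _, fun _ _ _ h => absurd h (by omega), fun _ h => absurd h (by omega),
    fun _ h => absurd h (by simp)⟩

/-! ### Extracting a chunk -/

/-- Size parameters: chunk size `z`, its logarithm, and the value of infinity. -/
structure Dim {k n : ℕ} (E : Env k n) (z lg : ℕ) (inf : ℤ) : Prop where
  pos : 1 ≤ z
  lg : 2 * z ≤ 2 ^ lg
  cap : 4 * z ≤ E.cap
  leB : (4 * z + 4 : ℤ) ≤ E.B
  infB : inf ≤ E.B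
  inf0 : 0 < inf

/-- The contents of the global registers. -/
structure Glob (z : ℕ) (inf : ℤ) (s : St) : Prop where
  size : s.v (0, 4) = z
  size2 : s.v (0, 5) = (2 * z : ℕ)
  inf : s.v gInf = inf
  one : s.v (0, 8) = (1 : ℕ)
  zero : ∀ i, s.a (0, 0) i = 0

theorem Glob.frm {z d : ℕ} {inf : ℤ} {s s' : St} (h : Glob z inf s) (hf : Frm d s s') :
    Glob z inf s' where
  size := (hf.v _ (Or.inl (by simp))).trans h.size
  size2 := (hf.v _ (Or.inl (by simp))).trans h.size2
  inf := (hf.v _ (Or.inl (by simp [gInf]))).trans h.inf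
  one := (hf.v _ (Or.inl (by simp))).trans h.one
  zero i := by rw [hf.a _ (Or.inl rfl)]; exact h.zero i

/-- `s'` differs from `s` only in registers and arrays of levels `1` and `2` and array `out`. -/
structure ExFrm (out : Var) (s s' : St) : Prop where
  v : ∀ x : Var, x.1 ≠ 1 → x.1 ≠ 2 → s'.v x = s.v x
  a : ∀ A : Var, A.1 ≠ 1 → A.1 ≠ 2 → A ≠ out → s'.a A = s.a A

theorem ExFrm.refl (out : Var) (s : St) : ExFrm out s s := ⟨fun _ _ _ => rfl, fun _ _ _ _ => rfl⟩

theorem ExFrm.trans {out : Var} {s s' s'' : St} (h1 : ExFrm out s s') (h2 : ExFrm out s' s'') :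
    ExFrm out s s'' :=
  ⟨fun x hx hx' => (h2.v x hx hx').trans (h1.v x hx hx'),
    fun A h h' h'' => (h2.a A h h' h'').trans (h1.a A h h' h'')⟩

theorem ExFrm.setV {out : Var} {s s' : St} (h : ExFrm out s s') {x : Var} (hx : x.1 = 2) (z : ℤ) :
    ExFrm out s (s'.setV x z) :=
  ⟨fun y hy hy' => by
    have : y ≠ x := by rintro rfl; exact hy' hx
    simp [this, h.v y hy hy'], h.a⟩

theorem ExFrm.setA {out : Var} {s s' : St} (h : ExFrm out s s') {A : Var}
    (hA : A.1 = 2 ∨ A = out) (i : ℕ) (z : ℤ) : ExFrm out s (s'.setA A i z) :=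
  ⟨h.v, fun B h1 h2 h3 => by
    have : B ≠ A := by rintro rfl; tauto
    rw [← h.a B h1 h2 h3]
    funext j
    simp [this]⟩

theorem StreamFrm.exFrm {q : ℕ} {out : Var} {s s' : St} (h : StreamFrm q s s') : ExFrm out s s' :=
  ⟨fun x hx _ => h.v x hx, fun A hA _ _ => h.a A (by rintro rfl; exact hA rfl)
    (by rintro rfl; exact hA rfl)⟩

theorem ExFrm.frm {out : Var} {d : ℕ} {s s' : St} (h : ExFrm out s s') (hd : 3 ≤ d)
    (ho : out.1 ≠ 0) (hod : out.1 < d) : Frm d s s' := by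
  refine ⟨fun x hx => h.v x ?_ ?_, fun A hA => h.a A ?_ ?_ ?_⟩
  · rcases hx with hx | hx <;> omega
  · rcases hx with hx | hx <;> omega
  · omega
  · omega
  · rintro rfl; omega

theorem ExFrm.glob {out : Var} {z : ℕ} {inf : ℤ} {s s' : St} (h : ExFrm out s s')
    (ho : out.1 ≠ 0) (hg : Glob z inf s) : Glob z inf s' :=
  hg.frm (h.frm (d := out.1 + 3) (by omega) ho (by omega))

/-- Append `y` to the output unless it is a repetition, infinite, or there is no room. -/
def appendOut (out : Var) : Cmd :=
  .ite (.var (2, 5) + .const 1) (.var (2, 6))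
    (.ite (.var (2, 6) + .const 1) (.var gInf)
      (.ite (.var (2, 4) + .const 1) (.var (0, 4))
        (.block [.store out (.var (2, 4)) (.var (2, 6)),
          .assign (2, 4) (.var (2, 4) + .const 1),
          .assign (2, 5) (.var (2, 6))]) .skip) .skip) .skip

def sortLoop (out : Var) : Cmd :=
  .for (2, 1) (.var (0, 5)) (.seq (.assign (2, 6) (.arr (treeA 0) (.const 1)))
    (.seq (popStream 0 (0, 5) (0, 8) (2, 0) (0, 0)) (appendOut out)))

/-- The finite keys of the buffer. -/
def bufSet (z : ℕ) (fA : ℕ → ℤ) (inf : ℤ) : Finset ℤ :=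
  ((Finset.range (2 * z)).image fA).filter (· < inf)

theorem mem_bufSet {z : ℕ} {fA : ℕ → ℤ} {inf x : ℤ} :
    x ∈ bufSet z fA inf ↔ (∃ l < 2 * z, fA l = x) ∧ x < inf := by
  simp [bufSet]

/-- The state of the output during sorting. -/
structure SortInv (z : ℕ) (θ inf : ℤ) (fA : ℕ → ℤ) (pt : ℕ → ℕ) (o : ℕ → ℤ) (c : ℕ) (last : ℤ) :
    Prop where
  le : c ≤ z
  mono : ∀ i j, i < j → j < c → o i < o j
  mem : ∀ i < c, o i ∈ bufSet z fA inf
  last_eq : last = if c = 0 then θ else o (c - 1)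
  key : ∀ l < 2 * z, last ≤ leafKey 1 fA (fun _ => 0) inf pt l
  compl : ∀ x ∈ bufSet z fA inf, (∃ i < c, o i = x) ∨ (c = z ∧ ∀ i < c, o i < x) ∨
    ∃ l < 2 * z, pt l = 0 ∧ fA l = x

theorem SortInv.le_last {z : ℕ} {θ inf : ℤ} {fA : ℕ → ℤ} {pt : ℕ → ℕ} {o : ℕ → ℤ} {c : ℕ}
    {last : ℤ} (h : SortInv z θ inf fA pt o c last) {i : ℕ} (hi : i < c) : o i ≤ last := by
  rw [h.last_eq, if_neg (by omega)]
  rcases Nat.lt_or_ge i (c - 1) with h1 | h1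
  · exact (h.mono _ _ h1 (by omega)).le
  · rw [show i = c - 1 by omega]

/-- The number of leaves that still hold a finite key. -/
def liveLeaves (z : ℕ) (fA : ℕ → ℤ) (inf : ℤ) (pt : ℕ → ℕ) : Finset ℕ :=
  (Finset.range (2 * z)).filter fun l => pt l = 0 ∧ fA l < inf

section
variable {z : ℕ} {θ inf : ℤ} {fA : ℕ → ℤ} {pt : ℕ → ℕ} {o : ℕ → ℤ} {c : ℕ} {last : ℤ}

/-- Either the popped leaf was live and is so no longer, or the smallest key was already infinite
and no leaf was live. Hence `2 z` pops empty the stream. -/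
theorem liveLeaves_pop {l : ℕ} {r m : ℕ} (hl : l < 2 * z)
    (hr : (liveLeaves z fA inf pt).card ≤ m - r)
    (hroot : ∀ j < 2 * z, leafKey 1 fA (fun _ => 0) inf pt l ≤ leafKey 1 fA (fun _ => 0) inf pt j) :
    (liveLeaves z fA inf (Function.update pt l (min (pt l + 1) 1))).card ≤ m - (r + 1) := by
  by_cases hlive : l ∈ liveLeaves z fA inf pt
  · have hsub : liveLeaves z fA inf (Function.update pt l (min (pt l + 1) 1)) ⊆
        (liveLeaves z fA inf pt).erase l := by
      intro j hj
      simp only [liveLeaves, Finset.mem_filter, Finset.mem_range, Function.update_apply] at hj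
      by_cases hjl : j = l
      · simp [hjl] at hj
      · simp only [hjl, if_false] at hj
        simp [liveLeaves, hjl, hj]
    have := Finset.card_le_card hsub
    rw [Finset.card_erase_of_mem hlive] at this
    omega
  · have : liveLeaves z fA inf (Function.update pt l (min (pt l + 1) 1)) = ∅ := by
      rw [Finset.eq_empty_iff_forall_notMem]
      intro j hj
      simp only [liveLeaves, Finset.mem_filter, Finset.mem_range, Function.update_apply] at hj
      by_cases hjl : j = l
      · simp [hjl] at hj
      · simp only [hjl, if_false] at hj
        have h1 := hroot j hj.1
        simp only [leafKey, hj.2.1, zero_lt_one, if_true] at h1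
        simp only [liveLeaves, Finset.mem_filter, Finset.mem_range, not_and] at hlive
        split_ifs at h1 with h2
        · have := hlive hl (by omega)
          omega
        · omega
    rw [this]
    simp

/-- Keys come out in nondecreasing order. A finite key that is not appended either equals the last
output, or it is larger and the output already has `z` elements; in both cases the completeness
clause survives. -/
theorem SortInv.pop (h : SortInv z θ inf fA pt o c last)
    (hθ : ∀ l < 2 * z, fA l = inf ∨ (θ < fA l ∧ fA l < inf)) {l : ℕ}
    (hl : l < 2 * z)
    (hroot : ∀ j < 2 * z, leafKey 1 fA (fun _ => 0) inf pt l ≤ leafKey 1 fA (fun _ => 0) inf pt j)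
    {o' : ℕ → ℤ} {c' : ℕ} {last' : ℤ} {y : ℤ} (hy : y = leafKey 1 fA (fun _ => 0) inf pt l)
    (h' : (last < y ∧ y < inf ∧ c < z ∧ c' = c + 1 ∧ last' = y ∧ o' = Function.update o c y) ∨
      (¬ (last < y ∧ y < inf ∧ c < z) ∧ c' = c ∧ last' = last ∧ o' = o)) :
    SortInv z θ inf fA (Function.update pt l (min (pt l + 1) 1)) o' c' last' := by
  have hupd : ∀ j, Function.update pt l (min (pt l + 1) 1) j = if j = l then 1 else pt j := by
    intro j
    rw [Function.update_apply]
    split_ifs <;> omega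
  have hykey : y < inf → pt l = 0 ∧ fA l = y := by
    intro hyi
    rw [hy, leafKey] at hyi ⊢
    split_ifs at hyi ⊢ with h0
    · exact ⟨by omega, by simp⟩
    · exact absurd hyi (lt_irrefl _)
  have hyle : y ≤ inf := by
    rw [hy, leafKey]
    split_ifs with h0
    · rcases hθ l hl with h1 | h1 <;> simp <;> omega
    · exact le_rfl
  have hnew : ∀ j < 2 * z, y ≤
      leafKey 1 fA (fun _ => 0) inf (Function.update pt l (min (pt l + 1) 1)) j := by
    intro j hj
    simp only [leafKey, hupd]
    by_cases hjl : j = l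
    · simp [hjl, hyle]
    · have := hroot j hj
      rw [← hy] at this
      simpa [hjl, leafKey] using this
  have hlast : last ≤ y := hy ▸ h.key l hl
  rcases h' with ⟨h1, h2, h3, rfl, rfl, rfl⟩ | ⟨h1, rfl, rfl, rfl⟩
  · obtain ⟨k1, k2⟩ := hykey h2
    refine ⟨h3, ?_, ?_, ?_, hnew, ?_⟩
    · intro i j hij hj
      have hic : i ≠ c := by omega
      by_cases hjc : j = c
      · have := h.le_last (i := i) (by omega)
        simp [Function.update_apply, hic, hjc]
        omega
      · simp [Function.update_apply, hic, hjc]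
        exact h.mono i j hij (by omega)
    · intro i hi
      by_cases hic : i = c
      · simp only [hic, Function.update_self]
        exact mem_bufSet.2 ⟨⟨l, hl, k2⟩, h2⟩
      · simp only [Function.update_apply, hic, if_false]
        exact h.mem i (by omega)
    · simp
    · intro x hx
      rcases h.compl x hx with ⟨i, hi, hix⟩ | ⟨h5, _⟩ | ⟨j, hj, hj0, hjx⟩
      · exact Or.inl ⟨i, by omega, by simp [Function.update_apply, hi.ne, hix]⟩
      · omega
      · by_cases hjl : j = l
        · subst hjl
          exact Or.inl ⟨c, by omega, by simp [← hjx, k2]⟩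
        · exact Or.inr (Or.inr ⟨j, hj, by rw [hupd, if_neg hjl]; exact hj0, hjx⟩)
  · refine ⟨h.le, h.mono, h.mem, h.last_eq, fun j hj => hlast.trans (hnew j hj), ?_⟩
    intro x hx
    rcases h.compl x hx with h5 | h5 | ⟨j, hj, hj0, hjx⟩
    · exact Or.inl h5
    · exact Or.inr (Or.inl h5)
    · by_cases hjl : j = l
      · subst hjl
        have hyx : y = x := by rw [hy, leafKey, if_pos (by omega), hjx]; simp
        have hxi : x < inf := (mem_bufSet.1 hx).2
        by_cases h6 : last' < y
        · have hcz : c' = z := by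
            have := h.le
            by_contra hne
            exact h1 ⟨h6, by omega, by omega⟩
          refine Or.inr (Or.inl ⟨hcz, fun i hi => ?_⟩)
          have := h.le_last hi
          omega
        · have hly : last' = x := by omega
          -- A rejected key that does not exceed `last'` equals it. It is a repetition of an actual
          -- output, not of the initial threshold, because all finite keys exceed the threshold.
          have hc0 : c' ≠ 0 := by
            intro h0
            have h7 := h.last_eq
            rw [if_pos h0] at h7
            rcases hθ j hj with h8 | h8 <;> omega
          have h7 := h.last_eq
          rw [if_neg hc0] at h7
          exact Or.inl ⟨c' - 1, by omega, by omega⟩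
      · exact Or.inr (Or.inr ⟨j, hj, by rw [hupd, if_neg hjl]; exact hj0, hjx⟩)

end

section
variable {k n : ℕ} {E : Env k n}

/-- A stream with one column over the zero array is a plain heap sort of the buffer. The loop always
performs `2 z` pops; after them no leaf is live, so every finite key has been dealt with. -/
theorem sortLoop_run {s : St} {z lg : ℕ} {inf θ : ℤ} {out : Var} {fA : ℕ → ℤ} (hd : Dim E z lg inf)
    (hg : Glob z inf s) (hout : 3 ≤ out.1)
    (hst : SInv 0 (2 * z) 1 fA (fun _ => 0) inf (fun _ => 0) s)
    (hbuf : ∀ l < 2 * z, s.a (2, 0) l = fA l)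
    (hθ : ∀ l < 2 * z, fA l = inf ∨ (θ < fA l ∧ fA l < inf)) (hθi : θ < inf)
    (hcnt : s.v (2, 4) = 0) (hlast : s.v (2, 5) = θ) :
    Run E s (sortLoop out) (2000 * z * (lg + 1)) (fun s' => ∃ c : ℕ, s'.v (2, 4) = c ∧
      Chunk z (bufSet z fA inf) (s'.a out) c ∧ s'.v (2, 0) = s.v (2, 0) ∧ ExFrm out s s') := by
  have hz := hd.pos
  have hleB := hd.leB
  refine Run.of_bounded fun hv0 ha0 => ?_
  have hkey : ∀ l < 2 * z, ∀ j < 1, |fA l + (fun _ : ℕ => (0 : ℤ)) j| ≤ E.B := fun l hl j _ => by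
    simpa [← hbuf l hl] using ha0 (2, 0) l
  refine (Run.for (m := 2 * z) (t := 600 * (lg + 1) + 130) (fun r s' => s'.v (2, 1) = r ∧
    s'.v (2, 0) = s.v (2, 0) ∧ ExFrm out s s' ∧ s'.a (2, 0) = s.a (2, 0) ∧
    ∃ (pt : ℕ → ℕ) (c : ℕ), s'.v (2, 4) = c ∧
      SInv 0 (2 * z) 1 fA (fun _ => 0) inf pt s' ∧
      SortInv z θ inf fA pt (s'.a out) c (s'.v (2, 5)) ∧
      (liveLeaves z fA inf pt).card ≤ 2 * z - r) (by push_cast; omega) ?_ ?_ ?_ ?_).mono ?_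
    fun _ h => h
  · refine ⟨by simp, by simp, (ExFrm.refl _ _).setV rfl _, rfl, fun _ => 0, 0, by simp [hcnt],
      hst.congr rfl rfl, ⟨by omega, fun _ _ _ h => absurd h (by omega),
      fun _ h => absurd h (by omega), by simp [hlast], ?_, ?_⟩, ?_⟩
    · intro l hl
      simp only [leafKey, zero_lt_one, if_true, add_zero, St.setV_v]
      simp [hlast]
      rcases hθ l hl with h | h <;> omega
    · intro x hx
      obtain ⟨l, hl, hlx⟩ := (mem_bufSet.1 hx).1
      exact Or.inr (Or.inr ⟨l, hl, rfl, hlx⟩)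
    · exact (Finset.card_filter_le _ _).trans (by simp)
  · rintro r s' hr ⟨h1, h2, h3, -⟩
    exact ⟨h1, by simp [(h3.glob (by omega) hg).size2]⟩
  · rintro r s' hr ⟨h1, h2, h3, h4, pt, c, h5, h6, h7, h8⟩
    have hg' := h3.glob (by omega) hg
    have hc := h7.le
    have hroot : (Expr.arr (treeA 0) (.const 1)).eval E.x s' = s'.a (treeA 0) 1 :=
      Expr.eval_arr_nat (by simp)
    refine Run.of_bounded fun hv ha => ?_
    have hpop := popStream_run (E := E) (s := s'.setV (2, 6) (s'.a (treeA 0) 1)) (q := 0)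
      (M := 2 * z) (J := 1) (lg := lg) (Mv := (0, 5)) (Jv := (0, 8)) (A := (2, 0)) (B := (0, 0))
      (fA := fA) (fB := fun _ => 0) (inf := inf) (pt := pt) (h6.congr rfl rfl)
      (by simp [hg'.size2]) (by simp) (by simp [hg'.one]) (by simp)
      (by simp [hg'.inf, gInf]; exact hg'.inf) (by simp) (by simp)
      (fun l hl => by simp [h4, hbuf l hl]) (fun j _ => by simp [hg'.zero]) (by omega) hd.lg
      (by push_cast; omega) (by have := hd.cap; omega) (by push_cast; omega) hkey
    refine (Run.seq (Run.assign (Q := fun s1 => s1 = s'.setV (2, 6) (s'.a (treeA 0) 1)) ?_ ?_)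
      fun s1 hs1 => Run.seq (hs1 ▸ hpop) fun s2 hs2 => (Run.straight ?_ ?_).mono
        (?_ : _ ≤ 105) fun _ h => h).mono ?_ fun _ h => h
    · rw [hroot]; exact ha _ _
    · rw [hroot]
    · subst hs1
      obtain ⟨l, hl, e1, e2, e3⟩ := hs2
      have f4 : s2.v (2, 4) = c := by rw [e3.v _ (by simp)]; simp [h5]
      have f6 : |s2.v (2, 6)| ≤ E.B := by
        rw [e3.v _ (by simp)]; simp only [St.setV_v, if_true]; exact ha _ _
      have fS : s2.v (0, 4) = z := by rw [e3.v _ (by simp)]; simp [hg'.size]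
      have hcap := hd.cap
      simp [appendOut, Cmd.block, Cmd.Ok, Cmd.exec, f4, f6, fS]
      intro _ _ _
      exact ⟨by omega, by rw [abs_of_nonneg (by positivity)]; omega⟩
    · subst hs1
      obtain ⟨l, hl, e1, e2, e3⟩ := hs2
      have hfr : ExFrm out s s2 := (h3.setV rfl _).trans e3.exFrm
      have f1 : s2.v (2, 1) = r := by rw [e3.v _ (by simp)]; simp [h1]
      have f0 : s2.v (2, 0) = s.v (2, 0) := by rw [e3.v _ (by simp)]; simp [h2]
      have f4 : s2.v (2, 4) = c := by rw [e3.v _ (by simp)]; simp [h5]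
      have f5 : s2.v (2, 5) = s'.v (2, 5) := by rw [e3.v _ (by simp)]; simp
      have f6 : s2.v (2, 6) = s'.a (treeA 0) 1 := by rw [e3.v _ (by simp)]; simp
      have hg2 := hfr.glob (by omega) hg
      have hot : out ≠ treeA 0 := by rintro rfl; simp [treeA] at hout
      have hop : out ≠ ptrA 0 := by rintro rfl; simp [ptrA] at hout
      have fo : s2.a out = s'.a out := by rw [e3.a _ hot hop]; rfl
      have fbuf : s2.a (2, 0) = s.a (2, 0) := by
        rw [e3.a _ (by simp [treeA]) (by simp [ptrA])]; exact h4
      have hob : (2, 0) ≠ out := by rintro rfl; simp at hout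
      have hroot' : ∀ j < 2 * z, leafKey 1 fA (fun _ => 0) inf pt l ≤
          leafKey 1 fA (fun _ => 0) inf pt j := fun j hj => by
        rw [← e1]; exact h6.root_le hj
      have key := fun o' c' last' => h7.pop hθ hl hroot' (o' := o') (c' := c')
        (last' := last') (y := s'.a (treeA 0) 1) (by rw [← e1]; rfl)
      have hlive := liveLeaves_pop hl h8 hroot'
      set pt' := Function.update pt l (min (pt l + 1) 1)
      have base : ¬ (s'.v (2, 5) < s'.a (treeA 0) 1 ∧ s'.a (treeA 0) 1 < inf ∧ c < z) →
          s2.v (2, 1) = r ∧ ((s2.setV (2, 1) (r + 1)).v (2, 1) = ((r + 1 : ℕ) : ℤ) ∧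
            (s2.setV (2, 1) (r + 1)).v (2, 0) = s.v (2, 0) ∧ ExFrm out s (s2.setV (2, 1) (r + 1)) ∧
            (s2.setV (2, 1) (r + 1)).a (2, 0) = s.a (2, 0) ∧
            ∃ (pt : ℕ → ℕ) (c : ℕ), (s2.setV (2, 1) (r + 1)).v (2, 4) = c ∧
              SInv 0 (2 * z) 1 fA (fun _ => 0) inf pt (s2.setV (2, 1) (r + 1)) ∧
              SortInv z θ inf fA pt ((s2.setV (2, 1) (r + 1)).a out) c
                ((s2.setV (2, 1) (r + 1)).v (2, 5)) ∧
              (liveLeaves z fA inf pt).card ≤ 2 * z - (r + 1)) := by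
        intro hneg
        refine ⟨f1, by simp, by simp [f0], hfr.setV rfl _, fbuf, pt', c, by simp [f4],
          e2.congr rfl rfl, ?_, hlive⟩
        simp only [St.setV_a, fo, St.setV_v]
        simp [f5]
        exact key _ _ _ (Or.inr ⟨hneg, rfl, rfl, rfl⟩)
      simp only [appendOut, Cmd.block, Cmd.exec, Expr.eval_add, Expr.eval_var, Expr.eval_const,
        f5, f6, f4, hg2.inf, hg2.size]
      split_ifs with g1 g2 g3
      · refine ⟨by simp [f1], by simp, by simp [f0],
          (((hfr.setA (Or.inr rfl) _ _).setV rfl _).setV rfl _).setV rfl _, ?_, pt', c + 1,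
          by simp [f4], e2.congr ?_ ?_, ?_, hlive⟩
        · funext j
          simp [hob, fbuf]
        · funext j
          simp [hot.symm]
        · funext j
          simp [hop.symm]
        · refine key _ _ _ (Or.inl ⟨by omega, by omega, by omega, rfl, ?_, ?_⟩)
          · simp [f6]
          · funext j
            simp [Function.update_apply, fo, f4, f6]
      · exact base (by omega)
      · exact base (by omega)
      · exact base (by omega)
    · simp [appendOut, Cmd.block, Cmd.cost]
    · simp; omega
  · rintro s' ⟨h1, h2, h3, h4, pt, c, h5, h6, h7, h8⟩
    refine ⟨c, h5, ⟨h7.le, h7.mono, h7.mem, fun x hx => ?_⟩, h2, h3⟩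
    rcases h7.compl x hx with h9 | h9 | ⟨l, hl, hl0, hlx⟩
    · exact Or.inl h9
    · exact Or.inr h9
    · exfalso
      have : l ∈ liveLeaves z fA inf pt := by
        simp [liveLeaves, hl, hl0, hlx, (mem_bufSet.1 hx).2]
      have := Finset.card_pos.2 ⟨l, this⟩
      omega
  · simp only [Expr.cost_var]
    nlinarith [Nat.zero_le lg, Nat.zero_le (z * lg)]

end

end KSumRam

/-! ### The smallest elements of a window of a virtual array. -/

namespace KSumRam

/-- The registers holding the parameters of a window: the numbers `x > θ` with
`(p * x + c) % Q < W` among `m` blocks of the source. -/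
structure WinVars where
  p : Var
  c : Var
  Q : Var
  W : Var
  θ : Var
  m : Var

structure WinVars.Ok (w : WinVars) : Prop where
  p : w.p.1 ≠ 1 ∧ w.p.1 ≠ 2
  c : w.c.1 ≠ 1 ∧ w.c.1 ≠ 2
  Q : w.Q.1 ≠ 1 ∧ w.Q.1 ≠ 2
  W : w.W.1 ≠ 1 ∧ w.W.1 ≠ 2
  θ : w.θ.1 ≠ 1 ∧ w.θ.1 ≠ 2
  m : w.m.1 ≠ 1 ∧ w.m.1 ≠ 2

/-- The window test in a given state. -/
def WinVars.Mem (w : WinVars) (s : St) (x : ℤ) : Prop :=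
  (s.v w.p * x + s.v w.c) % s.v w.Q < s.v w.W ∧ s.v w.θ < x

instance (w : WinVars) (s : St) : DecidablePred (w.Mem s) := fun x => by
  unfold WinVars.Mem; infer_instance

/-- The lower half of the buffer receives the current chunk, the upper half the elements of the next
block that pass the window test; unused cells become infinite and are dropped by the sorting. -/
def fillBuf (src : Expr) (out : Var) (w : WinVars) : Cmd :=
  .for (2, 1) (.var (0, 4)) (.block [
    .ite (.var (2, 1) + .const 1) (.var (2, 4))
      (.store (2, 0) (.var (2, 1)) (.arr out (.var (2, 1))))
      (.store (2, 0) (.var (2, 1)) (.var gInf)),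
    .assign (2, 3) (.var (2, 0) * .var (0, 4) + .var (2, 1)),
    .assign (2, 2) src,
    .ite ((.var w.p * .var (2, 2) + .var w.c) % .var w.Q + .const 1) (.var w.W)
      (.ite (.var w.θ + .const 1) (.var (2, 2))
        (.store (2, 0) (.var (0, 4) + .var (2, 1)) (.var (2, 2)))
        (.store (2, 0) (.var (0, 4) + .var (2, 1)) (.var gInf)))
      (.store (2, 0) (.var (0, 4) + .var (2, 1)) (.var gInf))])

/-- The list solvers expect sorted lists of length exactly `z`. Repeating the largest element keeps
the list sorted and adds no new value. An empty chunk is left as it is; no solver will be called on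
it. -/
def padOut (out : Var) : Cmd :=
  .for (2, 1) (.var (0, 4)) (.ite (.var (2, 1) + .const 1) (.var (2, 4)) .skip
    (.ite (.const 1) (.var (2, 4))
      (.store out (.var (2, 1)) (.arr out (.var (2, 4) - .const 1))) .skip))

/-- Write the smallest elements of a window of the source to `out`; their number is left in
register `(2, 4)`, and `out` is padded with copies of the last one. -/
def extract (src : Expr) (out : Var) (w : WinVars) : Cmd :=
  .seq (.assign (2, 4) (.const 0)) (.seq (.for (2, 0) (.var w.m)
    (.seq (fillBuf src out w) (.seq (initStream 0 (0, 5) (2, 0) (0, 0))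
      (.seq (.seq (.assign (2, 4) (.const 0)) (.assign (2, 5) (.var w.θ))) (sortLoop out)))))
    (padOut out))

/-- The window of a source of `j` entries. -/
def winSet (w : WinVars) (s : St) (V : ℕ → ℤ) (j : ℕ) : Finset ℤ :=
  ((Finset.range j).image V).filter (w.Mem s)

theorem mem_winSet {w : WinVars} {s : St} {V : ℕ → ℤ} {j : ℕ} {x : ℤ} :
    x ∈ winSet w s V j ↔ (∃ i < j, V i = x) ∧ w.Mem s x := by
  simp [winSet]

section
variable {k n : ℕ} {E : Env k n}

theorem fillBuf_run {s₀ s : St} {z lg m c b : ℕ} {inf : ℤ} {src : Expr} {out : Var} {w : WinVars}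
    {V : ℕ → ℤ} (hd : Dim E z lg inf) (hg : Glob z inf s₀) (hout : 3 ≤ out.1) (hw : w.Ok)
    (hs : ExFrm out s₀ s)
    (hsrc : ∀ s', ExFrm out s₀ s' → ∀ j < m * z, s'.v (2, 3) = j → src.eval E.x s' = V j)
    (hV : ∀ j < m * z, |V j| < inf) (hm : (m * z : ℤ) ≤ E.B) (hb : s.v (2, 0) = b) (hbm : b < m)
    (hc : s.v (2, 4) = c) :
    Run E s (fillBuf src out w) (z * (src.cost + 290)) (fun s' => ExFrm out s s' ∧
      s'.v (2, 0) = b ∧ s'.v (2, 4) = c ∧ s'.a out = s.a out ∧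
      (∀ l < z, s'.a (2, 0) l = if l < c then s.a out l else inf) ∧
      ∀ l < z, s'.a (2, 0) (z + l) =
        if w.Mem s₀ (V (b * z + l)) then V (b * z + l) else inf) := by
  have hz := hd.pos
  have hleB := hd.leB
  have hcap := hd.cap
  have hob : (2, 0) ≠ out := by rintro rfl; simp at hout
  refine (Run.for (m := z) (t := src.cost + 210) (fun r s' => s'.v (2, 1) = r ∧ ExFrm out s s' ∧
      s'.v (2, 0) = b ∧ s'.v (2, 4) = c ∧ s'.a out = s.a out ∧
      (∀ l < r, s'.a (2, 0) l = if l < c then s.a out l else inf) ∧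
      ∀ l < r, s'.a (2, 0) (z + l) =
        if w.Mem s₀ (V (b * z + l)) then V (b * z + l) else inf) (by omega) ?_ ?_ ?_ ?_).mono ?_
    fun _ h => h
  · exact ⟨by simp, (ExFrm.refl _ _).setV rfl _, by simp [hb], by simp [hc], rfl,
      fun _ h => absurd h (by omega), fun _ h => absurd h (by omega)⟩
  · rintro r s' hr ⟨h1, h2, -⟩
    exact ⟨h1, by simp [((hs.trans h2).glob (by omega) hg).size]⟩
  · rintro r s' hr ⟨h1, h2, h3, h4, h5, h6, h7⟩
    have hfr := hs.trans h2
    have hg' := hfr.glob (by omega) hg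
    refine Run.of_bounded fun hv ha => ?_
    have hidx : b * z + r < m * z := by
      calc b * z + r < b * z + z := by omega
        _ = (b + 1) * z := by ring
        _ ≤ m * z := Nat.mul_le_mul_right _ hbm
    have hval : (b : ℤ) * z + r = ((b * z + r : ℕ) : ℤ) := by push_cast; ring
    set key := if w.Mem s₀ (V (b * z + r)) then V (b * z + r) else inf with hkey
    set old := if r < c then s.a out r else inf with hold
    have hzr : ((z : ℤ) + r).toNat = z + r := by omega
    have hrun1 : Run E s' (.ite (.var (2, 1) + .const 1) (.var (2, 4))
      (.store (2, 0) (.var (2, 1)) (.arr out (.var (2, 1))))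
      (.store (2, 0) (.var (2, 1)) (.var gInf))) 61 (fun s1 => s1 = s'.setA (2, 0) r old) := by
      refine (Run.straight ?_ ?_).mono (?_ : _ ≤ 61) fun _ h => h
      · simp [Cmd.Ok, h1, h4, Expr.eval_arr]
        split_ifs
        · exact ⟨ha _ _, by omega⟩
        · exact ⟨hv _, by omega⟩
      · have hinf : s'.v gInf = inf := hg'.inf
        have h5r : s'.a out r = s.a out r := by rw [h5]
        by_cases h : r < c
        · have h' : (r : ℤ) + 1 ≤ c := by omega
          simp only [Cmd.exec, Expr.eval_add, Expr.eval_var, Expr.eval_const, h1, h4, if_pos h',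
            Expr.eval_arr, Int.toNat_natCast, hold, if_pos h, h5r, Nat.cast_nonneg, if_true]
        · have h' : ¬ (r : ℤ) + 1 ≤ c := by omega
          simp only [Cmd.exec, Expr.eval_add, Expr.eval_var, Expr.eval_const, h1, h4, if_neg h',
            hinf, Int.toNat_natCast, hold, if_neg h]
      · simp [Cmd.cost]
    set s2 := (s'.setA (2, 0) r old).setV (2, 3) ((b * z + r : ℕ) : ℤ) with hs2
    have hfr2 : ExFrm out s₀ s2 := (hfr.setA (Or.inl rfl) _ _).setV rfl _
    have hsv : src.eval E.x s2 = V (b * z + r) := hsrc s2 hfr2 _ hidx (by simp [hs2])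
    set s3 := s2.setV (2, 2) (V (b * z + r)) with hs3
    have hfr3 : ExFrm out s₀ s3 := hfr2.setV rfl _
    have hg3 := hfr3.glob (by omega) hg
    have hinf3 : s3.v gInf = inf := hg3.inf
    have e1 : s3.v (2, 1) = r := by simp [hs3, hs2, h1]
    have e2 : s3.v (2, 2) = V (b * z + r) := by simp [hs3]
    have hrun4 : Run E s3 (.ite ((.var w.p * .var (2, 2) + .var w.c) % .var w.Q + .const 1)
        (.var w.W) (.ite (.var w.θ + .const 1) (.var (2, 2))
        (.store (2, 0) (.var (0, 4) + .var (2, 1)) (.var (2, 2)))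
        (.store (2, 0) (.var (0, 4) + .var (2, 1)) (.var gInf)))
        (.store (2, 0) (.var (0, 4) + .var (2, 1)) (.var gInf))) 120
        (fun s4 => s4 = s3.setA (2, 0) (z + r) key) := by
      refine Run.of_bounded fun hv3 ha3 => ?_
      refine (Run.straight ?_ ?_).mono (?_ : _ ≤ 120) fun _ h => h
      · have q1 : s3.v (0, 4) = z := hg3.size
        simp only [Cmd.Ok, Expr.eval_add, Expr.eval_var, q1, e1]
        have hp : (0 : ℤ) ≤ z + r ∧ (z : ℤ) + r < E.cap := by omega
        split_ifs
        · exact ⟨hv3 _, hp⟩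
        · exact ⟨hv3 _, hp⟩
        · exact ⟨hv3 _, hp⟩
      · simp only [Cmd.exec, Expr.eval_add, Expr.eval_var, Expr.eval_mod, Expr.eval_mul,
          Expr.eval_const, hfr3.v _ hw.p.1 hw.p.2, hfr3.v _ hw.c.1 hw.c.2, hfr3.v _ hw.Q.1 hw.Q.2,
          hfr3.v _ hw.W.1 hw.W.2, hfr3.v _ hw.θ.1 hw.θ.2, e1, e2, hg3.size, hinf3, hzr,
          Int.add_one_le_iff, hkey, WinVars.Mem]
        by_cases c1 : (s₀.v w.p * V (b * z + r) + s₀.v w.c) % s₀.v w.Q < s₀.v w.W <;>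
          by_cases c2 : s₀.v w.θ < V (b * z + r) <;> simp [c1, c2]
      · simp [Cmd.cost]
    simp only [Cmd.block]
    refine (Run.seq hrun1 fun s1 hs1 => Run.seq (Run.assign (Q := fun s => s = s2) ?_ ?_)
      fun s5 hs5 => Run.seq (Run.assign (Q := fun s => s = s3) ?_ ?_) fun s6 hs6 =>
      (hs6 ▸ hrun4).mono le_rfl ?_).mono ?_ fun _ h => h
    · subst hs1
      simp only [Expr.eval_add, Expr.eval_mul, Expr.eval_var, St.setA_v, h3, hg'.size, h1, hval]
      rw [abs_of_nonneg (by positivity)]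
      exact le_trans (by exact_mod_cast hidx.le) hm
    · subst hs1
      simp only [Expr.eval_add, Expr.eval_mul, Expr.eval_var, St.setA_v, h3, hg'.size, h1, hval,
        hs2]
    · subst hs5
      rw [hsv]
      exact (hV _ hidx).le.trans hd.infB
    · subst hs5
      rw [hsv]
    · simp; omega
    · subst hs6
      rintro s7 rfl
      have hfr7 : ExFrm out s ((s3.setA (2, 0) (z + r) key).setV (2, 1) (r + 1)) :=
        ((((h2.setA (Or.inl rfl) _ _).setV rfl _).setV rfl _).setA (Or.inl rfl) _ _).setV rfl _
      refine ⟨e1, by simp, hfr7, by simp [hs3, hs2, h3], by simp [hs3, hs2, h4], ?_, ?_, ?_⟩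
      · rw [← h5]
        funext j
        simp [hs3, hs2, hob.symm]
      · intro l hl
        have : l ≠ z + r := by omega
        by_cases hlr : l = r
        · simp [hs3, hs2, hlr, show ¬ z = 0 by omega, hold]
        · simp [hs3, hs2, hlr, this, h6 l (by omega)]
      · intro l hl
        have : z + l ≠ r := by omega
        by_cases hlr : l = r
        · simp [hlr, hkey]
        · simp [hs3, hs2, hlr, this, h7 l (by omega)]
  · rintro s' ⟨-, h⟩
    exact h
  · simp only [Expr.cost_var]
    nlinarith

theorem padOut_run {s : St} {z lg c : ℕ} {inf : ℤ} {out : Var}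
    (hd : Dim E z lg inf) (hg : Glob z inf s) (hout : 3 ≤ out.1)
    (hc : s.v (2, 4) = c) :
    Run E s (padOut out) (150 * z) (fun s' => ExFrm out s s' ∧ s'.v (2, 4) = c ∧
      (∀ l < c, s'.a out l = s.a out l) ∧
      (1 ≤ c → ∀ l < z, c ≤ l → s'.a out l = s.a out (c - 1))) := by
  have hz := hd.pos
  have hleB := hd.leB
  have hcap := hd.cap
  refine (Run.for (m := z) (t := 80) (fun r s' => s'.v (2, 1) = r ∧ ExFrm out s s' ∧
      s'.v (2, 4) = c ∧ (∀ l < c, s'.a out l = s.a out l) ∧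
      (1 ≤ c → ∀ l < r, c ≤ l → s'.a out l = s.a out (c - 1))) (by omega) ?_ ?_ ?_ ?_).mono ?_
    fun _ h => h
  · exact ⟨by simp, (ExFrm.refl _ _).setV rfl _, by simp [hc], fun _ _ => rfl,
      fun _ _ h => absurd h (by omega)⟩
  · rintro r s' hr ⟨h1, h2, -⟩
    exact ⟨h1, by simp [(h2.glob (by omega) hg).size]⟩
  · rintro r s' hr ⟨h1, h2, h3, h4, h5⟩
    refine Run.of_bounded fun hv ha => ?_
    refine (Run.straight ?_ ?_).mono (?_ : _ ≤ 80) fun _ h => h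
    · simp only [Cmd.Ok, Expr.eval_add, Expr.eval_var, Expr.eval_const, h1, h3]
      split_ifs
      exact ⟨by rw [Expr.eval_arr]; split_ifs <;> exact ha _ _, by omega, by omega⟩
    · simp only [Cmd.exec, Expr.eval_add, Expr.eval_var, Expr.eval_const, h1, h3]
      split_ifs with g1 g2
      · refine ⟨h1, by simp, h2.setV rfl _, by simp [h3], by simpa using h4, fun hc1 l hl hcl => ?_⟩
        simpa using h5 hc1 l (by omega) hcl
      · have hcr : c ≤ r := by omega
        rw [Expr.eval_arr_nat (j := c - 1) (by simp [h3]; omega), h4 _ (by omega),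
          Int.toNat_natCast]
        refine ⟨by simp [h1], by simp, (h2.setA (Or.inr rfl) _ _).setV rfl _, by simp [h3], ?_, ?_⟩
        · intro l hl
          simp [show l ≠ r by omega, h4 l hl]
        · intro hc1 l hl hcl
          by_cases hlr : l = r
          · simp [hlr]
          · simp [hlr, h5 hc1 l (by omega) hcl]
      · refine ⟨h1, by simp, h2.setV rfl _, by simp [h3], by simpa using h4, fun hc1 l hl hcl => ?_⟩
        omega
    · simp [Cmd.cost]
  · rintro s' ⟨-, h⟩
    exact h
  · simp only [Expr.cost_var]
    omega

/-- One pass over the `m` blocks of the source, with `Chunk.extend` as the invariant. The source is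
never stored: it is an expression evaluated entry by entry, so `O(z)` cells suffice for arrays of
length `m z`. -/
theorem extract_run {s : St} {z lg m : ℕ} {inf : ℤ} {src : Expr} {out : Var} {w : WinVars}
    {V : ℕ → ℤ} (hd : Dim E z lg inf) (hg : Glob z inf s) (hout : 3 ≤ out.1) (hw : w.Ok)
    (hsrc : ∀ s', ExFrm out s s' → ∀ j < m * z, s'.v (2, 3) = j → src.eval E.x s' = V j)
    (hV : ∀ j < m * z, |V j| < inf) (hm : (m * z : ℤ) ≤ E.B) (hmv : s.v w.m = m) (hm1 : 1 ≤ m)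
    (hθi : s.v w.θ < inf) :
    Run E s (extract src out w) ((src.cost + 4000) * (m * z) * (lg + 1)) (fun s' => ∃ c : ℕ,
      s'.v (2, 4) = c ∧ Chunk z (winSet w s V (m * z)) (s'.a out) c ∧
      (1 ≤ c → ∀ l < z, c ≤ l → s'.a out l = s'.a out (c - 1)) ∧ ExFrm out s s') := by
  have hz := hd.pos
  have hleB := hd.leB
  have hcap := hd.cap
  have hB2 := E.hB2
  have hmB : (m : ℤ) ≤ E.B := by
    have : (1 : ℤ) ≤ z := by exact_mod_cast hz
    nlinarith
  have hfor : Run E (s.setV (2, 4) 0) (.for (2, 0) (.var w.m)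
    (.seq (fillBuf src out w) (.seq (initStream 0 (0, 5) (2, 0) (0, 0))
      (.seq (.seq (.assign (2, 4) (.const 0)) (.assign (2, 5) (.var w.θ))) (sortLoop out)))))
      (m * (z * (src.cost + 290) + (800 * z + (13 + 2000 * z * (lg + 1) + 1) + 1) + 1 + 25) + 19)
      (fun s' => ExFrm out s s' ∧ ∃ c : ℕ, s'.v (2, 4) = c ∧
        Chunk z (winSet w s V (m * z)) (s'.a out) c) := by
    refine (Run.for (m := m) (fun r s' => s'.v (2, 0) = r ∧ ExFrm out s s' ∧ ∃ c : ℕ,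
      s'.v (2, 4) = c ∧ Chunk z (winSet w s V (r * z)) (s'.a out) c) hmB ?_ ?_ ?_ ?_).mono
      le_rfl fun _ h => h
    · refine ⟨by simp, ((ExFrm.refl _ _).setV rfl _).setV rfl _, 0, by simp, ?_⟩
      have : winSet w s V (0 * z) = ∅ := by simp [winSet]
      rw [this]
      exact Chunk.empty _ _
    · rintro r s' hr ⟨h1, h2, -⟩
      exact ⟨h1, by simp [h2.v _ hw.m.1 hw.m.2, hmv]⟩
    · rintro r s' hr ⟨h1, h2, c, h3, h4⟩
      refine Run.seq (fillBuf_run hd hg hout hw h2 hsrc hV hm h1 hr h3) ?_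
      rintro s2 ⟨f1, f2, f3, f4, f5, f6⟩
      have hfr2 := h2.trans f1
      have hg2 := hfr2.glob (by omega) hg
      have hob : out ≠ (2, 0) := by rintro rfl; simp at hout
      refine Run.of_bounded fun hv2 ha2 => ?_
      have hidx : ∀ l < z, r * z + l < m * z := fun l hl => by
        calc r * z + l < r * z + z := by omega
          _ = (r + 1) * z := by ring
          _ ≤ m * z := Nat.mul_le_mul_right _ hr
      set fA : ℕ → ℤ := s2.a (2, 0) with hfA
      refine Run.seq ((initStream_run (E := E) (q := 0) (M := 2 * z) (J := 1) (Mv := (0, 5))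
        (A := (2, 0)) (B := (0, 0)) (fA := fA) (fB := fun _ => 0) inf hg2.size2 (by simp) (by simp)
        (by simp) (fun l hl => rfl) (fun j _ => hg2.zero j) (by omega) le_rfl
        (by push_cast; omega) (by omega) (fun l hl j _ => by simpa using ha2 (2, 0) l)).mono
        (t' := 800 * z) (by omega) fun _ h => h) ?_
      rintro s3 ⟨i1, i2⟩
      have hfr3 := hfr2.trans (i2.exFrm (out := out))
      have hot : out ≠ treeA 0 := by rintro rfl; simp [treeA] at hout
      have hop : out ≠ ptrA 0 := by rintro rfl; simp [ptrA] at hout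
      have hθ3 : s3.v w.θ = s.v w.θ := hfr3.v _ hw.θ.1 hw.θ.2
      have hθne : w.θ ≠ (2, 4) := by intro h; exact hw.θ.2 (by rw [h])
      refine Run.of_bounded fun hv3 ha3 => ?_
      refine Run.seq ((Run.straight (Q := fun s4 => s4 = (s3.setV (2, 4) 0).setV (2, 5)
        (s.v w.θ)) ?_ ?_).mono (t' := 13) ?_ fun _ h => h) ?_
      · simp [Cmd.Ok, Cmd.exec, hθne]
        exact ⟨by omega, hv3 _⟩
      · simp [Cmd.exec, hθne, hθ3]
      · simp [Cmd.cost]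
      rintro s4 rfl
      have hfr4 : ExFrm out s ((s3.setV (2, 4) 0).setV (2, 5) (s.v w.θ)) :=
        (hfr3.setV rfl _).setV rfl _
      have hfa1 : ∀ l < z, fA l = if l < c then s'.a out l else inf := f5
      have hfa2 : ∀ l < z, fA (z + l) =
        if w.Mem s (V (r * z + l)) then V (r * z + l) else inf := f6
      have hwin : ∀ x ∈ winSet w s V (m * z), s.v w.θ < x ∧ x < inf := by
        intro x hx
        obtain ⟨⟨j, hj, hjx⟩, hx2⟩ := mem_winSet.1 hx
        have := hV j hj
        rw [hjx] at this
        exact ⟨hx2.2, lt_of_le_of_lt (le_abs_self _) this⟩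
      have hsub : ∀ x ∈ winSet w s V (r * z), s.v w.θ < x ∧ x < inf := by
        intro x hx
        obtain ⟨⟨j, hj, hjx⟩, hx2⟩ := mem_winSet.1 hx
        exact hwin x (mem_winSet.2 ⟨⟨j, hj.trans_le (Nat.mul_le_mul_right _ hr.le), hjx⟩, hx2⟩)
      have hfaθ : ∀ l < 2 * z, fA l = inf ∨ (s.v w.θ < fA l ∧ fA l < inf) := by
        intro l hl
        rcases Nat.lt_or_ge l z with hlz | hlz
        · rw [hfa1 l hlz]
          split_ifs with hlc
          · exact Or.inr (hsub _ (h4.mem l hlc))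
          · exact Or.inl rfl
        · obtain ⟨j, rfl⟩ : ∃ j, l = z + j := ⟨l - z, by omega⟩
          rw [hfa2 j (by omega)]
          split_ifs with hj
          · exact Or.inr (hwin _ (mem_winSet.2 ⟨⟨_, hidx j (by omega), rfl⟩, hj⟩))
          · exact Or.inl rfl
      refine Run.of_bounded fun hv4 ha4 => ?_
      refine (sortLoop_run (θ := s.v w.θ) (fA := fA) hd (hfr4.glob (by omega) hg) hout
        (i1.congr rfl rfl) ?_ hfaθ hθi (by simp) (by simp)).mono le_rfl ?_
      · intro l hl
        simp only [St.setV_a]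
        rw [i2.a _ (by simp [treeA]) (by simp [ptrA])]
      · rintro s5 ⟨c', g1, g2, g3, g4⟩
        have hfr5 := hfr4.trans g4
        have hb5 : s5.v (2, 0) = r := by
          rw [g3]
          simp [i2.v, f2]
        refine ⟨hb5, by simp, hfr5.setV rfl _, c', by simp [g1], ?_⟩
        have hX : winSet w s V ((r + 1) * z) = winSet w s V (r * z) ∪
            ((Finset.range z).image fun l => V (r * z + l)).filter (w.Mem s) := by
          ext x
          simp only [Finset.mem_union, mem_winSet, Finset.mem_filter, Finset.mem_image,
            Finset.mem_range]
          constructor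
          · rintro ⟨⟨i, hi, hix⟩, hx⟩
            rcases Nat.lt_or_ge i (r * z) with h | h
            · exact Or.inl ⟨⟨i, h, hix⟩, hx⟩
            · refine Or.inr ⟨⟨i - r * z, ?_, ?_⟩, hx⟩
              · have : (r + 1) * z = r * z + z := by ring
                omega
              · rw [show r * z + (i - r * z) = i by omega]; exact hix
          · rintro (⟨⟨i, hi, hix⟩, hx⟩ | ⟨⟨i, hi, hix⟩, hx⟩)
            · exact ⟨⟨i, hi.trans_le (Nat.mul_le_mul_right _ (by omega)), hix⟩, hx⟩
            · exact ⟨⟨r * z + i, by have : (r + 1) * z = r * z + z := by ring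
                                    omega, hix⟩, hx⟩
        rw [hX]
        refine h4.extend ?_
        -- The finite entries of the buffer are the old chunk together with the window elements of
        -- the new block, which is the set that `Chunk.extend` asks for.
        have hU : bufSet z fA inf = (Finset.range c).image (s'.a out) ∪
            ((Finset.range z).image fun l => V (r * z + l)).filter (w.Mem s) := by
          have hcz := h4.le
          ext x
          simp only [Finset.mem_union, mem_bufSet, Finset.mem_filter, Finset.mem_image,
            Finset.mem_range]
          constructor
          · rintro ⟨⟨l, hl, hlx⟩, hx⟩
            rcases Nat.lt_or_ge l z with hlz | hlz
            · rw [hfa1 l hlz] at hlx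
              split_ifs at hlx with hlc
              · exact Or.inl ⟨l, hlc, hlx⟩
              · omega
            · obtain ⟨j, rfl⟩ : ∃ j, l = z + j := ⟨l - z, by omega⟩
              rw [hfa2 j (by omega)] at hlx
              split_ifs at hlx with hj
              · exact Or.inr ⟨⟨j, by omega, hlx⟩, hlx ▸ hj⟩
              · omega
          · rintro (⟨l, hl, hlx⟩ | ⟨⟨j, hj, hjx⟩, hx⟩)
            · refine ⟨⟨l, by omega, ?_⟩, hlx ▸ (hsub _ (h4.mem l hl)).2⟩
              rw [hfa1 l (by omega), if_pos hl, hlx]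
            · refine ⟨⟨z + j, by omega, ?_⟩, ?_⟩
              · rw [hfa2 j hj, if_pos (hjx ▸ hx), hjx]
              · exact (hwin _ (mem_winSet.2 ⟨⟨_, hidx j hj, hjx⟩, hx⟩)).2
        rw [← hU]
        exact g2.congr fun i _ => rfl
    · rintro s' ⟨-, h1, h2⟩
      exact ⟨h1, h2⟩
  refine (Run.seq (Run.assign (Q := fun s1 => s1 = s.setV (2, 4) 0) ?_ rfl)
    fun s1 hs1 => Run.seq (hs1 ▸ hfor) ?_).mono (t := (Expr.const 0).cost + 4 +
      (m * (z * (src.cost + 290) + (800 * z + (13 + 2000 * z * (lg + 1) + 1) + 1) + 1 + 25) + 19 +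
      150 * z + 1) + 1) ?_ fun _ h => h
  · simp; omega
  · rintro s2 ⟨h1, c, h2, h3⟩
    refine (padOut_run hd (h1.glob (by omega) hg) hout h2).mono le_rfl ?_
    rintro s3 ⟨p1, p2, p3, p4⟩
    refine ⟨c, p2, h3.congr p3, fun hc1 l hl hcl => ?_, h1.trans p1⟩
    rw [p4 hc1 l hl hcl, p3 _ (by omega)]
  · have h1 : 1 ≤ m * z := Nat.mul_pos hm1 hz
    have h2 : z ≤ m * z := Nat.le_mul_of_pos_left _ hm1
    have h3 : m ≤ m * z := Nat.le_mul_of_pos_right _ hz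
    simp only [Expr.cost_const]
    have h4 : m * (z * (src.cost + 290) + (800 * z + (13 + 2000 * z * (lg + 1) + 1) + 1) + 1 + 25) =
      (m * z) * (src.cost + 290) + 800 * (m * z) + 2000 * (m * z) * (lg + 1) + 41 * m := by ring
    rw [h4]
    have h5 : (src.cost + 4000) * (m * z) ≤ (src.cost + 4000) * (m * z) * (lg + 1) :=
      Nat.le_mul_of_pos_right _ (by omega)
    have h6 : (src.cost + 4000) * (m * z) * (lg + 1) = (src.cost + 2000) * (m * z) * (lg + 1) +
      2000 * (m * z) * (lg + 1) := by ring
    have h7 : (src.cost + 2000) * (m * z) ≤ (src.cost + 2000) * (m * z) * (lg + 1) :=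
      Nat.le_mul_of_pos_right _ (by omega)
    nlinarith

end

end KSumRam

namespace KSumRam

/-! ### Running through all chunks of a window -/

/-- The register holding the result flag. -/
def gF : Var := (0, 2)

/-- How a search changes the flag: it is set if `must` holds, and only if `may` holds. -/
structure Flag (s s' : St) (must may : Prop) : Prop where
  bool : s'.v gF = 0 ∨ s'.v gF = 1
  keep : s.v gF = 1 → s'.v gF = 1
  complete : must → s'.v gF = 1
  sound : s'.v gF = 1 → s.v gF = 1 ∨ may

theorem Flag.mono {s s' : St} {a b a' b' : Prop} (h : Flag s s' a b) (ha : a' → a) (hb : b → b') :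
    Flag s s' a' b' :=
  ⟨h.bool, h.keep, fun h' => h.complete (ha h'), fun h' => (h.sound h').imp id hb⟩

theorem Flag.trans {s s' s'' : St} {a b a' b' : Prop} (h : Flag s s' a b) (h' : Flag s' s'' a' b') :
    Flag s s'' (a ∨ a') (b ∨ b') where
  bool := h'.bool
  keep h1 := h'.keep (h.keep h1)
  complete h1 := h1.elim (fun h2 => h'.keep (h.complete h2)) h'.complete
  sound h1 := (h'.sound h1).elim (fun h2 => (h.sound h2).imp id Or.inl) fun h2 => Or.inr (Or.inr h2)

theorem Flag.refl {s s' : St} (h : s.v gF = 0 ∨ s.v gF = 1) (hs : s'.v gF = s.v gF) :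
    Flag s s' False False :=
  ⟨hs ▸ h, fun h' => hs.trans h', False.elim, fun h' => Or.inl (hs ▸ h')⟩

/-- `s'` agrees with `s` above level `d`, and on level `d` up to the registers `(d, 0)`,
`(d, 3)` and the arrays. -/
structure OwnFrm (d : ℕ) (s s' : St) : Prop where
  frm : Frm (d + 1) s s'
  own : ∀ i, i ≠ 0 → i ≠ 3 → s'.v (d, i) = s.v (d, i)

theorem OwnFrm.refl (d : ℕ) (s : St) : OwnFrm d s s := ⟨Frm.refl _ _, fun _ _ _ => rfl⟩

theorem OwnFrm.trans {d : ℕ} {s s' s'' : St} (h : OwnFrm d s s') (h' : OwnFrm d s' s'') :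
    OwnFrm d s s'' :=
  ⟨h.frm.trans h'.frm, fun i h0 h3 => (h'.own i h0 h3).trans (h.own i h0 h3)⟩

theorem OwnFrm.of_frm {d : ℕ} {s s' : St} (hd : 1 ≤ d) (h : Frm d s s') : OwnFrm d s s' :=
  ⟨h.mono (by omega), fun i _ _ => h.v _ (Or.inr ⟨by simp; omega, le_rfl⟩)⟩

theorem OwnFrm.setV {d : ℕ} {s s' : St} (hd : 1 ≤ d) (h : OwnFrm d s s') {i : ℕ}
    (hi : i = 0 ∨ i = 3) (z : ℤ) : OwnFrm d s (s'.setV (d, i) z) :=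
  ⟨h.frm.setV (by simp [Prot]; omega) z, fun j h0 h3 => by
    rw [St.setV_v, if_neg]
    · exact h.own j h0 h3
    · simp only [Prod.mk.injEq, true_and]; omega⟩

theorem ExFrm.ownFrm {d : ℕ} {s s' : St} (hd : 3 ≤ d) (h : ExFrm (d, 0) s s') : OwnFrm d s s' :=
  ⟨h.frm (by omega) (by simp; omega) (by simp), fun i _ _ => h.v _ (by simp; omega)
    (by simp; omega)⟩

/-- Run `body` on all chunks of a window of the source; level `d` is private to this loop. -/
def chunkLoop (d : ℕ) (src : Expr) (w : WinVars) (body : Cmd) : Cmd :=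
  .seq (.seq (.assign (d, 0) (.const 1)) (.assign (d, 3) (.const 0 - .var gInf)))
    (.loop (.const 1) (.var (d, 0)) (.seq (extract src (d, 0) w) (.seq (.assign (d, 0) (.var (2, 4)))
      (.ite (.const 1) (.var (d, 0))
        (.seq (.assign (d, 3) (.arr (d, 0) (.var (0, 4) - .const 1))) body) .skip))))

/-- The elements of the source in the window, whatever the threshold. -/
def fullWin (w : WinVars) (s : St) (V : ℕ → ℤ) (j : ℕ) : Finset ℤ :=
  ((Finset.range j).image V).filter fun x => (s.v w.p * x + s.v w.c) % s.v w.Q < s.v w.W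

theorem mem_fullWin {w : WinVars} {s : St} {V : ℕ → ℤ} {j : ℕ} {x : ℤ} :
    x ∈ fullWin w s V j ↔
      (∃ i < j, V i = x) ∧ (s.v w.p * x + s.v w.c) % s.v w.Q < s.v w.W := by
  simp [fullWin]

/-- Extracting a chunk reduces the number of remaining elements by the size of the chunk; this
bounds the number of extractions. -/
theorem Chunk.card_rest {z : ℕ} {X Y : Finset ℤ} {o : ℕ → ℤ} {c : ℕ} (h : Chunk z X o c)
    (hY : ∀ x ∈ Y, x ∈ X ∧ ∀ i < c, o i < x) : Y.card + c ≤ X.card := by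
  have h1 : Disjoint Y ((Finset.range c).image o) := by
    rw [Finset.disjoint_left]
    intro x hx hx'
    obtain ⟨i, hi, hix⟩ := Finset.mem_image.1 hx'
    have := (hY x hx).2 i (Finset.mem_range.1 hi)
    omega
  have h2 : Y ∪ (Finset.range c).image o ⊆ X := by
    intro x hx
    rcases Finset.mem_union.1 hx with hx | hx
    · exact (hY x hx).1
    · obtain ⟨i, hi, hix⟩ := Finset.mem_image.1 hx
      exact hix ▸ h.mem i (Finset.mem_range.1 hi)
  have := Finset.card_le_card h2
  rwa [Finset.card_union_of_disjoint h1, h.card_image] at this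

section
variable {k n : ℕ} {E : Env k n}

/-- The last element of each chunk becomes the threshold for the next, so the chunks run through the
window in increasing order without memory of earlier ones. The predicates `must` and `may` differ
because a nested search is obliged to find only solutions matching its windows, but it may report
any true solution. -/
theorem chunkLoop_run {s : St} {z lg m d T : ℕ} {inf : ℤ} {src : Expr} {w : WinVars} {V : ℕ → ℤ}
    {body : Cmd} {must may : ℤ → Prop}
    (hd : Dim E z lg inf) (hg : Glob z inf s) (hd3 : 3 ≤ d)
    (hp : Prot (d + 1) w.p) (hQ : Prot (d + 1) w.Q) (hW : Prot (d + 1) w.W)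
    (hmp : Prot (d + 1) w.m) (hc : w.c = (d, 2)) (hθ : w.θ = (d, 3))
    (hsrc : ∀ s', Frm (d + 1) s s' → ∀ j < m * z, s'.v (2, 3) = j → src.eval E.x s' = V j)
    (hV : ∀ j < m * z, |V j| < inf) (hm : (m * z : ℤ) ≤ E.B) (hmv : s.v w.m = m) (hm1 : 1 ≤ m)
    (hF : s.v gF = 0 ∨ s.v gF = 1)
    (hbody : ∀ s1, OwnFrm d s s1 → (s1.v gF = 0 ∨ s1.v gF = 1) →
      (∀ j < z, s1.a (d, 0) j ∈ fullWin w s V (m * z)) →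
      (∀ i j, i ≤ j → j < z → s1.a (d, 0) i ≤ s1.a (d, 0) j) →
      Run E s1 body T (fun s2 => Frm d s1 s2 ∧
        Flag s1 s2 (∃ j < z, must (s1.a (d, 0) j)) (∃ j < z, may (s1.a (d, 0) j)))) :
    Run E s (chunkLoop d src w body)
      (((fullWin w s V (m * z)).card / z + 2) * ((src.cost + 4100) * (m * z) * (lg + 1) + T) + 40)
      (fun s' => OwnFrm d s s' ∧ Flag s s' (∃ x ∈ fullWin w s V (m * z), must x)
        (∃ x ∈ fullWin w s V (m * z), may x)) := by
  have hz := hd.pos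
  have hleB := hd.leB
  have hcap := hd.cap
  have hB2 := E.hB2
  have hinf0 := hd.inf0
  have hinfB := hd.infB
  set X := fullWin w s V (m * z) with hX
  have hlvl : ∀ x : Var, Prot (d + 1) x → x.1 ≠ 1 ∧ x.1 ≠ 2 := fun x hx => by
    rcases hx with h | h <;> omega
  have hw : w.Ok := ⟨hlvl _ hp, by rw [hc]; simp; omega, hlvl _ hQ, hlvl _ hW,
    by rw [hθ]; simp; omega, hlvl _ hmp⟩
  have hgd : gF ≠ (d, 0) ∧ gF ≠ (d, 3) ∧ gInf ≠ (d, 0) := by simp [gF, gInf]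
  have hwin : ∀ s', OwnFrm d s s' → ∀ x, x ∈ winSet w s' V (m * z) ↔ x ∈ X ∧ s'.v (d, 3) < x := by
    intro s' hs' x
    rw [mem_winSet, hX, mem_fullWin, WinVars.Mem, hs'.frm.v _ hp, hs'.frm.v _ hQ, hs'.frm.v _ hW, hc,
      hs'.own 2 (by omega) (by omega), hθ, and_assoc]
  have hXV : ∀ x ∈ X, -inf < x ∧ x < inf := by
    intro x hx
    obtain ⟨⟨j, hj, hjx⟩, -⟩ := mem_fullWin.1 (hX ▸ hx)
    have := hV j hj
    rw [hjx] at this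
    exact abs_lt.1 this
  set rem : ℤ → Finset ℤ := fun θ => X.filter (θ < ·) with hrem
  set C := (src.cost + 4000) * (m * z) * (lg + 1) with hC
  -- The three alternatives at the end: the last chunk was incomplete and nothing remains; or all
  -- `r` chunks so far were full; or the last extraction returned nothing and the loop is about to
  -- stop.
  let I : ℕ → St → Prop := fun r s' => OwnFrm d s s' ∧ (s'.v gF = 0 ∨ s'.v gF = 1) ∧
    (s.v gF = 1 → s'.v gF = 1) ∧ s'.v (d, 3) < inf ∧
    (∀ x ∈ X, must x → x ≤ s'.v (d, 3) → s'.v gF = 1) ∧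
    (s'.v gF = 1 → s.v gF = 1 ∨ ∃ x ∈ X, may x) ∧
    ((rem (s'.v (d, 3)) = ∅ ∧ z * r ≤ X.card + z - 1) ∨
      (1 ≤ s'.v (d, 0) ∧ (rem (s'.v (d, 3))).card + z * r ≤ X.card) ∨
      (rem (s'.v (d, 3)) = ∅ ∧ s'.v (d, 0) = 0))
  have hinit : Run E s (.seq (.assign (d, 0) (.const 1)) (.assign (d, 3) (.const 0 - .var gInf)))
      17 (I 0) := by
    refine (Run.straight ?_ ?_).mono (?_ : _ ≤ 17) fun _ h => h
    · have : s.v gInf = inf := hg.inf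
      simp [Cmd.Ok, Cmd.exec, hgd, this, abs_of_pos hinf0]
      omega
    · have : s.v gInf = inf := hg.inf
      have h30 : (d, 3) ≠ (d, 0) := by simp
      simp only [Cmd.exec, Expr.eval_const, Expr.eval_sub, Expr.eval_var]
      refine ⟨((OwnFrm.refl d s).setV (by omega) (Or.inl rfl) _).setV (by omega) (Or.inr rfl) _,
        by simp [hgd, hF], by simp [hgd], ?_, ?_, ?_, ?_⟩
      · simp [hgd, this]; omega
      · intro x hx _ hle
        simp [hgd, this] at hle
        have := hXV x hx
        omega
      · intro h; left; simpa [hgd] using h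
      · refine Or.inr (Or.inl ⟨by simp, ?_⟩)
        simp only [mul_zero, add_zero]
        exact Finset.card_filter_le _ _
    · simp [Cmd.cost]
  refine (Run.seq hinit fun s1 hs1 => Run.loop (t := fun _ => C + (7 + (3 + 1 + (21 + T + 1) + 3) + 1) + 1)
    (m := X.card / z + 2) (Q := fun s' => OwnFrm d s s' ∧ Flag s s' (∃ x ∈ X, must x)
        (∃ x ∈ X, may x)) I hs1 ?_ ?_).mono ?_ fun _ h => h
  · rintro r s2 ⟨i1, i2, i3, i4, i5, i6, i7⟩ hguard
    simp only [Expr.eval_const, Expr.eval_var] at hguard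
    have hdiv := Nat.div_add_mod X.card z
    have hmod := Nat.mod_lt X.card hz
    constructor
    -- All chunks before the last nonempty one are full, so at most `⌈|X| / z⌉` of them are
    -- nonempty. One further extraction may be needed to see that the window is exhausted, whence
    -- the bound `|X| / z + 2`.
    · have hle : z * r ≤ X.card + z - 1 := by
        rcases i7 with h | h | h
        · exact h.2
        · omega
        · omega
      by_contra hcon
      have : z * (X.card / z + 2) ≤ z * r := Nat.mul_le_mul_left _ (by omega)
      have : z * (X.card / z + 2) = z * (X.card / z) + z * 2 := by ring
      omega
    have hg2 := hg.frm i1.frm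
    have hex := extract_run (E := E) (s := s2) (src := src) (out := (d, 0)) (w := w) (V := V)
      (m := m) hd hg2 hd3 hw (fun s' hs' => hsrc s' (i1.frm.trans (hs'.ownFrm hd3).frm)) hV hm
      ((i1.frm.v _ hmp).trans hmv) hm1 (by rw [hθ]; exact i4)
    refine Run.seq hex ?_
    rintro s3 ⟨c, c1, c2, c3, c4⟩
    have o3 := i1.trans (c4.ownFrm hd3)
    have hcz := c2.le
    have hF3 : s3.v gF = s2.v gF := c4.v _ (by simp [gF]) (by simp [gF])
    have hθ3 : s3.v (d, 3) = s2.v (d, 3) := c4.v _ (by simp; omega) (by simp; omega)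
    refine Run.seq (Run.assign (Q := fun s4 => s4 = s3.setV (d, 0) c) ?_ (by simp [c1])) ?_
    · simp [c1]; omega
    rintro s4 rfl
    have o4 : OwnFrm d s (s3.setV (d, 0) c) := o3.setV (by omega) (Or.inl rfl) _
    have hg4 := hg.frm o4.frm
    refine Run.ite (fun hc1 => ?_) (fun hc0 => ?_)
    · simp at hc1
      -- Because of the padding, entry `z - 1` is the largest element of the chunk even if the chunk
      -- is incomplete.
      have hlast : (Expr.arr (d, 0) (.var (0, 4) - .const 1)).eval E.x (s3.setV (d, 0) c) =
          s3.a (d, 0) (c - 1) := by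
        rw [Expr.eval_arr_nat (j := z - 1)]
        · rcases Nat.lt_or_ge (c - 1) (z - 1) with h | h
          · exact c3 (by omega) _ (by omega) (by omega)
          · rw [St.setV_a, show z - 1 = c - 1 by omega]
        · simp only [Expr.eval_sub, Expr.eval_var, Expr.eval_const, hg4.size]
          omega
      refine Run.of_bounded fun hv4 ha4 => ?_
      refine Run.seq (Run.assign (Q := fun s5 => s5 = (s3.setV (d, 0) c).setV (d, 3)
        (s3.a (d, 0) (c - 1))) ?_ (by rw [hlast])) ?_
      · rw [hlast]; exact ha4 (d, 0) _
      rintro s5 rfl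
      have o5 : OwnFrm d s ((s3.setV (d, 0) c).setV (d, 3) (s3.a (d, 0) (c - 1))) :=
        o4.setV (by omega) (Or.inr rfl) _
      have hmem : ∀ i < c, s3.a (d, 0) i ∈ X ∧ s2.v (d, 3) < s3.a (d, 0) i := fun i hi =>
        (hwin s2 i1 _).1 (c2.mem i hi)
      have hout : ∀ j < z, ∃ i < c, s3.a (d, 0) j = s3.a (d, 0) i ∧ (j ≤ i ∨ i = c - 1) := by
        intro j hj
        rcases Nat.lt_or_ge j c with h | h
        · exact ⟨j, h, rfl, Or.inl le_rfl⟩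
        · exact ⟨c - 1, by omega, c3 (by omega) j hj h, Or.inr rfl⟩
      have hmono : ∀ i j, i ≤ j → j < c → s3.a (d, 0) i ≤ s3.a (d, 0) j := by
        intro i j hij hj
        rcases Nat.lt_or_ge i j with h | h
        · exact (c2.mono i j h hj).le
        · rw [show i = j by omega]
      have hF5 : ((s3.setV (d, 0) c).setV (d, 3) (s3.a (d, 0) (c - 1))).v gF = s2.v gF := by
        simp [hgd, hF3]
      refine (hbody _ o5 (by rw [hF5]; exact i2) ?_ ?_).mono le_rfl ?_
      · intro j hj
        obtain ⟨i, hi, hji, -⟩ := hout j hj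
        simp only [St.setV_a]
        rw [hji]
        exact (hmem i hi).1
      · intro i j hij hj
        simp only [St.setV_a]
        rcases Nat.lt_or_ge j c with h | h
        · exact hmono i j hij h
        · rw [c3 (by omega) j hj h]
          rcases Nat.lt_or_ge i c with h' | h'
          · exact hmono i (c - 1) (by omega) (by omega)
          · rw [c3 (by omega) i (by omega) h']
      · rintro s6 ⟨f1, f2⟩
        have o6 := o5.trans (OwnFrm.of_frm (by omega) f1)
        have hv6 : ∀ i, s6.v (d, i) = ((s3.setV (d, 0) c).setV (d, 3) (s3.a (d, 0) (c - 1))).v (d, i) :=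
          fun i => f1.v _ (Or.inr ⟨by simp; omega, le_rfl⟩)
        have h3 : s6.v (d, 3) = s3.a (d, 0) (c - 1) := by rw [hv6]; simp
        have h0 : s6.v (d, 0) = c := by rw [hv6]; simp
        have hlt := (hmem (c - 1) (by omega)).2
        refine ⟨o6, f2.bool, fun h => f2.keep (hF5.trans (i3 h)), ?_, ?_, ?_, ?_⟩
        · rw [h3]; exact (hXV _ (hmem _ (by omega)).1).2
        · intro x hx hmx hle
          rw [h3] at hle
          by_cases hx2 : x ≤ s2.v (d, 3)
          · exact f2.keep (hF5.trans (i5 x hx hmx hx2))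
          · rcases c2.compl x ((hwin s2 i1 x).2 ⟨hx, by omega⟩) with ⟨i, hi, hix⟩ | ⟨_, h⟩
            · exact f2.complete ⟨i, by omega, by simpa [hix] using hmx⟩
            · have := h (c - 1) (by omega)
              omega
        · intro h
          rcases f2.sound h with h' | ⟨j, hj, h'⟩
          · exact i6 (hF5 ▸ h')
          · simp only [St.setV_a] at h'
            obtain ⟨i, hi, hji, -⟩ := hout j hj
            rw [hji] at h'
            exact Or.inr ⟨_, (hmem i hi).1, h'⟩
        · rw [h3, h0]
          have hold : (winSet w s2 V (m * z)).card = (rem (s2.v (d, 3))).card := by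
            congr 1
            ext x
            rw [hwin s2 i1, hrem, Finset.mem_filter]
          have hrest := c2.card_rest (Y := rem (s3.a (d, 0) (c - 1))) (fun x hx => by
            rw [hrem, Finset.mem_filter] at hx
            refine ⟨(hwin s2 i1 x).2 ⟨hx.1, by omega⟩, fun i hi => ?_⟩
            have := hmono i (c - 1) (by omega) (by omega)
            omega)
          rw [hold] at hrest
          have hpos : 1 ≤ (rem (s2.v (d, 3))).card := by omega
          have hcnt : (rem (s2.v (d, 3))).card + z * r ≤ X.card := by
            rcases i7 with h | h | h
            · rw [h.1] at hpos; simp at hpos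
            · exact h.2
            · omega
          have hzr : z * (r + 1) = z * r + z := by ring
          by_cases hcz' : c = z
          · exact Or.inr (Or.inl ⟨by omega, by omega⟩)
          · refine Or.inl ⟨?_, by omega⟩
            rw [Finset.eq_empty_iff_forall_notMem]
            intro x hx
            rw [hrem, Finset.mem_filter] at hx
            rcases c2.compl x ((hwin s2 i1 x).2 ⟨hx.1, by omega⟩) with ⟨i, hi, hix⟩ | ⟨h, _⟩
            · have := hmono i (c - 1) (by omega) (by omega)
              omega
            · exact hcz' h
    · simp at hc0
      have hc0' : c = 0 := by omega
      refine (Run.skip ?_).mono (t := 1) (by omega) fun _ h => h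
      have hr : rem (s2.v (d, 3)) = ∅ := by
        rw [Finset.eq_empty_iff_forall_notMem]
        intro x hx
        rw [hrem, Finset.mem_filter] at hx
        rcases c2.compl x ((hwin s2 i1 x).2 ⟨hx.1, hx.2⟩) with ⟨i, hi, -⟩ | ⟨h, _⟩ <;> omega
      refine ⟨o4, ?_⟩
      simp only [St.setV_v, hgd, if_false, hF3]
      simp only [Prod.mk.injEq, true_and, show (3 : ℕ) ≠ 0 by omega, if_false, hθ3]
      exact ⟨i2, i3, i4, i5, i6, Or.inr (Or.inr ⟨hr, by simp [hc0']⟩)⟩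
  · rintro r s2 ⟨i1, i2, i3, i4, i5, i6, i7⟩ hguard
    simp only [Expr.eval_const, Expr.eval_var] at hguard
    have hr : rem (s2.v (d, 3)) = ∅ := by
      rcases i7 with h | h | h
      · exact h.1
      · omega
      · exact h.1
    refine ⟨i1, i2, i3, ?_, i6⟩
    rintro ⟨x, hx, hmx⟩
    refine i5 x hx hmx ?_
    by_contra hcon
    have : x ∈ rem (s2.v (d, 3)) := by
      rw [hrem, Finset.mem_filter]
      exact ⟨hx, by omega⟩
    rw [hr] at this
    simp at this
  · simp only [Finset.sum_const, Finset.card_range, smul_eq_mul, Expr.cost_const, Expr.cost_var]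
    have h1 : 1 ≤ m * z := Nat.mul_pos hm1 hz
    have h2 : 1 ≤ (m * z) * (lg + 1) := Nat.mul_pos h1 (by omega)
    have h3 : (src.cost + 4100) * (m * z) * (lg + 1) = C + 100 * ((m * z) * (lg + 1)) := by
      rw [hC]; ring
    have h4 : C + (7 + (3 + 1 + (21 + T + 1) + 3) + 1) + 1 + (1 + 3 + 3) ≤
        (src.cost + 4100) * (m * z) * (lg + 1) + T := by omega
    have := Nat.mul_le_mul_left (X.card / z + 2) h4
    omega

end

end KSumRam

namespace KSumRam

/-! ### Meet in the middle for at most four arrays -/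

theorem Heap.exists_leaf {M : ℕ} {T : ℕ → ℤ} (h : Heap M T) (hM : 1 ≤ M) :
    ∃ l < M, T (M + l) = T 1 := by
  have key : ∀ d i, 2 * M ≤ i + d → 1 ≤ i → i < 2 * M → ∃ l < M, T (M + l) = T i := by
    intro d
    induction d with
    | zero => intro i h1 _ h2; omega
    | succ d ih =>
      intro i h1 h2 h3
      by_cases hi : M ≤ i
      · exact ⟨i - M, by omega, by rw [Nat.add_sub_cancel' hi]⟩
      · rw [h i h2 (by omega)]
        rcases min_choice (T (2 * i)) (T (2 * i + 1)) with h4 | h4 <;> rw [h4]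
        · exact ih _ (by omega) (by omega) (by omega)
        · exact ih _ (by omega) (by omega) (by omega)
  exact key (2 * M) 1 (by omega) le_rfl (by omega)

/-- Equal sums that have not been passed by both streams have been found. -/
def MeetInv (z J J' : ℕ) (fA fB gA gB : ℕ → ℤ) (p p' : ℕ → ℕ) (done : Prop) : Prop :=
  ∀ l < z, ∀ j < J, ∀ l' < z, ∀ j' < J', fA l + fB j = gA l' + gB j' →
    done ∨ (p l ≤ j ∧ p' l' ≤ j')

section
variable {z J J' : ℕ} {fA fB gA gB : ℕ → ℤ} {p p' : ℕ → ℕ} {done : Prop} {inf ρ ρ' : ℤ}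

theorem MeetInv.symm (h : MeetInv z J J' fA fB gA gB p p' done) :
    MeetInv z J' J gA gB fA fB p' p done := fun l hl j hj l' hl' j' hj' e =>
  (h l' hl' j' hj' l hl j hj e.symm).imp id And.symm

/-- Suppose the popped entry belongs to a matching pair of which neither entry has been passed. Its
key is `ρ`, and the partner's leaf stands at or before the partner, so `ρ'` is at most the common
sum `ρ`. Together with `ρ ≤ ρ'` the two roots agree, and then the pair has been noticed. -/
theorem MeetInv.pop (h : MeetInv z J J' fA fB gA gB p p' done) {done' : Prop} (hd : done → done')
    {l : ℕ} (hρ : ρ = leafKey J fA fB inf p l)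
    (hρ' : ∀ i < z, ρ' ≤ leafKey J' gA gB inf p' i) (hle : ρ ≤ ρ') (heq : ρ = ρ' → p l < J → done')
    (hgB : ∀ i j, i ≤ j → j < J' → gB i ≤ gB j) :
    MeetInv z J J' fA fB gA gB (Function.update p l (min (p l + 1) J)) p' done' := by
  intro i hi j hj i' hi' j' hj' e
  rcases h i hi j hj i' hi' j' hj' e with h1 | ⟨h1, h2⟩
  · exact Or.inl (hd h1)
  by_cases hil : i = l
  · subst hil
    rw [Function.update_self]
    rcases Nat.lt_or_ge (p i) j with h3 | h3
    · exact Or.inr ⟨by omega, h2⟩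
    · have h4 : p i = j := by omega
      subst h4
      have h5 := hρ' i' hi'
      have h6 := hgB _ _ h2 hj'
      rw [leafKey, if_pos (by omega)] at h5
      rw [leafKey, if_pos hj] at hρ
      exact Or.inl (heq (by omega) hj)
  · rw [Function.update_of_ne hil]
    exact Or.inr ⟨h1, h2⟩

theorem sum_update_min {l : ℕ} (hl : l < z) (hp : p l < J) :
    ∑ i ∈ Finset.range z, Function.update p l (min (p l + 1) J) i = ∑ i ∈ Finset.range z, p i + 1 := by
  rw [Finset.sum_update_of_mem (Finset.mem_range.2 hl),
    ← Finset.add_sum_erase _ p (Finset.mem_range.2 hl), min_eq_left (by omega),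
    Finset.sdiff_singleton_eq_erase]
  omega

theorem sum_update_min_le {l : ℕ} (hl : l < z) (hp : p l ≤ J) :
    ∑ i ∈ Finset.range z, p i ≤ ∑ i ∈ Finset.range z, Function.update p l (min (p l + 1) J) i := by
  refine Finset.sum_le_sum fun i _ => ?_
  by_cases h : i = l
  · subst h; simp; omega
  · simp [h]

/-- Used at the end of the merge: when the pointers have made `z (J + J')` moves in total, the first
stream is exhausted, and no unnoticed pair can be left. -/
theorem eq_of_sum_ge (h : ∀ i < z, p i ≤ J) (h' : ∀ i < z, p' i ≤ J')
    (hs : z * (J + J') ≤ ∑ i ∈ Finset.range z, p i + ∑ i ∈ Finset.range z, p' i) :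
    ∀ i < z, p i = J := by
  by_contra hcon
  push Not at hcon
  obtain ⟨i, hi, hne⟩ := hcon
  have h1 : ∑ i ∈ Finset.range z, p i < ∑ i ∈ Finset.range z, J :=
    Finset.sum_lt_sum (fun j hj => h j (Finset.mem_range.1 hj))
      ⟨i, Finset.mem_range.2 hi, lt_of_le_of_ne (h i hi) hne⟩
  have h2 : ∑ i ∈ Finset.range z, p' i ≤ ∑ i ∈ Finset.range z, J' :=
    Finset.sum_le_sum (fun j hj => h' j (Finset.mem_range.1 hj))
  simp only [Finset.sum_const, Finset.card_range, smul_eq_mul] at h1 h2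
  nlinarith

end

/-- Compare the two streams and advance the one that is behind. -/
def meetStep (J J' A B : Var) : Cmd :=
  .ite (.arr (treeA 0) (.const 1) + .const 1) (.arr (treeA 1) (.const 1))
    (popStream 0 (0, 4) J A B)
    (.seq (.ite (.arr (treeA 0) (.const 1)) (.arr (treeA 1) (.const 1))
        (.ite (.arr (treeA 1) (.const 1) + .const 1) (.var gInf) (.assign gF (.const 1)) .skip) .skip)
      (popStream 1 (0, 4) J' (2, 10) (2, 11)))

def meetLoop (J J' A B : Var) : Cmd :=
  .seq (initStream 0 (0, 4) A B) (.seq (initStream 1 (0, 4) (2, 10) (2, 11))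
    (.for (2, 0) (.var (0, 4) * (.var J + .var J')) (meetStep J J' A B)))

/-- Are there entries of the arrays `A, B, C, D` (`B` and `D` sorted, of lengths `J, J'`) with
sum `tv`? -/
def meet (tv J J' A B C D : Var) : Cmd :=
  .seq (.for (2, 0) (.var (0, 4)) (.store (2, 10) (.var (2, 0)) (.var tv - .arr C (.var (2, 0)))))
    (.seq (.for (2, 0) (.var J') (.store (2, 11) (.var (2, 0))
      (.const 0 - .arr D (.var J' - .const 1 - .var (2, 0))))) (meetLoop J J' A B))

section
variable {k n : ℕ} {E : Env k n}

theorem Expr.eval_arr_one (x : KInstance k n) (s : St) (A : Var) :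
    (Expr.arr A (.const 1)).eval x s = s.a A 1 := Expr.eval_arr_nat (j := 1) rfl

/-- Two increasing streams are merged; on equality the flag is set and the second stream advances.
The streams visit up to `z J` and `z J'` sums, but each is represented by `z` leaves only. -/
theorem meetLoop_run {s : St} {z lg J J' : ℕ} {inf : ℤ} {Jv Jv' A B : Var} {fA fB gA gB : ℕ → ℤ}
    (hd : Dim E z lg inf) (hg : Glob z inf s) (hJv : s.v Jv = J) (hJv' : s.v Jv' = J')
    (hJl : Prot 3 Jv) (hJl' : Prot 3 Jv') (hJ : 1 ≤ J) (hJ' : 1 ≤ J') (hJz : J ≤ z) (hJz' : J' ≤ z)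
    (hA : A.1 ≠ 1 ∧ A.1 ≠ 2) (hB : B.1 ≠ 1 ∧ B.1 ≠ 2) (hzB : (z * (J + J') : ℤ) ≤ E.B)
    (hfA : ∀ l < z, s.a A l = fA l) (hfB : ∀ j < J, s.a B j = fB j)
    (hgA : ∀ l < z, s.a (2, 10) l = gA l) (hgB : ∀ j < J', s.a (2, 11) j = gB j)
    (hf : ∀ l < z, ∀ j < J, |fA l + fB j| < inf) (hg' : ∀ l < z, ∀ j < J', |gA l + gB j| < inf)
    (hBm : ∀ i j, i ≤ j → j < J → fB i ≤ fB j) (hBm' : ∀ i j, i ≤ j → j < J' → gB i ≤ gB j)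
    (hF : s.v gF = 0 ∨ s.v gF = 1) :
    Run E s (meetLoop Jv Jv' A B) ((z * (J + J')) * (1000 * (lg + 1)) + 800 * z + 100) (fun s' =>
      Frm 3 s s' ∧ Flag s s'
        (∃ l < z, ∃ j < J, ∃ l' < z, ∃ j' < J', fA l + fB j = gA l' + gB j')
        (∃ l < z, ∃ j < J, ∃ l' < z, ∃ j' < J', fA l + fB j = gA l' + gB j')) := by
  have hz := hd.pos
  have hlg := hd.lg
  have hleB := hd.leB
  have hcap := hd.cap
  have hinfB := hd.infB
  have hB2 := E.hB2
  have hne1 : ∀ x : Var, Prot 3 x → x.1 ≠ 1 := fun x hx => by rcases hx with h | h <;> omega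
  have hkf : ∀ l < z, ∀ j < J, |fA l + fB j| ≤ E.B := fun l hl j hj => by
    have := hf l hl j hj; omega
  have hkg : ∀ l < z, ∀ j < J', |gA l + gB j| ≤ E.B := fun l hl j hj => by
    have := hg' l hl j hj; omega
  set sol := ∃ l < z, ∃ j < J, ∃ l' < z, ∃ j' < J', fA l + fB j = gA l' + gB j' with hsol
  refine (Run.seq (initStream_run (E := E) (q := 0) inf hg.size (by simp) hA.1 hB.1 hfA hfB hz hJ
    (by omega) (by omega) hkf) (u := (z * (J + J')) * (1000 * (lg + 1)) + 400 * z + 99) ?_).mono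
    (by omega) fun _ h => h
  rintro s1 ⟨i1, f1⟩
  have g1 := hg.frm (f1.frm le_rfl)
  refine (Run.seq (initStream_run (E := E) (s := s1) (q := 1) (M := z) (J := J') (fA := gA) (fB := gB)
    inf g1.size (by simp) (by simp) (by simp)
    (fun l hl => by rw [f1.a _ (by simp [treeA]) (by simp [ptrA])]; exact hgA l hl)
    (fun l hl => by rw [f1.a _ (by simp [treeA]) (by simp [ptrA])]; exact hgB l hl) hz hJ'
    (by omega) (by omega) hkg) (u := (z * (J + J')) * (1000 * (lg + 1)) + 98) ?_).mono
    (by omega) fun _ h => h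
  rintro s2 ⟨i2, f2⟩
  have hfr2 : Frm 3 s s2 := (f1.frm (by omega)).trans (f2.frm (by omega))
  have haux : ∀ q (A : Var), A.1 ≠ 1 → A ≠ treeA q ∧ A ≠ ptrA q := fun q A h =>
    ⟨by rintro rfl; exact h rfl, by rintro rfl; exact h rfl⟩
  have ha2 : ∀ A : Var, A.1 ≠ 1 → s2.a A = s.a A := fun A h => by
    rw [f2.a _ (haux 1 A h).1 (haux 1 A h).2, f1.a _ (haux 0 A h).1 (haux 0 A h).2]
  -- Progress is measured by the sum of all pointers, which is at least the number of turns so far.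
  refine (Run.for (m := z * (J + J')) (t := 1000 * (lg + 1) - 40) (fun r s' => s'.v (2, 0) = r ∧
    Frm 3 s s' ∧ (∀ A : Var, A.1 ≠ 1 → s'.a A = s.a A) ∧ ∃ p p' : ℕ → ℕ,
      SInv 0 z J fA fB inf p s' ∧ SInv 1 z J' gA gB inf p' s' ∧
      r ≤ ∑ i ∈ Finset.range z, p i + ∑ i ∈ Finset.range z, p' i ∧
      MeetInv z J J' fA fB gA gB p p' (s'.v gF = 1) ∧
      Flag s s' False sol) (by push_cast; exact hzB) ?_ ?_ ?_ ?_).mono ?_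
    fun _ h => h
  · refine ⟨by simp, hfr2.setV (by simp [Prot]) _, ha2, fun _ => 0, fun _ => 0,
      (i1.congr (by rw [St.setV_a, f2.a _ (by simp [treeA]) (by simp [treeA, ptrA])])
        (by rw [St.setV_a, f2.a _ (by simp [treeA, ptrA]) (by simp [ptrA])])).congr rfl rfl,
      i2.congr rfl rfl, by simp, fun l _ j _ l' _ j' _ _ => Or.inr ⟨Nat.zero_le _, Nat.zero_le _⟩,
      (Flag.refl hF ?_).mono id (fun h => h.elim)⟩
    simp [gF, f2.v, f1.v]
  · rintro r s' hr ⟨h1, h2, -⟩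
    exact ⟨h1, by simp [(hg.frm h2).size, h2.v _ hJl, h2.v _ hJl', hJv, hJv']⟩
  · rintro r s' hr ⟨h1, h2, h3, p, p', h4, h5, h6, h7, h8⟩
    have hg1 := hg.frm h2
    obtain ⟨l0, hl0, hr0⟩ := h4.heap.exists_leaf hz
    rw [h4.leaf l0 hl0] at hr0
    obtain ⟨l1, hl1, hr1⟩ := h5.heap.exists_leaf hz
    rw [h5.leaf l1 hl1] at hr1
    have hlt1 : ∀ l < z, p l < J → leafKey J fA fB inf p l < inf := fun l hl hp => by
      rw [leafKey, if_pos hp]; exact (abs_lt.1 (hf l hl _ hp)).2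
    have hlt2 : ∀ l < z, p' l < J' → leafKey J' gA gB inf p' l < inf := fun l hl hp => by
      rw [leafKey, if_pos hp]; exact (abs_lt.1 (hg' l hl _ hp)).2
    have hnlt1 : ∀ l, leafKey J fA fB inf p l < inf → p l < J := fun l hp => by
      by_contra hc; rw [leafKey, if_neg hc] at hp; omega
    have hnlt2 : ∀ l, leafKey J' gA gB inf p' l < inf → p' l < J' := fun l hp => by
      by_contra hc; rw [leafKey, if_neg hc] at hp; omega
    refine (Run.ite (t := 1000 * (lg + 1) - 71) ?_ ?_).mono (by simp; omega) fun _ h => h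
    · simp only [Expr.eval_add, Expr.eval_arr_one, Expr.eval_const]
      intro hlt
      refine (popStream_run h4 hg1.size (by simp) ((h2.v _ hJl).trans hJv) (hne1 _ hJl) hg1.inf
        hA.1 hB.1 (fun l hl => by rw [h3 _ hA.1]; exact hfA l hl)
        (fun l hl => by rw [h3 _ hB.1]; exact hfB l hl) hz (lg := lg) (by omega) (by omega) (by omega)
        (by omega) hkf).mono (by omega) ?_
      rintro s3 ⟨l, hl, e1, e2, e3⟩
      refine ⟨(e3.v _ (by simp)).trans h1, by simp, (h2.trans (e3.frm (by omega))).setV (by simp [Prot]) _,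
        fun A hA => by rw [St.setV_a, e3.a _ (haux 0 A hA).1 (haux 0 A hA).2, h3 A hA], _, p',
        e2.congr rfl rfl,
        h5.congr (by rw [St.setV_a, e3.a _ (by simp [treeA]) (by simp [treeA, ptrA])])
          (by rw [St.setV_a, e3.a _ (by simp [treeA, ptrA]) (by simp [ptrA])]), ?_, ?_, ?_⟩
      · rw [sum_update_min hl (hnlt1 l ?_)]
        · omega
        · rw [← e1]
          have : leafKey J' gA gB inf p' l1 ≤ inf := by
            by_cases h : p' l1 < J'
            · exact (hlt2 l1 hl1 h).le
            · rw [leafKey, if_neg h]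
          omega
      · refine h7.pop (fun h => ?_) e1 (fun i hi => h5.root_le hi) (by omega) (fun h => by omega) hBm'
        simp [gF, e3.v] at h ⊢; exact h
      · have hff : (s3.setV (2, 0) (r + 1)).v gF = s'.v gF := by simp [gF, e3.v]
        exact ⟨hff ▸ h8.bool, fun h => hff ▸ h8.keep h, False.elim, fun h => h8.sound (hff ▸ h)⟩
    · simp only [Expr.eval_add, Expr.eval_arr_one, Expr.eval_const]
      intro hlt
      refine (Run.seq (t := 100) (u := 600 * (lg + 1)) (R := fun s3 => (s3 = s' ∧ ¬ (s'.a (treeA 0) 1 ≤ s'.a (treeA 1) 1 ∧ s'.a (treeA 1) 1 < inf)) ∨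
          (s3 = s'.setV gF 1 ∧ s'.a (treeA 0) 1 ≤ s'.a (treeA 1) 1 ∧ s'.a (treeA 1) 1 < inf)) ?_ ?_).mono
        (by omega) fun _ h => h
      · refine (Run.straight ?_ ?_).mono (?_ : _ ≤ 100) fun _ h => h
        · simp only [Cmd.Ok, Expr.eval_const]
          split_ifs
          simp
          omega
        · simp only [Cmd.exec, Expr.eval_arr_one, Expr.eval_add, Expr.eval_const, Expr.eval_var, hg1.inf]
          split_ifs with c1 c2
          · exact Or.inr ⟨rfl, c1, by omega⟩
          · exact Or.inl ⟨rfl, by omega⟩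
          · exact Or.inl ⟨rfl, by omega⟩
        · simp [Cmd.cost]
      · intro s3 hs3
        have ha3 : s3.a = s'.a := by rcases hs3 with h | h <;> simp [h.1]
        have hv3 : ∀ x, x ≠ gF → s3.v x = s'.v x := fun x hx => by
          rcases hs3 with h | h <;> simp [h.1, hx]
        have hfr3 : Frm 3 s s3 := by
          rcases hs3 with h | h
          · rw [h.1]; exact h2
          · rw [h.1]; exact h2.setV (by simp [Prot, gF]) _
        have hg3 := hg.frm hfr3
        refine (popStream_run (E := E) (s := s3) (q := 1) (pt := p') (fA := gA) (fB := gB) (M := z)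
          (h5.congr (by rw [ha3]) (by rw [ha3])) hg3.size (by simp)
          ((hfr3.v _ hJl').trans hJv') (hne1 _ hJl') hg3.inf
          (by simp) (by simp) (fun l hl => by rw [ha3, h3 _ (by simp)]; exact hgA l hl)
          (fun l hl => by rw [ha3, h3 _ (by simp)]; exact hgB l hl) hz (lg := lg) (by omega) (by omega)
          (by omega) (by omega) hkg).mono le_rfl ?_
        rintro s4 ⟨l, hl, e1, e2, e3⟩
        rw [ha3] at e1
        refine ⟨(e3.v _ (by simp)).trans ((hv3 _ (by simp [gF])).trans h1), by simp,
          (hfr3.trans (e3.frm (by omega))).setV (by simp [Prot]) _,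
          fun A hA => by rw [St.setV_a, e3.a _ (haux 1 A hA).1 (haux 1 A hA).2, ha3, h3 A hA], p, _,
          h4.congr (by rw [St.setV_a, e3.a _ (by simp [treeA]) (by simp [treeA, ptrA]), ha3])
            (by rw [St.setV_a, e3.a _ (by simp [treeA, ptrA]) (by simp [ptrA]), ha3]),
          e2.congr rfl rfl, ?_, ?_, ?_⟩
        -- If the second stream is exhausted when it is popped, its root is infinite. The comparison
        -- then shows the first one to be exhausted too, so the pointer sum already has its maximal
        -- value and exceeds `r`.
        · by_cases hp : p' l < J'
          · rw [sum_update_min hl hp]; omega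
          · have hinf : s'.a (treeA 1) 1 = inf := by rw [e1, leafKey, if_neg hp]
            have hall : ∀ i < z, p i = J := fun i hi => by
              have := h4.root_le hi
              have := h4.le i hi
              by_contra hc
              have := hlt1 i hi (by omega)
              omega
            have hall' : ∀ i < z, p' i = J' := fun i hi => by
              have := h5.root_le hi
              have := h5.le i hi
              by_contra hc
              have := hlt2 i hi (by omega)
              omega
            have e4 : ∑ i ∈ Finset.range z, p i = z * J := by
              rw [Finset.sum_congr rfl fun i hi => hall i (Finset.mem_range.1 hi)]; simp
            have e5 : ∑ i ∈ Finset.range z, p' i = z * J' := by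
              rw [Finset.sum_congr rfl fun i hi => hall' i (Finset.mem_range.1 hi)]; simp
            have := sum_update_min_le hl (h5.le l hl)
            rw [mul_add] at hr
            omega
        · refine (h7.symm.pop (fun h => ?_) e1 (fun i hi => h4.root_le hi) (by omega)
            (fun h hp => ?_) hBm).symm
          · simp only [gF, St.setV_v, Prod.mk.injEq, OfNat.ofNat_ne_zero, false_and, if_false,
              OfNat.zero_ne_ofNat, e3.v (0, 2) (by simp)] at h ⊢
            rcases hs3 with h' | h'
            · rw [h'.1]; exact h
            · simp [h'.1, gF]
          · have h9 := hlt2 l hl hp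
            rw [← e1] at h9
            rcases hs3 with h' | h'
            · exact absurd ⟨by omega, h9⟩ h'.2
            · simp [gF, e3.v, h'.1]
        · have hff : (s4.setV (2, 0) (r + 1)).v gF = s3.v gF := by simp [gF, e3.v]
          rcases hs3 with h' | h'
          · rw [h'.1] at hff
            exact ⟨hff ▸ h8.bool, fun h => hff ▸ h8.keep h, False.elim, fun h => h8.sound (hff ▸ h)⟩
          · have h1' : (s4.setV (2, 0) (r + 1)).v gF = 1 := by rw [hff, h'.1]; simp
            refine ⟨Or.inr h1', fun _ => h1', False.elim, fun _ => Or.inr ?_⟩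
            -- The flag is set only for finite equal roots, so both roots are sums of actual
            -- entries.
            have e6 : p l0 < J := hnlt1 _ (by omega)
            have e7 : p' l1 < J' := hnlt2 _ (by omega)
            refine ⟨l0, hl0, p l0, e6, l1, hl1, p' l1, e7, ?_⟩
            rw [leafKey, if_pos e6] at hr0
            rw [leafKey, if_pos e7] at hr1
            omega
  · rintro s' ⟨h1, h2, h3, p, p', h4, h5, h6, h7, h8⟩
    refine ⟨h2, h8.bool, h8.keep, ?_, h8.sound⟩
    rintro ⟨l, hl, j, hj, l', hl', j', hj', e⟩
    rcases h7 l hl j hj l' hl' j' hj' e with h | ⟨h, -⟩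
    · exact h
    · have := eq_of_sum_ge h4.le h5.le h6 l hl
      omega
  · simp only [Expr.cost_mul, Expr.cost_add, Expr.cost_var]
    have : (1000 * (lg + 1) - 40 + (3 + (3 + 3 + 3) + 3 + 22)) ≤ 1000 * (lg + 1) := by omega
    have := Nat.mul_le_mul_left (z * (J + J')) this
    omega

/-- The equation is split as `A + B = tv - C - D`. To make the right side an increasing stream, `D`
is negated and read backwards; the shifted copies of `C` and `D` take `O(z)` additional cells. -/
theorem meet_run {s : St} {z lg J J' : ℕ} {inf : ℤ} {tv Jv Jv' A B C D : Var}
    (hd : Dim E z lg inf) (hg : Glob z inf s) (hJv : s.v Jv = J) (hJv' : s.v Jv' = J')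
    (hJl : Prot 3 Jv) (hJl' : Prot 3 Jv') (htv : Prot 3 tv)
    (hJ : 1 ≤ J) (hJ' : 1 ≤ J') (hJz : J ≤ z) (hJz' : J' ≤ z)
    (hA : A.1 ≠ 1 ∧ A.1 ≠ 2) (hB : B.1 ≠ 1 ∧ B.1 ≠ 2) (hC : C.1 ≠ 1 ∧ C.1 ≠ 2)
    (hD : D.1 ≠ 1 ∧ D.1 ≠ 2) (hzB : (z * (J + J') : ℤ) ≤ E.B)
    (hf : ∀ l < z, ∀ j < J, |s.a A l + s.a B j| < inf)
    (hg' : ∀ l < z, ∀ j < J', |s.a C l| + |s.a D j| + |s.v tv| < inf)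
    (hBm : ∀ i j, i ≤ j → j < J → s.a B i ≤ s.a B j)
    (hDm : ∀ i j, i ≤ j → j < J' → s.a D i ≤ s.a D j)
    (hF : s.v gF = 0 ∨ s.v gF = 1) {sol : Prop}
    (hsol : (∃ l < z, ∃ j < J, ∃ l' < z, ∃ j' < J', s.a A l + s.a B j + s.a C l' + s.a D j' = s.v tv) ↔
      sol) :
    Run E s (meet tv Jv Jv' A B C D) ((z * (J + J')) * (1000 * (lg + 1)) + 1000 * z + 200)
      (fun s' => Frm 3 s s' ∧ Flag s s' sol sol) := by
  have hz := hd.pos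
  have hleB := hd.leB
  have hcap := hd.cap
  have hinfB := hd.infB
  have hB2 := E.hB2
  refine (Run.seq (t := z * 80 + 20) (R := fun s' => Frm 3 s s' ∧
      (∀ x : Var, x.1 ≠ 1 → x.1 ≠ 2 → s'.v x = s.v x) ∧
      ∀ l < z, s'.a (2, 10) l = s.v tv - s.a C l)
      (u := (z * (J + J')) * (1000 * (lg + 1)) + 900 * z + 170) ?_ ?_).mono
      (by omega) fun _ h => h
  · refine (Run.for (m := z) (t := 50) (fun r s' => s'.v (2, 0) = r ∧ Frm 3 s s' ∧
      (∀ x : Var, x.1 ≠ 1 → x.1 ≠ 2 → s'.v x = s.v x) ∧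
      (∀ A : Var, A.1 ≠ 2 → s'.a A = s.a A) ∧
      ∀ l < r, s'.a (2, 10) l = s.v tv - s.a C l) (by omega) ?_ ?_ ?_ ?_).mono ?_ fun _ h => h
    · refine ⟨by simp, (Frm.refl _ _).setV (by simp [Prot]) _, ?_, fun _ _ => rfl, by simp⟩
      rintro ⟨x, y⟩ h1 h2
      simp at h1 h2
      simp [h2]
    · rintro r s' hr ⟨h1, h2, -⟩
      exact ⟨h1, by simp [(hg.frm h2).size]⟩
    · rintro r s' hr ⟨h1, h2, h3, h4, h5⟩
      have e : (Expr.arr C (.var (2, 0))).eval E.x s' = s.a C r := by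
        rw [Expr.eval_arr_nat (j := r) (by simp [h1]), h4 _ hC.2]
      refine (Run.store ?_ ?_ ?_ ?_).mono (?_ : _ ≤ 50) fun _ h => h
      · simp only [Expr.eval_sub, e, Expr.eval_var, h2.v _ htv]
        have := hg' r hr 0 hJ'
        have := abs_nonneg (s.a D 0)
        exact (abs_sub _ _).trans (by omega)
      · simp [h1]
      · simp [h1]; omega
      · simp only [Expr.eval_sub, e, Expr.eval_var, h2.v _ htv, h1]
        refine ⟨h1, by simp, (h2.setA (by simp) _ _).setV (by simp [Prot]) _, ?_, ?_, ?_⟩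
        · rintro ⟨x, y⟩ h6 h7
          simp at h6 h7
          simp [h7, h3 (x, y) h6 h7]
        · intro A hA
          funext j
          have : A ≠ (2, 10) := by rintro rfl; exact hA rfl
          simp [this, h4 A hA]
        · intro l hl
          simp only [St.setV_a, St.setA_a, true_and, Int.toNat_natCast]
          split_ifs with hlr
          · rw [hlr]
          · exact h5 l (by omega)
      · simp
    · rintro s' ⟨h1, h2, h3, h4, h5⟩
      exact ⟨h2, h3, h5⟩
    · simp; omega
  rintro s1 ⟨q1, q2, q3⟩
  refine (Run.seq (t := J' * 100 + 20) (R := fun s' => Frm 3 s s' ∧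
      (∀ x : Var, x.1 ≠ 1 → x.1 ≠ 2 → s'.v x = s.v x) ∧
      (∀ l < z, s'.a (2, 10) l = s.v tv - s.a C l) ∧
      ∀ l < J', s'.a (2, 11) l = - s.a D (J' - 1 - l))
      (u := (z * (J + J')) * (1000 * (lg + 1)) + 800 * z + 100) ?_ ?_).mono
      (by omega) fun _ h => h
  · refine (Run.for (m := J') (t := 60) (fun r s' => s'.v (2, 0) = r ∧ Frm 3 s s' ∧
      (∀ x : Var, x.1 ≠ 1 → x.1 ≠ 2 → s'.v x = s.v x) ∧
      (∀ l < z, s'.a (2, 10) l = s.v tv - s.a C l) ∧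
      ∀ l < r, s'.a (2, 11) l = - s.a D (J' - 1 - l)) (by omega) ?_ ?_ ?_ ?_).mono ?_ fun _ h => h
    · refine ⟨by simp, q1.setV (by simp [Prot]) _, ?_, q3, by simp⟩
      rintro ⟨x, y⟩ h1 h2
      have := q2 (x, y) h1 h2
      simp at h1 h2
      simp [h2, this]
    · rintro r s' hr ⟨h1, h2, -⟩
      exact ⟨h1, by simp [h2.v _ hJl', hJv']⟩
    · rintro r s' hr ⟨h1, h2, h3, h4, h5⟩
      have hDa : s'.a D = s.a D := by
        refine h2.a _ ?_
        omega
      have e : (Expr.arr D (.var Jv' - .const 1 - .var (2, 0))).eval E.x s' = s.a D (J' - 1 - r) := by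
        rw [Expr.eval_arr_nat (j := J' - 1 - r) (by simp [h1, h2.v _ hJl', hJv']; omega), hDa]
      refine (Run.store ?_ ?_ ?_ ?_).mono (?_ : _ ≤ 60) fun _ h => h
      · simp only [Expr.eval_sub, e, Expr.eval_const, zero_sub, abs_neg]
        have := hg' 0 (by omega) (J' - 1 - r) (by omega)
        have := abs_nonneg (s.a C 0)
        have := abs_nonneg (s.v tv)
        omega
      · simp [h1]
      · simp [h1]; omega
      · simp only [Expr.eval_sub, e, Expr.eval_const, Expr.eval_var, zero_sub, h1]
        refine ⟨h1, by simp, (h2.setA (by simp) _ _).setV (by simp [Prot]) _, ?_, ?_, ?_⟩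
        · rintro ⟨x, y⟩ h6 h7
          simp at h6 h7
          simp [h7, h3 (x, y) h6 h7]
        · intro l hl
          simpa using h4 l hl
        · intro l hl
          simp only [St.setV_a, St.setA_a, true_and, Int.toNat_natCast]
          split_ifs with hlr
          · rw [hlr]
          · exact h5 l (by omega)
      · simp
    · rintro s' ⟨h1, h2, h3, h4, h5⟩
      exact ⟨h2, h3, h4, h5⟩
    · simp; omega
  rintro s2 ⟨r1, r2, r3, r4⟩
  have ha : ∀ A : Var, A.1 ≠ 1 ∧ A.1 ≠ 2 → s2.a A = s.a A := fun A hA => r1.a _ (by omega)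
  have hFs : s2.v gF = s.v gF := r2 _ (by simp [gF]) (by simp [gF])
  refine (meetLoop_run (E := E) (s := s2) (fA := s.a A) (fB := s.a B) (gA := fun l => s.v tv - s.a C l)
    (gB := fun l => - s.a D (J' - 1 - l)) hd (hg.frm r1) ((r1.v _ hJl).trans hJv)
    ((r1.v _ hJl').trans hJv') hJl hJl' hJ hJ' hJz hJz' hA hB hzB (fun l _ => by rw [ha A hA])
    (fun l _ => by rw [ha B hB]) r3 r4 hf ?_ hBm ?_ (hFs ▸ hF)).mono le_rfl ?_
  · intro l hl j hj
    have := hg' l hl (J' - 1 - j) (by omega)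
    have h1 := abs_le.1 (le_refl |s.a C l|)
    have h2 := abs_le.1 (le_refl |s.a D (J' - 1 - j)|)
    have h3 := abs_le.1 (le_refl |s.v tv|)
    rw [abs_lt]
    constructor <;> linarith [h1.1, h1.2, h2.1, h2.2, h3.1, h3.2]
  · intro i j hij hj
    have := hDm (J' - 1 - j) (J' - 1 - i) (by omega) (by omega)
    omega
  · rintro s3 ⟨t1, t2⟩
    have key : (∃ l < z, ∃ j < J, ∃ l' < z, ∃ j' < J', s.a A l + s.a B j =
        s.v tv - s.a C l' + - s.a D (J' - 1 - j')) ↔ sol := by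
      rw [← hsol]
      constructor
      · rintro ⟨l, hl, j, hj, l', hl', j', hj', e⟩
        exact ⟨l, hl, j, hj, l', hl', J' - 1 - j', by omega, by omega⟩
      · rintro ⟨l, hl, j, hj, l', hl', j', hj', e⟩
        refine ⟨l, hl, j, hj, l', hl', J' - 1 - j', by omega, ?_⟩
        rw [show J' - 1 - (J' - 1 - j') = j' by omega]
        omega
    refine ⟨r1.trans t1, t2.bool, fun h => t2.keep (hFs ▸ h), fun h => t2.complete (key.2 h),
      fun h => (t2.sound h).imp (fun h => hFs ▸ h) key.1⟩

end

end KSumRam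

namespace KSumRam

/-! ### Counting collisions of the random linear map -/

/-- As `a` runs below `Q`, the products `a d` form a progression with step `d` that winds at most
`|d|` times around the residues. Each time it meets an interval of length `W` in at most about `W /
|d| + 1` points. No primality is needed. -/
theorem card_mul_emod_lt {Q : ℕ} (hQ : 0 < Q) (W : ℕ) {d : ℤ} (hd : d ≠ 0) :
    ((Finset.range Q).filter fun a : ℕ => ((a : ℤ) * d) % Q < W).card ≤ 3 * (W + d.natAbs) := by
  obtain ⟨D, hD⟩ : ∃ D, d.natAbs = D := ⟨_, rfl⟩
  have hDd : |d| = (D : ℤ) := by rw [← hD, Int.natCast_natAbs]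
  have hD1 : 1 ≤ D := by
    have := Int.natAbs_pos.2 hd
    omega
  rw [hD]
  have hQ' : (0 : ℤ) < Q := by exact_mod_cast hQ
  have hD' : (0 : ℤ) < D := by exact_mod_cast hD1
  -- Possible pairs of winding number and position within the window in units of `D`: `(2 D + 1) (W
  -- / D + 1) ≤ 3 (W + D)` because `D ≥ 1`.
  have hcard : (Finset.Icc (-(D : ℤ)) D ×ˢ Finset.range (W / D + 1)).card ≤ 3 * (W + D) := by
    rw [Finset.card_product, Int.card_Icc, Finset.card_range]
    have h1 : ((D : ℤ) + 1 - -(D : ℤ)).toNat = 2 * D + 1 := by omega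
    rw [h1]
    have h2 := Nat.div_mul_le_self W D
    nlinarith [Nat.zero_le (W / D)]
  refine (Finset.card_le_card_of_injOn
    (fun a : ℕ => (((a : ℤ) * d) / Q, ((((a : ℤ) * d) % Q) / D).toNat)) ?_ ?_).trans hcard
  · intro a ha
    simp only [Finset.coe_filter, Finset.mem_range, Set.mem_ofPred_eq] at ha
    obtain ⟨ha1, ha2⟩ := ha
    have ha1' : (a : ℤ) ≤ Q := by omega
    have h0 : 0 ≤ ((a : ℤ) * d) % Q := Int.emod_nonneg _ hQ'.ne'
    have hb : |(a : ℤ) * d| ≤ D * Q := by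
      rw [abs_mul, hDd, Nat.abs_cast, mul_comm]
      exact mul_le_mul_of_nonneg_left ha1' hD'.le
    have hb' := abs_le.1 hb
    simp only [Finset.coe_product, Set.mem_prod, Finset.coe_Icc, Set.mem_Icc, Finset.coe_range,
      Set.mem_Iio]
    refine ⟨⟨?_, ?_⟩, ?_⟩
    · rw [Int.le_ediv_iff_mul_le hQ']
      linarith [hb'.1]
    · exact (Int.ediv_le_ediv hQ' hb'.2).trans (by rw [Int.mul_ediv_cancel _ hQ'.ne'])
    · have h3 : ((a : ℤ) * d) % Q / D ≤ ((W / D : ℕ) : ℤ) := by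
        push_cast
        exact Int.ediv_le_ediv hD' ha2.le
      have h4 : 0 ≤ ((W / D : ℕ) : ℤ) := Int.natCast_nonneg _
      rw [Int.toNat_lt' (by omega)]
      push_cast at h3 h4 ⊢
      exact h3.trans_lt (lt_add_one _)
  · intro a ha b hb hab
    simp only [Prod.mk.injEq] at hab
    obtain ⟨h1, h2⟩ := hab
    have ha0 : 0 ≤ ((a : ℤ) * d) % Q := Int.emod_nonneg _ hQ'.ne'
    have hb0 : 0 ≤ ((b : ℤ) * d) % Q := Int.emod_nonneg _ hQ'.ne'
    have h3 : ((a : ℤ) * d) % Q / D = ((b : ℤ) * d) % Q / D := by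
      have := Int.ediv_nonneg ha0 hD'.le
      have := Int.ediv_nonneg hb0 hD'.le
      omega
    have ea := Int.mul_ediv_add_emod ((a : ℤ) * d) Q
    have eb := Int.mul_ediv_add_emod ((b : ℤ) * d) Q
    have ra := Int.mul_ediv_add_emod (((a : ℤ) * d) % Q) D
    have rb := Int.mul_ediv_add_emod (((b : ℤ) * d) % Q) D
    have la := Int.emod_lt_of_pos (((a : ℤ) * d) % Q) hD'
    have lb := Int.emod_lt_of_pos (((b : ℤ) * d) % Q) hD'
    have na := Int.emod_nonneg (((a : ℤ) * d) % Q) hD'.ne'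
    have nb := Int.emod_nonneg (((b : ℤ) * d) % Q) hD'.ne'
    rw [h1] at ea
    rw [h3] at ra
    -- Multipliers with the same winding number and the same position have products less than `|d|`
    -- apart, so they coincide.
    have hlt : |((a : ℤ) - b) * d| < |d| := by
      rw [hDd, sub_mul, abs_lt]
      constructor <;> linarith
    rw [abs_mul] at hlt
    have hz : |(a : ℤ) - b| < 1 := by
      by_contra hc
      push Not at hc
      have := mul_le_mul_of_nonneg_right hc (abs_nonneg d)
      linarith
    have := Int.abs_lt_one_iff.1 hz
    omega

/-- The number of elements of `X` that an affine map modulo `Q` sends below `W`. -/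
def winCard (X : Finset ℤ) (p c Q W : ℤ) : ℕ := (X.filter fun x => (p * x + c) % Q < W).card

section
variable {m L K : ℕ}

/-- Shifts by multiples of `L` do not change the residue modulo `L`, which divides the modulus `m
L`. So the quotient by `L`, one of `K` values, determines the shifted residue, and this determines
`v` below `m`. -/
theorem card_shift_emod_lt (hL : 0 < L) (h : ℤ) :
    ((Finset.range m).filter fun v : ℕ => (h - L * v) % ((m * L : ℕ) : ℤ) < ((K * L : ℕ) : ℤ)).card ≤ K := by
  rcases Nat.eq_zero_or_pos m with rfl | hm
  · simp
  have hL' : (0 : ℤ) < L := by exact_mod_cast hL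
  have hQ : (0 : ℤ) < ((m * L : ℕ) : ℤ) := by exact_mod_cast Nat.mul_pos hm hL
  refine (Finset.card_le_card_of_injOn (t := Finset.range K)
    (fun v : ℕ => (((h - L * v) % ((m * L : ℕ) : ℤ)) / L).toNat) ?_ ?_).trans (by simp)
  · intro v hv
    simp only [Finset.coe_filter, Finset.mem_range, Set.mem_ofPred_eq] at hv
    simp only [Finset.coe_range, Set.mem_Iio]
    have h1 : (h - L * v) % ((m * L : ℕ) : ℤ) / L < K := by
      rw [Int.ediv_lt_iff_lt_mul hL']
      have := hv.2
      push_cast at this ⊢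
      exact this
    have := Int.ediv_nonneg (Int.emod_nonneg (h - L * v) hQ.ne') hL'.le
    omega
  · intro v hv w hw hvw
    simp only [Finset.coe_filter, Finset.mem_range, Set.mem_ofPred_eq] at hv hw hvw
    have hv0 := Int.emod_nonneg (h - L * v) hQ.ne'
    have hw0 := Int.emod_nonneg (h - L * w) hQ.ne'
    have h3 : (h - L * v) % ((m * L : ℕ) : ℤ) / L = (h - L * w) % ((m * L : ℕ) : ℤ) / L := by
      have := Int.ediv_nonneg hv0 hL'.le
      have := Int.ediv_nonneg hw0 hL'.le
      omega
    have hmod : ∀ v : ℕ, (h - L * v) % ((m * L : ℕ) : ℤ) % L = h % L := by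
      intro v
      rw [Int.emod_emod_of_dvd _ (by push_cast; exact Dvd.intro_left _ rfl)]
      exact Int.sub_mul_emod_self_left h L v
    have h4 : (h - L * v) % ((m * L : ℕ) : ℤ) = (h - L * w) % ((m * L : ℕ) : ℤ) := by
      rw [← Int.mul_ediv_add_emod ((h - L * v) % ((m * L : ℕ) : ℤ)) L, h3, hmod v, ← hmod w,
        Int.mul_ediv_add_emod]
    have h5 := Int.ModEq.dvd h4
    obtain ⟨q, hq⟩ := h5
    have h6 : (v : ℤ) - w = m * q := by
      have : (L : ℤ) * ((v : ℤ) - w) = L * (m * q) := by push_cast at hq; linarith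
      exact mul_left_cancel₀ hL'.ne' this
    have hv1 : (v : ℤ) < m := by exact_mod_cast hv.1
    have hw1 : (w : ℤ) < m := by exact_mod_cast hw.1
    have hq0 : q = 0 := by
      by_contra hne
      rcases lt_or_gt_of_ne hne with h7 | h7
      · have : (m : ℤ) * q ≤ m * (-1) := mul_le_mul_of_nonneg_left (by omega) (by omega)
        omega
      · have : (m : ℤ) * 1 ≤ m * q := mul_le_mul_of_nonneg_left (by omega) (by omega)
        omega
    rw [hq0] at h6
    omega

/-- Double counting: every element lies in at most `K` of the windows. This bound holds for every
multiplier. -/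
theorem sum_winCard_le (hL : 0 < L) (X : Finset ℤ) (p c : ℤ) :
    ∑ v ∈ Finset.range m, winCard X p (c - L * v) ((m * L : ℕ) : ℤ) ((K * L : ℕ) : ℤ) ≤
      K * X.card := by
  simp only [winCard, Finset.card_filter]
  rw [Finset.sum_comm, mul_comm K X.card, ← smul_eq_mul X.card]
  refine Finset.sum_le_card_nsmul _ _ _ fun x _ => ?_
  rw [← Finset.card_filter]
  simpa only [add_sub_assoc] using card_shift_emod_lt (m := m) (K := K) hL (p * x + c)

/-- Two elements that can lie in a common window. -/
def Close (p Q W : ℤ) (y : ℤ × ℤ) : Prop := (p * (y.1 - y.2)) % Q < W ∨ (p * (y.2 - y.1)) % Q < W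

instance (p Q W : ℤ) : DecidablePred (Close p Q W) := fun _ => inferInstanceAs (Decidable (_ ∨ _))

theorem close_of_window {p c Q W : ℤ} {y : ℤ × ℤ} (hQ : 0 < Q) (h1 : (p * y.1 + c) % Q < W)
    (h2 : (p * y.2 + c) % Q < W) : Close p Q W y := by
  have a1 := Int.emod_nonneg (p * y.1 + c) hQ.ne'
  have a2 := Int.emod_nonneg (p * y.2 + c) hQ.ne'
  have b1 := Int.emod_lt_of_pos (p * y.1 + c) hQ
  have b2 := Int.emod_lt_of_pos (p * y.2 + c) hQ
  have key : ∀ u w : ℤ, w % Q ≤ u % Q → (u - w) % Q = u % Q - w % Q := fun u w huw => by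
    rw [Int.sub_emod, Int.emod_eq_of_lt (by omega)]
    have := Int.emod_nonneg w hQ.ne'
    have := Int.emod_lt_of_pos u hQ
    omega
  rcases le_total ((p * y.2 + c) % Q) ((p * y.1 + c) % Q) with h | h
  · left
    rw [show p * (y.1 - y.2) = p * y.1 + c - (p * y.2 + c) by ring, key _ _ h]
    omega
  · right
    rw [show p * (y.2 - y.1) = p * y.2 + c - (p * y.1 + c) by ring, key _ _ h]
    omega

/-- The square counts ordered pairs within a window. Only close pairs occur, and each of them shares
at most `K` windows. -/
theorem sum_winCard_sq_le (hL : 0 < L) (hm : 0 < m) (X : Finset ℤ) (p c : ℤ) :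
    ∑ v ∈ Finset.range m, winCard X p (c - L * v) ((m * L : ℕ) : ℤ) ((K * L : ℕ) : ℤ) ^ 2 ≤
      K * ((X ×ˢ X).filter (Close p ((m * L : ℕ) : ℤ) ((K * L : ℕ) : ℤ))).card := by
  have hQ : (0 : ℤ) < ((m * L : ℕ) : ℤ) := by exact_mod_cast Nat.mul_pos hm hL
  have h1 : ∀ v : ℕ, winCard X p (c - L * v) ((m * L : ℕ) : ℤ) ((K * L : ℕ) : ℤ) ^ 2 =
      ∑ y ∈ X ×ˢ X, if (p * y.1 + (c - L * v)) % ((m * L : ℕ) : ℤ) < ((K * L : ℕ) : ℤ) ∧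
        (p * y.2 + (c - L * v)) % ((m * L : ℕ) : ℤ) < ((K * L : ℕ) : ℤ) then 1 else 0 := by
    intro v
    rw [← Finset.card_filter, sq, winCard, ← Finset.card_product]
    congr 1
    ext y
    simp only [Finset.mem_product, Finset.mem_filter]
    tauto
  rw [Finset.sum_congr rfl fun v _ => h1 v, Finset.sum_comm, Finset.card_filter, Finset.mul_sum]
  refine Finset.sum_le_sum fun y _ => ?_
  rw [← Finset.card_filter]
  split_ifs with hy
  · rw [mul_one]
    refine (Finset.card_le_card ?_).trans (card_shift_emod_lt (m := m) (K := K) hL (p * y.1 + c))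
    intro v hv
    rw [Finset.mem_filter] at hv ⊢
    refine ⟨hv.1, ?_⟩
    rw [add_sub_assoc]
    exact hv.2.1
  · rw [mul_zero, Nat.le_zero, Finset.card_eq_zero, Finset.filter_eq_empty_iff]
    intro v _ h
    exact hy (close_of_window hQ h.1 h.2)

/-- A diagonal pair counts for all `m L` multipliers. An off-diagonal pair, having a difference
between `1` and `L` in absolute value, is close for at most `2 * 3 (K L + L) ≤ 12 K L` of them. The
shift `c` may depend on the multiplier, as it does for array `0`. -/
theorem sum_sum_winCard_sq_le (hL : 0 < L) (hm : 0 < m) (hK : 1 ≤ K) (X : Finset ℤ)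
    (hX : ∀ x ∈ X, ∀ y ∈ X, (x - y).natAbs ≤ L) {ε : ℤ} (hε : ε = 1 ∨ ε = -1) (c : ℕ → ℤ) :
    ∑ a ∈ Finset.range (m * L), ∑ v ∈ Finset.range m,
      winCard X (ε * a) (c a - L * v) ((m * L : ℕ) : ℤ) ((K * L : ℕ) : ℤ) ^ 2 ≤
      K * (X.card * (m * L) + X.card ^ 2 * (12 * K * L)) := by
  have hQ := Nat.mul_pos hm hL
  calc _ ≤ ∑ a ∈ Finset.range (m * L), K * ((X ×ˢ X).filter
        (Close (ε * a) ((m * L : ℕ) : ℤ) ((K * L : ℕ) : ℤ))).card :=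
        Finset.sum_le_sum fun a _ => sum_winCard_sq_le hL hm X _ _
    _ = K * ∑ y ∈ X ×ˢ X, ((Finset.range (m * L)).filter fun a : ℕ =>
        Close (ε * a) ((m * L : ℕ) : ℤ) ((K * L : ℕ) : ℤ) y).card := by
        simp only [Finset.card_filter, ← Finset.mul_sum]
        rw [Finset.sum_comm]
    _ ≤ K * ∑ y ∈ X ×ˢ X, ((if y.1 = y.2 then m * L else 0) + 12 * K * L) := by
        refine Nat.mul_le_mul_left _ (Finset.sum_le_sum fun y hy => ?_)
        obtain ⟨hy1, hy2⟩ := Finset.mem_product.1 hy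
        split_ifs with h
        · refine (Finset.card_filter_le _ _).trans ?_
          rw [Finset.card_range]; omega
        have hd : ε * (y.1 - y.2) ≠ 0 := by rcases hε with h | h <;> subst h <;> omega
        have hd' : ε * (y.2 - y.1) ≠ 0 := by rcases hε with h | h <;> subst h <;> omega
        have e1 := card_mul_emod_lt hQ (K * L) hd
        have e2 := card_mul_emod_lt hQ (K * L) hd'
        have n1 : (ε * (y.1 - y.2)).natAbs ≤ L := by
          have := hX _ hy1 _ hy2
          rcases hε with h | h <;> subst h <;> omega
        have n2 : (ε * (y.2 - y.1)).natAbs ≤ L := by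
          have := hX _ hy1 _ hy2
          rcases hε with h | h <;> subst h <;> omega
        have e3 : ((Finset.range (m * L)).filter fun a : ℕ =>
            Close (ε * a) ((m * L : ℕ) : ℤ) ((K * L : ℕ) : ℤ) y).card ≤
            ((Finset.range (m * L)).filter fun a : ℕ =>
              ((a : ℤ) * (ε * (y.1 - y.2))) % ((m * L : ℕ) : ℤ) < ((K * L : ℕ) : ℤ)).card +
            ((Finset.range (m * L)).filter fun a : ℕ =>
              ((a : ℤ) * (ε * (y.2 - y.1))) % ((m * L : ℕ) : ℤ) < ((K * L : ℕ) : ℤ)).card := by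
          refine (Finset.card_le_card ?_).trans (Finset.card_union_le _ _)
          intro a ha
          rw [Finset.mem_filter] at ha
          rw [Finset.mem_union, Finset.mem_filter, Finset.mem_filter]
          rcases ha.2 with h | h
          · exact Or.inl ⟨ha.1, by rwa [← mul_assoc, mul_comm (a : ℤ) ε]⟩
          · exact Or.inr ⟨ha.1, by rwa [← mul_assoc, mul_comm (a : ℤ) ε]⟩
        have : L ≤ K * L := Nat.le_mul_of_pos_left L hK
        rw [mul_assoc]
        omega
    _ = _ := by
        congr 1
        rw [Finset.sum_add_distrib, Finset.sum_const, Finset.card_product, smul_eq_mul, sq]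
        congr 1
        rw [← Finset.sum_filter, Finset.sum_const, smul_eq_mul]
        congr 1
        rw [← Finset.diag_eq_filter, Finset.diag_card]

/-- Windows have `O(z)` elements on average and `|X| ≤ m z`, so the second moment of the number of
chunks, too, is `O(m)` on average over the multipliers. The constants come from `(t + 2) ^ 2 ≤ 2 t ^
2 + 8` and `K (1 + 12 K) ≤ 13 K ^ 2`. -/
theorem sum_sum_chunks_sq_le {z : ℕ} (hz : 0 < z) (hL : 0 < L) (hm : 0 < m) (hK : 1 ≤ K)
    (X : Finset ℤ) (hX : ∀ x ∈ X, ∀ y ∈ X, (x - y).natAbs ≤ L) (hXc : X.card ≤ m * z)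
    {ε : ℤ} (hε : ε = 1 ∨ ε = -1) (c : ℕ → ℤ) :
    ∑ a ∈ Finset.range (m * L), ∑ v ∈ Finset.range m,
      (winCard X (ε * a) (c a - L * v) ((m * L : ℕ) : ℤ) ((K * L : ℕ) : ℤ) / z + 2) ^ 2 ≤
      m * L * ((26 * K ^ 2 + 8) * m) := by
  have h1 := sum_sum_winCard_sq_le hL hm hK X hX hε c
  obtain ⟨b, hb⟩ : ∃ b : ℕ → ℕ → ℕ, ∀ a v : ℕ, winCard X (ε * a) (c a - L * v) ((m * L : ℕ) : ℤ)
      ((K * L : ℕ) : ℤ) = b a v := ⟨_, fun _ _ => rfl⟩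
  simp only [hb] at h1 ⊢
  have h2 : ∀ a v, z ^ 2 * (b a v / z + 2) ^ 2 ≤ 2 * b a v ^ 2 + 8 * z ^ 2 := fun a v => by
    have h3 := Nat.div_mul_le_self (b a v) z
    have h4 : (b a v / z * z) ^ 2 ≤ b a v ^ 2 := Nat.pow_le_pow_left h3 2
    have h5 : (b a v / z + 2) ^ 2 ≤ 2 * (b a v / z) ^ 2 + 8 := by
      generalize b a v / z = t
      zify
      nlinarith [sq_nonneg ((t : ℤ) - 2)]
    calc _ ≤ z ^ 2 * (2 * (b a v / z) ^ 2 + 8) := Nat.mul_le_mul_left _ h5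
      _ = 2 * (b a v / z * z) ^ 2 + 8 * z ^ 2 := by ring
      _ ≤ _ := by omega
  have h6 : z ^ 2 * ∑ a ∈ Finset.range (m * L), ∑ v ∈ Finset.range m, (b a v / z + 2) ^ 2 ≤
      2 * (K * (X.card * (m * L) + X.card ^ 2 * (12 * K * L))) + m * L * (m * (8 * z ^ 2)) := by
    calc _ ≤ ∑ a ∈ Finset.range (m * L), ∑ v ∈ Finset.range m, (2 * b a v ^ 2 + 8 * z ^ 2) := by
          simp only [Finset.mul_sum]
          exact Finset.sum_le_sum fun a _ => Finset.sum_le_sum fun v _ => h2 a v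
      _ = 2 * ∑ a ∈ Finset.range (m * L), ∑ v ∈ Finset.range m, b a v ^ 2 +
          m * L * (m * (8 * z ^ 2)) := by
          simp only [Finset.sum_add_distrib, Finset.sum_const, Finset.card_range, smul_eq_mul,
            ← Finset.mul_sum]
      _ ≤ _ := by omega
  have h7 : X.card * (m * L) + X.card ^ 2 * (12 * K * L) ≤ 13 * K * m ^ 2 * L * z ^ 2 := by
    have e1 : X.card * (m * L) ≤ m * z * (m * L) := Nat.mul_le_mul_right _ hXc
    have e2 : X.card ^ 2 * (12 * K * L) ≤ (m * z) ^ 2 * (12 * K * L) :=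
      Nat.mul_le_mul_right _ (Nat.pow_le_pow_left hXc 2)
    have e3 : m * z * (m * L) ≤ K * m ^ 2 * L * z ^ 2 := by
      calc m * z * (m * L) = (m ^ 2 * L) * (1 * z) := by ring
        _ ≤ (m ^ 2 * L) * (K * z ^ 2) := Nat.mul_le_mul_left _
          (Nat.mul_le_mul hK (Nat.le_self_pow (by omega) z))
        _ = _ := by ring
    nlinarith
  have h8 : z ^ 2 * ∑ a ∈ Finset.range (m * L), ∑ v ∈ Finset.range m, (b a v / z + 2) ^ 2 ≤
      z ^ 2 * (m * L * ((26 * K ^ 2 + 8) * m)) := by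
    have := Nat.mul_le_mul_left K h7
    nlinarith
  exact Nat.le_of_mul_le_mul_left h8 (pow_pos hz 2)

end

theorem sum_range_periodic {g : ℕ → ℕ} {m : ℕ} (hg : ∀ u, g (u + m) = g u) (u : ℕ) :
    ∑ v ∈ Finset.range m, g (u + v) = ∑ v ∈ Finset.range m, g v := by
  induction u with
  | zero => simp
  | succ u ih =>
    rw [← ih]
    have h1 := Finset.sum_range_succ (fun v => g (u + v)) m
    have h2 := Finset.sum_range_succ' (fun v => g (u + v)) m
    simp only [hg, add_zero] at h1 h2
    have h3 : ∀ v, u + 1 + v = u + (v + 1) := fun v => by omega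
    simp only [h3]
    omega

end KSumRam

namespace KSumRam

/-! ### Reducing large virtual arrays to chunks by linear hashing -/

/-- The window registers of stage `r` of the reduction of `K` arrays. -/
def redWin (d K r : ℕ) : WinVars :=
  ⟨(d + K, if r = 0 then 6 else 7), (d + r, 2), (d + K, 1), (d + K, 3), (d + r, 3), (d + K, 0)⟩

/-- The stages `r, …, 0`: choose windows of the arrays, and call `prog` on all tuples of chunks. -/
def nest (d K : ℕ) (src : ℕ → Expr) (tv : Var) (prog : Cmd) : ℕ → Cmd
  | 0 => .seq (.assign (d, 2) (.var (d + K, 7) * .var tv - .var (d + 1, 4)))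
      (chunkLoop d (src 0) (redWin d K 0) prog)
  | r + 1 => .for (d + (r + 1), 1) (.var (d + K, 0))
      (.seq (.seq (.assign (d + (r + 1), 2) (.const 0 - .var (d + K, 2) * .var (d + (r + 1), 1)))
        (.assign (d + (r + 1), 4) (.var (d + (r + 2), 4) + .var (d + K, 2) * .var (d + (r + 1), 1))))
        (chunkLoop (d + (r + 1)) (src (r + 1)) (redWin d K (r + 1)) (nest d K src tv prog r)))

/-- A solution with given chunks for the arrays after `r`. -/
def Pick (d K N z : ℕ) (V : ℕ → ℕ → ℤ) (t : ℤ) (r : ℕ) (s : St) (x : ℕ → ℤ) : Prop :=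
  ∑ i ∈ Finset.range K, x i = t ∧ (∀ i ≤ r, ∃ j < N, V i j = x i) ∧
    ∀ i, r < i → i < K → ∃ j < z, s.a (d + i, 0) j = x i

/-- The hash values of the chosen entries after `r` are close to their windows. -/
def HashOk (K m L a r u : ℕ) (x : ℕ → ℤ) : Prop :=
  (a * ∑ i ∈ Finset.Ico (r + 1) K, x i - L * u) % ((m * L : ℕ) : ℤ) + (r + 1) * (L - 1) ≤
    K * ((L : ℤ) - 1)

/-- The witness is `v = ⌊(a x mod Q) / L⌋`. It leaves a rounding error of at most `L - 1`, and
`HashOk` provides a budget of `L - 1` for each of the `K` arrays. -/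
theorem HashOk.step {K m L a r u : ℕ} {x : ℕ → ℤ} (hL : 1 ≤ L) (hm : 1 ≤ m) (hr : r + 1 < K)
    (h : HashOk K m L a (r + 1) u x) : ∃ v < m, (a * x (r + 1) - L * v) % ((m * L : ℕ) : ℤ) <
      ((K * L : ℕ) : ℤ) ∧ HashOk K m L a r (u + v) x := by
  have hL' : (0 : ℤ) < L := by exact_mod_cast hL
  have hQ : (0 : ℤ) < ((m * L : ℕ) : ℤ) := by exact_mod_cast Nat.mul_pos hm hL
  set y := (a : ℤ) * x (r + 1) with hy
  have h0 := Int.emod_nonneg y hQ.ne'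
  have h1 := Int.emod_lt_of_pos y hQ
  have hq := Int.mul_ediv_add_emod y ((m * L : ℕ) : ℤ)
  have hv0 := Int.ediv_nonneg h0 hL'.le
  have hv1 : y % ((m * L : ℕ) : ℤ) / L < m := by
    rw [Int.ediv_lt_iff_lt_mul hL']
    push_cast at h1 ⊢
    exact h1
  obtain ⟨v, hv⟩ := Int.eq_ofNat_of_zero_le hv0
  have hdm := Int.mul_ediv_add_emod (y % ((m * L : ℕ) : ℤ)) L
  have l0 := Int.emod_nonneg (y % ((m * L : ℕ) : ℤ)) hL'.ne'
  have l1 := Int.emod_lt_of_pos (y % ((m * L : ℕ) : ℤ)) hL'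
  rw [hv] at hdm hv1
  have hLQ : (L : ℤ) ≤ ((m * L : ℕ) : ℤ) := by exact_mod_cast Nat.le_mul_of_pos_left L hm
  have hLK : (L : ℤ) ≤ ((K * L : ℕ) : ℤ) := by exact_mod_cast Nat.le_mul_of_pos_left L (by omega)
  have hρ : (y - L * v) % ((m * L : ℕ) : ℤ) = y % ((m * L : ℕ) : ℤ) % L := by
    have : y - L * v = y % ((m * L : ℕ) : ℤ) % L + ((m * L : ℕ) : ℤ) * (y / ((m * L : ℕ) : ℤ)) := by
      linarith
    rw [this, Int.add_mul_emod_self_left, Int.emod_eq_of_lt l0 (by omega)]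
  refine ⟨v, by omega, by omega, ?_⟩
  unfold HashOk at h ⊢
  rw [Finset.sum_eq_sum_Ico_succ_bot hr]
  set A := (a : ℤ) * ∑ i ∈ Finset.Ico (r + 1 + 1) K, x i - L * u with hA
  have e : (a : ℤ) * (x (r + 1) + ∑ k ∈ Finset.Ico (r + 1 + 1) K, x k) - L * ((u + v : ℕ) : ℤ) =
      A + (y - L * v) := by
    rw [hA, hy]; push_cast; ring
  rw [e]
  have hle : (A + (y - L * v)) % ((m * L : ℕ) : ℤ) ≤
      A % ((m * L : ℕ) : ℤ) + (y - L * v) % ((m * L : ℕ) : ℤ) := by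
    rw [Int.add_emod]
    have h5 := add_nonneg (Int.emod_nonneg A hQ.ne') (Int.emod_nonneg (y - L * v) hQ.ne')
    have h6 := mul_nonneg hQ.le (Int.ediv_nonneg h5 hQ.le)
    have h7 := Int.mul_ediv_add_emod (A % ((m * L : ℕ) : ℤ) + (y - L * v) % ((m * L : ℕ) : ℤ))
      ((m * L : ℕ) : ℤ)
    linarith
  push_cast at h hle ⊢
  push_cast at hρ l1
  linarith

/-- The number of chunks of window `u` of array `r`, plus `1`. -/
def numChunks (K m L z N a : ℕ) (t : ℤ) (V : ℕ → ℕ → ℤ) (r u : ℕ) : ℕ :=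
  winCard ((Finset.range N).image (V r)) (if r = 0 then (-a : ℤ) else a)
    ((if r = 0 then a * t else 0) - L * u) ((m * L : ℕ) : ℤ) ((K * L : ℕ) : ℤ) / z + 2

/-- The cost of `nest`, where `X` is the cost of extracting a chunk, and `T` that of `prog`. -/
def nestCost (m X T : ℕ) (β : ℕ → ℕ → ℕ) : ℕ → ℕ → ℕ
  | 0, u => β 0 u * (X + T) + 80
  | r + 1, u => ∑ v ∈ Finset.range m, (β (r + 1) v * (X + nestCost m X T β r (u + v)) + 130) + 30

section
variable {k n : ℕ} {E : Env k n}

/-- The static data of a reduction: `K` virtual arrays `V` of `m` blocks of length `z`. -/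
structure RedCtx (E : Env k n) (z lg : ℕ) (inf : ℤ) (d K m L a S : ℕ) (t : ℤ) (src : ℕ → Expr)
    (V : ℕ → ℕ → ℤ) (tv : Var) (s₀ : St) : Prop where
  dim : Dim E z lg inf
  glob : Glob z inf s₀
  d3 : 3 ≤ d
  m1 : 1 ≤ m
  L1 : 1 ≤ L
  mzB : (m * z : ℤ) ≤ E.B
  vm : s₀.v (d + K, 0) = m
  vQ : s₀.v (d + K, 1) = (m * L : ℕ)
  vL : s₀.v (d + K, 2) = L
  vW : s₀.v (d + K, 3) = (K * L : ℕ)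
  vna : s₀.v (d + K, 6) = -a
  va : s₀.v (d + K, 7) = a
  vt : s₀.v tv = t
  tvP : Prot (d + K) tv
  srcE : ∀ r < K, ∀ s', Frm (d + K) s₀ s' → ∀ j < m * z, s'.v (2, 3) = j → (src r).eval E.x s' = V r j
  bnd : ∀ r < K, ∀ j < m * z, |V r j| < inf
  leB : |a * t| + (K * m * L : ℕ) ≤ E.B
  cost : ∀ r < K, (src r).cost ≤ S

theorem RedCtx.chunk {z lg d K m L a S : ℕ} {inf t : ℤ} {src : ℕ → Expr} {V : ℕ → ℕ → ℤ} {tv : Var}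
    {s₀ s : St} {r T : ℕ} {body : Cmd} {must may : ℤ → Prop}
    (h : RedCtx E z lg inf d K m L a S t src V tv s₀) (hr : r < K) (hs : Frm (d + K) s₀ s)
    {c : ℤ} (hc : s.v (d + r, 2) = c) (hF : s.v gF = 0 ∨ s.v gF = 1)
    (hbody : ∀ s1, OwnFrm (d + r) s s1 → (s1.v gF = 0 ∨ s1.v gF = 1) →
      (∀ j < z, ∃ l < m * z, V r l = s1.a (d + r, 0) j) →
      (∀ i j, i ≤ j → j < z → s1.a (d + r, 0) i ≤ s1.a (d + r, 0) j) →
      Run E s1 body T (fun s2 => Frm (d + r) s1 s2 ∧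
        Flag s1 s2 (∃ j < z, must (s1.a (d + r, 0) j)) (∃ j < z, may (s1.a (d + r, 0) j)))) :
    Run E s (chunkLoop (d + r) (src r) (redWin d K r) body)
      ((winCard ((Finset.range (m * z)).image (V r)) (if r = 0 then (-a : ℤ) else a) c ((m * L : ℕ) : ℤ)
        ((K * L : ℕ) : ℤ) / z + 2) * ((S + 4100) * (m * z) * (lg + 1) + T) + 40)
      (fun s' => OwnFrm (d + r) s s' ∧ Flag s s'
        (∃ j < m * z, ((if r = 0 then (-a : ℤ) else a) * V r j + c) % ((m * L : ℕ) : ℤ) < ((K * L : ℕ) : ℤ) ∧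
          must (V r j)) (∃ j < m * z, may (V r j))) := by
  have hP : ∀ i, Prot (d + K) (d + K, i) := fun i => Or.inr ⟨by have := h.d3; simp; omega, le_rfl⟩
  have hP' : ∀ i, Prot (d + r + 1) (d + K, i) := fun i =>
    Or.inr ⟨by have := h.d3; simp; omega, by simp; omega⟩
  have hp : s.v (redWin d K r).p = if r = 0 then (-a : ℤ) else a := by
    simp only [redWin]
    split_ifs
    · rw [hs.v _ (hP _), h.vna]
    · rw [hs.v _ (hP _), h.va]
  have hmem : ∀ y, y ∈ fullWin (redWin d K r) s (V r) (m * z) ↔ (∃ i < m * z, V r i = y) ∧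
      ((if r = 0 then (-a : ℤ) else a) * y + c) % ((m * L : ℕ) : ℤ) < ((K * L : ℕ) : ℤ) := fun y => by
    rw [mem_fullWin, hp]
    simp only [redWin, hc, hs.v _ (hP _), h.vQ, h.vW]
  have hcard : (fullWin (redWin d K r) s (V r) (m * z)).card =
      winCard ((Finset.range (m * z)).image (V r)) (if r = 0 then (-a : ℤ) else a) c ((m * L : ℕ) : ℤ)
        ((K * L : ℕ) : ℤ) := by
    rw [fullWin, winCard, hp]
    simp only [redWin, hc, hs.v _ (hP _), h.vQ, h.vW]
  refine (chunkLoop_run (w := redWin d K r) (V := V r) (must := must) (may := may) h.dim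
    (h.glob.frm hs) (by have := h.d3; omega) (hP' _) (hP' _) (hP' _) (hP' _) rfl rfl
    (fun s' hs' => h.srcE r hr s' (hs.trans (hs'.mono (by omega)))) (h.bnd r hr) h.mzB
    ((hs.v _ (hP _)).trans h.vm) h.m1 hF (fun s1 e1 e2 e3 e4 => hbody s1 e1 e2
      (fun j hj => ((hmem _).1 (e3 j hj)).1) e4)).mono ?_ ?_
  · rw [hcard]
    gcongr
    exact h.cost r hr
  · rintro s' ⟨h1, h2⟩
    refine ⟨h1, h2.mono ?_ ?_⟩
    · rintro ⟨j, hj, h3, h4⟩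
      exact ⟨_, (hmem _).2 ⟨⟨j, hj, rfl⟩, h3⟩, h4⟩
    · rintro ⟨x, hx, h3⟩
      obtain ⟨⟨j, hj, rfl⟩, -⟩ := (hmem _).1 hx
      exact ⟨j, hj, h3⟩

/-- The arrays `i` with `r < i < K` hold sorted chunks of the virtual arrays. -/
def Chunks (d K N z : ℕ) (V : ℕ → ℕ → ℤ) (r : ℕ) (s : St) : Prop :=
  ∀ i, r ≤ i → i < K → (∀ j < z, ∃ l < N, V i l = s.a (d + i, 0) j) ∧
    ∀ p q, p ≤ q → q < z → s.a (d + i, 0) p ≤ s.a (d + i, 0) q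

theorem Chunks.cons {d K N z r : ℕ} {V : ℕ → ℕ → ℤ} {s s' : St}
    (h : Chunks d K N z V (r + 1) s) (hs : OwnFrm (d + r) s s')
    (h1 : ∀ j < z, ∃ l < N, V r l = s'.a (d + r, 0) j)
    (h2 : ∀ i j, i ≤ j → j < z → s'.a (d + r, 0) i ≤ s'.a (d + r, 0) j) : Chunks d K N z V r s' := by
  intro i hi hiK
  by_cases hir : i = r
  · subst hir; exact ⟨h1, h2⟩
  · rw [hs.frm.a (d + i, 0) (Or.inr (by simp; omega))]
    exact h i (by omega) hiK

theorem Chunks.frm {d K N z r : ℕ} {V : ℕ → ℕ → ℤ} {s s' : St}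
    (h : Chunks d K N z V r s) (hs : Frm (d + r) s s') : Chunks d K N z V r s' := by
  intro i hi hiK
  rw [hs.a (d + i, 0) (Or.inr (by simp; omega))]
  exact h i hi hiK

/-- Induction on the stages. A solution is certain to be found along the windows containing the hash
values of its entries, which `HashOk` tracks. Soundness needs no hashing: `prog` reports only sums
equal to `t`, and the chunks contain only entries of the virtual arrays. The hypothesis on `u` keeps
the accumulated shift `L u` within `K m L`. -/
theorem nest_run {z lg d K m L a S T : ℕ} {inf t : ℤ} {src : ℕ → Expr} {V : ℕ → ℕ → ℤ} {tv : Var}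
    {s₀ : St} {prog : Cmd} (h : RedCtx E z lg inf d K m L a S t src V tv s₀)
    (hprog : ∀ s, Frm (d + K) s₀ s → (s.v gF = 0 ∨ s.v gF = 1) → Chunks d K (m * z) z V 0 s →
      Run E s prog T (fun s' => Frm d s s' ∧ Flag s s'
        (∃ x : ℕ → ℤ, ∑ i ∈ Finset.range K, x i = t ∧ ∀ i < K, ∃ j < z, s.a (d + i, 0) j = x i)
        (∃ x : ℕ → ℤ, ∑ i ∈ Finset.range K, x i = t ∧ ∀ i < K, ∃ j < z, s.a (d + i, 0) j = x i)))
    (r : ℕ) (hr : r < K) {s : St} {u : ℕ} (hs : Frm (d + K) s₀ s) (hF : s.v gF = 0 ∨ s.v gF = 1)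
    (hU : s.v (d + (r + 1), 4) = L * u) (hu : u + (r + 1) * m ≤ K * m)
    (hch : Chunks d K (m * z) z V (r + 1) s) :
    Run E s (nest d K src tv prog r) (nestCost m ((S + 4100) * (m * z) * (lg + 1)) T
      (numChunks K m L z (m * z) a t V) r u) (fun s' => Frm (d + r + 1) s s' ∧
        Flag s s' (∃ x, Pick d K (m * z) z V t r s x ∧ HashOk K m L a r u x)
          (∃ x, Pick d K (m * z) z V t r s x)) := by
  have hd3 := h.d3
  have hm1 := h.m1
  have hL1 := h.L1
  have hQ : (0 : ℤ) < ((m * L : ℕ) : ℤ) := by exact_mod_cast Nat.mul_pos hm1 hL1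
  have hP : ∀ i, Prot (d + K) (d + K, i) := fun i => Or.inr ⟨by simp; omega, le_rfl⟩
  have hLu : ∀ w : ℕ, w ≤ K * m → (L : ℤ) * w ≤ (K * m * L : ℕ) := fun w hw => by
    have := Nat.mul_le_mul_right L hw
    push_cast
    rw [mul_comm (L : ℤ)]
    exact_mod_cast this
  induction r generalizing s u with
  | zero =>
    simp only [nest, nestCost]
    set c := (a : ℤ) * t - L * u with hc
    have he : (Expr.var (d + K, 7) * .var tv - .var (d + 1, 4)).eval E.x s = c := by
      simp only [Expr.eval_sub, Expr.eval_mul, Expr.eval_var, hs.v _ (hP _), hs.v _ h.tvP, h.va, h.vt]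
      rw [show s.v (d + 1, 4) = L * u from hU]
    refine (Run.seq (Run.assign (Q := fun s' => s' = s.setV (d, 2) c) ?_ (by rw [he]))
      (u := numChunks K m L z (m * z) a t V 0 u * ((S + 4100) * (m * z) * (lg + 1) + T) + 40)
      ?_).mono ?_ fun _ h => h
    · rw [he, hc]
      have := hLu u (by omega)
      have h1 := h.leB
      refine (abs_sub _ _).trans ?_
      rw [abs_of_nonneg (a := (L : ℤ) * u) (by positivity)]
      omega
    · rintro s1 rfl
      set s1 := s.setV (d, 2) c with hs1
      have hfr : Frm (d + 1) s s1 := (Frm.refl _ _).setV (by simp [Prot]) _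
      have hF1 : s1.v gF = s.v gF := by
        rw [hs1, St.setV_v, if_neg]; simp [gF]; omega
      refine (h.chunk (r := 0) (c := c) (must := fun y => ∃ x, x 0 = y ∧ Pick d K (m * z) z V t 0 s x)
        (may := fun y => ∃ x, x 0 = y ∧ Pick d K (m * z) z V t 0 s x) hr
        (hs.trans (hfr.mono (by omega))) (by simp [hs1]) (hF1 ▸ hF) ?_).mono le_rfl ?_
      · intro s2 e1 e2 e3 e4
        have hfr2 : Frm (d + 1) s s2 := hfr.trans e1.frm
        refine (hprog s2 (hs.trans (hfr2.mono (by omega))) e2 ((hch.frm hfr).cons e1 e3 e4)).mono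
          le_rfl ?_
        have haa : ∀ i, 0 < i → i < K → s2.a (d + i, 0) = s.a (d + i, 0) := fun i hi _ =>
          hfr2.a _ (Or.inr (by simp; omega))
        have hiff : ∀ {x : ℕ → ℤ} {j : ℕ}, x 0 = s2.a (d + 0, 0) j → j < z → Pick d K (m * z) z V t 0 s x →
            ∑ i ∈ Finset.range K, x i = t ∧ ∀ i < K, ∃ j < z, s2.a (d + i, 0) j = x i := by
          intro x j hx hj hp
          refine ⟨hp.1, fun i hi => ?_⟩
          rcases Nat.eq_zero_or_pos i with rfl | hi0
          · exact ⟨j, hj, hx.symm⟩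
          · rw [haa i hi0 hi]
            exact hp.2.2 i hi0 hi
        rintro s3 ⟨f1, f2⟩
        refine ⟨f1, f2.mono ?_ ?_⟩
        · rintro ⟨j, hj, x, hx, hp⟩
          exact ⟨x, hiff hx hj hp⟩
        · rintro ⟨x, hx, hx'⟩
          obtain ⟨j, hj, hj'⟩ := hx' 0 hr
          refine ⟨j, hj, x, hj'.symm, hx, fun i hi => ?_, fun i hi hiK => ?_⟩
          · obtain rfl : i = 0 := by omega
            obtain ⟨l, hl, hl'⟩ := e3 j hj
            exact ⟨l, hl, hl'.trans hj'⟩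
          · rw [← haa i hi hiK]
            exact hx' i hiK
      · rintro s2 ⟨f1, f2⟩
        have hfl : Flag s s1 False False := Flag.refl hF hF1
        refine ⟨hfr.trans f1.frm, (hfl.trans f2).mono ?_ ?_⟩
        · rintro ⟨x, hp, hh⟩
          obtain ⟨j, hj, hjx⟩ := hp.2.1 0 le_rfl
          refine Or.inr ⟨j, hj, ?_, x, hjx.symm, hp⟩
          unfold HashOk at hh
          -- Since `x 0` is `t` minus the other entries, the accumulated hash becomes the affine
          -- test for array `0`. For `r = 0`, `HashOk` bounds it by `(K - 1) (L - 1)`, which is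
          -- below the window width `K L`.
          have e : (a : ℤ) * ∑ i ∈ Finset.Ico (0 + 1) K, x i - L * u = -a * V 0 j + c := by
            have := hp.1
            rw [Finset.range_eq_Ico, Finset.sum_eq_sum_Ico_succ_bot hr] at this
            rw [hc, hjx, ← this]; ring
          rw [e] at hh
          simp only [if_true]
          push_cast at hh ⊢
          have : (K : ℤ) * (L - 1) ≤ K * L := by nlinarith
          have hK0 : (1 : ℤ) ≤ K := by omega
          have hL0 : (1 : ℤ) ≤ L := by omega
          nlinarith
        · rintro (h' | ⟨j, hj, x, hx, hp⟩)
          · exact h'.elim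
          · exact ⟨x, hp⟩
    · simp; omega
  | succ r ih =>
    simp only [nest, nestCost]
    set X := (S + 4100) * (m * z) * (lg + 1) with hX
    set β := numChunks K m L z (m * z) a t V with hβ
    have hne : gF ≠ (d + (r + 1), 1) ∧ gF ≠ (d + (r + 1), 2) ∧ gF ≠ (d + (r + 1), 4) := by
      simp [gF]
    have hmKm : m ≤ K * m := Nat.le_mul_of_pos_left m (by omega)
    have hmB : (m : ℤ) ≤ E.B := by
      have h1 := h.leB
      have h2 : m * 1 ≤ K * m * L := Nat.mul_le_mul hmKm hL1
      have h3 := abs_nonneg ((a : ℤ) * t)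
      have h4 : (m : ℤ) ≤ (K * m * L : ℕ) := by exact_mod_cast (by omega : m ≤ K * m * L)
      omega
    -- The cost depends on the window `v`; only the sum over all windows is controlled later.
    refine (Run.for_sum (m := m) (t := fun v => β (r + 1) v * (X + nestCost m X T β r (u + v)) + 100)
      (fun v s' => s'.v (d + (r + 1), 1) = v ∧ Frm (d + (r + 1) + 1) s s' ∧
        Flag s s' (∃ v' < v, ∃ x, Pick d K (m * z) z V t (r + 1) s x ∧
          (a * x (r + 1) - L * v') % ((m * L : ℕ) : ℤ) < ((K * L : ℕ) : ℤ) ∧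
          HashOk K m L a r (u + v') x) (∃ x, Pick d K (m * z) z V t (r + 1) s x))
      hmB ?_ ?_ ?_ ?_).mono ?_ fun _ h => h
    · refine ⟨by simp, (Frm.refl _ _).setV (by simp [Prot]) _,
        (Flag.refl hF (by simp [hne])).mono ?_ False.elim⟩
      rintro ⟨v', hv', -⟩
      omega
    · rintro v s' hv ⟨h1, h2, -⟩
      exact ⟨h1, by simp [(hs.trans (h2.mono (by omega))).v _ (hP _), h.vm]⟩
    · rintro v s' hv ⟨h1, h2, h3⟩
      have hs' := hs.trans (h2.mono (show d + (r + 1) + 1 ≤ d + K by omega))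
      have hU' : s'.v (d + (r + 2), 4) = L * u := by
        rw [h2.v _ (Or.inr ⟨by simp, by simp⟩)]; exact hU
      have hLv := hLu v (by omega)
      have huv : (u + v) + (r + 1) * m ≤ K * m := by
        have : (r + 1 + 1) * m = (r + 1) * m + m := by ring
        omega
      have hLuv := hLu (u + v) (by omega)
      have habs := abs_nonneg ((a : ℤ) * t)
      have hleB := h.leB
      set s1 := (s'.setV (d + (r + 1), 2) (0 - L * v)).setV (d + (r + 1), 4) (L * (u + v : ℕ)) with hs1
      refine (Run.seq (t := 50) (R := fun s2 => s2 = s1) ?_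
        (u := β (r + 1) v * (X + nestCost m X T β r (u + v)) + 40) ?_).mono (by omega) fun _ h => h
      · refine (Run.straight ?_ ?_).mono (?_ : _ ≤ 50) fun _ h => h
        · simp only [Cmd.Ok, Cmd.exec, Expr.eval_sub, Expr.eval_add, Expr.eval_mul, Expr.eval_var,
            Expr.eval_const, St.setV_v, hs'.v _ (hP _), h.vL, h1]
          have hn1 : ((d + (r + 2), 4) : Var) ≠ (d + (r + 1), 2) := by simp
          have hn2 : ((d + K, 2) : Var) ≠ (d + (r + 1), 2) := by simp; omega
          have hn3 : ((d + (r + 1), 1) : Var) ≠ (d + (r + 1), 2) := by simp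
          rw [if_neg hn1, if_neg hn2, if_neg hn3, hU']
          have e0 : (0 : ℤ) ≤ L * v := by positivity
          have e1 : (0 : ℤ) ≤ L * u := by positivity
          have e2 : (L : ℤ) * (u + v : ℕ) = L * u + L * v := by push_cast; ring
          rw [e2] at hLuv
          rw [zero_sub, abs_neg, abs_of_nonneg e0, abs_of_nonneg (by omega)]
          omega
        · simp only [Cmd.exec, Expr.eval_sub, Expr.eval_add, Expr.eval_mul, Expr.eval_var,
            Expr.eval_const, St.setV_v, hs'.v _ (hP _), h.vL, h1]
          have hn1 : ((d + (r + 2), 4) : Var) ≠ (d + (r + 1), 2) := by simp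
          have hn2 : ((d + K, 2) : Var) ≠ (d + (r + 1), 2) := by simp; omega
          have hn3 : ((d + (r + 1), 1) : Var) ≠ (d + (r + 1), 2) := by simp
          rw [if_neg hn1, if_neg hn2, if_neg hn3, hU', hs1]
          congr 1
          push_cast; ring
        · simp [Cmd.cost]
      rintro _ rfl
      have hfr : Frm (d + (r + 1) + 1) s' s1 :=
        ((Frm.refl _ _).setV (by simp [Prot]) _).setV (by simp [Prot]) _
      have hF1 : s1.v gF = s'.v gF := by simp [hs1, hne]
      have hss1 : Frm (d + (r + 1) + 1) s s1 := h2.trans hfr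
      refine (h.chunk (r := r + 1) (c := 0 - L * v) (T := nestCost m X T β r (u + v))
        (must := fun y => ∃ x, x (r + 1) = y ∧ Pick d K (m * z) z V t (r + 1) s x ∧
          HashOk K m L a r (u + v) x)
        (may := fun y => ∃ x, x (r + 1) = y ∧ Pick d K (m * z) z V t (r + 1) s x) hr
        (hs.trans (hss1.mono (by omega))) (by simp [hs1]) (hF1 ▸ h3.bool) ?_).mono ?_ ?_
      · intro s2 e1 e2 e3 e4
        have hfr2 : Frm (d + (r + 1) + 1) s s2 := hss1.trans e1.frm
        refine (ih (by omega) (u := u + v) (hs.trans (hfr2.mono (by omega))) e2 ?_ huv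
          ((hch.frm hss1).cons e1 e3 e4)).mono le_rfl ?_
        · rw [e1.own 4 (by omega) (by omega)]
          simp [hs1]
        · have haa : ∀ i, r + 1 < i → i < K → s2.a (d + i, 0) = s.a (d + i, 0) := fun i hi _ =>
            hfr2.a _ (Or.inr (by simp; omega))
          rintro s3 ⟨f1, f2⟩
          refine ⟨f1, f2.mono ?_ ?_⟩
          · rintro ⟨j, hj, x, hx, hp, hh⟩
            refine ⟨x, ⟨hp.1, fun i hi => hp.2.1 i (by omega), fun i hi hiK => ?_⟩, hh⟩
            by_cases hir : i = r + 1
            · subst hir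
              exact ⟨j, hj, hx.symm⟩
            · rw [haa i (by omega) hiK]
              exact hp.2.2 i (by omega) hiK
          · rintro ⟨x, hp⟩
            obtain ⟨j, hj, hj'⟩ := hp.2.2 (r + 1) (by omega) hr
            refine ⟨j, hj, x, hj'.symm, hp.1, fun i hi => ?_, fun i hi hiK => ?_⟩
            · by_cases hir : i = r + 1
              · subst hir
                obtain ⟨l, hl, hl'⟩ := e3 j hj
                exact ⟨l, hl, hl'.trans hj'⟩
              · exact hp.2.1 i (by omega)
            · rw [← haa i hi hiK]
              exact hp.2.2 i (by omega) hiK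
      · have : numChunks K m L z (m * z) a t V (r + 1) v = winCard (Finset.image (V (r + 1))
            (Finset.range (m * z))) (if r + 1 = 0 then (-a : ℤ) else a) (0 - L * v) ((m * L : ℕ) : ℤ)
            ((K * L : ℕ) : ℤ) / z + 2 := by
          simp [numChunks]
        rw [hβ, this]
      · rintro s2 ⟨f1, f2⟩
        have hfl : Flag s' s1 False False := Flag.refl h3.bool hF1
        have hfr2 : Frm (d + (r + 1) + 1) s s2 := hss1.trans f1.frm
        refine ⟨?_, by simp, hfr2.setV (by simp [Prot]) _, ?_⟩
        · rw [f1.own 1 (by omega) (by omega)]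
          simp [hs1, h1]
        · have hfl2 : Flag s2 (s2.setV (d + (r + 1), 1) (v + 1)) False False :=
            Flag.refl f2.bool (by simp [hne])
          refine (h3.trans ((hfl.trans f2).trans hfl2)).mono ?_ ?_
          · rintro ⟨v', hv', x, hp, hw, hh⟩
            by_cases hvv : v' < v
            · exact Or.inl ⟨v', hvv, x, hp, hw, hh⟩
            · obtain rfl : v' = v := by omega
              obtain ⟨j, hj, hjx⟩ := hp.2.1 (r + 1) le_rfl
              refine Or.inr (Or.inl (Or.inr ⟨j, hj, ?_, x, hjx.symm, hp, hh⟩))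
              rw [hjx, if_neg (by omega)]
              convert hw using 2
              ring
          · rintro (h' | (h' | ⟨j, hj, x, hx, hp⟩) | h')
            · exact h'
            · exact h'.elim
            · exact ⟨x, hp⟩
            · exact h'.elim
    · rintro s' ⟨h1, h2, h3⟩
      refine ⟨h2, h3.mono ?_ id⟩
      rintro ⟨x, hp, hh⟩
      obtain ⟨v, hv, hw, hh'⟩ := hh.step hL1 hm1 hr
      exact ⟨v, hv, x, hp, hw, hh'⟩
    · simp only [Expr.cost_var]
      refine Nat.add_le_add (Finset.sum_le_sum fun v _ => ?_) (by omega)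
      omega

end

end KSumRam

namespace KSumRam

/-! ### The expected cost of the reduction -/

/-- Both factors of `β 1 v * β 0 (u + v)` depend on the same multiplier. Bounding the product by
squares separates them, and periodicity removes `u` from the sum over all windows. -/
theorem nestCost_one_le {m X T u : ℕ} {β : ℕ → ℕ → ℕ} (hm : 1 ≤ m) (hβ : ∀ r u, 2 ≤ β r u)
    (h0 : ∀ u, β 0 (u + m) = β 0 u) :
    nestCost m X T β 1 u ≤ 2 * (X + T + 130) *
      (∑ v ∈ Finset.range m, β 1 v ^ 2 + ∑ v ∈ Finset.range m, β 0 v ^ 2) := by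
  obtain ⟨H, hH⟩ : ∃ H, X + T + 130 = H := ⟨_, rfl⟩
  rw [hH]
  have h1 : ∀ v, β 1 v * (X + nestCost m X T β 0 (u + v)) + 130 ≤ H * (β 1 v ^ 2 + β 0 (u + v) ^ 2) := by
    intro v
    simp only [nestCost]
    have e0 := hβ 1 v
    have e1 := hβ 0 (u + v)
    generalize β 1 v = p at *
    generalize β 0 (u + v) = q at *
    have e2 : X + (q * (X + T) + 80) ≤ (q + 1) * H := by
      have : q * (X + T) ≤ q * H := Nat.mul_le_mul_left _ (by omega)
      rw [add_mul]; omega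
    have e3 : p * (X + (q * (X + T) + 80)) + 130 ≤ p * ((q + 1) * H) + H := by
      have := Nat.mul_le_mul_left p e2
      omega
    refine e3.trans ?_
    -- Holds for `p, q ≥ 2`; the summand `2` in the number of chunks thus also pays for the overhead
    -- of a window.
    have e4 : p * (q + 1) + 1 ≤ p ^ 2 + q ^ 2 := by
      rcases le_total p q with h | h
      · obtain ⟨c, rfl⟩ := Nat.exists_eq_add_of_le h
        nlinarith
      · obtain ⟨c, rfl⟩ := Nat.exists_eq_add_of_le h
        nlinarith
    calc p * ((q + 1) * H) + H = H * (p * (q + 1) + 1) := by ring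
      _ ≤ _ := Nat.mul_le_mul_left _ e4
  have h2 : ∑ v ∈ Finset.range m, β 0 (u + v) ^ 2 = ∑ v ∈ Finset.range m, β 0 v ^ 2 :=
    sum_range_periodic (g := fun v => β 0 v ^ 2) (fun u => by simp only [h0]) u
  obtain ⟨Z, hZ⟩ : ∃ Z, ∑ v ∈ Finset.range m, β 1 v ^ 2 + ∑ v ∈ Finset.range m, β 0 v ^ 2 = Z := ⟨_, rfl⟩
  have hZ1 : 1 ≤ Z := by
    have : β 1 0 ^ 2 ≤ ∑ v ∈ Finset.range m, β 1 v ^ 2 :=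
      Finset.single_le_sum (f := fun v => β 1 v ^ 2) (fun _ _ => Nat.zero_le _)
        (Finset.mem_range.2 hm)
    have := Nat.pow_le_pow_left (hβ 1 0) 2
    omega
  have h3 : nestCost m X T β 1 u ≤ H * Z + 30 := by
    rw [nestCost, ← hZ, ← h2, ← Finset.sum_add_distrib, Finset.mul_sum]
    exact Nat.add_le_add_right (Finset.sum_le_sum fun v _ => h1 v) _
  rw [hZ]
  have : H * 1 ≤ H * Z := Nat.mul_le_mul_left _ hZ1
  rw [mul_assoc]
  omega

/-- Each further array multiplies the cost by at most `4 G`, where `G` bounds its total number of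
chunks for every multiplier. Only arrays `0` and `1` need second moments. -/
theorem nestCost_le {m X T G r u : ℕ} {β : ℕ → ℕ → ℕ} (hm : 1 ≤ m) (hβ : ∀ r u, 2 ≤ β r u)
    (h0 : ∀ u, β 0 (u + m) = β 0 u) (hG : 1 ≤ G)
    (hsum : ∀ i, 2 ≤ i → i ≤ r + 1 → ∑ v ∈ Finset.range m, β i v ≤ G) :
    nestCost m X T β (r + 1) u ≤ 2 * (X + T + 130) *
      (∑ v ∈ Finset.range m, β 1 v ^ 2 + ∑ v ∈ Finset.range m, β 0 v ^ 2) * (4 * G) ^ r := by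
  induction r generalizing u with
  | zero => simpa using nestCost_one_le hm hβ h0
  | succ r ih =>
    have ih' := fun u => ih (u := u) fun i h1 h2 => hsum i h1 (by omega)
    set Z := ∑ v ∈ Finset.range m, β 1 v ^ 2 + ∑ v ∈ Finset.range m, β 0 v ^ 2 with hZ
    set Y := 2 * (X + T + 130) * Z * (4 * G) ^ r with hY
    have hZ1 : 1 ≤ Z := by
      have : β 1 0 ^ 2 ≤ ∑ v ∈ Finset.range m, β 1 v ^ 2 :=
        Finset.single_le_sum (f := fun v => β 1 v ^ 2) (fun _ _ => Nat.zero_le _)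
          (Finset.mem_range.2 hm)
      have := Nat.pow_le_pow_left (hβ 1 0) 2
      omega
    have hYX : X + 130 ≤ Y := by
      have h1 : 1 ≤ (4 * G) ^ r := Nat.one_le_pow _ _ (by omega)
      calc X + 130 ≤ 2 * (X + T + 130) * 1 * 1 := by omega
        _ ≤ Y := Nat.mul_le_mul (Nat.mul_le_mul_left _ hZ1) h1
    rw [nestCost]
    calc _ ≤ ∑ v ∈ Finset.range m, β (r + 1 + 1) v * (3 * Y) + Y := by
          refine Nat.add_le_add (Finset.sum_le_sum fun v _ => ?_) (by omega)
          have h1 := ih' (u + v)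
          have h2 := hβ (r + 1 + 1) v
          have h3 := Nat.mul_le_mul_left (β (r + 1 + 1) v) (show X + nestCost m X T β (r + 1) (u + v) ≤ 2 * Y by omega)
          have h4 := Nat.mul_le_mul_right Y h2
          have h5 : β (r + 1 + 1) v * (3 * Y) = β (r + 1 + 1) v * (2 * Y) + β (r + 1 + 1) v * Y := by ring
          omega
      _ ≤ G * (3 * Y) + Y := by
          rw [← Finset.sum_mul]
          exact Nat.add_le_add_right (Nat.mul_le_mul_right _ (hsum _ (by omega) le_rfl)) _
      _ ≤ Y * (4 * G) := by nlinarith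
      _ = _ := by rw [hY, pow_succ]; ring

/-- The constant in the expected number of chunk tuples. -/
def redConst (K : ℕ) : ℕ := 4 * (26 * K ^ 2 + 8) * (4 * (K + 2)) ^ (K - 2)

theorem two_le_numChunks (K m L z N a : ℕ) (t : ℤ) (V : ℕ → ℕ → ℤ) (r u : ℕ) :
    2 ≤ numChunks K m L z N a t V r u := by simp [numChunks]

/-- The expectation over the multiplier, stated as a sum over its `m L` values. -/
theorem sum_nestCost_le {K m L z X T : ℕ} {t inf : ℤ} {V : ℕ → ℕ → ℤ} (hK : 2 ≤ K) (hz : 1 ≤ z)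
    (hm : 1 ≤ m) (hL : (L : ℤ) = 2 * inf + 1) (hV : ∀ r < K, ∀ j < m * z, |V r j| < inf) :
    ∑ a ∈ Finset.range (m * L), nestCost m X T (numChunks K m L z (m * z) a t V) (K - 1) 0 ≤
      m * L * (redConst K * m ^ (K - 1) * (X + T + 130)) := by
  obtain ⟨r, rfl⟩ : ∃ r, K = r + 2 := ⟨K - 2, by omega⟩
  have hinf : 0 < inf := by
    have := hV 0 (by omega) 0 (Nat.mul_pos hm hz)
    have := abs_nonneg (V 0 0)
    omega
  have hL1 : 0 < L := by omega
  have hX : ∀ r' < r + 2, ∀ x ∈ (Finset.range (m * z)).image (V r'),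
      ∀ y ∈ (Finset.range (m * z)).image (V r'), (x - y).natAbs ≤ L := by
    intro r' hr' x hx y hy
    obtain ⟨i, hi, rfl⟩ := Finset.mem_image.1 hx
    obtain ⟨j, hj, rfl⟩ := Finset.mem_image.1 hy
    have h1 := abs_lt.1 (hV r' hr' i (Finset.mem_range.1 hi))
    have h2 := abs_lt.1 (hV r' hr' j (Finset.mem_range.1 hj))
    omega
  have hXc : ∀ r', ((Finset.range (m * z)).image (V r')).card ≤ m * z := fun r' =>
    Finset.card_image_le.trans (by simp)
  -- Increasing `u` by `m` shifts the hash by the full modulus `m L`.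
  have hper : ∀ a u, numChunks (r + 2) m L z (m * z) a t V 0 (u + m) =
      numChunks (r + 2) m L z (m * z) a t V 0 u := by
    intro a u
    simp only [numChunks, winCard, if_true]
    congr 3
    refine Finset.filter_congr fun x _ => ?_
    have : (-a : ℤ) * x + (a * t - L * ((u + m : ℕ) : ℤ)) =
        (-a : ℤ) * x + (a * t - L * (u : ℤ)) + ((m * L : ℕ) : ℤ) * (-1) := by
      push_cast; ring
    rw [this, Int.add_mul_emod_self_left]
  -- There are at most `K m` full chunks over all windows, and the two extra ones for each of the
  -- `m` windows give `(K + 2) m`, where `K = r + 2`.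
  have hsum : ∀ a i, 2 ≤ i → i ≤ r + 1 →
      ∑ v ∈ Finset.range m, numChunks (r + 2) m L z (m * z) a t V i v ≤ (r + 4) * m := by
    intro a i hi _
    have h1 := sum_winCard_le (m := m) (K := r + 2) hL1 ((Finset.range (m * z)).image (V i)) a 0
    have h2 : z * ∑ v ∈ Finset.range m, winCard ((Finset.range (m * z)).image (V i)) a (0 - L * v)
        ((m * L : ℕ) : ℤ) (((r + 2) * L : ℕ) : ℤ) / z ≤ z * ((r + 2) * m) := by
      calc _ ≤ ∑ v ∈ Finset.range m, winCard ((Finset.range (m * z)).image (V i)) a (0 - L * v)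
            ((m * L : ℕ) : ℤ) (((r + 2) * L : ℕ) : ℤ) := by
            rw [Finset.mul_sum]
            exact Finset.sum_le_sum fun v _ => Nat.mul_div_le _ _
        _ ≤ (r + 2) * (m * z) := h1.trans (Nat.mul_le_mul_left _ (hXc i))
        _ = _ := by ring
    have h3 := Nat.le_of_mul_le_mul_left h2 hz
    simp only [numChunks, if_neg (show i ≠ 0 by omega), Finset.sum_add_distrib, Finset.sum_const,
      Finset.card_range, smul_eq_mul]
    calc _ ≤ (r + 2) * m + m * 2 := Nat.add_le_add_right h3 _
      _ = _ := by ring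
  have hcost := fun a => nestCost_le (X := X) (T := T) (r := r) (u := 0) (G := (r + 4) * m)
    (β := numChunks (r + 2) m L z (m * z) a t V) hm (two_le_numChunks _ _ _ _ _ _ _ _) (hper a)
    (Nat.mul_pos (by omega) hm) (hsum a)
  have hs0 := sum_sum_chunks_sq_le hz hL1 hm (K := r + 2) (by omega) _ (hX 0 (by omega)) (hXc 0)
    (ε := -1) (Or.inr rfl) (fun a => a * t)
  have hs1 := sum_sum_chunks_sq_le hz hL1 hm (K := r + 2) (by omega) _ (hX 1 (by omega)) (hXc 1)
    (ε := 1) (Or.inl rfl) (fun _ => 0)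
  have hs : ∑ a ∈ Finset.range (m * L), (∑ v ∈ Finset.range m, numChunks (r + 2) m L z (m * z) a t V 1 v ^ 2 +
      ∑ v ∈ Finset.range m, numChunks (r + 2) m L z (m * z) a t V 0 v ^ 2) ≤
      2 * (m * L * ((26 * (r + 2) ^ 2 + 8) * m)) := by
    rw [Finset.sum_add_distrib, two_mul]
    refine Nat.add_le_add ?_ ?_
    · simpa [numChunks] using hs1
    · simpa [numChunks] using hs0
  calc _ ≤ ∑ a ∈ Finset.range (m * L), 2 * (X + T + 130) *
        (∑ v ∈ Finset.range m, numChunks (r + 2) m L z (m * z) a t V 1 v ^ 2 +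
        ∑ v ∈ Finset.range m, numChunks (r + 2) m L z (m * z) a t V 0 v ^ 2) * (4 * ((r + 4) * m)) ^ r :=
        Finset.sum_le_sum fun a _ => hcost a
    _ ≤ 2 * (X + T + 130) * (2 * (m * L * ((26 * (r + 2) ^ 2 + 8) * m))) * (4 * ((r + 4) * m)) ^ r := by
        rw [← Finset.sum_mul, ← Finset.mul_sum]
        exact Nat.mul_le_mul_right _ (Nat.mul_le_mul_left _ hs)
    _ = _ := by
        simp only [redConst, Nat.add_sub_cancel, show r + 2 - 1 = r + 1 by omega]
        rw [← mul_assoc 4 (r + 4) m, mul_pow (4 * (r + 4)) m r]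
        ring

/-- Solve an instance with `K` virtual arrays `src` of `mE` blocks each by running `prog`, which
handles chunks of one block per array. -/
def reduce (d K : ℕ) (mE : Expr) (src : ℕ → Expr) (tv : Var) (prog : Cmd) : Cmd :=
  .seq (.block [.assign (d + K, 0) mE, .assign (d + K, 2) (.const 2 * .var gInf + .const 1),
      .assign (d + K, 1) (.var (d + K, 0) * .var (d + K, 2)),
      .assign (d + K, 3) (.const K * .var (d + K, 2)), .assign (d + K, 4) (.const 0)])
    (.seq (.rand (d + K, 7) (.var (d + K, 1))) (.seq (.assign (d + K, 6) (.const 0 - .var (d + K, 7)))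
      (nest d K src tv prog (K - 1))))

section
variable {k n : ℕ} {E : Env k n}

/-- The expected number of tuples of chunks is `O(m ^ (K - 1))`; each of them is charged with one
extraction, which scans all `m z` entries, and one call of `prog`. -/
theorem reduce_run {s : St} {z lg d K m S T : ℕ} {inf : ℤ} {mE : Expr} {src : ℕ → Expr}
    {V : ℕ → ℕ → ℤ} {tv : Var} {prog : Cmd} (hd : Dim E z lg inf) (hg : Glob z inf s) (hd3 : 3 ≤ d)
    (hK : 2 ≤ K) (hm : 1 ≤ m) (hmE : mE.eval E.x s = m) (htv : Prot (d + K + 1) tv)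
    (ht : |s.v tv| < inf) (hmz : (m * z : ℤ) ≤ E.B) (hB : m * (2 * inf + 1) * (inf + K) ≤ E.B)
    (hsrc : ∀ r < K, ∀ s', Frm (d + K + 1) s s' → ∀ j < m * z, s'.v (2, 3) = j →
      (src r).eval E.x s' = V r j)
    (hV : ∀ r < K, ∀ j < m * z, |V r j| < inf) (hS : ∀ r < K, (src r).cost ≤ S)
    (hF : s.v gF = 0 ∨ s.v gF = 1)
    (hprog : ∀ s1, Frm (d + K + 1) s s1 → (s1.v gF = 0 ∨ s1.v gF = 1) →
      Chunks d K (m * z) z V 0 s1 → Run E s1 prog T (fun s' => Frm d s1 s' ∧ Flag s1 s'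
        (∃ x : ℕ → ℤ, ∑ i ∈ Finset.range K, x i = s.v tv ∧ ∀ i < K, ∃ j < z, s1.a (d + i, 0) j = x i)
        (∃ x : ℕ → ℤ, ∑ i ∈ Finset.range K, x i = s.v tv ∧ ∀ i < K, ∃ j < z, s1.a (d + i, 0) j = x i))) :
    Run E s (reduce d K mE src tv prog)
      (redConst K * m ^ (K - 1) * ((S + 4100) * (m * z) * (lg + 1) + T + 130) + (mE.cost + 150))
      (fun s' => Frm (d + K + 1) s s' ∧ Flag s s'
        (∃ x : ℕ → ℤ, ∑ i ∈ Finset.range K, x i = s.v tv ∧ ∀ i < K, ∃ j < m * z, V i j = x i)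
        (∃ x : ℕ → ℤ, ∑ i ∈ Finset.range K, x i = s.v tv ∧ ∀ i < K, ∃ j < m * z, V i j = x i)) := by
  have hinf0 := hd.inf0
  have hz := hd.pos
  have hm' : (1 : ℤ) ≤ m := by exact_mod_cast hm
  have hK' : (2 : ℤ) ≤ K := by exact_mod_cast hK
  -- All entries are below `inf` in absolute value, so `L = 2 inf + 1` exceeds every difference of
  -- two of them.
  obtain ⟨L, hL⟩ := Int.eq_ofNat_of_zero_le (show 0 ≤ 2 * inf + 1 by omega)
  have hLe : (m : ℤ) * L * (inf + K) ≤ E.B := by rw [← hL]; exact hB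
  have hL1 : (1 : ℤ) ≤ L := by omega
  have hmL : (m : ℤ) * L ≤ E.B := by
    refine le_trans ?_ hLe
    exact le_mul_of_one_le_right (by positivity) (by omega)
  have hLB : (L : ℤ) ≤ E.B := (le_mul_of_one_le_left (by omega) hm').trans hmL
  have hmB : (m : ℤ) ≤ E.B := (le_mul_of_one_le_right (by omega) hL1).trans hmL
  have hKL : (K : ℤ) * L ≤ E.B := by
    refine le_trans ?_ hLe
    have : (L : ℤ) * (inf + K) ≤ m * L * (inf + K) :=
      mul_le_mul_of_nonneg_right (le_mul_of_one_le_left (by omega) hm') (by omega)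
    nlinarith
  have hB2 := E.hB2
  set D := d + K with hD
  set s0 := ((((s.setV (D, 0) m).setV (D, 2) L).setV (D, 1) (m * L : ℕ)).setV (D, 3)
    (K * L : ℕ)).setV (D, 4) 0 with hs0
  have hnp : ∀ i, ¬ Prot (D + 1) (D, i) := fun i => by simp [Prot]; omega
  have hDF : ∀ i, gF ≠ (D, i) := fun i => by simp [gF]; omega
  have hDI : ∀ i, gInf ≠ (D, i) := fun i => by simp [gInf]; omega
  have hfr0 : Frm (D + 1) s s0 := ((((((Frm.refl _ s).setV (hnp _) _).setV (hnp _) _).setV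
    (hnp _) _).setV (hnp _) _).setV (hnp _) _)
  have hF0 : s0.v gF = s.v gF := by simp [hs0, hDF]
  set X := (S + 4100) * (m * z) * (lg + 1) with hX
  simp only [reduce, ← hD]
  refine (Run.seq (t := mE.cost + 100) (R := fun s' => s' = s0) ?_
    (u := redConst K * m ^ (K - 1) * (X + T + 130) + 25 + 3 + 3) ?_).mono (by omega) fun _ h => h
  · refine (Run.straight ?_ ?_).mono (?_ : _ ≤ mE.cost + 100) fun _ h => h
    · simp only [Cmd.block, Cmd.Ok, Cmd.exec, Expr.eval_mul, Expr.eval_add, Expr.eval_var,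
        Expr.eval_const, hmE, St.setV_v, if_neg (hDI _), hg.inf, hL]
      simp only [Prod.mk.injEq, true_and, OfNat.ofNat_ne_zero, OfNat.ofNat_ne_one, if_true, if_false,
        OfNat.zero_ne_ofNat, OfNat.one_ne_ofNat]
      refine ⟨?_, ?_, ?_, ?_, by simp; omega⟩ <;> rw [abs_of_nonneg (by positivity)] <;> assumption
    · simp only [Cmd.block, Cmd.exec, Expr.eval_mul, Expr.eval_add, Expr.eval_var,
        Expr.eval_const, hmE, St.setV_v, if_neg (hDI _), hg.inf, hL, hs0]
      simp
    · simp [Cmd.block, Cmd.cost]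
  rintro _ rfl
  have hsum := sum_nestCost_le (X := X) (T := T) (L := L) (t := s.v tv) hK hz hm (by omega) hV
  have hmL0 : 0 < m * L := Nat.mul_pos hm (by omega)
  refine Run.rand_seq (m := m * L) (t := fun a => nestCost m X T
    (numChunks K m L z (m * z) a (s.v tv) V) (K - 1) 0 + 25)
    (T := redConst K * m ^ (K - 1) * (X + T + 130) + 25) (by simp [hs0]) hmL0 (by push_cast; exact hmL)
    (fun a ha => ?_) ?_
  swap
  · rw [Finset.sum_add_distrib, mul_add]
    refine Nat.add_le_add hsum (by simp)
  have haB : (a : ℤ) < m * L := by exact_mod_cast ha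
  set s1 := s0.setV (D, 7) a with hs1
  refine (Run.seq (Run.assign (Q := fun s' => s' = s1.setV (D, 6) (-a)) ?_ (by simp [hs1]))
    (u := nestCost m X T (numChunks K m L z (m * z) a (s.v tv) V) (K - 1) 0) ?_).mono
    (by simp; omega) fun _ h => h
  · simp [hs1]; omega
  rintro _ rfl
  set s2 := s1.setV (D, 6) (-a) with hs2
  have hfr2 : Frm (D + 1) s s2 := (hfr0.setV (hnp _) _).setV (hnp _) _
  have hF2 : s2.v gF = s.v gF := by simp [hs2, hs1, hDF, hF0]
  have ctx : RedCtx E z lg inf d K m L a S (s.v tv) src V tv s2 :=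
    { dim := hd
      glob := hg.frm hfr2
      d3 := hd3
      m1 := hm
      L1 := by omega
      mzB := hmz
      vm := by simp [hs2, hs1, hs0, ← hD]
      vQ := by simp [hs2, hs1, hs0, ← hD]
      vL := by simp [hs2, hs1, hs0, ← hD]
      vW := by simp [hs2, hs1, hs0, ← hD]
      vna := by simp [hs2, hs1, hs0, ← hD]
      va := by simp [hs2, hs1, hs0, ← hD]
      vt := hfr2.v _ htv
      tvP := htv.imp id fun h => ⟨h.1, by omega⟩
      srcE := fun r hr s' hs' => hsrc r hr s' (hfr2.trans (hs'.mono (by omega)))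
      bnd := hV
      leB := by
        refine le_trans ?_ hLe
        rw [abs_mul, Nat.abs_cast]
        have h1 : (a : ℤ) * |s.v tv| ≤ m * L * inf :=
          mul_le_mul haB.le ht.le (abs_nonneg _) (by positivity)
        push_cast
        nlinarith
      cost := hS }
  refine (nest_run ctx (fun s3 h1 h2 h3 => hprog s3 (hfr2.trans (h1.mono (by omega))) h2 h3) (K - 1)
    (by omega) (u := 0) (Frm.refl _ _) (hF2 ▸ hF) ?_ ?_ ?_).mono le_rfl ?_
  · rw [show d + (K - 1 + 1) = D by omega]
    simp [hs2, hs1, hs0]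
  · rw [show K - 1 + 1 = K by omega]; omega
  · intro i h1 h2; omega
  · rintro s' ⟨f1, f2⟩
    have hfl : Flag s s2 False False := Flag.refl hF hF2
    refine ⟨hfr2.trans (f1.mono (by omega)), (hfl.trans f2).mono ?_ ?_⟩
    · rintro ⟨x, hx, hx'⟩
      refine Or.inr ⟨x, ⟨hx, fun i hi => hx' i (by omega), fun i hi hiK => by omega⟩, ?_⟩
      unfold HashOk
      rw [show K - 1 + 1 = K by omega, Finset.Ico_self]
      have : ((K - 1 : ℕ) : ℤ) + 1 = K := by omega
      rw [this]
      simp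
    · rintro (h | ⟨x, hx⟩)
      · exact h.elim
      · exact ⟨x, hx.1, fun i hi => hx.2.1 i (by omega)⟩

end

end KSumRam

namespace KSumRam

/-! ### Linear-space solvers -/

theorem linExp_succ_le (m : ℕ) : linExp (m + 5) ≤ linExp (m + 4) + 1 := by
  rw [linExp]
  exact (Finset.fold_min_le _).2 (Or.inl le_rfl)

theorem linExp_le_self (K : ℕ) : linExp K ≤ K := by
  induction K using Nat.strong_induction_on with
  | _ K ih =>
    match K with
    | 0 => simp [linExp]
    | 1 => simp [linExp]
    | 2 => simp [linExp]
    | 3 => simp [linExp]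
    | 4 => simp [linExp]
    | m + 5 =>
      have := linExp_succ_le m
      have := ih (m + 4) (by omega)
      omega

/-- The divisor `1` contributes only the value `K`, which the first alternative already covers
because `linExp (K - 1) + 1 ≤ K`. So only proper factorizations have to be implemented. -/
theorem linExp_cases {K : ℕ} (hK : 5 ≤ K) : linExp (K - 1) + 1 ≤ linExp K ∨
    ∃ p q, 2 ≤ p ∧ p < K ∧ 2 ≤ q ∧ p * q = K ∧ (p - 1) * (q - 1) + max (linExp p) q ≤ linExp K := by
  obtain ⟨m, rfl⟩ : ∃ m, K = m + 5 := ⟨K - 5, by omega⟩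
  have h : linExp (m + 5) ≤ linExp (m + 5) := le_rfl
  conv at h => lhs; rw [linExp]
  rcases (Finset.fold_min_le _).1 h with h1 | ⟨⟨p, hp⟩, -, h1⟩
  · exact Or.inl h1
  · obtain ⟨hp1, hp2⟩ := Nat.mem_properDivisors.1 hp
    have hpos : 0 < p := Nat.pos_of_dvd_of_pos hp1 (by omega)
    obtain ⟨q, hq⟩ := hp1
    have hq2 : (m + 5) / p = q := by rw [hq]; exact Nat.mul_div_cancel_left q hpos
    simp only [hq2] at h1
    by_cases h2 : p = 1
    · left
      subst h2
      have := linExp_le_self (m + 4)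
      have : q ≤ max (linExp 1) q := le_max_right _ _
      simp at h1 hq ⊢
      omega
    · refine Or.inr ⟨p, q, by omega, hp2, ?_, hq.symm, h1⟩
      rcases q with _ | _ | q
      · omega
      · omega
      · omega

/-- The conditions under which a solver for `K` sorted lists is called. -/
structure SolveHyp {k n : ℕ} (E : Env k n) (z lg : ℕ) (inf : ℤ) (K d : ℕ) (A : ℕ → Var) (tv : Var)
    (D : ℤ) (s : St) : Prop where
  dim : Dim E z lg inf
  glob : Glob z inf s
  lvl : ∀ i < K, d ≤ (A i).1
  tvP : Prot d tv
  flag : s.v gF = 0 ∨ s.v gF = 1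
  sorted : ∀ i < K, ∀ p q, p ≤ q → q < z → s.a (A i) p ≤ s.a (A i) q
  bnd : ∀ i < K, ∀ j < z, |s.a (A i) j| ≤ D
  tot : K * D + |s.v tv| < inf
  leB : (z : ℤ) ^ K * (2 * inf + 1) * (inf + K) ≤ E.B

/-- The lists `A 0, …, A (K - 1)` of length `z` have entries with sum `t`. -/
def ListSol (K z : ℕ) (A : ℕ → Var) (t : ℤ) (s : St) : Prop :=
  ∃ x : ℕ → ℤ, ∑ i ∈ Finset.range K, x i = t ∧ ∀ i < K, ∃ j < z, s.a (A i) j = x i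

/-- `prog` solves `K`-SUM for lists in memory, using variables of level below `d`. -/
def Solves (K d : ℕ) (prog : (ℕ → Var) → Var → Cmd) (C : ℕ) : Prop :=
  3 ≤ d ∧ ∀ {k n : ℕ} (E : Env k n) (z lg : ℕ) (inf : ℤ) (A : ℕ → Var) (tv : Var) (D : ℤ) (s : St),
    SolveHyp E z lg inf K d A tv D s →
    Run E s (prog A tv) (C * z ^ linExp K * (lg + 1)) (fun s' => Frm d s s' ∧
      Flag s s' (ListSol K z A (s.v tv) s) (ListSol K z A (s.v tv) s))

section
variable {k n : ℕ} {E : Env k n}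

theorem SolveHyp.D_nonneg {z lg K d : ℕ} {inf D : ℤ} {A : ℕ → Var} {tv : Var} {s : St}
    (h : SolveHyp E z lg inf K d A tv D s) (hK : 1 ≤ K) : 0 ≤ D :=
  (abs_nonneg _).trans (h.bnd 0 hK 0 h.dim.pos)

/-- Two, three and four lists are handled alike: a missing list is replaced by a single entry of the
zero array `(0, 0)`. -/
theorem meetSolve {z lg K e J J' : ℕ} {inf D : ℤ} {A : ℕ → Var} {tv Jv Jv' B C : Var} {s : St}
    (h : SolveHyp E z lg inf K 3 A tv D s) (hK : 2 ≤ K) (hJv : s.v Jv = J) (hJv' : s.v Jv' = J')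
    (hJl : Prot 3 Jv) (hJl' : Prot 3 Jv') (hJ : 1 ≤ J) (hJ' : 1 ≤ J') (hJz : J ≤ z) (hJz' : J' ≤ z)
    (hB : (B = (0, 0) ∧ J = 1) ∨ (B = A 2 ∧ 3 ≤ K)) (hC : (C = (0, 0) ∧ J' = 1) ∨ (C = A 3 ∧ 4 ≤ K))
    (he : z * (J + J') ≤ 2 * z ^ e) (he1 : 1 ≤ e)
    (hsol : (∃ l < z, ∃ j < J, ∃ l' < z, ∃ j' < J', s.a (A 0) l + s.a B j + s.a (A 1) l' + s.a C j' = s.v tv) ↔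
      ListSol K z A (s.v tv) s) :
    Run E s (meet tv Jv Jv' (A 0) B (A 1) C) (3200 * z ^ e * (lg + 1)) (fun s' => Frm 3 s s' ∧
      Flag s s' (ListSol K z A (s.v tv) s) (ListSol K z A (s.v tv) s)) := by
  have hD := h.D_nonneg (by omega)
  have hz := h.dim.pos
  have hinf := h.dim.inf0
  have hK' : (2 : ℤ) ≤ K := by exact_mod_cast hK
  have hlv : ∀ i < K, (A i).1 ≠ 1 ∧ (A i).1 ≠ 2 := fun i hi => by have := h.lvl i hi; omega
  have hKD : ∀ c : ℤ, c ≤ K → c * D ≤ K * D := fun c hc => mul_le_mul_of_nonneg_right hc hD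
  have htot := h.tot
  have ht := abs_nonneg (s.v tv)
  have hBb : ∀ j < J, |s.a B j| ≤ D := fun j hj => by
    rcases hB with ⟨rfl, rfl⟩ | ⟨rfl, h3⟩
    · rw [h.glob.zero]; simpa using hD
    · exact h.bnd 2 (by omega) j (by omega)
  have hBB : ((B = (0, 0) ∧ J = 1) ∨ 3 ≤ K) := hB.imp id And.right
  have hCC : ((C = (0, 0) ∧ J' = 1) ∨ 4 ≤ K) := hC.imp id And.right
  have hz1 : (1 : ℤ) ≤ z := by exact_mod_cast hz
  have hleB : (z * (J + J') : ℤ) ≤ E.B := by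
    refine le_trans ?_ h.leB
    have h1 : (z : ℤ) ^ 2 ≤ z ^ K := pow_le_pow_right₀ hz1 hK
    have h2 : (2 : ℤ) ≤ (2 * inf + 1) * (inf + K) := by nlinarith
    have h3 : (z * (J + J') : ℤ) ≤ z ^ 2 * 2 := by
      rw [sq, mul_assoc]
      exact mul_le_mul_of_nonneg_left (by omega) (by omega)
    calc (z * (J + J') : ℤ) ≤ z ^ 2 * 2 := h3
      _ ≤ z ^ K * ((2 * inf + 1) * (inf + K)) := mul_le_mul h1 h2 (by omega) (by positivity)
      _ = _ := by ring
  refine (meet_run (J := J) (J' := J') (sol := ListSol K z A (s.v tv) s) h.dim h.glob hJv hJv' hJl hJl'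
    h.tvP hJ hJ' hJz hJz' (hlv 0 (by omega)) ?_ (hlv 1 (by omega)) ?_ hleB ?_ ?_ ?_ ?_ h.flag
    hsol).mono ?_ fun _ h => h
  · rcases hB with ⟨rfl, rfl⟩ | ⟨rfl, h3⟩
    · simp
    · exact hlv 2 (by omega)
  · rcases hC with ⟨rfl, rfl⟩ | ⟨rfl, h3⟩
    · simp
    · exact hlv 3 (by omega)
  · intro l hl j hj
    have h1 := h.bnd 0 (by omega) l hl
    have h2 := hBb j hj
    have h3 := hKD 2 hK'
    have := abs_add_le (s.a (A 0) l) (s.a B j)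
    omega
  · intro l hl j hj
    have h1 := h.bnd 1 (by omega) l hl
    have h2 : |s.a C j| ≤ D := by
      rcases hC with ⟨rfl, rfl⟩ | ⟨rfl, h3⟩
      · rw [h.glob.zero]; simpa using hD
      · exact h.bnd 3 (by omega) j (by omega)
    have h3 := hKD 2 hK'
    omega
  · intro i j hij hj
    rcases hB with ⟨rfl, rfl⟩ | ⟨rfl, h3⟩
    · simp [h.glob.zero]
    · exact h.sorted 2 (by omega) i j hij (by omega)
  · intro i j hij hj
    rcases hC with ⟨rfl, rfl⟩ | ⟨rfl, h3⟩
    · simp [h.glob.zero]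
    · exact h.sorted 3 (by omega) i j hij (by omega)
  · have h1 : z ≤ z ^ e := Nat.le_self_pow (by omega) z
    have h2 := Nat.mul_le_mul_right (1000 * (lg + 1)) he
    have h3 : z * 1 ≤ z ^ e * (lg + 1) := Nat.mul_le_mul h1 (by omega)
    have h4 : 1 * 1 ≤ z ^ e * (lg + 1) := Nat.mul_le_mul (hz.trans h1) (by omega)
    linarith

end

theorem solves_two : Solves 2 3 (fun A tv => meet tv (0, 8) (0, 8) (A 0) (0, 0) (A 1) (0, 0)) 3200 := by
  refine ⟨le_rfl, fun E z lg inf A tv D s h => ?_⟩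
  have hz := h.dim.pos
  refine meetSolve (J := 1) (J' := 1) h le_rfl h.glob.one h.glob.one (by simp [Prot]) (by simp [Prot])
    le_rfl le_rfl hz hz (Or.inl ⟨rfl, rfl⟩) (Or.inl ⟨rfl, rfl⟩) (by simp [linExp]; omega)
    (by simp [linExp]) ?_
  simp only [h.glob.zero, add_zero]
  constructor
  · rintro ⟨l, hl, -, -, l', hl', -, -, e⟩
    refine ⟨fun i => if i = 0 then s.a (A 0) l else s.a (A 1) l', by simpa [Finset.sum_range_succ] using e, ?_⟩
    intro i hi
    interval_cases i
    · exact ⟨l, hl, rfl⟩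
    · exact ⟨l', hl', rfl⟩
  · rintro ⟨x, hx, hx'⟩
    obtain ⟨l, hl, e0⟩ := hx' 0 (by omega)
    obtain ⟨l', hl', e1⟩ := hx' 1 (by omega)
    refine ⟨l, hl, 0, by omega, l', hl', 0, by omega, ?_⟩
    simp only [Finset.sum_range_succ, Finset.sum_range_zero] at hx
    omega

theorem solves_three : Solves 3 3 (fun A tv => meet tv (0, 4) (0, 8) (A 0) (A 2) (A 1) (0, 0)) 3200 := by
  refine ⟨le_rfl, fun E z lg inf A tv D s h => ?_⟩
  have hz := h.dim.pos
  refine meetSolve (J := z) (J' := 1) h (by omega) h.glob.size h.glob.one (by simp [Prot]) (by simp [Prot])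
    hz le_rfl le_rfl hz (Or.inr ⟨rfl, le_rfl⟩) (Or.inl ⟨rfl, rfl⟩) (by simp [linExp]; nlinarith)
    (by simp [linExp]) ?_
  simp only [h.glob.zero, add_zero]
  constructor
  · rintro ⟨l, hl, j, hj, l', hl', -, -, e⟩
    refine ⟨fun i => if i = 0 then s.a (A 0) l else if i = 1 then s.a (A 1) l' else s.a (A 2) j, ?_, ?_⟩
    · simp [Finset.sum_range_succ]; omega
    intro i hi
    interval_cases i
    · exact ⟨l, hl, rfl⟩
    · exact ⟨l', hl', rfl⟩
    · exact ⟨j, hj, rfl⟩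
  · rintro ⟨x, hx, hx'⟩
    obtain ⟨l, hl, e0⟩ := hx' 0 (by omega)
    obtain ⟨l', hl', e1⟩ := hx' 1 (by omega)
    obtain ⟨j, hj, e2⟩ := hx' 2 (by omega)
    refine ⟨l, hl, j, hj, l', hl', 0, by omega, ?_⟩
    simp only [Finset.sum_range_succ, Finset.sum_range_zero] at hx
    omega

theorem solves_four : Solves 4 3 (fun A tv => meet tv (0, 4) (0, 4) (A 0) (A 2) (A 1) (A 3)) 3200 := by
  refine ⟨le_rfl, fun E z lg inf A tv D s h => ?_⟩
  have hz := h.dim.pos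
  refine meetSolve (J := z) (J' := z) h (by omega) h.glob.size h.glob.size (by simp [Prot]) (by simp [Prot])
    hz hz le_rfl le_rfl (Or.inr ⟨rfl, by omega⟩) (Or.inr ⟨rfl, le_rfl⟩) (by simp [linExp]; nlinarith)
    (by simp [linExp]) ?_
  constructor
  · rintro ⟨l, hl, j, hj, l', hl', j', hj', e⟩
    refine ⟨fun i => if i = 0 then s.a (A 0) l else if i = 1 then s.a (A 1) l' else
      if i = 2 then s.a (A 2) j else s.a (A 3) j', ?_, ?_⟩
    · simp [Finset.sum_range_succ]; omega
    intro i hi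
    interval_cases i
    · exact ⟨l, hl, rfl⟩
    · exact ⟨l', hl', rfl⟩
    · exact ⟨j, hj, rfl⟩
    · exact ⟨j', hj', rfl⟩
  · rintro ⟨x, hx, hx'⟩
    obtain ⟨l, hl, e0⟩ := hx' 0 (by omega)
    obtain ⟨l', hl', e1⟩ := hx' 1 (by omega)
    obtain ⟨j, hj, e2⟩ := hx' 2 (by omega)
    obtain ⟨j', hj', e3⟩ := hx' 3 (by omega)
    refine ⟨l, hl, j, hj, l', hl', j', hj', ?_⟩
    simp only [Finset.sum_range_succ, Finset.sum_range_zero] at hx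
    omega

/-- For every entry of the last list, the target is lowered by it and the remaining lists are
searched. The condition `tot` is inherited, because the target grows by at most `D` while one list
disappears. -/
theorem Solves.succ {K d C : ℕ} {prog : (ℕ → Var) → Var → Cmd} (h : Solves K d prog C) (hK : 1 ≤ K)
    (he : linExp K + 1 ≤ linExp (K + 1)) :
    Solves (K + 1) (d + 1) (fun A tv => .for (d, 0) (.var (0, 4))
      (.seq (.assign (d, 1) (.var tv - .arr (A K) (.var (d, 0)))) (prog A (d, 1)))) (C + 100) := by
  obtain ⟨hd3, hprog⟩ := h
  refine ⟨by omega, fun E z lg inf A tv D s h => ?_⟩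
  have hD := h.D_nonneg (by omega)
  have hz := h.dim.pos
  have hinf := h.dim.inf0
  have hinfB := h.dim.infB
  have hleB := h.dim.leB
  have htot := h.tot
  have htP : Prot (d + 1) tv := h.tvP
  have hgn : gF ≠ (d, 0) ∧ gF ≠ (d, 1) := by simp [gF]
  have hn : ∀ i, ¬ Prot (d + 1) (d, i) := fun i => by simp [Prot]; omega
  have hz1 : (1 : ℤ) ≤ z := by exact_mod_cast hz
  refine (Run.for (m := z) (t := C * z ^ linExp K * (lg + 1) + 24) (fun v s' => s'.v (d, 0) = v ∧
    Frm (d + 1) s s' ∧ Flag s s' (∃ v' < v, ListSol K z A (s.v tv - s.a (A K) v') s)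
      (ListSol (K + 1) z A (s.v tv) s)) (by omega) ?_ ?_ ?_ ?_).mono ?_ fun _ h => h
  · refine ⟨by simp, (Frm.refl _ _).setV (hn _) _, (Flag.refl h.flag (by simp [hgn])).mono ?_ False.elim⟩
    rintro ⟨v', hv', -⟩
    omega
  · rintro v s' hv ⟨h1, h2, -⟩
    exact ⟨h1, by simp [(h.glob.frm h2).size]⟩
  · rintro v s' hv ⟨h1, h2, h3⟩
    have hA : ∀ i < K + 1, s'.a (A i) = s.a (A i) := fun i hi => h2.a _ (Or.inr (h.lvl i hi))
    have ev : (Expr.var tv - .arr (A K) (.var (d, 0))).eval E.x s' = s.v tv - s.a (A K) v := by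
      rw [Expr.eval_sub, Expr.eval_arr_nat (j := v) (by simp [h1]), hA K (by omega), Expr.eval_var,
        h2.v _ htP]
    have hx := h.bnd K (by omega) v hv
    have hab := abs_sub (s.v tv) (s.a (A K) v)
    have hKD : (0 : ℤ) ≤ K * D := by positivity
    have htot' : (K : ℤ) * D + D + |s.v tv| < inf := by
      have : ((K + 1 : ℕ) : ℤ) * D = K * D + D := by push_cast; ring
      omega
    refine (Run.seq (Run.assign (Q := fun s1 => s1 = s'.setV (d, 1) (s.v tv - s.a (A K) v)) ?_ (by rw [ev]))
      (u := C * z ^ linExp K * (lg + 1)) ?_).mono (by simp; omega) fun _ h => h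
    · rw [ev]
      omega
    rintro _ rfl
    set s1 := s'.setV (d, 1) (s.v tv - s.a (A K) v) with hs1
    have hfr : Frm (d + 1) s s1 := h2.setV (hn _) _
    have hA1 : ∀ i < K + 1, s1.a (A i) = s.a (A i) := hA
    have hF1 : s1.v gF = s'.v gF := by simp [hs1, hgn]
    have ht1 : s1.v (d, 1) = s.v tv - s.a (A K) v := by simp [hs1]
    have hsol : ListSol K z A (s1.v (d, 1)) s1 ↔ ListSol K z A (s.v tv - s.a (A K) v) s := by
      unfold ListSol
      rw [ht1]
      refine exists_congr fun x => and_congr_right fun _ => forall_congr' fun i => ?_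
      refine imp_congr_right fun hi => ?_
      rw [hA1 i (by omega)]
    refine (hprog E z lg inf A (d, 1) D s1 ⟨h.dim, h.glob.frm hfr, fun i hi => ?_, ?_, hF1 ▸ h3.bool,
      fun i hi => ?_, fun i hi => ?_, ?_, ?_⟩).mono le_rfl ?_
    · exact (Nat.le_succ d).trans (h.lvl i (by omega))
    · exact Or.inr ⟨by simp; omega, le_rfl⟩
    · rw [hA1 i (by omega)]; exact h.sorted i (by omega)
    · rw [hA1 i (by omega)]; exact h.bnd i (by omega)
    · rw [ht1]; omega
    · refine le_trans ?_ h.leB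
      have h5 : (z : ℤ) ^ K ≤ z ^ (K + 1) := pow_le_pow_right₀ hz1 (by omega)
      have h6 : inf + (K : ℤ) ≤ inf + (K + 1 : ℕ) := by push_cast; omega
      exact mul_le_mul (mul_le_mul_of_nonneg_right h5 (by omega)) h6 (by omega) (by positivity)
    · rintro s2 ⟨f1, f2⟩
      have hfl : Flag s' s1 False False := Flag.refl h3.bool hF1
      have hfl2 : Flag s2 (s2.setV (d, 0) (v + 1)) False False := Flag.refl f2.bool (by simp [hgn])
      have hdd : ∀ i, Prot d (d, i) := fun i => Or.inr ⟨by simp; omega, le_rfl⟩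
      refine ⟨by rw [f1.v _ (hdd _)]; simp [hs1, h1], by simp,
        (hfr.trans (f1.mono (by omega))).setV (hn _) _,
        (h3.trans ((hfl.trans f2).trans hfl2)).mono ?_ ?_⟩
      · rintro ⟨v', hv', h7⟩
        by_cases hvv : v' < v
        · exact Or.inl ⟨v', hvv, h7⟩
        · obtain rfl : v' = v := by omega
          exact Or.inr (Or.inl (Or.inr (hsol.2 h7)))
      · rintro (h7 | (h7 | h7) | h7)
        · exact h7
        · exact h7.elim
        · obtain ⟨x, hx1, hx2⟩ := hsol.1 h7
          refine ⟨fun i => if i = K then s.a (A K) v else x i, ?_, fun i hi => ?_⟩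
          · rw [Finset.sum_range_succ, if_pos rfl, Finset.sum_congr rfl (g := x), hx1]
            · ring
            · intro i hi
              rw [if_neg (by have := Finset.mem_range.1 hi; omega)]
          · by_cases hiK : i = K
            · subst hiK
              exact ⟨v, hv, by simp⟩
            · simp only [if_neg hiK]
              exact hx2 i (by omega)
        · exact h7.elim
  · rintro s' ⟨h1, h2, h3⟩
    refine ⟨h2, h3.mono ?_ id⟩
    rintro ⟨x, hx1, hx2⟩
    obtain ⟨v, hv, hvx⟩ := hx2 K (by omega)
    refine ⟨v, hv, x, ?_, fun i hi => hx2 i (by omega)⟩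
    rw [Finset.sum_range_succ] at hx1
    omega
  · simp only [Expr.cost_var]
    have h1 : z ^ (linExp K + 1) ≤ z ^ linExp (K + 1) := Nat.pow_le_pow_right hz he
    have h2 : z * (C * z ^ linExp K * (lg + 1)) = C * (z ^ (linExp K + 1) * (lg + 1)) := by ring
    have h3 : z ^ (linExp K + 1) * (lg + 1) ≤ z ^ linExp (K + 1) * (lg + 1) := Nat.mul_le_mul_right _ h1
    have h4 : z ≤ z ^ linExp (K + 1) * (lg + 1) := by
      have : z ≤ z ^ (linExp K + 1) := Nat.le_self_pow (by omega) z
      nlinarith [Nat.zero_le (z ^ (linExp K + 1) * lg)]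
    have h5 := Nat.mul_le_mul_left C h3
    rw [show C * z ^ linExp K * (lg + 1) + 24 + (3 + 22) = C * z ^ linExp K * (lg + 1) + 49 by omega,
      mul_add, h2, mul_assoc (C + 100), add_mul]
    omega

/-! #### Virtual arrays of sums -/

/-- The `l`-th power of `e`. -/
def powE (e : Expr) : ℕ → Expr
  | 0 => .const 1
  | l + 1 => powE e l * e

/-- The sum of entries of `q` lists, whose indices are the digits of the register `(2, 3)`. -/
def sumE (A : ℕ → Var) (o : ℕ) : ℕ → Expr
  | 0 => .const 0
  | q + 1 => sumE A o q + .arr (A (o + q)) (.var (2, 3) / powE (.var (0, 4)) q % .var (0, 4))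

theorem cost_sumE (A A' : ℕ → Var) (o o' q : ℕ) : (sumE A o q).cost = (sumE A' o' q).cost := by
  induction q with
  | zero => rfl
  | succ q ih => simp [sumE, ih]

section
variable {k n : ℕ} {x : KInstance k n} {s : St}

theorem eval_powE {e : Expr} {z : ℕ} (hz : e.eval x s = z) (l : ℕ) :
    (powE e l).eval x s = (z ^ l : ℕ) := by
  induction l with
  | zero => simp [powE]
  | succ l ih => simp [powE, ih, hz, pow_succ]

theorem eval_sumE {z j : ℕ} (hz : s.v (0, 4) = z) (hj : s.v (2, 3) = j) (A : ℕ → Var) (o q : ℕ) :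
    (sumE A o q).eval x s = ∑ l ∈ Finset.range q, s.a (A (o + l)) (j / z ^ l % z) := by
  induction q with
  | zero => simp [sumE]
  | succ q ih =>
    rw [sumE, Expr.eval_add, ih, Finset.sum_range_succ, Expr.eval_arr_nat (j := j / z ^ q % z)]
    simp only [Expr.eval_mod, Expr.eval_div, Expr.eval_var, eval_powE (e := .var (0, 4)) hz, hz, hj]
    push_cast
    rfl

end

theorem exists_digits {z : ℕ} (hz : 1 ≤ z) (f : ℕ → ℕ) (q : ℕ) (hf : ∀ l < q, f l < z) :
    ∃ j < z ^ q, ∀ l < q, j / z ^ l % z = f l := by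
  induction q with
  | zero => exact ⟨0, by simp, fun l hl => absurd hl (by omega)⟩
  | succ q ih =>
    obtain ⟨j, hj, hl⟩ := ih fun l hl => hf l (by omega)
    have hfq := hf q (by omega)
    have hp : 0 < z ^ q := Nat.pow_pos hz
    refine ⟨j + z ^ q * f q, ?_, fun l hlq => ?_⟩
    · calc j + z ^ q * f q < z ^ q + z ^ q * f q := by omega
        _ = z ^ q * (f q + 1) := by ring
        _ ≤ z ^ q * z := Nat.mul_le_mul_left _ hfq
        _ = _ := (pow_succ z q).symm
    · by_cases h : l = q
      · subst h
        rw [Nat.add_mul_div_left _ _ hp, Nat.div_eq_of_lt hj, zero_add, Nat.mod_eq_of_lt hfq]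
      · have hlq' : l < q := by omega
        obtain ⟨c, rfl⟩ : ∃ c, q = l + 1 + c := ⟨q - l - 1, by omega⟩
        rw [show z ^ (l + 1 + c) * f (l + 1 + c) = z ^ l * (z * (z ^ c * f (l + 1 + c))) by ring,
          Nat.add_mul_div_left _ _ (Nat.pow_pos hz), Nat.add_mul_mod_self_left, hl l hlq']

theorem sum_range_mul_eq (f : ℕ → ℤ) (p q : ℕ) :
    ∑ i ∈ Finset.range (p * q), f i = ∑ r ∈ Finset.range p, ∑ l ∈ Finset.range q, f (r * q + l) := by
  induction p with
  | zero => simp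
  | succ p ih => rw [Nat.succ_mul, Finset.sum_range_add, ih, Finset.sum_range_succ]

/-- An index below `z ^ q` encodes one choice from each of `q` lists by its digits in base `z`, so
an entry of a virtual array is the sum of one group. -/
theorem listSol_mul {p q z : ℕ} (hz : 1 ≤ z) (A : ℕ → Var) (t : ℤ) (s : St) :
    (∃ x : ℕ → ℤ, ∑ r ∈ Finset.range p, x r = t ∧ ∀ r < p, ∃ j < z ^ q,
      ∑ l ∈ Finset.range q, s.a (A (r * q + l)) (j / z ^ l % z) = x r) ↔ ListSol (p * q) z A t s := by
  constructor
  · rintro ⟨x, hx, hx'⟩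
    choose! j hj hj' using hx'
    refine ⟨fun i => s.a (A i) (j (i / q) / z ^ (i % q) % z), ?_, fun i hi => ⟨_, Nat.mod_lt _ hz, rfl⟩⟩
    rw [sum_range_mul_eq, ← hx]
    refine Finset.sum_congr rfl fun r hr => ?_
    rw [← hj' r (Finset.mem_range.1 hr)]
    refine Finset.sum_congr rfl fun l hl => ?_
    have hl' := Finset.mem_range.1 hl
    have h1 : (r * q + l) / q = r := by
      rw [mul_comm, Nat.mul_add_div (by omega), Nat.div_eq_of_lt hl', add_zero]
    have h2 : (r * q + l) % q = l := by
      rw [mul_comm, Nat.mul_add_mod, Nat.mod_eq_of_lt hl']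
    rw [h1, h2]
  · rintro ⟨x, hx, hx'⟩
    choose! f hf hf' using hx'
    refine ⟨fun r => ∑ l ∈ Finset.range q, x (r * q + l), by rw [← sum_range_mul_eq]; exact hx, fun r hr => ?_⟩
    have hlt : ∀ l < q, r * q + l < p * q := fun l hl => by
      calc r * q + l < r * q + q := by omega
        _ = (r + 1) * q := by ring
        _ ≤ p * q := Nat.mul_le_mul_right _ hr
    obtain ⟨j, hj, hj'⟩ := exists_digits hz (fun l => f (r * q + l)) q fun l hl => hf _ (hlt l hl)
    refine ⟨j, hj, Finset.sum_congr rfl fun l hl => ?_⟩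
    have hl' := Finset.mem_range.1 hl
    rw [hj' l hl', hf' _ (hlt l hl')]

/-- The virtual arrays have `z ^ q` entries in `m = z ^ (q - 1)` blocks and are evaluated on demand,
so no space is spent on them. The reduction costs `m ^ (p - 1) (z ^ q + z ^ f p)` up to a logarithm.
This is the exponent `(p - 1) (q - 1) + max (f p) q` of the recursion. Levels `d, …, d + p` are used
by the reduction, so the new solver has level `d + p + 1`. -/
theorem Solves.mul {p q d C : ℕ} {prog : (ℕ → Var) → Var → Cmd} (h : Solves p d prog C) (hp : 2 ≤ p)
    (hq : 2 ≤ q) (he : (p - 1) * (q - 1) + max (linExp p) q ≤ linExp (p * q)) :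
    Solves (p * q) (d + p + 1) (fun A tv => reduce d p (powE (.var (0, 4)) (q - 1)) (fun r => sumE A (r * q) q) tv
      (prog (fun i => (d + i, 0)) tv))
      (redConst p * ((sumE (fun _ => (0, 0)) 0 q).cost + 4230 + C) + (powE (.var (0, 4)) (q - 1)).cost + 150) := by
  obtain ⟨hd3, hprog⟩ := h
  refine ⟨by omega, fun E z lg inf A tv D s h => ?_⟩
  have hpq : 1 ≤ p * q := Nat.mul_pos (by omega) (by omega)
  have hD := h.D_nonneg hpq
  have hz := h.dim.pos
  have hinf := h.dim.inf0
  have htot := h.tot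
  have hz1 : (1 : ℤ) ≤ z := by exact_mod_cast hz
  have hp' : (2 : ℤ) ≤ p := by exact_mod_cast hp
  have hq' : (2 : ℤ) ≤ q := by exact_mod_cast hq
  have hppq : p ≤ p * q := Nat.le_mul_of_pos_right p (by omega)
  have hqpq : q ≤ p * q := Nat.le_mul_of_pos_left q (by omega)
  have hmz : z ^ (q - 1) * z = z ^ q := by rw [← pow_succ, Nat.sub_add_cancel (by omega)]
  set V : ℕ → ℕ → ℤ := fun r j => ∑ l ∈ Finset.range q, s.a (A (r * q + l)) (j / z ^ l % z) with hV
  have hlt : ∀ r < p, ∀ l < q, r * q + l < p * q := fun r hr l hl => by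
    calc r * q + l < r * q + q := by omega
      _ = (r + 1) * q := by ring
      _ ≤ p * q := Nat.mul_le_mul_right _ hr
  have hVb : ∀ r < p, ∀ j, |V r j| ≤ q * D := fun r hr j => by
    refine (Finset.abs_sum_le_sum_abs _ _).trans ?_
    refine (Finset.sum_le_card_nsmul _ _ D fun l hl => ?_).trans (by simp)
    exact h.bnd _ (hlt r hr l (Finset.mem_range.1 hl)) _ (Nat.mod_lt _ hz)
  have htP : Prot d tv := h.tvP.imp id fun h => ⟨h.1, by omega⟩
  have hleB : ∀ a b : ℕ, a ≤ p * q → b ≤ p * q → (z : ℤ) ^ a * (2 * inf + 1) * (inf + b) ≤ E.B := by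
    intro a b ha hb
    refine le_trans ?_ h.leB
    have h5 : (z : ℤ) ^ a ≤ z ^ (p * q) := pow_le_pow_right₀ hz1 ha
    have h6 : inf + (b : ℤ) ≤ inf + (p * q : ℕ) := by
      have : (b : ℤ) ≤ (p * q : ℕ) := by exact_mod_cast hb
      omega
    exact mul_le_mul (mul_le_mul_of_nonneg_right h5 (by omega)) h6 (by positivity) (by positivity)
  have hDs : (p : ℤ) * (q * D) + |s.v tv| < inf := by
    have : ((p * q : ℕ) : ℤ) * D = p * (q * D) := by push_cast; ring
    omega
  have hVi : ∀ r < p, ∀ j < z ^ (q - 1) * z, |V r j| < inf := fun r hr j _ => by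
    have h1 := hVb r hr j
    have h2 : (1 : ℤ) * (q * D) ≤ p * (q * D) := mul_le_mul_of_nonneg_right (by omega) (by positivity)
    have := abs_nonneg (s.v tv)
    omega
  have hsol := listSol_mul (p := p) (q := q) hz A (s.v tv) s
  set S := (sumE (fun _ => (0, 0)) 0 q).cost with hS
  refine (reduce_run (m := z ^ (q - 1)) (S := S) (V := V) (T := C * z ^ linExp p * (lg + 1)) h.dim h.glob
    hd3 hp (Nat.pow_pos hz) (by rw [eval_powE (e := .var (0, 4)) h.glob.size]) h.tvP ?_ ?_ ?_ ?_ hVi ?_ h.flag ?_).mono ?_ ?_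
  · have : (0 : ℤ) ≤ p * (q * D) := by positivity
    omega
  · have h1 : ((z ^ (q - 1) : ℕ) : ℤ) * z = z ^ q := by exact_mod_cast hmz
    rw [h1]
    refine le_trans ?_ (hleB q 0 hqpq (by omega))
    have h2 : (1 : ℤ) ≤ (2 * inf + 1) * (inf + (0 : ℕ)) := by push_cast; nlinarith
    rw [mul_assoc]
    exact le_mul_of_one_le_right (by positivity) h2
  · push_cast
    exact hleB (q - 1) p (by omega) hppq
  · intro r hr s' hs' j hj hjv
    rw [eval_sumE ((hs'.v _ (Or.inl (by simp))).trans h.glob.size) hjv]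
    refine Finset.sum_congr rfl fun l hl => ?_
    rw [hs'.a _ (Or.inr (h.lvl _ (hlt r hr l (Finset.mem_range.1 hl))))]
  · intro r hr
    exact (cost_sumE _ _ _ _ _).le
  · intro s1 h1 h2 h3
    have ht1 : s1.v tv = s.v tv := h1.v _ h.tvP
    have := hprog E z lg inf (fun i => (d + i, 0)) tv (q * D) s1 ⟨h.dim, h.glob.frm h1,
      fun i _ => Nat.le_add_right _ _, htP, h2, fun i hi => (h3 i (Nat.zero_le _) hi).2, fun i hi j hj => ?_,
      by rw [ht1]; exact hDs, hleB p p hppq hppq⟩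
    · rw [ht1] at this
      exact this
    · obtain ⟨l, hl, hl'⟩ := (h3 i (Nat.zero_le _) hi).1 j hj
      rw [← hl']
      exact hVb i hi l
  · rw [hmz]
    set e := (p - 1) * (q - 1) + max (linExp p) q with hE
    have h1 : (z ^ (q - 1)) ^ (p - 1) = z ^ ((p - 1) * (q - 1)) := by rw [← pow_mul, mul_comm]
    have h2 : (S + 4100) * z ^ q * (lg + 1) + C * z ^ linExp p * (lg + 1) + 130 ≤
        (S + 4230 + C) * (z ^ max (linExp p) q * (lg + 1)) := by
      have e1 : z ^ q ≤ z ^ max (linExp p) q := Nat.pow_le_pow_right hz (le_max_right _ _)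
      have e2 : z ^ linExp p ≤ z ^ max (linExp p) q := Nat.pow_le_pow_right hz (le_max_left _ _)
      have e3 : 1 * 1 ≤ z ^ max (linExp p) q * (lg + 1) := Nat.mul_le_mul (Nat.pow_pos hz) (by omega)
      calc (S + 4100) * z ^ q * (lg + 1) + C * z ^ linExp p * (lg + 1) + 130
          ≤ (S + 4100) * z ^ max (linExp p) q * (lg + 1) + C * z ^ max (linExp p) q * (lg + 1) +
            130 * (z ^ max (linExp p) q * (lg + 1)) := by gcongr; omega
        _ = _ := by ring
    have h3 : z ^ e ≤ z ^ linExp (p * q) := Nat.pow_le_pow_right hz he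
    have h4 : 1 * 1 ≤ z ^ linExp (p * q) * (lg + 1) := Nat.mul_le_mul (Nat.pow_pos hz) (by omega)
    rw [h1]
    calc _ ≤ redConst p * z ^ ((p - 1) * (q - 1)) * ((S + 4230 + C) * (z ^ max (linExp p) q * (lg + 1))) +
          ((powE (.var (0, 4)) (q - 1)).cost + 150) := by gcongr
      _ = redConst p * (S + 4230 + C) * (z ^ e * (lg + 1)) + ((powE (.var (0, 4)) (q - 1)).cost + 150) := by
          rw [hE, pow_add]; ring
      _ ≤ redConst p * (S + 4230 + C) * (z ^ linExp (p * q) * (lg + 1)) +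
          ((powE (.var (0, 4)) (q - 1)).cost + 150) * (z ^ linExp (p * q) * (lg + 1)) := by
          gcongr
          exact Nat.le_mul_of_pos_right _ h4
      _ = _ := by ring
  · rintro s' ⟨h1, h2⟩
    rw [hmz] at h2
    exact ⟨h1, h2.mono hsol.2 hsol.1⟩

theorem exists_solver (K : ℕ) (hK : 2 ≤ K) :
    ∃ (d : ℕ) (prog : (ℕ → Var) → Var → Cmd) (C : ℕ), Solves K d prog C := by
  induction K using Nat.strong_induction_on with
  | _ K ih =>
    by_cases h5 : 5 ≤ K
    · rcases linExp_cases h5 with h | ⟨p, q, hp, hpK, hq, rfl, h⟩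
      · obtain ⟨d, prog, C, hs⟩ := ih (K - 1) (by omega) (by omega)
        obtain ⟨m, rfl⟩ : ∃ m, K = m + 1 := ⟨K - 1, by omega⟩
        exact ⟨_, _, _, Solves.succ hs (by omega) h⟩
      · obtain ⟨d, prog, C, hs⟩ := ih p hpK hp
        exact ⟨_, _, _, hs.mul hp hq h⟩
    · interval_cases K
      · exact ⟨_, _, _, solves_two⟩
      · exact ⟨_, _, _, solves_three⟩
      · exact ⟨_, _, _, solves_four⟩

end KSumRam

namespace KSumRam

/-! ### The algorithms -/

section
variable {k n : ℕ} {E : Env k n}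

/-- The abstract initial state. -/
structure Start (x : KInstance k n) (hint : ℕ) (s : St) : Prop where
  size : s.v (0, 0) = n
  target : s.v (0, 1) = x.target
  hint : s.v (1, 0) = hint
  flag : s.v gF = 0
  zero : ∀ A i, s.a A i = 0

/-- The result register holds the answer. -/
def Answer (x : KInstance k n) (s : St) : Prop :=
  (x.HasSolution → s.v (0, 0) = 1) ∧ (¬ x.HasSolution → s.v (0, 0) = 0)

theorem start_init (x : KInstance k n) (hint : ℕ) {N : ℕ} (hN : 3 ≤ N) :
    Start x hint (absSt N (initConfig .skip x hint).store) where
  size := by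
    have : enc (0, 0) = 0 := rfl
    simp [absSt, this, initConfig, show 0 < N by omega]
  target := by
    have : enc (0, 1) = 1 := rfl
    simp [absSt, this, initConfig, show 1 < N by omega]
  hint := by
    have : enc (1, 0) = 2 := rfl
    simp [absSt, this, initConfig, show 2 < N by omega]
  flag := by
    have : enc gF = 4 := rfl
    simp [absSt, this, initConfig]
  zero A i := by simp [absSt, initConfig]

theorem KInstance.abs_read_le (x : KInstance k n) {w : ℕ} (hx : x.FitsIn w) (a b : ℤ) :
    |x.read a b| ≤ 2 ^ w := by
  unfold KInstance.read
  split_ifs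
  · exact hx.1 _ _
  · simp

/-- A command that answers correctly from every initial state is a Las Vegas algorithm. -/
theorem exists_isLasVegas (hint : ℕ → ℕ) (hhint : ∀ n, hint n ≤ n + 1) (c : Cmd) (cap T : ℕ → ℕ)
    (e : ℕ) (h : ∀ {n : ℕ} (E : Env k n) (w : ℕ), 1 ≤ w → n ≤ 2 ^ w → E.x.FitsIn w → E.cap = cap n →
      ((2 : ℤ) ^ w) ^ e ≤ E.B → ∀ s, Start E.x (hint n) s → Run E s c (T n) (Answer E.x)) :
    ∃ N, IsLasVegasKSum k hint (c.code N) (fun n => T n) (fun n => 3 * N + N * cap n) := by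
  obtain ⟨N₀, hN₀⟩ := c.exists_wf
  set N := N₀ + 3 with hN
  refine ⟨N, (e + N + 2) * N + 1, fun n w hw hn x hx => ?_⟩
  have hW : (2 : ℤ) ≤ 2 ^ w := by simpa using pow_le_pow_right₀ (one_le_two (α := ℤ)) hw
  have hW1 : (1 : ℤ) ≤ 2 ^ w := by omega
  have hle : ∀ a b : ℕ, a ≤ b → ((2 : ℤ) ^ w) ^ a ≤ (2 ^ w) ^ b := fun a b hab =>
    pow_le_pow_right₀ hW1 hab
  have hB1 : (2 : ℤ) ^ w ≤ (2 ^ w) ^ (e + N + 2) := by simpa using hle 1 (e + N + 2) (by omega)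
  have hB2 : (2 : ℤ) ^ w + 1 ≤ (2 ^ w) ^ (e + N + 2) := by
    have := hle 2 (e + N + 2) (by omega)
    nlinarith
  have hNB : (N : ℤ) ≤ (2 ^ w) ^ (e + N + 2) := by
    have h1 : (N : ℤ) < 2 ^ N := by exact_mod_cast Nat.lt_two_pow_self
    have h2 : (2 : ℤ) ^ N ≤ (2 ^ w) ^ N := pow_le_pow_left₀ (by norm_num) hW N
    have := hle N (e + N + 2) (by omega)
    omega
  -- The exponent of `B` has room for the demand `e` of the algorithm, for `N < 2 ^ N ≤ (2 ^ w) ^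
  -- N`, and for the extra word, since `n + 1 ≤ (2 ^ w) ^ 2`.
  let E : Env k n :=
    { x := x
      N := N
      cap := cap n
      B := (2 ^ w) ^ (e + N + 2)
      hN := by omega
      hB := hNB
      hB2 := by omega
      hx := fun a b => (x.abs_read_le hx a b).trans hB1 }
  have hn' : (n : ℤ) ≤ 2 ^ w := by exact_mod_cast hn
  have hh : (hint n : ℤ) ≤ n + 1 := by exact_mod_cast hhint n
  obtain ⟨h1, h2⟩ := Run.sound (hint := hint n) (h E w hw hn hx rfl (hle _ _ (by omega)) _
    (start_init x (hint n) (show 3 ≤ N by omega))) (hN₀ N (by omega)) rfl (show 3 ≤ N by omega)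
    (by simp only [E]; omega) (hx.2.trans hB1) (by simp only [E]; omega)
  refine ⟨fun C hC => ?_, h2.trans (by simp)⟩
  obtain ⟨h3, h4⟩ := h1 C hC
  refine ⟨h3.usesAtMost, h3.wordSized ?_, fun ht => ?_⟩
  · simp only [E]
    rw [← pow_mul, ← pow_mul]
    refine pow_lt_pow_right₀ (by norm_num) ?_
    rw [add_one_mul, mul_comm w]
    omega
  · have h5 := h4 ht
    have e0 : enc (0, 0) = 0 := rfl
    have e1 : 0 < E.N := by simp only [E]; omega
    simpa [Answer, absSt, e0, e1] using h5

/-! #### One array -/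

/-- Look for the target in the only array. -/
def scanOne : Cmd :=
  .seq (.for (2, 1) (.var (0, 0)) (.ite (.inp (.const 0) (.var (2, 1))) (.var (0, 1))
    (.ite (.var (0, 1)) (.inp (.const 0) (.var (2, 1))) (.assign gF (.const 1)) .skip) .skip))
    (.assign (0, 0) (.var gF))

theorem KInstance.read_natCast (x : KInstance k n) {i j : ℕ} (hi : i < k) (hj : j < n) :
    x.read i j = x.arr ⟨i, hi⟩ ⟨j, hj⟩ := by
  simp [KInstance.read, hi, hj]

theorem Flag.answer {x : KInstance k n} {s s' : St} {sol : Prop} (h : Flag s s' sol sol)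
    (hs : s.v gF = 0) (hsol : sol ↔ x.HasSolution) :
    (x.HasSolution → s'.v gF = 1) ∧ (¬ x.HasSolution → s'.v gF = 0) := by
  refine ⟨fun h1 => h.complete (hsol.2 h1), fun h1 => ?_⟩
  rcases h.bool with h2 | h2
  · exact h2
  · rcases h.sound h2 with h3 | h3
    · omega
    · exact absurd (hsol.1 h3) h1

theorem scanOne_run {n : ℕ} {E : Env 1 n} {hint : ℕ} {s : St} (hs : Start E.x hint s)
    (hn : (n : ℤ) ≤ E.B) : Run E s scanOne (60 * n + 40) (Answer E.x) := by
  have hB2 := E.hB2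
  have hiff : (∃ i < n, E.x.read 0 i = E.x.target) ↔ E.x.HasSolution := by
    constructor
    · rintro ⟨i, hi, he⟩
      refine ⟨fun _ => ⟨i, hi⟩, ?_⟩
      rw [← he, Fin.sum_univ_one]
      exact (E.x.read_natCast one_pos hi).symm
    · rintro ⟨i, hi⟩
      refine ⟨i 0, (i 0).2, ?_⟩
      rw [Fin.sum_univ_one] at hi
      rw [← hi]
      exact E.x.read_natCast one_pos (i 0).2
  refine (Run.seq (R := fun s' => Flag s s' (∃ i < n, E.x.read 0 i = E.x.target)
    (∃ i < n, E.x.read 0 i = E.x.target)) (Run.for (m := n) (t := 34) (fun r s' => s'.v (2, 1) = r ∧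
      s'.v (0, 0) = n ∧ s'.v (0, 1) = E.x.target ∧ Flag s s' (∃ i < r, E.x.read 0 i = E.x.target)
      (∃ i < n, E.x.read 0 i = E.x.target)) hn ?_ ?_ ?_ ?_) (u := 7) ?_).mono ?_ fun _ h => h
  · exact ⟨by simp, by simp [hs.size], by simp [hs.target],
      (Flag.refl (Or.inl hs.flag) (by simp [gF])).mono (fun ⟨i, hi, _⟩ => absurd hi (by omega)) False.elim⟩
  · rintro r s' hr ⟨h1, h2, -⟩
    exact ⟨h1, by simp [h2]⟩
  · rintro r s' hr ⟨h1, h2, h3, h4⟩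
    refine (Run.straight ?_ ?_).mono (?_ : _ ≤ 34) fun _ h => h
    · simp only [Cmd.Ok, Expr.eval_const]
      split_ifs
      all_goals simp
      omega
    · have hneg : ¬ (E.x.read 0 r ≤ E.x.target ∧ E.x.target ≤ E.x.read 0 r) →
          s'.v (2, 1) = r ∧ (s'.setV (2, 1) (r + 1)).v (2, 1) = ((r + 1 : ℕ) : ℤ) ∧
          (s'.setV (2, 1) (r + 1)).v (0, 0) = n ∧ (s'.setV (2, 1) (r + 1)).v (0, 1) = E.x.target ∧
          Flag s (s'.setV (2, 1) (r + 1)) (∃ i < r + 1, E.x.read 0 i = E.x.target)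
            (∃ i < n, E.x.read 0 i = E.x.target) := by
        intro hne
        refine ⟨h1, by simp, by simp [h2], by simp [h3], ?_⟩
        refine (h4.trans (Flag.refl (s' := s'.setV (2, 1) (r + 1)) h4.bool (by simp [gF]))).mono ?_ ?_
        · rintro ⟨i, hi, he⟩
          by_cases hir : i < r
          · exact Or.inl ⟨i, hir, he⟩
          · obtain rfl : i = r := by omega
            exact absurd ⟨he.le, he.ge⟩ hne
        · rintro (h | h)
          · exact h
          · exact h.elim
      simp only [Cmd.exec, Expr.eval_inp, Expr.eval_const, Expr.eval_var, h1, h3]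
      split_ifs with c1 c2
      · have hf : ((s'.setV gF 1).setV (2, 1) (r + 1)).v gF = 1 := by simp [gF]
        refine ⟨by simp [gF, h1], by simp, by simp [gF, h2], by simp [gF, h3], Or.inr hf, fun _ => hf,
          fun _ => hf, fun _ => Or.inr ⟨r, hr, le_antisymm c1 c2⟩⟩
      · exact hneg fun h => c2 h.2
      · exact hneg fun h => c1 h.1
    · simp [Cmd.cost]
  · rintro s' ⟨h1, h2, h3, h4⟩
    exact h4
  · intro s' hs'
    have := hs'.answer hs.flag hiff
    refine (Run.assign ?_ ?_).mono (by simp) fun _ h => h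
    · rcases hs'.bool with h | h <;> simp [h] <;> omega
    · simpa [Answer] using this
  · simp; omega

/-! #### At least two arrays -/

/-- The sum of the squares of the entries with index `(2, 1)` in the first `q` arrays. -/
def sqE : ℕ → Expr
  | 0 => .const 0
  | q + 1 => sqE q + .inp (.const q) (.var (2, 1)) * .inp (.const q) (.var (2, 1))

theorem eval_sqE {x : KInstance k n} {s : St} {j : ℕ} (hj : s.v (2, 1) = j) (q : ℕ) :
    (sqE q).eval x s = ∑ i ∈ Finset.range q, x.read i j ^ 2 := by
  induction q with
  | zero => simp [sqE]
  | succ q ih => rw [sqE, Expr.eval_add, ih, Finset.sum_range_succ]; simp [hj, sq]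

/-- The sum of the squares of all input numbers. -/
def KInstance.energy (x : KInstance k n) : ℤ :=
  x.target ^ 2 + ∑ j ∈ Finset.range n, ∑ i ∈ Finset.range k, x.read i j ^ 2

/-- Set up the global registers; the block length has been computed. -/
def setup (k : ℕ) : Cmd :=
  .seq (.block [.assign (0, 3) (.var (0, 0)), .assign (0, 5) (.const 2 * .var (0, 4)),
      .assign (0, 8) (.const 1), .assign (0, 9) (.var (0, 1) * .var (0, 1))])
    (.seq (.for (2, 1) (.var (0, 3)) (.assign (0, 9) (.var (0, 9) + sqE k)))
      (.assign gInf (.const (k + 1) * .var (0, 9) + .const 1)))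

theorem KInstance.energy_nonneg (x : KInstance k n) : 0 ≤ x.energy :=
  add_nonneg (sq_nonneg _) (Finset.sum_nonneg fun _ _ => Finset.sum_nonneg fun _ _ => sq_nonneg _)

theorem abs_le_sq (y : ℤ) : |y| ≤ y ^ 2 := by
  rw [← sq_abs]
  have h := abs_nonneg y
  rcases h.eq_or_lt with h | h
  · simp [← h]
  · nlinarith

/-- A sum of squares is a bound for all input numbers that needs neither comparisons nor absolute
values; it is polynomial in `2 ^ w`, so it occupies only a constant number of words. -/
theorem KInstance.abs_target_le_energy (x : KInstance k n) : |x.target| ≤ x.energy := by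
  have h1 : |x.target| ≤ x.target ^ 2 := abs_le_sq _
  have h2 : 0 ≤ ∑ j ∈ Finset.range n, ∑ i ∈ Finset.range k, x.read i j ^ 2 :=
    Finset.sum_nonneg fun _ _ => Finset.sum_nonneg fun _ _ => sq_nonneg _
  unfold energy
  omega

theorem KInstance.abs_read_le_energy (x : KInstance k n) {i j : ℕ} (hi : i < k) (hj : j < n) :
    |x.read i j| ≤ x.energy := by
  have h1 : |x.read i j| ≤ x.read i j ^ 2 := abs_le_sq _
  have h2 : x.read i j ^ 2 ≤ ∑ i ∈ Finset.range k, x.read i j ^ 2 :=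
    Finset.single_le_sum (f := fun i : ℕ => x.read i j ^ 2) (fun _ _ => sq_nonneg _) (Finset.mem_range.2 hi)
  have h3 : ∑ i ∈ Finset.range k, x.read i j ^ 2 ≤
      ∑ j ∈ Finset.range n, ∑ i ∈ Finset.range k, x.read i j ^ 2 :=
    Finset.single_le_sum (f := fun j : ℕ => ∑ i ∈ Finset.range k, x.read i j ^ 2)
      (fun _ _ => Finset.sum_nonneg fun _ _ => sq_nonneg _) (Finset.mem_range.2 hj)
  have h4 := sq_nonneg x.target
  unfold energy
  omega

theorem KInstance.energy_le (x : KInstance k n) {w : ℕ} (hx : x.FitsIn w) :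
    x.energy ≤ (2 ^ w) ^ 2 * (1 + n * k) := by
  have hsq : ∀ y : ℤ, |y| ≤ 2 ^ w → y ^ 2 ≤ (2 ^ w) ^ 2 := fun y hy => sq_le_sq' (by
    have := (abs_le.1 hy).1; omega) (abs_le.1 hy).2
  have h1 : ∑ j ∈ Finset.range n, ∑ i ∈ Finset.range k, x.read i j ^ 2 ≤ n * (k * (2 ^ w) ^ 2) := by
    refine (Finset.sum_le_card_nsmul _ _ ((k : ℤ) * (2 ^ w) ^ 2) fun j _ => ?_).trans (by simp)
    refine (Finset.sum_le_card_nsmul _ _ (((2 : ℤ) ^ w) ^ 2) fun i _ => ?_).trans (by simp)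
    exact hsq _ (x.abs_read_le hx _ _)
  have h2 := hsq _ hx.2
  unfold energy
  linarith

theorem setup_run {s : St} {z : ℕ} {inf : ℤ} (hinf : inf = (k + 1) * E.x.energy + 1) (hn : (n : ℤ) ≤ E.B)
    (hzB : (2 * z : ℤ) ≤ E.B) (hinfB : inf ≤ E.B) (h0 : s.v (0, 0) = n) (h1 : s.v (0, 1) = E.x.target)
    (h4 : s.v (0, 4) = z) (ha : ∀ i, s.a (0, 0) i = 0) :
    Run E s (setup k) (((sqE k).cost + 40) * n + 100) (fun s' => Glob z inf s' ∧ s'.v (0, 3) = n ∧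
      s'.v (0, 1) = E.x.target ∧ s'.v gF = s.v gF) := by
  have hB2 := E.hB2
  have hen := E.x.energy_nonneg
  have henB : E.x.energy ≤ E.B := by nlinarith [Int.natCast_nonneg k]
  refine (Run.seq (t := 50) (R := fun s' => Glob z (s.v gInf) s' ∧ s'.v (0, 3) = n ∧
      s'.v (0, 1) = E.x.target ∧ s'.v gF = s.v gF ∧ s'.v (0, 9) = E.x.target ^ 2)
      (u := ((sqE k).cost + 40) * n + 49) ?_ ?_).mono (by omega) fun _ h => h
  · refine (Run.straight ?_ ?_).mono (?_ : _ ≤ 50) fun _ h => h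
    · simp [Cmd.block, Cmd.Ok, Cmd.exec, h0, h1, h4]
      refine ⟨hn, hzB, by omega, ?_⟩
      rw [← sq]
      refine le_trans ?_ henB
      unfold KInstance.energy
      have : 0 ≤ ∑ j ∈ Finset.range n, ∑ i ∈ Finset.range k, E.x.read i j ^ 2 :=
        Finset.sum_nonneg fun _ _ => Finset.sum_nonneg fun _ _ => sq_nonneg _
      omega
    · refine ⟨⟨?_, ?_, ?_, ?_, ha⟩, ?_⟩ <;>
        simp [Cmd.block, Cmd.exec, h0, h1, h4, gInf, gF, sq]
    · simp [Cmd.block, Cmd.cost]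
  rintro s1 ⟨g1, g2, g3, g4, g5⟩
  refine (Run.seq (R := fun s' => Glob z (s.v gInf) s' ∧ s'.v (0, 3) = n ∧
      s'.v (0, 1) = E.x.target ∧ s'.v gF = s.v gF ∧ s'.v (0, 9) = E.x.energy)
      (Run.for (m := n) (t := (sqE k).cost + 10) (fun r s' => s'.v (2, 1) = r ∧ Glob z (s.v gInf) s' ∧
        s'.v (0, 3) = n ∧ s'.v (0, 1) = E.x.target ∧ s'.v gF = s.v gF ∧ s'.v (0, 9) = E.x.target ^ 2 +
          ∑ j ∈ Finset.range r, ∑ i ∈ Finset.range k, E.x.read i j ^ 2) hn ?_ ?_ ?_ ?_) (u := 17)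
      ?_).mono ?_ fun _ h => h
  · refine ⟨by simp, ⟨?_, ?_, ?_, ?_, g1.zero⟩, ?_, ?_, ?_, ?_⟩
    · simpa using g1.size
    · simpa using g1.size2
    · simpa [gInf] using g1.inf
    · simpa using g1.one
    · simpa using g2
    · simpa using g3
    · simpa [gF] using g4
    · simpa using g5
  · rintro r s' hr ⟨f1, f2, f3, -⟩
    exact ⟨f1, by simp [f3]⟩
  · rintro r s' hr ⟨f1, f2, f3, f4, f5, f6⟩
    have hev : (Expr.var (0, 9) + sqE k).eval E.x s' = E.x.target ^ 2 +
        ∑ j ∈ Finset.range (r + 1), ∑ i ∈ Finset.range k, E.x.read i j ^ 2 := by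
      rw [Expr.eval_add, Expr.eval_var, f6, eval_sqE f1, Finset.sum_range_succ, add_assoc]
    refine (Run.assign ?_ ?_).mono (by simp; omega) fun _ h => h
    · rw [hev, abs_of_nonneg]
      · refine le_trans ?_ henB
        unfold KInstance.energy
        have : ∑ j ∈ Finset.range (r + 1), ∑ i ∈ Finset.range k, E.x.read i j ^ 2 ≤
            ∑ j ∈ Finset.range n, ∑ i ∈ Finset.range k, E.x.read i j ^ 2 :=
          Finset.sum_le_sum_of_subset_of_nonneg (Finset.range_subset_range.2 hr)
            fun _ _ _ => Finset.sum_nonneg fun _ _ => sq_nonneg _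
        omega
      · exact add_nonneg (sq_nonneg _) (Finset.sum_nonneg fun _ _ => Finset.sum_nonneg fun _ _ => sq_nonneg _)
    · rw [hev]
      refine ⟨by simp [f1], by simp, ⟨?_, ?_, ?_, ?_, f2.zero⟩, ?_, ?_, ?_, ?_⟩
      · simpa using f2.size
      · simpa using f2.size2
      · simpa [gInf] using f2.inf
      · simpa using f2.one
      · simpa using f3
      · simpa using f4
      · simpa [gF] using f5
      · simp
  · rintro s' ⟨f1, f2, f3, f4, f5, f6⟩
    exact ⟨f2, f3, f4, f5, f6⟩
  · rintro s' ⟨f1, f2, f3, f4, f5⟩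
    have hev : (Expr.const (k + 1) * .var (0, 9) + .const 1).eval E.x s' = inf := by
      simp [f5, hinf]
    refine (Run.assign ?_ ?_).mono (by simp) fun _ h => h
    · rw [hev, abs_of_nonneg]
      · exact hinfB
      · rw [hinf]; positivity
    · rw [hev]
      refine ⟨⟨?_, ?_, ?_, ?_, f1.zero⟩, ?_, ?_, ?_⟩
      · simpa [gInf] using f1.size
      · simpa [gInf] using f1.size2
      · simp
      · simpa [gInf] using f1.one
      · simpa [gInf] using f2
      · simpa [gInf] using f3
      · simpa [gInf, gF] using f4
  · simp only [Expr.cost_var]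
    have : ((sqE k).cost + 40) * n = n * ((sqE k).cost + 10 + (3 + 22)) + 5 * n := by ring
    omega

/-- Solve `k`-SUM, given a solver for `k` sorted lists of the block length. -/
def solve (k d : ℕ) (prog : (ℕ → Var) → Var → Cmd) : Cmd :=
  .seq (setup k) (.seq (reduce d k ((.var (0, 3) + .var (0, 4) - .const 1) / .var (0, 4))
    (fun r => .inp (.const r) (.var (2, 3) % .var (0, 3))) (0, 1) (prog (fun i => (d + i, 0)) (0, 1)))
    (.assign (0, 0) (.var gF)))

/-- The cost of `solve` for block length `z`. -/
def solveCost (k C n z lg : ℕ) : ℕ :=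
  ((sqE k).cost + 40) * n + redConst k * ((n + z - 1) / z) ^ (k - 1) *
    (4200 * ((n + z - 1) / z * z) * (lg + 1) + C * z ^ linExp k * (lg + 1) + 130) + 400

/-- Arrays are padded to whole blocks by reading them cyclically; this repeats entries but creates
no new values. -/
theorem hasSolution_iff (x : KInstance k n) {N : ℕ} (hn : 1 ≤ n) (hN : n ≤ N) :
    (∃ y : ℕ → ℤ, ∑ i ∈ Finset.range k, y i = x.target ∧
      ∀ i < k, ∃ j < N, x.read i ((j % n : ℕ) : ℤ) = y i) ↔ x.HasSolution := by
  constructor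
  · rintro ⟨y, hy, hy'⟩
    choose! j hj hj' using hy'
    refine ⟨fun i => ⟨j i % n, Nat.mod_lt _ hn⟩, ?_⟩
    rw [← hy, Finset.sum_range]
    refine Finset.sum_congr rfl fun i _ => ?_
    rw [← hj' i i.2, x.read_natCast i.2 (Nat.mod_lt _ hn)]
  · rintro ⟨i, hi⟩
    refine ⟨fun l => if h : l < k then x.arr ⟨l, h⟩ (i ⟨l, h⟩) else 0, ?_, fun l hl => ?_⟩
    · rw [← hi, Finset.sum_range]
      exact Finset.sum_congr rfl fun l _ => by simp
    · refine ⟨i ⟨l, hl⟩, (i ⟨l, hl⟩).2.trans_le hN, ?_⟩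
      rw [Nat.mod_eq_of_lt (i ⟨l, hl⟩).2, x.read_natCast hl (i ⟨l, hl⟩).2]
      simp [hl]

theorem solve_run {s : St} {z lg d C : ℕ} {prog : (ℕ → Var) → Var → Cmd} (hprog : Solves k d prog C)
    (hk : 2 ≤ k) (hn : 1 ≤ n) (hz : 1 ≤ z) (hzn : z ≤ n) (hlg : 2 * z ≤ 2 ^ lg) (hcap : 4 * z ≤ E.cap)
    {inf : ℤ} (hinf : inf = (k + 1) * E.x.energy + 1)
    (hB : 8 * ((n : ℤ) ^ k * (2 * inf + 1) * (inf + k)) ≤ E.B) (h0 : s.v (0, 0) = n)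
    (h1 : s.v (0, 1) = E.x.target) (h4 : s.v (0, 4) = z) (ha : ∀ i, s.a (0, 0) i = 0)
    (hF : s.v gF = 0) : Run E s (solve k d prog) (solveCost k C n z lg) (Answer E.x) := by
  have hen := E.x.energy_nonneg
  have hinf1 : 1 ≤ inf := by rw [hinf]; have : 0 ≤ ((k : ℤ) + 1) * E.x.energy := by positivity
                             omega
  have hn' : (1 : ℤ) ≤ n := by exact_mod_cast hn
  have hz' : (1 : ℤ) ≤ z := by exact_mod_cast hz
  have hzn' : (z : ℤ) ≤ n := by exact_mod_cast hzn
  have hk' : (2 : ℤ) ≤ k := by exact_mod_cast hk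
  have hcast : ((n + z - 1 : ℕ) : ℤ) = n + z - 1 := by omega
  rw [solveCost]
  -- The number of blocks is `⌈n / z⌉`, written with a truncating division.
  obtain ⟨m, hm⟩ : ∃ m, m = (n + z - 1) / z := ⟨_, rfl⟩
  rw [← hm]
  have hnm : n ≤ m * z := by
    have h2 := Nat.div_add_mod (n + z - 1) z
    have h3 := Nat.mod_lt (n + z - 1) hz
    rw [← hm, mul_comm z m] at h2
    omega
  have hmz : m * z ≤ n + z - 1 := hm ▸ Nat.div_mul_le_self _ _
  have hm1 : 1 ≤ m := by
    by_contra hc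
    have : m = 0 := by omega
    rw [this, zero_mul] at hnm
    omega
  have hmn : m ≤ n := by
    refine hm ▸ Nat.div_le_of_le_mul ?_
    -- That `⌈n / z⌉ ≤ n` amounts to `(n - 1) (z - 1) ≥ 0`.
    have : (n - 1) * (z - 1) + (n + z - 1) = z * n := by
      obtain ⟨a, rfl⟩ := Nat.exists_eq_add_of_le' hn
      obtain ⟨b, rfl⟩ := Nat.exists_eq_add_of_le' hz
      simp only [Nat.add_sub_cancel]
      rw [show a + 1 + (b + 1) - 1 = a + b + 1 by omega]
      ring
    omega
  have hG0 : (9 : ℤ) ≤ (2 * inf + 1) * (inf + k) := by nlinarith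
  have hP : ∀ a b : ℤ, 0 ≤ a → a ≤ n ^ k → 0 ≤ b → b ≤ k →
      a * (2 * inf + 1) * (inf + b) ≤ (n : ℤ) ^ k * (2 * inf + 1) * (inf + k) := by
    intro a b ha0 ha hb0 hb
    exact mul_le_mul (mul_le_mul_of_nonneg_right ha (by omega)) (by omega) (by omega) (by positivity)
  have hnk : (n : ℤ) ≤ n ^ k := le_self_pow₀ hn' (by omega)
  have hGn : (n : ℤ) * 9 ≤ n ^ k * (2 * inf + 1) * (inf + k) := by
    rw [mul_assoc]
    exact mul_le_mul hnk hG0 (by norm_num) (by positivity)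
  have hGi : inf ≤ (n : ℤ) ^ k * (2 * inf + 1) * (inf + k) := by
    have := hP 1 0 (by norm_num) (by omega) le_rfl (by omega)
    nlinarith
  have hmz' : (m * z : ℤ) ≤ 2 * n := by
    have : m * z ≤ 2 * n := by omega
    exact_mod_cast this
  have hdim : Dim E z lg inf := ⟨hz, hlg, hcap, by omega, by omega, by omega⟩
  refine (Run.seq (setup_run hinf (by omega) (by omega) (by omega) h0 h1 h4 ha)
    (u := redConst k * m ^ (k - 1) * (4200 * (m * z) * (lg + 1) + C * z ^ linExp k * (lg + 1) + 130) +
      280) ?_).mono (by omega) fun _ h => h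
  rintro s1 ⟨g1, g2, g3, g4⟩
  have hF1 : s1.v gF = 0 := g4.trans hF
  have htar := E.x.abs_target_le_energy
  have hken : (k : ℤ) * E.x.energy + |E.x.target| < inf := by
    rw [hinf]
    linarith
  have hlt : ∀ y : ℤ, |y| ≤ E.x.energy → |y| < inf := fun y hy => by
    have : (0 : ℤ) ≤ k * E.x.energy := by positivity
    rw [hinf]
    linarith
  have hrd : ∀ r < k, ∀ j : ℕ, |E.x.read r ((j % n : ℕ) : ℤ)| ≤ E.x.energy := fun r hr j =>
    E.x.abs_read_le_energy hr (Nat.mod_lt _ hn)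
  have hsol := hasSolution_iff E.x hn hnm
  rw [← g3] at hsol
  refine (Run.seq (reduce_run (m := m) (z := z) (lg := lg) (S := 14) (T := C * z ^ linExp k * (lg + 1))
    (V := fun r j => E.x.read r ((j % n : ℕ) : ℤ)) hdim g1 hprog.1 hk hm1 ?_ (Or.inl (by simp)) ?_ (by omega) ?_
    ?_ ?_ ?_ (Or.inl hF1) ?_) (u := 7) ?_).mono ?_ fun _ h => h
  · simp [g2, g1.size, hm, hcast]
  · rw [g3]; exact hlt _ htar
  · have := hP m k (by positivity) (le_trans (by exact_mod_cast hmn) hnk) (by omega) le_rfl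
    have h5 : 0 ≤ (n : ℤ) ^ k * (2 * inf + 1) * (inf + k) := by positivity
    omega
  · intro r hr s' hs' j hj hjv
    have h3 : s'.v (0, 3) = n := (hs'.v _ (Or.inl (by simp))).trans g2
    simp [hjv, h3]
  · intro r hr j _
    exact hlt _ (hrd r hr j)
  · intro r hr
    simp
  · intro s2 f1 f2 f3
    have ht : s2.v (0, 1) = s1.v (0, 1) := f1.v _ (Or.inl (by simp))
    have := hprog.2 E z lg inf (fun i => (d + i, 0)) (0, 1) E.x.energy s2 ⟨hdim, g1.frm f1,
      fun i _ => Nat.le_add_right _ _, Or.inl (by simp), f2, fun i hi => (f3 i (Nat.zero_le _) hi).2,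
      fun i hi j hj => ?_, by rw [ht, g3]; exact hken, ?_⟩
    · rw [ht] at this
      exact this
    · obtain ⟨l, hl, hl'⟩ := (f3 i (Nat.zero_le _) hi).1 j hj
      rw [← hl']
      exact hrd i hi l
    · have := hP (z ^ k) k (by positivity) (pow_le_pow_left₀ (by omega) hzn' k) (by omega) le_rfl
      have h5 : 0 ≤ (n : ℤ) ^ k * (2 * inf + 1) * (inf + k) := by positivity
      omega
  · rintro s2 ⟨f1, f2⟩
    have := f2.answer hF1 hsol
    refine (Run.assign ?_ ?_).mono (by simp) fun _ h => h
    · rcases f2.bool with h | h <;> simp [h] <;> omega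
    · simpa [Answer] using this
  · simp; ring_nf; omega

/-! #### The block length -/

/-- `c` computes the block length `z n` from the input size and the extra word. -/
def Sizes (c : Cmd) (hint z : ℕ → ℕ) (b : ℕ) : Prop :=
  ∀ {k n : ℕ} (E : Env k n) (s : St), 1 ≤ n → (n : ℤ) ≤ E.B → Start E.x (hint n) s →
    Run E s c (b * z n + b) (fun s' => s'.v (0, 4) = z n ∧ s'.v (0, 0) = n ∧ s'.v (0, 1) = E.x.target ∧
      s'.v gF = 0 ∧ ∀ i, s'.a (0, 0) i = 0)

theorem sizes_hint {z : ℕ → ℕ} (hz : ∀ n, 1 ≤ n → z n ≤ n) :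
    Sizes (.assign (0, 4) (.var (1, 0))) z z 10 := by
  intro k n E s hn hnB hs
  have := hz n hn
  refine (Run.assign ?_ ?_).mono (by simp) fun _ h => h
  · simp [hs.hint]; omega
  · simp [hs.hint, hs.size, hs.target, gF, hs.zero]
    exact hs.flag

/-- Find the largest `z` with `z ^ q ≤ n ^ p`. -/
def rootLoop (p q : ℕ) : Cmd :=
  .seq (.assign (0, 4) (.const 0)) (.loop (powE (.var (0, 4) + .const 1) q) (powE (.var (0, 0)) p)
    (.assign (0, 4) (.var (0, 4) + .const 1)))

/-- Trying `z = 1, 2, …` takes `O(z)` turns, which the total time bound allows. The powers are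
recomputed within one expression, so they are covered by the size bound for expressions. -/
theorem sizes_root {p q : ℕ} {z : ℕ → ℕ} (hz : ∀ n, 1 ≤ n → z n ≤ n)
    (hpq : ∀ n j, 1 ≤ n → (j ^ q ≤ n ^ p ↔ j ≤ z n)) :
    Sizes (rootLoop p q) (fun _ => 0) z
      ((powE (.var (0, 4) + .const 1) q).cost + (powE (.var (0, 0)) p).cost + 30) := by
  intro k n E s hn hnB hs
  have hB2 := E.hB2
  have hzn := hz n hn
  set c₁ := (powE (.var (0, 4) + .const 1) q).cost
  set c₂ := (powE (.var (0, 0)) p).cost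
  refine (Run.seq (Run.assign (Q := fun s' => s' = s.setV (0, 4) 0) (by simp; omega) (by simp))
    (u := z n * (11 + (c₁ + c₂ + 3)) + (c₁ + c₂ + 3)) ?_).mono ?_ fun _ h => h
  · rintro s1 hs1
    have := Run.loop (E := E) (s := s1) (a := powE (.var (0, 4) + .const 1) q) (b := powE (.var (0, 0)) p)
      (c := .assign (0, 4) (.var (0, 4) + .const 1)) (t := fun _ => 11) (m := z n)
      (Q := fun s' => s'.v (0, 4) = z n ∧ s'.v (0, 0) = n ∧ s'.v (0, 1) = E.x.target ∧
        s'.v gF = 0 ∧ ∀ i, s'.a (0, 0) i = 0)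
      (fun r s' => s'.v (0, 4) = r ∧ r ≤ z n ∧ s'.v (0, 0) = n ∧ s'.v (0, 1) = E.x.target ∧
        s'.v gF = 0 ∧ ∀ i, s'.a (0, 0) i = 0) ?_ ?_ ?_
    · simpa using this
    · subst hs1
      exact ⟨by simp, Nat.zero_le _, by simp [hs.size], by simp [hs.target],
        by simpa [gF] using hs.flag, by simp [hs.zero]⟩
    · rintro r s' ⟨h1, h2, h3, h4, h5, h6⟩ hg
      rw [eval_powE (z := r + 1) (by simp [h1]), eval_powE (z := n) (by simp [h3])] at hg
      have hr : r + 1 ≤ z n := (hpq n (r + 1) hn).1 (by exact_mod_cast hg)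
      refine ⟨by omega, (Run.assign ?_ ?_).mono (by simp) fun _ h => h⟩
      · simp only [Expr.eval_add, Expr.eval_var, Expr.eval_const, h1]
        rw [abs_of_nonneg (by positivity)]
        omega
      · exact ⟨by simp [h1], hr, by simp [h3], by simp [h4], by simpa [gF] using h5, by simp [h6]⟩
    · rintro r s' ⟨h1, h2, h3, h4, h5, h6⟩ hg
      rw [eval_powE (z := r + 1) (by simp [h1]), eval_powE (z := n) (by simp [h3])] at hg
      have hr : ¬ r + 1 ≤ z n := fun h => hg (by exact_mod_cast (hpq n (r + 1) hn).2 h)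
      exact ⟨by rw [h1]; congr 1; omega, h3, h4, h5, h6⟩
  · simp only [Expr.cost_const]
    have h7 : (c₁ + c₂ + 30) * z n = z n * (11 + (c₁ + c₂ + 3)) + 16 * z n := by ring
    omega

/-- The whole algorithm. -/
def algorithm (c : Cmd) (k d : ℕ) (prog : (ℕ → Var) → Var → Cmd) : Cmd :=
  .ite (.const 1) (.var (0, 0)) (.seq c (solve k d prog)) .skip

theorem exists_lasVegas_of_sizes {c : Cmd} {hint z : ℕ → ℕ} {b k d C : ℕ}
    {prog : (ℕ → Var) → Var → Cmd} (hc : Sizes c hint z b) (hhint : ∀ n, hint n ≤ n + 1)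
    (hz : ∀ n, 1 ≤ n → 1 ≤ z n ∧ z n ≤ n) (hk : 2 ≤ k) (hprog : Solves k d prog C) :
    ∃ (P : Prog) (N : ℕ), IsLasVegasKSum k hint P
      (fun n => ((b * z n + b + solveCost k C n (z n) (Nat.log 2 n + 2) + 20 : ℕ) : ℝ))
      (fun n => 3 * N + N * (4 * z n)) := by
  suffices h : ∀ {n : ℕ} (E : Env k n) (w : ℕ), 1 ≤ w → n ≤ 2 ^ w → E.x.FitsIn w → E.cap = 4 * z n →
      ((2 : ℤ) ^ w) ^ (5 * k + 20) ≤ E.B → ∀ s, Start E.x (hint n) s → Run E s (algorithm c k d prog)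
        (b * z n + b + solveCost k C n (z n) (Nat.log 2 n + 2) + 20) (Answer E.x) by
    obtain ⟨N, hN⟩ := exists_isLasVegas hint hhint (algorithm c k d prog) (fun n => 4 * z n) _ _ h
    exact ⟨_, N, hN⟩
  intro n E w hw hnw hx hcap hB s hs
  have hW : (2 : ℤ) ≤ 2 ^ w := by simpa using pow_le_pow_right₀ (one_le_two (α := ℤ)) hw
  have hnW : (n : ℤ) ≤ 2 ^ w := by exact_mod_cast hnw
  have hnB : (n : ℤ) ≤ E.B := by
    have : ((2 : ℤ) ^ w) ^ 1 ≤ (2 ^ w) ^ (5 * k + 20) := pow_le_pow_right₀ (by omega) (by omega)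
    rw [pow_one] at this
    omega
  refine (Run.ite (t := b * z n + b + solveCost k C n (z n) (Nat.log 2 n + 2) + 1) ?_ ?_).mono
    (by simp; omega) fun _ h => h
  · intro h1
    have hn : 1 ≤ n := by
      simp only [Expr.eval_const, Expr.eval_var, hs.size] at h1
      exact_mod_cast h1
    obtain ⟨hz1, hzn⟩ := hz n hn
    refine Run.seq (hc E s hn hnB hs) ?_
    rintro s1 ⟨g1, g2, g3, g4, g5⟩
    refine solve_run (inf := (k + 1) * E.x.energy + 1) hprog hk hn hz1 hzn ?_ (by rw [hcap]) rfl ?_ g2 g3 g1 g5 g4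
    · have := Nat.lt_pow_succ_log_self (one_lt_two) n
      rw [pow_succ] at this ⊢
      omega
    · refine le_trans ?_ hB
      -- All magnitudes are polynomial in `W`: the energy is at most `W ^ (k + 4)`, infinity at most
      -- `W ^ (2 k + 5)`, and the product required by `solve_run` at most `W ^ (5 k + 17)`.
      set W : ℤ := 2 ^ w with hWd
      have hk2 : (k : ℤ) + 1 ≤ W ^ k := by
        have h2 : ((k + 1 : ℕ) : ℤ) ≤ 2 ^ k := by exact_mod_cast Nat.lt_two_pow_self (n := k)
        have h3 : (2 : ℤ) ^ k ≤ W ^ k := pow_le_pow_left₀ (by norm_num) hW k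
        push_cast at h2
        omega
      have hWk : (1 : ℤ) ≤ W ^ k := one_le_pow₀ (by omega)
      have hen : E.x.energy ≤ W ^ (k + 4) := by
        refine (E.x.energy_le hx).trans ?_
        have h2 : (1 : ℤ) + n * k ≤ W * W ^ k := by nlinarith
        calc W ^ 2 * (1 + n * k) ≤ W ^ 2 * (W * W ^ k) := mul_le_mul_of_nonneg_left h2 (by positivity)
          _ = W ^ (k + 3) := by ring
          _ ≤ W ^ (k + 4) := pow_le_pow_right₀ (by omega) (by omega)
      have hen0 := E.x.energy_nonneg
      have hinf : ((k : ℤ) + 1) * E.x.energy + 1 ≤ W ^ (2 * k + 5) := by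
        have h2 : ((k : ℤ) + 1) * E.x.energy ≤ W ^ k * W ^ (k + 4) :=
          mul_le_mul hk2 hen hen0 (by positivity)
        have h3 : W ^ k * W ^ (k + 4) = W ^ (2 * k + 4) := by ring
        have h4 : W ^ (2 * k + 5) = W ^ (2 * k + 4) * W := pow_succ _ _
        have h5 : (1 : ℤ) ≤ W ^ (2 * k + 4) := one_le_pow₀ (by omega)
        nlinarith
      have hinf0 : 0 ≤ ((k : ℤ) + 1) * E.x.energy := by positivity
      set inf := ((k : ℤ) + 1) * E.x.energy + 1
      have e1 : (n : ℤ) ^ k ≤ W ^ k := pow_le_pow_left₀ (by positivity) hnW k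
      have e2 : 2 * inf + 1 ≤ W ^ (2 * k + 7) := by
        have h4 : W ^ (2 * k + 7) = W ^ (2 * k + 5) * W ^ 2 := by ring
        have h5 : (1 : ℤ) ≤ W ^ (2 * k + 5) := one_le_pow₀ (by omega)
        have h6 : (4 : ℤ) ≤ W ^ 2 := by nlinarith
        nlinarith
      have e3 : inf + k ≤ W ^ (2 * k + 7) := by
        have h4 : W ^ (2 * k + 7) = W ^ (2 * k + 5) * W ^ 2 := by ring
        have h5 : W ^ (2 * k + 5) = W ^ k * W ^ (k + 5) := by ring
        have h6 : (4 : ℤ) ≤ W ^ 2 := by nlinarith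
        have h7 : (1 : ℤ) ≤ W ^ (k + 5) := one_le_pow₀ (by omega)
        have h8 : W ^ k ≤ W ^ (2 * k + 5) := pow_le_pow_right₀ (by omega) (by omega)
        nlinarith
      have e4 : (8 : ℤ) ≤ W ^ 3 := by
        have := pow_le_pow_left₀ (by norm_num) hW 3
        norm_num at this
        exact this
      calc 8 * ((n : ℤ) ^ k * (2 * inf + 1) * (inf + k))
          ≤ W ^ 3 * (W ^ k * W ^ (2 * k + 7) * W ^ (2 * k + 7)) := by gcongr
        _ = W ^ (5 * k + 17) := by ring
        _ ≤ _ := pow_le_pow_right₀ (by omega) (by omega)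
  · intro h1
    have hn : n = 0 := by
      simp only [Expr.eval_const, Expr.eval_var, hs.size] at h1
      omega
    subst hn
    refine (Run.skip ?_).mono (by omega) fun _ h => h
    refine ⟨?_, fun _ => by simpa using hs.size⟩
    rintro ⟨i, -⟩
    exact (i ⟨0, by omega⟩).elim0

end

end KSumRam
namespace KSumRam

/-! ### Asymptotics -/

theorem half_le_floor {a : ℝ} (ha : 1 ≤ a) : a / 2 ≤ (⌊a⌋₊ : ℝ) := by
  have h1 := Nat.lt_floor_add_one a
  have h2 : (1 : ℝ) ≤ ⌊a⌋₊ := by exact_mod_cast Nat.le_floor (by simpa using ha)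
  linarith

theorem natLog_add_le {n : ℕ} (hn : 3 ≤ n) : 1 ≤ Real.log n ∧ (Nat.log 2 n + 2 + 1 : ℝ) ≤ 5 * Real.log n := by
  have h3 : (3 : ℝ) ≤ n := by exact_mod_cast hn
  have h1 : 1 ≤ Real.log n := by
    rw [Real.le_log_iff_exp_le (by linarith)]
    linarith [Real.exp_one_lt_d9]
  have h2 : (Nat.log 2 n : ℝ) * Real.log 2 ≤ Real.log n := by
    rw [← Real.log_pow]
    refine Real.log_le_log (by positivity) ?_
    exact_mod_cast Nat.pow_log_le_self 2 (by omega)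
  have h4 := Real.log_two_gt_d9
  have h5 : (0 : ℝ) ≤ Nat.log 2 n := Nat.cast_nonneg _
  exact ⟨h1, by nlinarith⟩

theorem one_le_floor_rpow {n : ℕ} {δ : ℝ} (hδ0 : 0 ≤ δ) (hδ1 : δ ≤ 1) (hn : 1 ≤ n) :
    1 ≤ ⌊(n : ℝ) ^ δ⌋₊ ∧ ⌊(n : ℝ) ^ δ⌋₊ ≤ n := by
  have hn' : (1 : ℝ) ≤ n := by exact_mod_cast hn
  refine ⟨Nat.le_floor (by simpa using Real.one_le_rpow hn' hδ0), Nat.floor_le_of_le ?_⟩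
  simpa using Real.rpow_le_rpow_of_exponent_le hn' hδ1

/-- The time bound of the theorem. -/
noncomputable def timeBound (k : ℕ) (δ : ℝ) (n : ℕ) : ℝ :=
  (n : ℝ) ^ ((k : ℝ) - δ * ((k : ℝ) - 1)) +
    (n : ℝ) ^ ((k : ℝ) - δ * ((k : ℝ) - 1) + (δ * (linExp k : ℝ) - 1))

/-- With `m ≈ n ^ (1 - δ)` and `z ≈ n ^ δ`, the costs `m ^ (k - 1) n` and `m ^ (k - 1) z ^ f k` are
exactly the two summands of the bound. -/
theorem pow_mul_le_timeBound {k n : ℕ} {δ : ℝ} (hk : 1 ≤ k) (hn : 1 ≤ n) :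
    ((n : ℝ) ^ (1 - δ)) ^ (k - 1) * n ≤ timeBound k δ n ∧
      ((n : ℝ) ^ (1 - δ)) ^ (k - 1) * ((n : ℝ) ^ δ) ^ linExp k ≤ timeBound k δ n := by
  have hn' : (0 : ℝ) < n := by exact_mod_cast hn
  have hp : ∀ e : ℝ, 0 < (n : ℝ) ^ e := fun e => Real.rpow_pos_of_pos hn' e
  have hk' : ((k - 1 : ℕ) : ℝ) = k - 1 := by push_cast [hk]; rfl
  have h1 : ((n : ℝ) ^ (1 - δ)) ^ (k - 1) * n = (n : ℝ) ^ ((k : ℝ) - δ * ((k : ℝ) - 1)) := by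
    rw [← Real.rpow_mul_natCast hn'.le, ← Real.rpow_add_one hn'.ne', hk']
    ring_nf
  have h2 : ((n : ℝ) ^ (1 - δ)) ^ (k - 1) * ((n : ℝ) ^ δ) ^ linExp k =
      (n : ℝ) ^ ((k : ℝ) - δ * ((k : ℝ) - 1) + (δ * (linExp k : ℝ) - 1)) := by
    rw [← Real.rpow_mul_natCast hn'.le, ← Real.rpow_mul_natCast hn'.le, ← Real.rpow_add hn', hk']
    ring_nf
  rw [h1, h2, timeBound]
  exact ⟨le_add_of_nonneg_right (hp _).le, le_add_of_nonneg_left (hp _).le⟩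

theorem le_timeBound {k n : ℕ} {δ : ℝ} (hk : 1 ≤ k) (hδ1 : δ ≤ 1) (hn : 1 ≤ n) :
    (n : ℝ) ≤ timeBound k δ n := by
  have hn' : (1 : ℝ) ≤ n := by exact_mod_cast hn
  refine le_trans ?_ (pow_mul_le_timeBound hk hn).1
  exact le_mul_of_one_le_left (by linarith) (one_le_pow₀ (Real.one_le_rpow hn' (by linarith)))

theorem time_le {b k C n : ℕ} {δ : ℝ} (hδ0 : 0 ≤ δ) (hδ1 : δ ≤ 1) (hk : 2 ≤ k) (hn : 3 ≤ n) :
    ((b * ⌊(n : ℝ) ^ δ⌋₊ + b + solveCost k C n ⌊(n : ℝ) ^ δ⌋₊ (Nat.log 2 n + 2) + 20 : ℕ) : ℝ) ≤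
      (2 * b + ((sqE k).cost + 40) + redConst k * 4 ^ (k - 1) * (42000 + 5 * C + 130) + 420 : ℕ) *
        (timeBound k δ n * Real.log n) := by
  have hn' : (1 : ℝ) ≤ n := by exact_mod_cast (by omega : 1 ≤ n)
  obtain ⟨hlog, hL⟩ := natLog_add_le hn
  obtain ⟨hz1, hzn⟩ := one_le_floor_rpow hδ0 hδ1 (by omega : 1 ≤ n)
  obtain ⟨hG1, hG2⟩ := pow_mul_le_timeBound (δ := δ) (by omega : 1 ≤ k) (by omega : 1 ≤ n)
  have hG3 := le_timeBound (by omega : 1 ≤ k) hδ1 (by omega : 1 ≤ n)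
  have hza : (⌊(n : ℝ) ^ δ⌋₊ : ℝ) ≤ (n : ℝ) ^ δ := Nat.floor_le (by positivity)
  have haz := half_le_floor (Real.one_le_rpow hn' hδ0)
  have hpa : (n : ℝ) ^ (1 - δ) * (n : ℝ) ^ δ = n := by
    rw [← Real.rpow_add (by linarith)]; simp
  have hp1 : (1 : ℝ) ≤ (n : ℝ) ^ (1 - δ) := Real.one_le_rpow hn' (by linarith)
  set z := ⌊(n : ℝ) ^ δ⌋₊
  set a := (n : ℝ) ^ δ
  set p := (n : ℝ) ^ (1 - δ)
  set G := timeBound k δ n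
  set l := Real.log n
  have hz1' : (1 : ℝ) ≤ z := by exact_mod_cast hz1
  unfold solveCost
  obtain ⟨m, hm⟩ : ∃ m, m = (n + z - 1) / z := ⟨_, rfl⟩
  rw [← hm]
  have hmz : ((m * z : ℕ) : ℝ) ≤ 2 * n := by
    have : m * z ≤ 2 * n := by
      have := hm ▸ Nat.div_mul_le_self (n + z - 1) z
      omega
    exact_mod_cast this
  -- From `m z ≤ 2 n` and `z ≥ n ^ δ / 2`, the latter because the floor of a number at least `1` is
  -- at least half of it.
  have hmp : (m : ℝ) ≤ 4 * p := by
    push_cast at hmz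
    by_contra! hc
    have h1 : 4 * p * z < m * z := mul_lt_mul_of_pos_right hc (by linarith)
    nlinarith
  have hQ : (m : ℝ) ^ (k - 1) ≤ 4 ^ (k - 1) * p ^ (k - 1) := by
    rw [← mul_pow]
    exact pow_le_pow_left₀ (by positivity) hmp _
  have hQ1 : (1 : ℝ) ≤ p ^ (k - 1) := one_le_pow₀ hp1
  have hzf : (z : ℝ) ^ linExp k ≤ a ^ linExp k := pow_le_pow_left₀ (by positivity) hza _
  have hG0 : 1 ≤ G := by linarith
  have hGl : G ≤ G * l := le_mul_of_one_le_right (by linarith) hlog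
  have hzG : (z : ℝ) ≤ G * l := by
    have : (z : ℝ) ≤ n := by exact_mod_cast hzn
    linarith
  have key : (m : ℝ) ^ (k - 1) * (4200 * ((m * z : ℕ) : ℝ) * (Nat.log 2 n + 2 + 1) +
      C * z ^ linExp k * (Nat.log 2 n + 2 + 1) + 130) ≤ 4 ^ (k - 1) * (42000 + 5 * C + 130) * (G * l) := by
    calc (m : ℝ) ^ (k - 1) * (4200 * ((m * z : ℕ) : ℝ) * (Nat.log 2 n + 2 + 1) +
          C * z ^ linExp k * (Nat.log 2 n + 2 + 1) + 130)
        ≤ (4 ^ (k - 1) * p ^ (k - 1)) * (4200 * (2 * n) * (5 * l) + C * a ^ linExp k * (5 * l) + 130) := by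
          gcongr
      _ = 4 ^ (k - 1) * (42000 * (p ^ (k - 1) * n * l) + 5 * C * (p ^ (k - 1) * a ^ linExp k * l) +
          130 * p ^ (k - 1)) := by ring
      _ ≤ 4 ^ (k - 1) * (42000 * (G * l) + 5 * C * (G * l) + 130 * (G * l)) := by
          gcongr
          refine le_trans ?_ (hG1.trans hGl)
          exact le_mul_of_one_le_right (by linarith) hn'
      _ = _ := by ring
  push_cast at key ⊢
  have hb : (0 : ℝ) ≤ b := Nat.cast_nonneg b
  have hR : (0 : ℝ) ≤ redConst k := Nat.cast_nonneg _
  have hs : (0 : ℝ) ≤ (sqE k).cost := Nat.cast_nonneg _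
  have t1 : (b : ℝ) * z ≤ b * (G * l) := by gcongr
  have t2 : (b : ℝ) * 1 ≤ b * (G * l) := by gcongr; linarith
  have t3 : ((sqE k).cost + 40 : ℝ) * n ≤ ((sqE k).cost + 40) * (G * l) := by gcongr; linarith
  have t4 := mul_le_mul_of_nonneg_left key hR
  calc _ = (b : ℝ) * z + b * 1 + ((sqE k).cost + 40 : ℝ) * n + redConst k * ((m : ℝ) ^ (k - 1) *
        (4200 * (m * z) * (Nat.log 2 n + 2 + 1) + C * z ^ linExp k * (Nat.log 2 n + 2 + 1) + 130)) +
        420 * 1 := by ring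
    _ ≤ b * (G * l) + b * (G * l) + ((sqE k).cost + 40) * (G * l) + redConst k * (4 ^ (k - 1) *
        (42000 + 5 * C + 130) * (G * l)) + 420 * (G * l) := by
      gcongr
      linarith
    _ = _ := by ring

theorem isSoftO_of_le {T g : ℕ → ℝ} {K : ℕ} (hT : ∀ n, 0 ≤ T n) (h : ∀ n ≥ 3, T n ≤ K * (g n * Real.log n)) :
    IsSoftO T g := by
  refine ⟨1, Asymptotics.IsBigO.of_bound K ?_⟩
  filter_upwards [Filter.eventually_ge_atTop 3] with n hn
  rw [pow_one, Real.norm_eq_abs, Real.norm_eq_abs, abs_of_nonneg (hT n)]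
  exact (h n hn).trans (mul_le_mul_of_nonneg_left (le_abs_self _) (Nat.cast_nonneg _))

theorem space_isBigO (N : ℕ) {δ : ℝ} (hδ0 : 0 ≤ δ) {S : ℕ → ℕ}
    (hS : ∀ n ≥ 1, S n ≤ 3 * N + N * (4 * ⌊(n : ℝ) ^ δ⌋₊)) :
    (fun n => (S n : ℝ)) =O[Filter.atTop] (fun n : ℕ => (n : ℝ) ^ δ) := by
  refine Asymptotics.IsBigO.of_bound (7 * N : ℕ) ?_
  filter_upwards [Filter.eventually_ge_atTop 1] with n hn
  have hn' : (1 : ℝ) ≤ n := by exact_mod_cast hn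
  have h1 := Real.one_le_rpow hn' hδ0
  have h2 : (⌊(n : ℝ) ^ δ⌋₊ : ℝ) ≤ (n : ℝ) ^ δ := Nat.floor_le (by positivity)
  have h3 : (S n : ℝ) ≤ 3 * N + N * (4 * ⌊(n : ℝ) ^ δ⌋₊) := by exact_mod_cast hS n hn
  rw [Real.norm_eq_abs, Real.norm_eq_abs, abs_of_nonneg (by positivity), abs_of_nonneg (by positivity)]
  have hN : (0 : ℝ) ≤ N := Nat.cast_nonneg N
  push_cast
  nlinarith

/-- For rational `δ = p / q` the block length is characterized by integer powers, so the program can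
compute it without being told `δ`. -/
theorem le_floor_rpow_iff {p q : ℕ} {δ : ℝ} (hq : q ≠ 0) (hδ : δ = p / q) (n j : ℕ) :
    j ^ q ≤ n ^ p ↔ j ≤ ⌊(n : ℝ) ^ δ⌋₊ := by
  have hq' : (q : ℝ) ≠ 0 := by exact_mod_cast hq
  rw [Nat.le_floor_iff (by positivity), ← pow_le_pow_iff_left₀ (Nat.cast_nonneg (α := ℝ) j) (by positivity) hq,
    ← Real.rpow_mul_natCast (by positivity), hδ, div_mul_cancel₀ _ hq', Real.rpow_natCast]
  exact_mod_cast Iff.rfl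

theorem kSumSolvable_one (hint : ℕ → ℕ) (hhint : ∀ n, hint n ≤ n + 1) {δ : ℝ} (hδ0 : 0 ≤ δ) (hδ1 : δ ≤ 1) :
    KSumSolvable 1 hint (timeBound 1 δ) (fun n => (n : ℝ) ^ δ) := by
  obtain ⟨N, hN⟩ := exists_isLasVegas (k := 1) hint hhint scanOne (fun _ => 1) (fun n => 60 * n + 40) 1
    fun {n} E w _ hn _ _ hB s hs => scanOne_run hs (by
      rw [pow_one] at hB
      exact le_trans (by exact_mod_cast hn) hB)
  refine ⟨_, _, _, isSoftO_of_le (K := 100) (fun n => Nat.cast_nonneg _) fun n hn => ?_,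
    space_isBigO N hδ0 fun n hn => ?_, hN⟩
  · have h1 := le_timeBound le_rfl hδ1 (by omega : 1 ≤ n)
    have h2 := (natLog_add_le hn).1
    have h3 : (3 : ℝ) ≤ n := by exact_mod_cast hn
    push_cast
    nlinarith
  · have := (one_le_floor_rpow hδ0 hδ1 hn).1
    exact Nat.add_le_add_left (Nat.mul_le_mul_left _ (by omega)) _

theorem kSumSolvable_of_sizes {c : Cmd} {hint : ℕ → ℕ} {k b : ℕ} {δ : ℝ} (hδ0 : 0 ≤ δ) (hδ1 : δ ≤ 1)
    (hk : 2 ≤ k) (hhint : ∀ n, hint n ≤ n + 1) (hc : Sizes c hint (fun n => ⌊(n : ℝ) ^ δ⌋₊) b) :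
    KSumSolvable k hint (timeBound k δ) (fun n => (n : ℝ) ^ δ) := by
  obtain ⟨d, prog, C, hprog⟩ := exists_solver k hk
  obtain ⟨P, N, hP⟩ := exists_lasVegas_of_sizes hc hhint (fun n => one_le_floor_rpow hδ0 hδ1) hk hprog
  exact ⟨_, _, _, isSoftO_of_le (fun n => Nat.cast_nonneg _) fun n hn => time_le hδ0 hδ1 hk hn,
    space_isBigO N hδ0 fun n _ => le_rfl, hP⟩

end KSumRam

theorem mainTheorem4 (k : ℕ) (hk : 1 ≤ k) (δ : ℝ) (hδ0 : 0 ≤ δ) (hδ1 : δ ≤ 1) :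
    KSumRam.KSumSolvable k (fun n => ⌊(n : ℝ) ^ δ⌋₊)
      (fun n => (n : ℝ) ^ ((k : ℝ) - δ * ((k : ℝ) - 1)) +
        (n : ℝ) ^ ((k : ℝ) - δ * ((k : ℝ) - 1) + (δ * (KSumRam.linExp k : ℝ) - 1)))
      (fun n => (n : ℝ) ^ δ) ∧
    ((∃ q : ℚ, (q : ℝ) = δ) →
      KSumRam.KSumSolvable k (fun _ => 0)
        (fun n => (n : ℝ) ^ ((k : ℝ) - δ * ((k : ℝ) - 1)) +
          (n : ℝ) ^ ((k : ℝ) - δ * ((k : ℝ) - 1) + (δ * (KSumRam.linExp k : ℝ) - 1)))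
        (fun n => (n : ℝ) ^ δ)) := by
  have hz : ∀ n : ℕ, 1 ≤ n → ⌊(n : ℝ) ^ δ⌋₊ ≤ n := fun n hn => (KSumRam.one_le_floor_rpow hδ0 hδ1 hn).2
  have hint : ∀ n : ℕ, ⌊(n : ℝ) ^ δ⌋₊ ≤ n + 1 := by
    intro n
    rcases Nat.eq_zero_or_pos n with rfl | hn
    -- For `n = 0` and `δ = 0` the power is `1`, which is why the extra word is bounded by `n + 1`
    -- and not by `n`.
    · refine Nat.floor_le_of_le ?_
      simpa using Real.zero_rpow_le_one δ
    · have := hz n hn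
      omega
  rcases hk.eq_or_lt with rfl | hk
  · exact ⟨KSumRam.kSumSolvable_one _ hint hδ0 hδ1,
      fun _ => KSumRam.kSumSolvable_one _ (fun n => Nat.zero_le _) hδ0 hδ1⟩
  · refine ⟨KSumRam.kSumSolvable_of_sizes hδ0 hδ1 hk hint (KSumRam.sizes_hint hz), ?_⟩
    rintro ⟨q, hq⟩
    refine KSumRam.kSumSolvable_of_sizes hδ0 hδ1 hk (fun n => Nat.zero_le _)
      (KSumRam.sizes_root (p := q.num.toNat) (q := q.den) hz fun n j _ =>
        KSumRam.le_floor_rpow_iff q.den_nz ?_ n j)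
    have h0 : 0 ≤ q := by
      rw [← hq] at hδ0
      exact_mod_cast hδ0
    have h1 : ((q.num.toNat : ℤ) : ℝ) = (q.num : ℝ) := by rw [Int.toNat_of_nonneg (Rat.num_nonneg.2 h0)]
    rw [← hq, Rat.cast_def, ← h1, Int.cast_natCast]
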